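/- \textbf{Conventions.} Logarithms are to base $2$; $\log^{\circ c}$ is the $c$-fold composition of $\log$; $\log^\star(x)$ is the smallest integer $c\ge 0$ with $\log^{\circ c}(x)\le 1$; and for an integer $k\ge -1$, $\lambda_k(x)=\prod_{i=0}^{\min\{k,\log^\star x-1\}}\log^{\circ i}x$ (an empty product is $1$). Put $[\![n]\!]=\{0,\dots,n-1\}$, and let $|\mathbf e|_1$ be the sum of the entries of $\mathbf e\in\mathbb N^m$. The Hasse derivative $\overline\partial_{\mathbf e}(f)$ is the coefficient of $\mathbf y^{\mathbf e}$ in $f(\mathbf x+\mathbf y)$. Polynomials are given by their coefficient vectors, elements of $\mathbb Z/q\mathbb Z$ by their representatives in $[\![q]\!]$, and elements of $(\mathbb Z/r\mathbb Z)[z]/(E(z))$ by the $e$ coefficients in $[\![r]\!]$ of their representatives of degree less than $e=\deg E$. Time is counted on a random access machine: one step per read of a variable or an array cell, per control operation and per cell of an array built or copied, and $(\text{bits of }a+1)(\text{bits of }b+1)$ further steps for an arithmetic operation on natural numbers $a,b$. \textbf{MME-Product-Set}$(f,\mathbf a_1,\dots,\mathbf a_N,r,s)$, for $f$ over $\mathbb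 Z/r^s\mathbb Z$ in $m$ variables of individual degrees less than $d$, and $\mathbf a_i\in(\mathbb Z/r^s\mathbb Z)^m$: compute $f_{\mathbf e}=\overline\partial_{\mathbf e}(f)$ for all $|\mathbf e|_1<s$; evaluate each $f_{\mathbf e}$ on $[\![r]\!]^m$ by substituting the values in $[\![r]\!]$ for one variable and recursing on the others; let $\bar{\mathbf a}_i=\mathbf a_i\bmod r\in[\![r]\!]^m$; output $f(\mathbf a_i)=\sum_{|\mathbf e|_1<s}f_{\mathbf e}(\bar{\mathbf a}_i)(\mathbf a_i-\bar{\mathbf a}_i)^{\mathbf e}$ for all $i$. \textbf{MME-B}$(f,\mathbf a_1,\dots,\mathbf a_N,r,s,t)$, for such data and $1\le s\le m$: if $t=0$, run MME-Product-Set. Otherwise compute the $f_{\mathbf e}$ and $\bar{\mathbf a}_i$ as above and lift them to coefficients in $[\![r^s]\!]$ and coordinates in $[\![r]\!]$; let $M=dr^d$ and find primes $p_1<\dots<p_k\le 16\log M$ with $\prod_j p_j>M$ (here: the primes $2,3,5,\dots$ until their product is greater than $M$); for all $\mathbf e$ and $j$, reduce the lifts modulo $p_j^m$ and evaluate $f_{\mathbf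 e}$ at all $\bar{\mathbf a}_i$ modulo $p_j^m$ by MME-B with $(p_j,m,t-1)$ in place of $(r,s,t)$; recover the integers $f_{\mathbf e}(\bar{\mathbf a}_i)\in[\![\prod_jp_j^m]\!]$ by Chinese remaindering and reduce them modulo $r^s$; output $f(\mathbf a_i)=\sum_{|\mathbf e|_1<s}f_{\mathbf e}(\bar{\mathbf a}_i)(\mathbf a_i-\bar{\mathbf a}_i)^{\mathbf e}$. \textbf{MME-For-Extension-Rings-B}$(f,\mathbf a_1,\dots,\mathbf a_N,r,t,E(z))$, for $f$ over $R=(\mathbb Z/r\mathbb Z)[z]/(E(z))$ in $m$ variables of individual degrees less than $d$, and $\mathbf a_i\in R^m$: (1) Lift $f$ and the $\mathbf a_i$ to $F$ and $\tilde{\mathbf a}_i$ over $\mathbb Z[z]$, with coefficients and coordinates of degree less than $e$ in $z$ and with coefficients in $[\![r]\!]$. (2) Let $\ell=ed$, choose a prime $P\in[\ell,2\ell]$ (here: the least one), and let $q_0$ be the least power of $P$ with $q_0\ge d(er)^d$. Let $\bar F$, $\bar{\mathbf a}_i$ be the reductions modulo $q_0^m$. (3) Write $\bar F=\sum_{u<e}f_uz^u$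 and, for each $j\in[\![\ell]\!]$, $\bar{\mathbf a}_i=\sum_{u<e}\mathbf a_{i,j,u}(z-j)^u$. (4) For all $|\mathbf e|_1<m$ and $u<e$ compute $f_{\mathbf e,u}=\overline\partial_{\mathbf e}(f_u)$, and for every $j\in[\![\ell]\!]$ compute all $f_{\mathbf e,u}(\mathbf a_{i,j,0})\in\mathbb Z/q_0^m\mathbb Z$ by MME-B with parameters $(q_0,m,t)$. (5) Compute $b_{i,j}(z)=\sum_{u<e}\sum_{|\mathbf e|_1<m}f_{\mathbf e,u}(\mathbf a_{i,j,0})(\bar{\mathbf a}_i-\mathbf a_{i,j,0})^{\mathbf e}z^u\bmod(z-j)^m$. (6) By Hermite interpolation over $\mathbb Z/q_0^m\mathbb Z$ compute the polynomial $b_i(z)$ of degree less than $\ell m$ with $b_i\equiv b_{i,j}\pmod{(z-j)^m}$ for all $j\in[\![\ell]\!]$. (7) Lift $b_i$ to coefficients in $[\![q_0^m]\!]$ and output its remainder modulo $(r,E(z))$, for all $i$. \textbf{Theorem.} There are absolute constants $C,K>0$ and a polynomial $Q$ in three variables with natural number coefficients such that the following holds. Let $r\ge 2$ and $e,m,d\ge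 1$, let $E(z)\in(\mathbb Z/r\mathbb Z)[z]$ be monic of degree $e$, and let $R=(\mathbb Z/r\mathbb Z)[z]/(E(z))$. Let $f$ be an $m$-variate polynomial over $R$ of degree less than $d$ in each variable, let $N\ge 0$ and $\mathbf a_1,\dots,\mathbf a_N\in R^m$, and let $t$ be a non-negative integer less than $\log^\star(d(er)^d)$. Then, given $(f,\mathbf a_1,\dots,\mathbf a_N,r,t,E(z))$, the algorithm MME-For-Extension-Rings-B computes $f(\mathbf a_i)$ for all $i\in\{1,\dots,N\}$ in time at most \[ K\cdot 2^{C(t+1)m}\,\lambda_t(d)^t\,\lambda_{t-1}(\log r')\left(\left(\lambda_t(d)\log^{\circ t}r'\right)^m+N\right)\cdot Q(m,d,\log|R|),\qquad r'=2ed^2(er)^d . \] -/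

import Mathlib

namespace MME

/-! ## Machine model: a small language with a step-counting semantics

A program is a syntax tree over natural numbers of unbounded size, pairs and immutable arrays.  It is
run on a random access machine, where addresses fit into machine words.  Evaluating a node costs one
step (reading a variable, an array cell, a component of a pair, calling a procedure), an arithmetic
operation costs moreover `(bits of a + 1) * (bits of b + 1)` bit operations, writing a numeral costs
moreover its number of bits, and building or copying an array costs moreover one step per cell. -/

/-- Data types: natural numbers, arrays, pairs. -/
inductive Ty : Type
  | nat : Ty
  | list : Ty → Ty
  | prod : Ty → Ty → Ty

/-- The values of a data type. -/
abbrev Ty.den : Ty → Type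
  | .nat => ℕ
  | .list τ => List τ.den
  | .prod σ τ => σ.den × τ.den

/-- The value delivered by a read outside of an array. -/
def Ty.dflt : (τ : Ty) → τ.den
  | .nat => (0 : ℕ)
  | .list _ => []
  | .prod σ τ => (σ.dflt, τ.dflt)

/-- Binary operations on natural numbers; `lt` and `eq` deliver `1` for true and `0` for false. -/
inductive Op : Type
  | add | sub | mul | div | mod | lt | eq

def Op.app : Op → ℕ → ℕ → ℕ
  | .add, a, b => a + b
  | .sub, a, b => a - b
  | .mul, a, b => a * b
  | .div, a, b => a / b
  | .mod, a, b => a % b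
  | .lt, a, b => if a < b then 1 else 0
  | .eq, a, b => if a = b then 1 else 0

/-- Programs with a result of a given type. `V` is the type of variables, `F` that of names of
procedures. A program is polymorphic in `V` and `F`, so that it can handle its data only through the
instructions below. -/
inductive Tm (V : Ty → Type) (F : Ty → Ty → Type) : Ty → Type
  /-- a variable -/
  | var {τ : Ty} : V τ → Tm V F τ
  /-- a numeral -/
  | lit : ℕ → Tm V F .nat
  /-- an arithmetic operation -/
  | op : Op → Tm V F .nat → Tm V F .nat → Tm V F .nat
  /-- the number of binary digits -/
  | size : Tm V F .nat → Tm V F .nat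
  /-- `letE a b`: bind the value of `a` to a variable and continue with `b` -/
  | letE {σ τ : Ty} : Tm V F σ → (V σ → Tm V F τ) → Tm V F τ
  /-- `cond c a b`: if `c` is nonzero then `a`, else `b` -/
  | cond {τ : Ty} : Tm V F .nat → Tm V F τ → Tm V F τ → Tm V F τ
  | pair {σ τ : Ty} : Tm V F σ → Tm V F τ → Tm V F (.prod σ τ)
  | fst {σ τ : Ty} : Tm V F (.prod σ τ) → Tm V F σ
  | snd {σ τ : Ty} : Tm V F (.prod σ τ) → Tm V F τ
  /-- the length of an array -/
  | len {τ : Ty} : Tm V F (.list τ) → Tm V F .nat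
  /-- `get a i`: the cell `i` of the array `a`, counted from `0` -/
  | get {τ : Ty} : Tm V F (.list τ) → Tm V F .nat → Tm V F τ
  /-- `tab n b`: the array of length `n` whose cell `i` is `b i` -/
  | tab {τ : Ty} : Tm V F .nat → (V .nat → Tm V F τ) → Tm V F (.list τ)
  /-- concatenation of two arrays -/
  | append {τ : Ty} : Tm V F (.list τ) → Tm V F (.list τ) → Tm V F (.list τ)
  /-- concatenation of an array of arrays -/
  | flatten {τ : Ty} : Tm V F (.list (.list τ)) → Tm V F (.list τ)
  /-- `loop n x b`: starting from `x`, replace the state `s` by `b i s` for `i = 0, …, n - 1` -/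
  | loop {τ : Ty} : Tm V F .nat → Tm V F τ → (V .nat → V τ → Tm V F τ) → Tm V F τ
  /-- `recur n x base step`: call with argument `x` the recursive procedure with depth counter `n`.
  At depth `0` its body is `base`; at depth `k + 1` it is `step self k`, where `self` is the
  procedure at depth `k`. -/
  | recur {σ τ : Ty} : Tm V F .nat → Tm V F σ → (V σ → Tm V F τ) →
      (F σ τ → V .nat → V σ → Tm V F τ) → Tm V F τ
  /-- a procedure call -/
  | call {σ τ : Ty} : F σ τ → Tm V F σ → Tm V F τ

/-- `unroll base step k` is the procedure at depth `k`. -/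
def unroll {α β : Type} (base : α → β) (step : ℕ → (α → β) → α → β) : ℕ → α → β
  | 0 => base
  | k + 1 => step k (unroll base step k)

/-- A procedure at run time: it delivers a result and the number of steps. -/
abbrev Proc (σ τ : Ty) : Type := σ.den → τ.den × ℕ

/-- Execution of a program: its result and the number of steps. -/
def Tm.eval {τ : Ty} : Tm Ty.den Proc τ → τ.den × ℕ
  | .var x => (x, 1)
  | .lit n => (n, Nat.size n + 1)
  | .op o a b =>
      let u := a.eval
      let v := b.eval
      (o.app u.1 v.1, u.2 + v.2 + (Nat.size u.1 + 1) * (Nat.size v.1 + 1) + 1)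
  | .size a =>
      let u := a.eval
      (Nat.size u.1, u.2 + Nat.size u.1 + 1)
  | .letE a b =>
      let u := a.eval
      let v := (b u.1).eval
      (v.1, u.2 + v.2 + 1)
  | .cond c a b =>
      let u := c.eval
      let v := if u.1 ≠ 0 then a.eval else b.eval
      (v.1, u.2 + v.2 + 1)
  | .pair a b =>
      let u := a.eval
      let v := b.eval
      ((u.1, v.1), u.2 + v.2 + 1)
  | .fst a =>
      let u := a.eval
      (u.1.1, u.2 + 1)
  | .snd a =>
      let u := a.eval
      (u.1.2, u.2 + 1)
  | .len a =>
      let u := a.eval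
      (u.1.length, u.2 + 1)
  | .get (τ := τ) a i =>
      let u := a.eval
      let v := i.eval
      (u.1.getD v.1 τ.dflt, u.2 + v.2 + 1)
  | .tab n b =>
      let u := n.eval
      let w := (List.range u.1).map fun i => (b i).eval
      (w.map Prod.fst, u.2 + (w.map Prod.snd).sum + u.1 + 1)
  | .append a b =>
      let u := a.eval
      let v := b.eval
      (u.1 ++ v.1, u.2 + v.2 + u.1.length + v.1.length + 1)
  | .flatten a =>
      let u := a.eval
      (u.1.flatten, u.2 + u.1.length + u.1.flatten.length + 1)
  | .loop n x b =>
      let u := n.eval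
      let v := x.eval
      (List.range u.1).foldl
        (fun s i =>
          let w := (b i s.1).eval
          (w.1, s.2 + w.2 + 1))
        (v.1, u.2 + v.2 + 1)
  | .recur n x base step =>
      let u := n.eval
      let v := x.eval
      let w := unroll (fun y => (base y).eval) (fun k self y => (step self k y).eval) u.1 v.1
      (w.1, u.2 + v.2 + w.2 + 1)
  | .call p a =>
      let u := a.eval
      let v := p u.1
      (v.1, u.2 + v.2 + 1)

section Programs

variable {V : Ty → Type} {F : Ty → Ty → Type}

/-! ### Concrete syntax -/

instance : Add (Tm V F .nat) := ⟨Tm.op .add⟩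
instance : Sub (Tm V F .nat) := ⟨Tm.op .sub⟩
instance : Mul (Tm V F .nat) := ⟨Tm.op .mul⟩
instance : Div (Tm V F .nat) := ⟨Tm.op .div⟩
instance : Mod (Tm V F .nat) := ⟨Tm.op .mod⟩
instance (n : ℕ) : OfNat (Tm V F .nat) n := ⟨Tm.lit n⟩

def lt (a b : Tm V F .nat) : Tm V F .nat := .op .lt a b
def eq (a b : Tm V F .nat) : Tm V F .nat := .op .eq a b
def cond {τ : Ty} (c : Tm V F .nat) (a b : Tm V F τ) : Tm V F τ := .cond c a b
def size (a : Tm V F .nat) : Tm V F .nat := .size a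
def pair {σ τ : Ty} (a : Tm V F σ) (b : Tm V F τ) : Tm V F (.prod σ τ) := .pair a b
def fst {σ τ : Ty} (a : Tm V F (.prod σ τ)) : Tm V F σ := .fst a
def snd {σ τ : Ty} (a : Tm V F (.prod σ τ)) : Tm V F τ := .snd a
def len {τ : Ty} (a : Tm V F (.list τ)) : Tm V F .nat := .len a
def get {τ : Ty} (a : Tm V F (.list τ)) (i : Tm V F .nat) : Tm V F τ := .get a i
def append {τ : Ty} (a b : Tm V F (.list τ)) : Tm V F (.list τ) := .append a b
def flatten {τ : Ty} (a : Tm V F (.list (.list τ))) : Tm V F (.list τ) := .flatten a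
def call {σ τ : Ty} (p : F σ τ) (a : Tm V F σ) : Tm V F τ := .call p a

def share {σ τ : Ty} (a : Tm V F σ) (b : Tm V F σ → Tm V F τ) : Tm V F τ :=
  .letE a fun x => b (.var x)

def tab {τ : Ty} (n : Tm V F .nat) (b : Tm V F .nat → Tm V F τ) : Tm V F (.list τ) :=
  .tab n fun i => b (.var i)

def loop {τ : Ty} (n : Tm V F .nat) (x : Tm V F τ) (b : Tm V F .nat → Tm V F τ → Tm V F τ) :
    Tm V F τ :=
  .loop n x fun i s => b (.var i) (.var s)

def recur {σ τ : Ty} (n : Tm V F .nat) (x : Tm V F σ) (base : Tm V F σ → Tm V F τ)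
    (step : F σ τ → Tm V F .nat → Tm V F σ → Tm V F τ) : Tm V F τ :=
  .recur n x (fun y => base (.var y)) fun self k y => step self (.var k) (.var y)

/-- The array with the single cell `x`. -/
def single {τ : Ty} (x : Tm V F τ) : Tm V F (.list τ) := tab 1 fun _ => x

/-- The empty array of numbers. -/
def nil : Tm V F (.list .nat) := tab 0 fun i => i

/-! ### Arithmetic -/

/-- `a ^ n` -/
def pow (a n : Tm V F .nat) : Tm V F .nat := loop n 1 fun _ s => s * a

/-- `a ^ n mod q` -/
def powMod (q a n : Tm V F .nat) : Tm V F .nat := loop n 1 fun _ s => s * a % q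

/-- `∑ i < n, b i`, modulo `q` -/
def sumMod (q n : Tm V F .nat) (b : Tm V F .nat → Tm V F .nat) : Tm V F .nat :=
  loop n 0 fun i s => (s + b i) % q

/-- `∏ i < n, b i`, modulo `q` -/
def prodMod (q n : Tm V F .nat) (b : Tm V F .nat → Tm V F .nat) : Tm V F .nat :=
  loop n 1 fun i s => s * b i % q

/-- The binomial coefficient `n` over `k`. -/
def binom (n k : Tm V F .nat) : Tm V F .nat := loop k 1 fun i s => s * (n - i) / (i + 1)

/-- `1` if `x` is prime, otherwise `0`; by trial division. -/
def isPrime (x : Tm V F .nat) : Tm V F .nat :=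
  loop x (lt 1 x) fun i s => cond (lt 1 i) (cond (x % i) s 0) s

/-- The inverse of `x` modulo `q`, where `q` is a power of the prime `p` and `p` does not divide `x`:
the inverse `x ^ (p - 2)` modulo `p` is refined by Newton's iteration `y ↦ y * (2 - x * y)`. -/
def inverse (p q x : Tm V F .nat) : Tm V F .nat :=
  share x fun x =>
  loop (size q) (powMod p (x % p) (p - 2)) fun _ y => y * ((2 + (q - x * y % q)) % q) % q

/-! ### Multivariate polynomials modulo `q`

A polynomial in `x_0, …, x_{m-1}` of individual degrees less than `d` is the array of its `d ^ m`
coefficients. The coefficient of `∏ x_i ^ a_i` is in cell `∑ a_i * d ^ i`. -/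

/-- All vectors `v` of `m` natural numbers with sum less than `s`. -/
def exponents (m s : Tm V F .nat) : Tm V F (.list (.list .nat)) :=
  loop m (single nil) fun _ L =>
    flatten (tab (len L) fun k =>
      share (get L k) fun v =>
      tab (s - loop (len v) 0 fun i w => w + get v i) fun c => append v (single c))

/-- The Hasse derivative of `f` with respect to the monomial with exponent vector `v`: the
coefficient of `x ^ b` is that of `x ^ (b + v)` in `f`, times `∏ binom (b_i + v_i) v_i`. -/
def hasse (m d q : Tm V F .nat) (f v : Tm V F (.list .nat)) : Tm V F (.list .nat) :=
  tab (pow d m) fun k =>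
    share (loop m (pair 1 0) fun i s =>
      share (k / pow d i % d + get v i) fun a =>
      cond (lt a d)
        (pair (fst s * binom a (get v i) % q) (snd s + a * pow d i))
        (pair 0 (snd s))) fun s =>
    fst s * get f (snd s) % q

/-- The values of `f` on the product set `{0, …, r - 1} ^ m`; the value at `a` is in cell
`∑ a_i * r ^ i`. Each value `a` is substituted for the last variable, and the polynomials in the
remaining variables are evaluated recursively. -/
def evalGrid (m d r q : Tm V F .nat) (f : Tm V F (.list .nat)) : Tm V F (.list .nat) :=
  recur m f (fun f => f) fun self k f =>
    flatten (tab r fun a =>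
      call self (tab (pow d k) fun i =>
        sumMod q d fun c => get f (i + pow d k * c) * powMod q a c))

/-- The cell of the point `a` in the result of `evalGrid`. -/
def gridCell (m r : Tm V F .nat) (a : Tm V F (.list .nat)) : Tm V F .nat :=
  loop m 0 fun i s => s + get a i * pow r i

/-- `∑ v, y v * ∏ c, (a_c - b_c) ^ v_c` modulo `q`, where `v` runs through the array `vs` of exponent
vectors and `y` is applied to the number of the cell of `v`. -/
def taylor (m q : Tm V F .nat) (vs : Tm V F (.list (.list .nat)))
    (y : Tm V F .nat → Tm V F .nat) (a b : Tm V F (.list .nat)) : Tm V F .nat :=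
  sumMod q (len vs) fun k =>
    y k * prodMod q m fun c => powMod q (get a c - get b c) (get (get vs k) c)

/-! ### Multivariate multipoint evaluation over `ℤ/r^sℤ` -/

/-- The basic algorithm MME-Product-Set: the values of `f` modulo `r ^ s` at the points `as`. -/
def mmeProductSet (m d : Tm V F .nat) (f : Tm V F (.list .nat)) (as : Tm V F (.list (.list .nat)))
    (r s : Tm V F .nat) : Tm V F (.list .nat) :=
  share (pow r s) fun q =>
  -- Hasse derivatives of order less than `s`
  share (exponents m s) fun vs =>
  share (tab (len vs) fun k => hasse m d q f (get vs k)) fun fs =>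
  -- their values at all points of `{0, …, r - 1} ^ m`
  share (tab (len vs) fun k => evalGrid m d r q (get fs k)) fun ys =>
  -- the points modulo `r`
  share (tab (len as) fun i => tab m fun c => get (get as i) c % r) fun bs =>
  -- Taylor's formula
  tab (len as) fun i =>
    taylor m q vs (fun k => get (get ys k) (gridCell m r (get bs i))) (get as i) (get bs i)

/-- The primes `2, 3, 5, …` until their product is greater than `M`. They are sought among the numbers
less than `16 * size M`. -/
def smallPrimes (M : Tm V F .nat) : Tm V F (.list .nat) :=
  snd (loop (16 * size M) (pair 1 nil) fun x s =>
    cond (lt M (fst s)) s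
      (cond (isPrime x) (pair (fst s * x) (append (snd s) (single x))) s))

/-- The arguments of MME-B that change in the recursion: the coefficients of `f`, the points, `r`
and `s`. -/
abbrev Arg : Ty := .prod (.list .nat) (.prod (.list (.list .nat)) (.prod .nat .nat))

/-- The algorithm MME-B with recursion depth `t`: the values of `f` modulo `r ^ s` at the points
`as`. -/
def mmeB (m d : Tm V F .nat) (f : Tm V F (.list .nat)) (as : Tm V F (.list (.list .nat)))
    (r s t : Tm V F .nat) : Tm V F (.list .nat) :=
  recur (σ := Arg) t (pair f (pair as (pair r s)))
    (fun x =>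
      mmeProductSet m d (fst x) (fst (snd x)) (fst (snd (snd x))) (snd (snd (snd x))))
    fun self _ x =>
      share (fst x) fun f =>
      share (fst (snd x)) fun as =>
      share (fst (snd (snd x))) fun r =>
      share (snd (snd (snd x))) fun s =>
      share (pow r s) fun q =>
      -- Hasse derivatives of order less than `s`, with coefficients in `{0, …, q - 1}`
      share (exponents m s) fun vs =>
      share (tab (len vs) fun k => hasse m d q f (get vs k)) fun fs =>
      -- the points modulo `r`
      share (tab (len as) fun i => tab m fun c => get (get as i) c % r) fun bs =>
      -- the primes `p_j` and the moduli `n_j = p_j ^ m`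
      share (smallPrimes (d * pow r d)) fun ps =>
      share (tab (len ps) fun j => pow (get ps j) m) fun ns =>
      -- everything modulo `n_j`
      share (tab (len vs) fun k => tab (len ps) fun j =>
        tab (len (get fs k)) fun i => get (get fs k) i % get ns j) fun fjs =>
      share (tab (len ps) fun j => tab (len bs) fun i =>
        tab m fun c => get (get bs i) c % get ns j) fun bjs =>
      -- recursive calls
      share (tab (len vs) fun k => tab (len ps) fun j =>
        call self (pair (get (get fjs k) j) (pair (get bjs j) (pair (get ps j) m)))) fun ys =>
      -- Chinese remaindering: `w_j` is `1` modulo `n_j` and `0` modulo the other moduli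
      share (loop (len ns) 1 fun j z => z * get ns j) fun n =>
      share (tab (len ps) fun j =>
        share (n / get ns j) fun c => c * inverse (get ps j) (get ns j) (c % get ns j)) fun ws =>
      share (tab (len vs) fun k => tab (len as) fun i =>
        (sumMod n (len ps) fun j => get (get (get ys k) j) i * get ws j) % q) fun zs =>
      -- Taylor's formula
      tab (len as) fun i => taylor m q vs (fun k => get (get zs k) i) (get as i) (get bs i)

/-! ### Univariate polynomials modulo `q`

They are arrays of coefficients, starting with the constant one; leading zeros are allowed. -/

def polyMul (q : Tm V F .nat) (a b : Tm V F (.list .nat)) : Tm V F (.list .nat) :=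
  share a fun a => share b fun b =>
  tab (len a + len b) fun k => sumMod q (k + 1) fun i => get a i * get b (k - i)

/-- The remainder of `a` modulo the monic polynomial `g` of degree `n`, by long division. -/
def polyRem (q : Tm V F .nat) (a g : Tm V F (.list .nat)) (n : Tm V F .nat) :
    Tm V F (.list .nat) :=
  share a fun a => share g fun g =>
  share (loop (len a - n) a fun i s =>
    share (len s - 1 - i) fun k =>
    share (get s k) fun c =>
    tab (len s) fun x =>
      cond (lt (x + n) k) (get s x) ((get s x + (q - c) * get g (x + n - k)) % q)) fun s =>
  tab n fun x => get s x

/-- `(z - j) ^ n` -/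
def linPow (q j n : Tm V F .nat) : Tm V F (.list .nat) :=
  loop n (single 1) fun _ s => polyMul q s (append (single (q - j)) (single 1))

/-- `∏ k < l, ls k`, omitting the factor `k = j` -/
def prodExcept (q l j : Tm V F .nat) (ls : Tm V F (.list (.list .nat))) : Tm V F (.list .nat) :=
  loop l (single 1) fun k s => cond (eq k j) s (polyMul q s (get ls k))

/-- For Hermite interpolation at the nodes `0, …, l - 1` with multiplicity `n`, modulo a power `q` of
the prime `p`: the polynomials `δ_j` with `δ_j ≡ 1` modulo `(z - j) ^ n` and `δ_j ≡ 0` modulo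
`(z - k) ^ n` for `k ≠ j`. With `g = ∏ k ≠ j, (z - k) ^ n` and `u = g(j)`, one takes
`δ_j = 1 - (u⁻¹ * (u - g)) ^ n`. The array `ls` holds the polynomials `(z - j) ^ n`. -/
def hermiteBasis (p q l n : Tm V F .nat) (ls : Tm V F (.list (.list .nat))) :
    Tm V F (.list (.list .nat)) :=
  tab l fun j =>
    share (prodExcept q l j ls) fun g =>
    share (prodMod q l fun k =>
      cond (eq k j) 1 (powMod q ((j + (q - k)) % q) n)) fun u =>
    share (inverse p q u) fun w =>
    share (tab (len g) fun k => w * (cond (eq k 0) u 0 + (q - get g k)) % q) fun h =>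
    share (loop n (single 1) fun _ s => polyMul q s h) fun h' =>
    tab (len h') fun k => (cond (eq k 0) 1 0 + (q - get h' k)) % q

/-- Hermite interpolation: the polynomial of degree less than `l * n` that is congruent to `bs j`
modulo `(z - j) ^ n` for all `j < l`. Here `ds` is the Hermite basis and `g = ∏ (z - j) ^ n`. -/
def hermite (q l n : Tm V F .nat) (ds : Tm V F (.list (.list .nat))) (g : Tm V F (.list .nat))
    (bs : Tm V F (.list (.list .nat))) : Tm V F (.list .nat) :=
  loop l (tab (l * n) fun _ => 0) fun j s =>
    share (polyRem q (polyMul q (get ds j) (get bs j)) g (l * n)) fun h =>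
    tab (l * n) fun x => (get s x + get h x) % q

/-! ### Multivariate multipoint evaluation over `(ℤ/rℤ)[z]/(E(z))` -/

/-- The least prime in `[l, 2 * l]`. -/
def primeAbove (l : Tm V F .nat) : Tm V F .nat :=
  loop (l + 1) 0 fun i s => cond s s (cond (isPrime (l + i)) (l + i) 0)

/-- The least power of `p` that is at least `x`. -/
def powerAbove (p x : Tm V F .nat) : Tm V F .nat :=
  loop (size x) 1 fun _ s => cond (lt s x) (s * p) s

/-- `∑ u, ∑ v, y u v * (a - b) ^ v * z ^ u` modulo `(z - j) ^ m` and `q`. Here `u < e`, the vector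
`v` runs through the array `vs` and `y` is applied to the number of the cell of `v`, `a` is a vector of
`m` polynomials in `z` of degree less than `e`, `b` is a vector of `m` numbers, and `lj` is
`(z - j) ^ m`. -/
def taylorPoly (m e q : Tm V F .nat) (vs : Tm V F (.list (.list .nat)))
    (y : Tm V F .nat → Tm V F .nat → Tm V F .nat) (a : Tm V F (.list (.list .nat)))
    (b lj : Tm V F (.list .nat)) : Tm V F (.list .nat) :=
  share (tab m fun c => tab e fun k =>
    cond (eq k 0) ((get (get a c) k + (q - get b c)) % q) (get (get a c) k)) fun diff =>
  loop e (tab m fun _ => 0) fun u s =>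
    loop (len vs) s fun k s =>
      share (y u k) fun y =>
      share (loop m (polyRem q (tab (u + 1) fun i => eq i u) lj m) fun c h =>
        loop (get (get vs k) c) h fun _ h => polyRem q (polyMul q h (get diff c)) lj m) fun h =>
      tab m fun x => (get s x + y * get h x) % q

/-- The algorithm MME-For-Extension-Rings-B with recursion depth `t`. An element of
`(ℤ/rℤ)[z]/(E(z))` is the array of the `e` coefficients in `{0, …, r - 1}` of its representative of
degree less than `e = deg E`. The input consists of `m`, `d`, `e`, the array `f` of the `d ^ m`
coefficients of the polynomial, the array `as` of points, `r`, `t`, and the array `E` of the `e + 1`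
coefficients of `E(z)`. -/
def mmeForExtensionRingsB (m d e : Tm V F .nat) (f : Tm V F (.list (.list .nat)))
    (as : Tm V F (.list (.list (.list .nat)))) (r t : Tm V F .nat) (E : Tm V F (.list .nat)) :
    Tm V F (.list (.list .nat)) :=
  -- the arrays `f` and `as` also represent the lifts to `ℤ[z]`
  share (e * d) fun l =>
  share (primeAbove l) fun p =>
  share (powerAbove p (d * pow (e * r) d)) fun r' =>
  share (pow r' m) fun q =>
  share (tab (len f) fun k => tab e fun u => get (get f k) u % q) fun f' =>
  share (tab (len as) fun i => tab m fun c => tab e fun u =>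
    get (get (get as i) c) u % q) fun as' =>
  -- `f_u`, and the coefficient vectors `a_{i,j,u}` of the expansion of `a_i` in powers of `z - j`
  share (tab e fun u => tab (len f') fun k => get (get f' k) u) fun fus =>
  share (tab l fun j => tab (len as') fun i => tab e fun u => tab m fun c =>
    sumMod q e fun v =>
      binom v u * get (get (get as' i) c) v * powMod q j (v - u)) fun ajs =>
  -- Hasse derivatives of order less than `m`
  share (exponents m m) fun vs =>
  share (tab (len vs) fun k => tab e fun u => hasse m d q (get fus u) (get vs k)) fun fvs =>
  -- their values at the points `a_{i,j,0}`
  share (tab l fun j => tab (len as') fun i => get (get (get ajs j) i) 0) fun bjs =>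
  share (tab (len vs) fun k => tab l fun j => tab e fun u =>
    mmeB m d (get (get fvs k) u) (get bjs j) r' m t) fun ys =>
  -- `b_{i,j}`, the value at `a_i` modulo `(z - j) ^ m`
  share (tab l fun j => linPow q j m) fun ls =>
  share (tab (len as') fun i => tab l fun j =>
    taylorPoly m e q vs (fun u k => get (get (get (get ys k) j) u) i)
      (get as' i) (get (get bjs j) i) (get ls j)) fun bijs =>
  -- Hermite interpolation
  share (hermiteBasis p q l m ls) fun ds =>
  share (prodExcept q l l ls) fun g =>
  share (tab (len as') fun i => hermite q l m ds g (get bijs i)) fun bs =>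
  -- reduction modulo `r` and `E(z)`
  tab (len bs) fun i =>
    polyRem r (tab (len (get bs i)) fun k => get (get bs i) k % r) E e

end Programs

/-- Result and number of steps of MME-For-Extension-Rings-B on a given input. -/
def run (m d e : ℕ) (f : List (List ℕ)) (as : List (List (List ℕ))) (r t : ℕ) (E : List ℕ) :
    List (List ℕ) × ℕ :=
  Tm.eval (τ := .list (.list .nat))
    (mmeForExtensionRingsB (V := Ty.den) (F := Proc) (.var (τ := .nat) m) (.var (τ := .nat) d)
      (.var (τ := .nat) e) (.var (τ := .list (.list .nat)) f)
      (.var (τ := .list (.list (.list .nat))) as) (.var (τ := .nat) r) (.var (τ := .nat) t)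
      (.var (τ := .list .nat) E))

/-! ## Encoding of the input -/

open Polynomial in
/-- The `e` coefficients of the representative of degree less than `e` of an element of
`(ℤ/rℤ)[z]/(E(z))`, where `E` is monic of degree `e`. -/
noncomputable def encode {r : ℕ} {E : (ZMod r)[X]} (hE : E.Monic) (x : AdjoinRoot E) : List ℕ :=
  (List.range E.natDegree).map fun u => ((AdjoinRoot.modByMonicHom hE x).coeff u).val

open Polynomial in
/-- The `d ^ m` coefficients of the monomials of individual degree less than `d`. -/
noncomputable def encodePoly {r : ℕ} {E : (ZMod r)[X]} (hE : E.Monic) {m : ℕ} (d : ℕ)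
    (f : MvPolynomial (Fin m) (AdjoinRoot E)) : List (List ℕ) :=
  (List.range (d ^ m)).map fun k =>
    encode hE (f.coeff (Finsupp.equivFunOnFinite.symm fun i : Fin m => k / d ^ (i : ℕ) % d))

open Polynomial in
/-- The `e + 1` coefficients of `E(z)`. -/
def encodeModulus {r : ℕ} (E : (ZMod r)[X]) : List ℕ :=
  (List.range (E.natDegree + 1)).map fun u => (E.coeff u).val

/-! ## The functions in the time bound -/

/-- The `c`-fold composition of the binary logarithm with itself. -/
noncomputable def iterLog (c : ℕ) (x : ℝ) : ℝ := (Real.logb 2)^[c] x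

/-- The smallest `c` with `log^{∘c} x ≤ 1`. -/
noncomputable def logStar (x : ℝ) : ℕ := sInf {c : ℕ | iterLog c x ≤ 1}

/-- `λ_k(x)`, the product of `log^{∘i} x` over `0 ≤ i ≤ min (k, log^* x - 1)`; it is empty for
`k = -1`. -/
noncomputable def lam (k : ℤ) (x : ℝ) : ℝ :=
  ∏ i ∈ Finset.range (min (k + 1) (logStar x)).toNat, iterLog i x

end MME

namespace MME

/-! ## Values and step counts of programs -/

/-! Correctness rests on one truncation principle that is used twice. Taylor's formula with Hasse
derivatives (`taylor_formula`) lets exponent vectors be dropped as soon as the corresponding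
products of displacements vanish. In MME-B the displacements `a - a % r` are multiples of `r`, so
modulo `r ^ s` only the orders below `s` remain (`taylor_correct`), and evaluation is reduced to
points with coordinates below `r`. In the extension step the displacements are multiples of `z - j`,
so modulo `(z - j) ^ m` only the orders below `m` remain (`taylor_dvd`), and evaluation at vectors
of polynomials is reduced to evaluation at their values at `j`.

Each reduction is paired with a lift to characteristic zero. A Hasse derivative with coefficients
below `r ^ s`, `s ≤ m`, takes at a point with coordinates below `r` a natural number smaller than
the `m`-th power of any number above `d * r ^ d` (`crt_recover`). It is therefore known once it is
known modulo `p ^ m` for primes `p` with product above `d * r ^ d`, and primes below `16 * size (d *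
r ^ d)` are enough by Chebyshev's estimate (`two_pow_le_primorial`, `val_smallPrimes`). These
evaluations modulo `p ^ m` are the recursive calls; the base drops from `r` to about `d * log r`. In
the extension step the exact value of the lifted polynomial lies in `ℕ[z]`, has degree less than `e
* d * m` (`degree_valuePoly_lt`), and its coefficients, which are at most its value at `z = 1`, lie
below `(d * (e * r) ^ d) ^ m ≤ q` (`coeff_valuePoly_lt`). Thus it equals the lift of its image
modulo `q`, and that image is found by Hermite interpolation at `e * d` nodes of multiplicity `m`.
The nodes differ by units since `q` is a power of a prime not smaller than the number of nodes
(`sum_modByMonic_eq_of_congruences`, `hermite_basis_dvd`).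

For the running time, everything that is polynomial in `m`, `d` and `log |R|` is measured in powers
of one base `B`; the remaining factors are kept as an explicit weight, built from the at most `2 ^
(2 * m)` exponent vectors, the table sizes `d ^ m` and `r ^ m`, and the number `N` of points. One
level of MME-B makes at most `2 ^ (2 * m) * κ(r)` calls with bases at most `16 * κ(r)`, where `κ(r)
= size (d * r ^ d)` (`OkX.mmeStep`). This gives the recurrence `timeB`, which `timeB_le` solves: the
time is governed by the product of `κ` along the orbit of `R = r'` under `r ↦ 16 * κ(r)`, and by the
`m`-th power of the last base.

The analytic core is `primeCount_iterate_le`: along that orbit `κ` is at most `13 * d * max 1 (log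
d)` times the next iterated logarithm of `R`. The constants reproduce themselves because the
logarithm turns the factor `d * log d` of one level into a summand of the next. For `t ≥ 1` the
product `d * max 1 (log d)` is at most `λ_t(d)` (`mul_log_le_lam`), and the iterated logarithms
multiply to `λ_{t-1}(log r')`. The condition on `t` keeps all of them above `1`. The remaining
constants go into `2 ^ (17 * (t + 1) * m)` (`constants_le`), the powers of `B` into the polynomial
`Q`. -/

/-- The result of a program. -/
def Tm.val {τ : Ty} (t : Tm Ty.den Proc τ) : τ.den := t.eval.1

/-- The number of steps of a program. -/
def Tm.cost {τ : Ty} (t : Tm Ty.den Proc τ) : ℕ := t.eval.2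

/-- The result of a program that delivers a number. -/
def Tm.nv (t : Tm Ty.den Proc .nat) : ℕ := t.eval.1

section Semantics

variable {σ τ : Ty}

@[simp] theorem val_eq_nv (t : Tm Ty.den Proc .nat) : t.val = t.nv := (rfl)
@[simp] theorem val_var (x : τ.den) : (Tm.var x : Tm Ty.den Proc τ).val = x := (rfl)
@[simp] theorem nv_var (x : ℕ) : (Tm.var (τ := .nat) x : Tm Ty.den Proc .nat).nv = x := (rfl)
@[simp] theorem cost_var (x : τ.den) : (Tm.var x : Tm Ty.den Proc τ).cost = 1 := (rfl)
@[simp] theorem nv_zero : Tm.nv 0 = 0 := (rfl)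
@[simp] theorem nv_one : Tm.nv 1 = 1 := (rfl)
@[simp] theorem nv_two : Tm.nv 2 = 2 := (rfl)
@[simp] theorem nv_sixteen : Tm.nv 16 = 16 := (rfl)
theorem cost_ofNat (n : ℕ) :
    Tm.cost (OfNat.ofNat n : Tm Ty.den Proc .nat) = n.size + 1 := (rfl)

section Arithmetic

variable (a b : Tm Ty.den Proc .nat)

@[simp] theorem nv_add : (a + b).nv = a.nv + b.nv := (rfl)
@[simp] theorem nv_sub : (a - b).nv = a.nv - b.nv := (rfl)
@[simp] theorem nv_mul : (a * b).nv = a.nv * b.nv := (rfl)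
@[simp] theorem nv_div : (a / b).nv = a.nv / b.nv := (rfl)
@[simp] theorem nv_mod : (a % b).nv = a.nv % b.nv := (rfl)
@[simp] theorem nv_lt : (lt a b).nv = if a.nv < b.nv then 1 else 0 := (rfl)
@[simp] theorem nv_eq : (eq a b).nv = if a.nv = b.nv then 1 else 0 := (rfl)
@[simp] theorem nv_size : (size a).nv = Nat.size a.nv := (rfl)

theorem cost_op (o : Op) : (Tm.op o a b).cost
    = a.cost + b.cost + (Nat.size a.nv + 1) * (Nat.size b.nv + 1) + 1 := (rfl)
theorem cost_size : (size a).cost = a.cost + Nat.size a.nv + 1 := (rfl)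

end Arithmetic

@[simp] theorem val_share (a : Tm Ty.den Proc σ) (b : Tm Ty.den Proc σ → Tm Ty.den Proc τ) :
    (share a b).val = (b (.var a.val)).val := (rfl)
@[simp] theorem nv_share (a : Tm Ty.den Proc σ) (b : Tm Ty.den Proc σ → Tm Ty.den Proc .nat) :
    (share a b).nv = (b (.var a.val)).nv := (rfl)
theorem cost_share (a : Tm Ty.den Proc σ) (b : Tm Ty.den Proc σ → Tm Ty.den Proc τ) :
    (share a b).cost = a.cost + (b (.var a.val)).cost + 1 := (rfl)

@[simp] theorem val_cond (c : Tm Ty.den Proc .nat) (a b : Tm Ty.den Proc τ) :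
    (cond c a b).val = if c.nv ≠ 0 then a.val else b.val := by
  change (ite _ _ _ : _ × ℕ).1 = _
  split_ifs <;> first | rfl | contradiction
@[simp] theorem nv_cond (c a b : Tm Ty.den Proc .nat) :
    (cond c a b).nv = if c.nv ≠ 0 then a.nv else b.nv := val_cond c a b
theorem cost_cond (c : Tm Ty.den Proc .nat) (a b : Tm Ty.den Proc τ) :
    (cond c a b).cost = c.cost + (if c.nv ≠ 0 then a.cost else b.cost) + 1 := by
  change c.eval.2 + (ite _ _ _ : _ × ℕ).2 + 1 = _
  split_ifs <;> first | rfl | contradiction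

@[simp] theorem val_pair (a : Tm Ty.den Proc σ) (b : Tm Ty.den Proc τ) :
    (pair a b).val = (a.val, b.val) := (rfl)
theorem cost_pair (a : Tm Ty.den Proc σ) (b : Tm Ty.den Proc τ) :
    (pair a b).cost = a.cost + b.cost + 1 := (rfl)
@[simp] theorem val_snd (a : Tm Ty.den Proc (.prod σ τ)) : (snd a).val = a.val.2 := (rfl)
@[simp] theorem nv_fst (a : Tm Ty.den Proc (.prod .nat τ)) : (fst a).nv = a.val.1 := (rfl)
@[simp] theorem nv_snd (a : Tm Ty.den Proc (.prod τ .nat)) : (snd a).nv = a.val.2 := (rfl)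
theorem cost_fst (a : Tm Ty.den Proc (.prod σ τ)) : (fst a).cost = a.cost + 1 := (rfl)
theorem cost_snd (a : Tm Ty.den Proc (.prod σ τ)) : (snd a).cost = a.cost + 1 := (rfl)

@[simp] theorem dflt_list : Ty.dflt (.list τ) = [] := (rfl)
@[simp] theorem nv_len (a : Tm Ty.den Proc (.list τ)) :
    (len a).nv = List.length (α := τ.den) a.val := (rfl)
theorem cost_len (a : Tm Ty.den Proc (.list τ)) : (len a).cost = a.cost + 1 := (rfl)
@[simp] theorem val_get (a : Tm Ty.den Proc (.list τ)) (i : Tm Ty.den Proc .nat) :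
    (get a i).val = List.getD (α := τ.den) a.val i.nv τ.dflt := (rfl)
@[simp] theorem nv_get (a : Tm Ty.den Proc (.list .nat)) (i : Tm Ty.den Proc .nat) :
    (get a i).nv = List.getD (α := ℕ) a.val i.nv 0 := (rfl)
theorem cost_get (a : Tm Ty.den Proc (.list τ)) (i : Tm Ty.den Proc .nat) :
    (get a i).cost = a.cost + i.cost + 1 := (rfl)

@[simp] theorem val_append (a b : Tm Ty.den Proc (.list τ)) :
    (append a b).val = HAppend.hAppend (α := List τ.den) (β := List τ.den) a.val b.val := (rfl)
theorem cost_append (a b : Tm Ty.den Proc (.list τ)) : (append a b).cost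
    = a.cost + b.cost + List.length (α := τ.den) a.val
      + List.length (α := τ.den) b.val + 1 := (rfl)
@[simp] theorem val_flatten (a : Tm Ty.den Proc (.list (.list τ))) :
    (flatten a).val = List.flatten (α := τ.den) a.val := (rfl)
theorem cost_flatten (a : Tm Ty.den Proc (.list (.list τ))) : (flatten a).cost
    = a.cost + List.length (α := List τ.den) a.val
      + (List.flatten (α := τ.den) a.val).length + 1 := (rfl)

@[simp] theorem val_tab (n : Tm Ty.den Proc .nat)
    (b : Tm Ty.den Proc .nat → Tm Ty.den Proc τ) :
    (tab n b).val = (List.range n.nv).map fun i => (b (.var (τ := .nat) i)).val := by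
  change List.map Prod.fst (List.map _ _) = _
  rw [List.map_map]; rfl
theorem cost_tab (n : Tm Ty.den Proc .nat) (b : Tm Ty.den Proc .nat → Tm Ty.den Proc τ) :
    (tab n b).cost
      = n.cost + ((List.range n.nv).map fun i => (b (.var (τ := .nat) i)).cost).sum
        + n.nv + 1 := by
  change n.eval.2 + (List.map Prod.snd (List.map _ _)).sum + n.eval.1 + 1 = _
  rw [List.map_map]; rfl

theorem cost_tab_le {n : Tm Ty.den Proc .nat} {b : Tm Ty.den Proc .nat → Tm Ty.den Proc τ}
    {c : ℕ} (h : ∀ i < n.nv, (b (.var (τ := .nat) i)).cost ≤ c) :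
    (tab n b).cost ≤ n.cost + n.nv * (c + 1) + 1 := by
  rw [cost_tab]
  have := List.sum_le_card_nsmul ((List.range n.nv).map fun i => (b (.var (τ := .nat) i)).cost) c
    (by simpa using h)
  simp only [List.length_map, List.length_range, smul_eq_mul] at this
  linarith [Nat.mul_succ n.nv c]

theorem foldl_range_inv {α : Type} (I : ℕ → α → Prop) (g : α → ℕ → α) (x : α) (n : ℕ)
    (h0 : I 0 x) (hs : ∀ i < n, ∀ s, I i s → I (i + 1) (g s i)) :
    I n ((List.range n).foldl g x) := by
  induction n with
  | zero => simpa using h0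
  | succ n ih =>
    rw [List.range_succ, List.foldl_append]
    exact hs n (by simp) _ (ih fun i hi => hs i (by omega))

/-- The rule for loops: an invariant that bounds the cost of the body. -/
theorem loop_spec {n : Tm Ty.den Proc .nat} {x : Tm Ty.den Proc τ}
    {b : Tm Ty.den Proc .nat → Tm Ty.den Proc τ → Tm Ty.den Proc τ} {c : ℕ}
    (I : ℕ → τ.den → Prop) (h0 : I 0 x.val)
    (hs : ∀ i < n.nv, ∀ s, I i s → I (i + 1) (b (.var (τ := .nat) i) (.var s)).val ∧
      (b (.var (τ := .nat) i) (.var s)).cost ≤ c) :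
    I n.nv (loop n x b).val ∧ (loop n x b).cost ≤ n.cost + x.cost + n.nv * (c + 1) + 1 := by
  have := foldl_range_inv
    (fun i (s : τ.den × ℕ) => I i s.1 ∧ s.2 ≤ n.cost + x.cost + i * (c + 1) + 1)
    (fun s i => (((b (.var (τ := .nat) i) (.var s.1)).val,
      s.2 + (b (.var (τ := .nat) i) (.var s.1)).cost + 1) : τ.den × ℕ))
    (x.val, n.cost + x.cost + 1) n.nv ⟨h0, by simp⟩ (by
      rintro i hi s ⟨h1, h2⟩
      obtain ⟨h3, h4⟩ := hs i hi s.1 h1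
      exact ⟨h3, by simp only []; rw [Nat.succ_mul]; omega⟩)
  exact this

theorem loop_val {n : Tm Ty.den Proc .nat} {x : Tm Ty.den Proc τ}
    {b : Tm Ty.den Proc .nat → Tm Ty.den Proc τ → Tm Ty.den Proc τ}
    (I : ℕ → τ.den → Prop) (h0 : I 0 x.val)
    (hs : ∀ i < n.nv, ∀ s, I i s → I (i + 1) (b (.var (τ := .nat) i) (.var s)).val) :
    I n.nv (loop n x b).val := by
  have := foldl_range_inv (fun i s => I i s.1)
    (fun s i => (((b (.var (τ := .nat) i) (.var s.1)).val,
      s.2 + (b (.var (τ := .nat) i) (.var s.1)).cost + 1) : τ.den × ℕ))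
    (x.val, n.cost + x.cost + 1) n.nv h0 (fun i hi s h1 => hs i hi s.1 h1)
  exact this

theorem loop_val_eq {n : Tm Ty.den Proc .nat} {x : Tm Ty.den Proc τ}
    {b : Tm Ty.den Proc .nat → Tm Ty.den Proc τ → Tm Ty.den Proc τ}
    (g : ℕ → τ.den) (h0 : x.val = g 0)
    (hs : ∀ i < n.nv, (b (.var (τ := .nat) i) (.var (g i))).val = g (i + 1)) :
    (loop n x b).val = g n.nv :=
  loop_val (fun i s => s = g i) h0 fun i hi _ h => h ▸ hs i hi

theorem loop_nv_eq {n x : Tm Ty.den Proc .nat}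
    {b : Tm Ty.den Proc .nat → Tm Ty.den Proc .nat → Tm Ty.den Proc .nat}
    (g : ℕ → ℕ) (h0 : x.nv = g 0)
    (hs : ∀ i < n.nv, (b (.var (τ := .nat) i) (.var (τ := .nat) (g i))).nv = g (i + 1)) :
    (loop n x b).nv = g n.nv :=
  loop_val_eq (τ := .nat) g h0 hs

theorem loop_nv {n x : Tm Ty.den Proc .nat}
    {b : Tm Ty.den Proc .nat → Tm Ty.den Proc .nat → Tm Ty.den Proc .nat}
    (I : ℕ → ℕ → Prop) (h0 : I 0 x.nv)
    (hs : ∀ i < n.nv, ∀ s, I i s →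
      I (i + 1) (b (.var (τ := .nat) i) (.var (τ := .nat) s)).nv) :
    I n.nv (loop n x b).nv :=
  loop_val (τ := .nat) I h0 hs

end Semantics

/-! ## Polynomially bounded programs -/

/-- All numbers in a value have at most `b` binary digits. -/
def Bd (b : ℕ) : (τ : Ty) → τ.den → Prop
  | .nat, x => Nat.size x ≤ b
  | .list τ, l => ∀ x ∈ (show List τ.den from l), Bd b τ x
  | .prod σ τ, p => Bd b σ p.1 ∧ Bd b τ p.2

theorem Bd.mono {b c : ℕ} (h : b ≤ c) : ∀ {τ : Ty} {x : τ.den}, Bd b τ x → Bd c τ x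
  | .nat, _, hx => le_trans (show Nat.size _ ≤ b from hx) h
  | .list _, _, hx => fun y hy => Bd.mono h (hx y hy)
  | .prod _ _, _, hx => ⟨Bd.mono h hx.1, Bd.mono h hx.2⟩

theorem Bd.dflt (b : ℕ) : ∀ τ : Ty, Bd b τ τ.dflt
  | .nat => by change Nat.size 0 ≤ b; simp
  | .list _ => fun y hy => absurd (show y ∈ [] from hy) (by simp)
  | .prod σ τ => ⟨Bd.dflt b σ, Bd.dflt b τ⟩

theorem Bd.getD {b : ℕ} {τ : Ty} {l : List τ.den} (h : Bd b (.list τ) l) (i : ℕ) :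
    Bd b τ (l.getD i τ.dflt) := by
  by_cases hi : i < l.length
  · rw [List.getD_eq_getElem _ _ hi]; exact h _ (List.getElem_mem hi)
  · rw [List.getD_eq_default _ _ (by omega)]; exact Bd.dflt b τ

/-- The numbers in the result have at most `B ^ i` digits, and there are at most `B ^ k` steps. -/
structure Ok (B i k : ℕ) {τ : Ty} (t : Tm Ty.den Proc τ) : Prop where
  bd : Bd (B ^ i) τ t.val
  cost : t.cost ≤ B ^ k

theorem Ok.var {B i : ℕ} {τ : Ty} {x : τ.den} (h : Bd (B ^ i) τ x) :
    Ok B i 0 (.var x : Tm Ty.den Proc τ) :=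
  ⟨h, by simp⟩

theorem size_self_le (x : ℕ) : Nat.size x ≤ x := by
  rw [Nat.size_le]; exact Nat.lt_two_pow_self

theorem Bd.index {B j n N : ℕ} (h : n < N) (hN : N ≤ B ^ j) : Bd (B ^ j) .nat n :=
  (size_self_le n).trans (h.le.trans hN)

/-! ### Cost calculus: each construct of the language raises the exponents of `B` by a bounded
amount. -/

section Rules

variable {B : ℕ} [hB : Fact (8 ≤ B)]

theorem pow_mono_exp {i j : ℕ} (h : i ≤ j) : B ^ i ≤ B ^ j :=
  Nat.pow_le_pow_right (by have := hB.out; omega) h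

/-- This is why the base is at least `8`: one more power of `B` absorbs the few summands and small
constant factors that each construct adds. -/
theorem eight_mul_pow_le (k : ℕ) : 8 * B ^ k ≤ B ^ (k + 1) := by
  rw [pow_succ, mul_comm]; exact Nat.mul_le_mul_left _ hB.out

theorem one_le_pow_base (k : ℕ) : 1 ≤ B ^ k := Nat.one_le_pow _ _ (by have := hB.out; omega)

variable {σ τ : Ty} {i j k l : ℕ}

theorem Ok.mono {t : Tm Ty.den Proc τ} (h : Ok B i k t) (hi : i ≤ j) (hk : k ≤ l) : Ok B j l t :=
  ⟨h.bd.mono (pow_mono_exp hi), h.cost.trans (pow_mono_exp hk)⟩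

/-- Writing a numeral costs its number of digits plus one, and `7 + 1 ≤ 8 ≤ B`. -/
theorem Ok.ofNat (n : ℕ) (h : n.size ≤ 7 := by decide) :
    Ok B 1 1 (OfNat.ofNat n : Tm Ty.den Proc .nat) := by
  have := hB.out
  refine ⟨?_, ?_⟩
  · change n.size ≤ B ^ 1; rw [pow_one]; omega
  · rw [cost_ofNat, pow_one]; omega

/-- The bit operations multiply the two digit counts, so their exponents add; the costs of the
operands only enter through a maximum. -/
theorem Ok.op_cost {a b : Tm Ty.den Proc .nat} (o : Op) (ha : Ok B i k a) (hb : Ok B j l b) :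
    (Tm.op o a b).cost ≤ B ^ (max (max k l) (i + j) + 1) := by
  rw [cost_op]
  have h1 : Nat.size a.nv ≤ B ^ i := ha.bd
  have h2 : Nat.size b.nv ≤ B ^ j := hb.bd
  have h3 := ha.cost.trans (pow_mono_exp (B := B) (show k ≤ max (max k l) (i + j) by omega))
  have h4 := hb.cost.trans (pow_mono_exp (B := B) (show l ≤ max (max k l) (i + j) by omega))
  have h5 : (Nat.size a.nv + 1) * (Nat.size b.nv + 1) ≤ 4 * B ^ (i + j) := by
    have e1 := one_le_pow_base (B := B) i
    have e2 := one_le_pow_base (B := B) j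
    calc _ ≤ (2 * B ^ i) * (2 * B ^ j) := Nat.mul_le_mul (by omega) (by omega)
      _ = _ := by ring
  have h6 := pow_mono_exp (B := B) (show i + j ≤ max (max k l) (i + j) by omega)
  have h7 := eight_mul_pow_le (B := B) (max (max k l) (i + j))
  have h8 := one_le_pow_base (B := B) (max (max k l) (i + j))
  omega

variable {a b : Tm Ty.den Proc .nat}

theorem size_add_le (x y : ℕ) : Nat.size (x + y) ≤ max (Nat.size x) (Nat.size y) + 1 := by
  rw [Nat.size_le, pow_succ]
  have h1 := (Nat.lt_size_self x).trans_le (Nat.pow_le_pow_right two_pos (le_max_left x.size y.size))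
  have h2 := (Nat.lt_size_self y).trans_le (Nat.pow_le_pow_right two_pos (le_max_right x.size y.size))
  omega

theorem size_mul_le (x y : ℕ) : Nat.size (x * y) ≤ Nat.size x + Nat.size y := by
  rw [Nat.size_le, pow_add]
  exact Nat.mul_lt_mul'' (Nat.lt_size_self x) (Nat.lt_size_self y)

theorem size_pow_le (x n : ℕ) : Nat.size (x ^ n) ≤ n * Nat.size x + 1 := by
  rw [Nat.size_le, pow_succ, mul_comm n, pow_mul]
  have := Nat.pow_le_pow_left (Nat.lt_size_self x).le n
  have h2 : 0 < (2 ^ x.size) ^ n := by positivity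
  omega

theorem Ok.add (ha : Ok B i k a) (hb : Ok B j l b) :
    Ok B (max i j + 1) (max (max k l) (i + j) + 1) (a + b) := by
  refine ⟨?_, Ok.op_cost .add ha hb⟩
  have h1 : Nat.size a.nv ≤ B ^ i := ha.bd
  have h2 : Nat.size b.nv ≤ B ^ j := hb.bd
  have h3 := pow_mono_exp (B := B) (show i ≤ max i j by omega)
  have h4 := pow_mono_exp (B := B) (show j ≤ max i j by omega)
  have h7 := eight_mul_pow_le (B := B) (max i j)
  have h8 := one_le_pow_base (B := B) (max i j)
  have := size_add_le a.nv b.nv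
  change Nat.size (a.nv + b.nv) ≤ _
  omega

theorem Ok.mul (ha : Ok B i k a) (hb : Ok B j l b) :
    Ok B (max i j + 1) (max (max k l) (i + j) + 1) (a * b) := by
  refine ⟨?_, Ok.op_cost .mul ha hb⟩
  have h1 : Nat.size a.nv ≤ B ^ i := ha.bd
  have h2 : Nat.size b.nv ≤ B ^ j := hb.bd
  have h3 := pow_mono_exp (B := B) (show i ≤ max i j by omega)
  have h4 := pow_mono_exp (B := B) (show j ≤ max i j by omega)
  have h7 := eight_mul_pow_le (B := B) (max i j)
  have := size_mul_le a.nv b.nv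
  change Nat.size (a.nv * b.nv) ≤ _
  omega

theorem Ok.sub (ha : Ok B i k a) (hb : Ok B j l b) :
    Ok B i (max (max k l) (i + j) + 1) (a - b) :=
  ⟨(Nat.size_le_size (Nat.sub_le _ _)).trans ha.bd, Ok.op_cost .sub ha hb⟩

theorem Ok.div (ha : Ok B i k a) (hb : Ok B j l b) :
    Ok B i (max (max k l) (i + j) + 1) (a / b) :=
  ⟨(Nat.size_le_size (Nat.div_le_self _ _)).trans ha.bd, Ok.op_cost .div ha hb⟩

theorem Ok.mod (ha : Ok B i k a) (hb : Ok B j l b) :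
    Ok B i (max (max k l) (i + j) + 1) (a % b) :=
  ⟨(Nat.size_le_size (Nat.mod_le _ _)).trans ha.bd, Ok.op_cost .mod ha hb⟩

/-- The digits are bounded by those of the modulus instead of those of the dividend. This keeps the
states of modular loops from growing. -/
theorem Ok.mod_pos (ha : Ok B i k a) (hb : Ok B j l b) (h : 0 < b.nv) :
    Ok B j (max (max k l) (i + j) + 1) (a % b) :=
  ⟨(Nat.size_le_size (Nat.mod_lt _ h).le).trans hb.bd, Ok.op_cost .mod ha hb⟩

theorem Ok.lt (ha : Ok B i k a) (hb : Ok B j l b) :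
    Ok B 0 (max (max k l) (i + j) + 1) (lt a b) := by
  refine ⟨?_, Ok.op_cost .lt ha hb⟩
  change Nat.size (if _ then 1 else 0) ≤ B ^ 0
  split_ifs <;> simp

theorem Ok.eq (ha : Ok B i k a) (hb : Ok B j l b) :
    Ok B 0 (max (max k l) (i + j) + 1) (eq a b) := by
  refine ⟨?_, Ok.op_cost .eq ha hb⟩
  change Nat.size (if _ then 1 else 0) ≤ B ^ 0
  split_ifs <;> simp

theorem Ok.size (ha : Ok B i k a) : Ok B i (max i k + 1) (size a) := by
  refine ⟨(size_self_le _).trans ha.bd, ?_⟩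
  rw [cost_size]
  have h1 : Nat.size a.nv ≤ B ^ i := ha.bd
  have h2 := ha.cost
  have h3 := pow_mono_exp (B := B) (show i ≤ max i k by omega)
  have h4 := pow_mono_exp (B := B) (show k ≤ max i k by omega)
  have h7 := eight_mul_pow_le (B := B) (max i k)
  have h8 := one_le_pow_base (B := B) (max i k)
  omega

theorem Ok.share {a : Tm Ty.den Proc σ} {b : Tm Ty.den Proc σ → Tm Ty.den Proc τ}
    (ha : Ok B i k a) (hb : Bd (B ^ i) σ a.val → Ok B j l (b (.var a.val))) :
    Ok B j (max k l + 1) (share a b) := by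
  have hb := hb ha.bd
  refine ⟨hb.bd, ?_⟩
  rw [cost_share]
  have h1 := ha.cost
  have h2 := hb.cost
  have h3 := pow_mono_exp (B := B) (show k ≤ max k l by omega)
  have h4 := pow_mono_exp (B := B) (show l ≤ max k l by omega)
  have h7 := eight_mul_pow_le (B := B) (max k l)
  have h8 := one_le_pow_base (B := B) (max k l)
  omega

theorem Ok.cond {c : Tm Ty.den Proc .nat} {x y : Tm Ty.den Proc τ} {i₁ k₁ i₂ k₂ : ℕ}
    (hc : Ok B i k c) (hx : c.nv ≠ 0 → Ok B i₁ k₁ x)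
    (hy : c.nv = 0 → Ok B i₂ k₂ y) :
    Ok B (max i₁ i₂) (max k (max k₁ k₂) + 1) (cond c x y) := by
  have h1 := hc.cost
  have h3 := pow_mono_exp (B := B) (show k ≤ max k (max k₁ k₂) by omega)
  have h4 := pow_mono_exp (B := B) (show k₁ ≤ max k (max k₁ k₂) by omega)
  have h5 := pow_mono_exp (B := B) (show k₂ ≤ max k (max k₁ k₂) by omega)
  have h7 := eight_mul_pow_le (B := B) (max k (max k₁ k₂))
  have h8 := one_le_pow_base (B := B) (max k (max k₁ k₂))
  by_cases h : c.nv ≠ 0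
  · have hx := hx h
    refine ⟨?_, ?_⟩
    · rw [val_cond, if_pos h]; exact hx.bd.mono (pow_mono_exp (by omega))
    · rw [cost_cond, if_pos h]; have := hx.cost; omega
  · have hy := hy (by simpa using h)
    refine ⟨?_, ?_⟩
    · rw [val_cond, if_neg h]; exact hy.bd.mono (pow_mono_exp (by omega))
    · rw [cost_cond, if_neg h]; have := hy.cost; omega

theorem Ok.pair {x : Tm Ty.den Proc σ} {y : Tm Ty.den Proc τ} (hx : Ok B i k x)
    (hy : Ok B j l y) : Ok B (max i j) (max k l + 1) (pair x y) := by
  refine ⟨⟨hx.bd.mono (pow_mono_exp (by omega)), hy.bd.mono (pow_mono_exp (by omega))⟩, ?_⟩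
  rw [cost_pair]
  have h1 := hx.cost
  have h2 := hy.cost
  have h3 := pow_mono_exp (B := B) (show k ≤ max k l by omega)
  have h4 := pow_mono_exp (B := B) (show l ≤ max k l by omega)
  have h7 := eight_mul_pow_le (B := B) (max k l)
  have h8 := one_le_pow_base (B := B) (max k l)
  omega

theorem succ_pow_le (k : ℕ) : B ^ k + 1 ≤ B ^ (k + 1) := by
  have h7 := eight_mul_pow_le (B := B) k
  have h8 := one_le_pow_base (B := B) k
  omega

theorem Ok.fst {x : Tm Ty.den Proc (.prod σ τ)} (hx : Ok B i k x) : Ok B i (k + 1) (fst x) :=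
  ⟨hx.bd.1, by rw [cost_fst]; exact (Nat.succ_le_succ hx.cost).trans (succ_pow_le k)⟩

theorem Ok.snd {x : Tm Ty.den Proc (.prod σ τ)} (hx : Ok B i k x) : Ok B i (k + 1) (snd x) :=
  ⟨hx.bd.2, by rw [cost_snd]; exact (Nat.succ_le_succ hx.cost).trans (succ_pow_le k)⟩

/-- The length is not controlled by `Ok`, which only speaks of the entries, so a bound for it is
supplied separately. -/
theorem Ok.len {x : Tm Ty.den Proc (.list τ)} (hx : Ok B i k x)
    (h : List.length (α := τ.den) x.val ≤ B ^ j) : Ok B j (k + 1) (len x) :=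
  ⟨(size_self_le _).trans h, by
    rw [cost_len]; exact (Nat.succ_le_succ hx.cost).trans (succ_pow_le k)⟩

theorem Ok.get {x : Tm Ty.den Proc (.list τ)} (hx : Ok B i k x) (ha : Ok B j l a) :
    Ok B i (max k l + 1) (get x a) := by
  refine ⟨Bd.getD hx.bd _, ?_⟩
  rw [cost_get]
  have h1 := hx.cost
  have h2 := ha.cost
  have h3 := pow_mono_exp (B := B) (show k ≤ max k l by omega)
  have h4 := pow_mono_exp (B := B) (show l ≤ max k l by omega)
  have h7 := eight_mul_pow_le (B := B) (max k l)
  have h8 := one_le_pow_base (B := B) (max k l)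
  omega

theorem Ok.tab {x : Tm Ty.den Proc .nat → Tm Ty.den Proc τ} {j₁ : ℕ} (ha : Ok B i k a)
    (hn : a.nv ≤ B ^ j₁)
    (hx : ∀ n < a.nv, Ok B j l (x (.var (τ := .nat) n))) :
    Ok B j (max k (j₁ + (l + 1)) + 1) (tab a x) := by
  refine ⟨?_, ?_⟩
  · rw [val_tab]
    intro y hy
    obtain ⟨n, hn, rfl⟩ := List.mem_map.mp hy
    exact (hx n (List.mem_range.mp hn)).bd
  · refine (cost_tab_le fun n hn => (hx n hn).cost).trans ?_
    have h1 := ha.cost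
    have h2 := Nat.mul_le_mul hn (succ_pow_le (B := B) l)
    rw [← pow_add] at h2
    have h3 := pow_mono_exp (B := B) (show k ≤ max k (j₁ + (l + 1)) by omega)
    have h4 := pow_mono_exp (B := B) (show j₁ + (l + 1) ≤ max k (j₁ + (l + 1)) by omega)
    have h7 := eight_mul_pow_le (B := B) (max k (j₁ + (l + 1)))
    have h8 := one_le_pow_base (B := B) (max k (j₁ + (l + 1)))
    omega

theorem Ok.single {x : Tm Ty.den Proc τ} (hx : Ok B i k x) : Ok B i (k + 3) (single x) :=
  (Ok.tab (Ok.ofNat 1) (j₁ := 0) (le_of_eq rfl) fun _ _ => hx).mono le_rfl (by omega)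

@[simp] theorem val_single (x : Tm Ty.den Proc τ) : (single x).val = [x.val] := by
  simp [MME.single]

@[simp] theorem val_nil : (nil : Tm Ty.den Proc _).val = [] := by
  simp [MME.nil]

theorem Ok.nil : Ok B 0 3 (nil : Tm Ty.den Proc _) :=
  (Ok.tab (Ok.ofNat 0) (j₁ := 0) (Nat.zero_le _) fun n hn =>
    absurd hn (Nat.not_lt_zero _)).mono (le_refl 0) (show max 1 (0 + (0 + 1)) + 1 ≤ 3 by decide)

theorem Ok.append {x y : Tm Ty.den Proc (.list τ)} {j₁ j₂ : ℕ} (hx : Ok B i k x)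
    (hy : Ok B j l y) (h₁ : List.length (α := τ.den) x.val ≤ B ^ j₁) (h₂ : List.length (α := τ.den) y.val ≤ B ^ j₂) :
    Ok B (max i j) (max (max k l) (max j₁ j₂) + 1) (append x y) := by
  refine ⟨?_, ?_⟩
  · intro z hz
    rcases List.mem_append.mp (show z ∈ x.val ++ y.val from hz) with hz | hz
    · exact (hx.bd z hz).mono (pow_mono_exp (by omega))
    · exact (hy.bd z hz).mono (pow_mono_exp (by omega))
  · rw [cost_append]
    have h1 := hx.cost
    have h2 := hy.cost
    have h3 := pow_mono_exp (B := B) (show k ≤ max (max k l) (max j₁ j₂) by omega)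
    have h4 := pow_mono_exp (B := B) (show l ≤ max (max k l) (max j₁ j₂) by omega)
    have h5 := pow_mono_exp (B := B) (show j₁ ≤ max (max k l) (max j₁ j₂) by omega)
    have h6 := pow_mono_exp (B := B) (show j₂ ≤ max (max k l) (max j₁ j₂) by omega)
    have h7 := eight_mul_pow_le (B := B) (max (max k l) (max j₁ j₂))
    have h8 := one_le_pow_base (B := B) (max (max k l) (max j₁ j₂))
    omega

/-- Composing the rules once per iteration would raise the exponents at every pass. The invariant
has to give a bound for the state, hence for the cost of the body, that is uniform in the iteration.
-/
theorem Ok.loop {x : Tm Ty.den Proc τ} {j₁ i₁ k₁ : ℕ}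
    {b : Tm Ty.den Proc .nat → Tm Ty.den Proc τ → Tm Ty.den Proc τ} (ha : Ok B i k a)
    (hn : a.nv ≤ B ^ j₁) (hx : Ok B i₁ k₁ x) (I : ℕ → τ.den → Prop) (h0 : I 0 x.val)
    (hs : ∀ n < a.nv, ∀ s, I n s → I (n + 1) (b (.var (τ := .nat) n) (.var s)).val ∧
      (b (.var (τ := .nat) n) (.var s)).cost ≤ B ^ l) (hI : ∀ s, I a.nv s → Bd (B ^ j) τ s) :
    Ok B j (max (max k k₁) (j₁ + (l + 1)) + 1) (loop a x b) := by
  obtain ⟨h1, h2⟩ := loop_spec I h0 hs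
  refine ⟨hI _ h1, h2.trans ?_⟩
  have h1 := ha.cost
  have h2 := Nat.mul_le_mul hn (succ_pow_le (B := B) l)
  rw [← pow_add] at h2
  have h5 := hx.cost
  have h3 := pow_mono_exp (B := B) (show k ≤ max (max k k₁) (j₁ + (l + 1)) by omega)
  have h4 := pow_mono_exp (B := B) (show j₁ + (l + 1) ≤ max (max k k₁) (j₁ + (l + 1)) by omega)
  have h6 := pow_mono_exp (B := B) (show k₁ ≤ max (max k k₁) (j₁ + (l + 1)) by omega)
  have h7 := eight_mul_pow_le (B := B) (max (max k k₁) (j₁ + (l + 1)))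
  have h8 := one_le_pow_base (B := B) (max (max k k₁) (j₁ + (l + 1)))
  omega

end Rules

end MME

namespace MME

/-! ## Arithmetic programs -/

section Values

variable (p q a n k x : Tm Ty.den Proc .nat)

@[simp] theorem nv_pow : (pow a n).nv = a.nv ^ n.nv :=
  loop_nv_eq (fun i => a.nv ^ i) (by simp) fun i _ => by simp [pow_succ]

theorem nv_powMod (hq : 1 < q.nv) : (powMod q a n).nv = a.nv ^ n.nv % q.nv :=
  loop_nv_eq (fun i => a.nv ^ i % q.nv) (by simp [Nat.mod_eq_of_lt hq]) fun i _ => by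
    simp [pow_succ, Nat.mod_mul_mod]

theorem nv_sumMod (b : Tm Ty.den Proc .nat → Tm Ty.den Proc .nat) :
    (sumMod q n b).nv = (∑ i ∈ Finset.range n.nv, (b (.var (τ := .nat) i)).nv) % q.nv :=
  loop_nv_eq (fun i => (∑ i ∈ Finset.range i, (b (.var (τ := .nat) i)).nv) % q.nv)
    (by simp) fun i _ => by simp [Finset.sum_range_succ]

theorem nv_prodMod (b : Tm Ty.den Proc .nat → Tm Ty.den Proc .nat) (hq : 1 < q.nv) :
    (prodMod q n b).nv = (∏ i ∈ Finset.range n.nv, (b (.var (τ := .nat) i)).nv) % q.nv :=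
  loop_nv_eq (fun i => (∏ i ∈ Finset.range i, (b (.var (τ := .nat) i)).nv) % q.nv)
    (by simp [Nat.mod_eq_of_lt hq]) fun i _ => by simp [Finset.prod_range_succ, Nat.mod_mul_mod]

-- All divisions are exact, because the state after `i` passes is `choose n i` and `choose n (i + 1)
-- * (i + 1) = choose n i * (n - i)`.
@[simp] theorem nv_binom : (binom n k).nv = Nat.choose n.nv k.nv :=
  loop_nv_eq (fun i => Nat.choose n.nv i) (by simp) fun i _ => by
    simp only [nv_mul, nv_div, nv_sub, nv_add, nv_var, nv_one]
    exact Nat.div_eq_of_eq_mul_left (Nat.succ_pos i) (Nat.choose_succ_right_eq _ _).symm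

open Classical in
@[simp] theorem nv_isPrime : (isPrime x).nv = if Nat.Prime x.nv then 1 else 0 := by
  have h := loop_nv_eq (n := x) (x := lt 1 x)
    (b := fun i s => cond (lt 1 i) (cond (x % i) s 0) s)
    (fun i => if 1 < x.nv ∧ ∀ j < i, 1 < j → ¬ j ∣ x.nv then 1 else 0) (by simp) fun i _ => by
      have e : (∀ j < i + 1, 1 < j → ¬ j ∣ x.nv) ↔
          (∀ j < i, 1 < j → ¬ j ∣ x.nv) ∧ (1 < i → ¬ i ∣ x.nv) :=
        ⟨fun h => ⟨fun j hj => h j (by omega), h i (by omega)⟩, fun h j hj =>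
          (Nat.lt_succ_iff_lt_or_eq.mp hj).elim (h.1 j) fun e => e ▸ h.2⟩
      simp only [nv_cond, nv_lt, nv_mod, nv_var, nv_one, nv_zero, e]
      by_cases h1 : 1 < i <;> by_cases h2 : i ∣ x.nv <;>
        simp [h1, h2, ← Nat.dvd_iff_mod_eq_zero]
  refine h.trans (if_congr ?_ rfl rfl)
  rw [Nat.prime_def_lt']
  exact and_congr Iff.rfl ⟨fun h m h1 hm => h m hm h1, fun h j hj h1 => h j h1 hj⟩

/-- By Fermat's little theorem the starting value has an error `1 - x * y` divisible by `p`. Each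
Newton step squares the error, so after `i` steps it is a multiple of `p ^ (2 ^ i)`. After `size q`
steps the exponent is at least `q ≥ r`, and the error is zero modulo `p ^ r`. -/
theorem nv_inverse (r : ℕ) (hp : Nat.Prime p.nv) (hr : r ≠ 0) (hq : q.nv = p.nv ^ r)
    (hx : ¬ p.nv ∣ x.nv) :
    (inverse p q x).nv < q.nv ∧ ((inverse p q x).nv : ZMod q.nv) * x.nv = 1 := by
  have hq1 : 1 < q.nv := by rw [hq]; exact Nat.one_lt_pow hr hp.one_lt
  have hpq : p.nv ≤ q.nv := by rw [hq]; exact Nat.le_self_pow hr _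
  have := Fact.mk hp
  obtain ⟨h1, c, h2⟩ := loop_nv (n := size q)
    (x := powMod p (.var (τ := .nat) x.nv % p) (p - 2))
    (b := fun _ y => y * ((2 + (q - .var (τ := .nat) x.nv * y % q)) % q) % q)
    (fun i y => y < q.nv ∧ ∃ c : ZMod q.nv, 1 - x.nv * (y : ZMod q.nv) = p.nv ^ (2 ^ i) * c)
    (by
      rw [nv_powMod _ _ _ hp.one_lt]
      simp only [nv_mod, nv_var, nv_sub, nv_two, ← Nat.pow_mod]
      refine ⟨(Nat.mod_lt _ hp.pos).trans_le hpq, ?_⟩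
      have : ((p.nv : ℕ) : ℤ) ∣ 1 - x.nv * (x.nv ^ (p.nv - 2) % p.nv : ℕ) := by
        rw [← ZMod.intCast_zmod_eq_zero_iff_dvd]
        have hx0 : (x.nv : ZMod p.nv) ≠ 0 := by rwa [Ne, ZMod.natCast_eq_zero_iff]
        rw [Int.cast_sub, Int.cast_mul, Int.cast_natCast, Int.cast_natCast, ZMod.natCast_mod,
          Nat.cast_pow, Int.cast_one, ← pow_succ', show p.nv - 2 + 1 = p.nv - 1 by have := hp.two_le; omega,
          ZMod.pow_card_sub_one_eq_one hx0, sub_self]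
      obtain ⟨c, hc⟩ := this
      refine ⟨c, ?_⟩
      have := congrArg (fun z : ℤ => (z : ZMod q.nv)) hc
      rw [Int.cast_sub, Int.cast_mul, Int.cast_natCast, Int.cast_natCast, Int.cast_mul,
        Int.cast_natCast, Int.cast_one] at this
      simpa using this)
    (by
      rintro i - y ⟨hy, c, hc⟩
      simp only [nv_mod, nv_var, nv_sub, nv_two, nv_mul, nv_add]
      refine ⟨Nat.mod_lt _ (by omega), c ^ 2, ?_⟩
      have h1 := (Nat.mod_lt (x.nv * y) (show 0 < q.nv by omega)).le
      rw [ZMod.natCast_mod, Nat.cast_mul, ZMod.natCast_mod, Nat.cast_add, Nat.cast_sub h1,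
        ZMod.natCast_mod]
      push_cast
      rw [ZMod.natCast_self]
      have : (1 : ZMod q.nv) - x.nv * (y * (2 + (0 - x.nv * y))) = (1 - x.nv * y) ^ 2 := by ring
      rw [this, hc]; ring)
  refine ⟨h1, ?_⟩
  have h3 : ((p.nv : ZMod q.nv)) ^ (2 ^ (size q).nv) = 0 := by
    have h4 : r ≤ 2 ^ (size q).nv := by
      rw [nv_size]
      calc r ≤ p.nv ^ r := (Nat.lt_pow_self hp.one_lt).le
        _ = q.nv := hq.symm
        _ ≤ _ := (Nat.lt_size_self _).le
    rw [← Nat.add_sub_cancel' h4, pow_add, ← Nat.cast_pow, ← hq, ZMod.natCast_self, zero_mul]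
  rw [h3, zero_mul, sub_eq_zero] at h2
  rw [mul_comm]; exact h2.symm

end Values

/-! ### Cost of the arithmetic programs. -/

section Costs

variable {B : ℕ} [hB : Fact (8 ≤ B)] {i j k : ℕ} {p q a n x : Tm Ty.den Proc .nat}

theorem one_size_le (n : ℕ) : Nat.size 1 ≤ B ^ n := by
  rw [Nat.size_one]; exact one_le_pow_base n

/-- Unlike the base, the exponent must be bounded in value: the loop runs `n` times and the powers
have about `n * size a` digits. -/
theorem Ok.pow (ha : Ok B i k a) (hn : Ok B i k n) (hn' : n.nv ≤ B ^ j) :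
    Ok B (i + j + 1) (max k (2 * i + j + 1) + j + 3) (pow a n) := by
  have key : ∀ m ≤ n.nv, Nat.size (a.nv ^ m) ≤ B ^ (i + j + 1) := by
    intro m hm
    have h1 := size_pow_le a.nv m
    have h2 : Nat.size a.nv ≤ B ^ i := ha.bd
    have h3 := Nat.mul_le_mul (hm.trans hn') h2
    have h4 := succ_pow_le (B := B) (i + j)
    rw [← pow_add, add_comm j i] at h3
    omega
  refine (Ok.loop (i₁ := 1) (k₁ := 1) (l := max k (2 * i + j + 1) + 1) hn hn' (Ok.ofNat 1)
    (fun m s => s = a.nv ^ m) (by simp) ?_ ?_).mono le_rfl (by omega)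
  · intro m hm s hs
    have hs' : (s : ℕ) = a.nv ^ m := hs
    refine ⟨by simp [hs', pow_succ], ?_⟩
    refine ((Ok.var (B := B) (i := i + j + 1) (τ := .nat) ?_).mul ha |>.mono le_rfl ?_).cost
    · rw [hs']; exact key m hm.le
    · omega
  · intro s hs
    have hs' : (s : ℕ) = a.nv ^ n.nv := hs
    rw [hs']; exact key _ le_rfl

theorem Ok.powMod (hq : Ok B i k q) (ha : Ok B i k a) (hn : Ok B i k n) (hn' : n.nv ≤ B ^ j)
    (hq' : 0 < q.nv) : Ok B i (max k (2 * i + 1) + j + 4) (powMod q a n) := by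
  refine (Ok.loop (i₁ := 1) (k₁ := 1) (l := max k (2 * i + 1) + 2) hn hn' (Ok.ofNat 1)
    (fun _ s => Bd (B ^ i) .nat s) (one_size_le _) ?_ (fun _ h => h)).mono le_rfl (by omega)
  intro m hm s hs
  have := ((Ok.var hs).mul ha).mod_pos hq hq'
  exact ⟨this.bd, (this.mono le_rfl (by omega)).cost⟩

theorem Ok.prodMod {b : Tm Ty.den Proc .nat → Tm Ty.den Proc .nat} (hq : Ok B i k q)
    (hn : Ok B i k n) (hn' : n.nv ≤ B ^ j) (hq' : 0 < q.nv)
    (hb : ∀ m < n.nv, Ok B i k (b (.var (τ := .nat) m))) :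
    Ok B i (max k (2 * i + 1) + j + 4) (prodMod q n b) := by
  refine (Ok.loop (i₁ := 1) (k₁ := 1) (l := max k (2 * i + 1) + 2) hn hn' (Ok.ofNat 1)
    (fun _ s => Bd (B ^ i) .nat s) (one_size_le _) ?_ (fun _ h => h)).mono le_rfl (by omega)
  intro m hm s hs
  have := ((Ok.var hs).mul (hb m hm)).mod_pos hq hq'
  exact ⟨this.bd, (this.mono le_rfl (by omega)).cost⟩

/-- All intermediate results are binomial coefficients, hence at most `2 ^ n`, with about as many
digits as the value of `n`. -/
theorem Ok.binom (hn : Ok B i k n) (ha : Ok B i k a) (hn' : n.nv ≤ B ^ j) (ha' : a.nv ≤ B ^ j) :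
    Ok B (j + 1) (max k (2 * i + 2 * j + 3) + j + 5) (binom n a) := by
  have key : ∀ m, Nat.size (Nat.choose n.nv m) ≤ B ^ (j + 1) := by
    intro m
    have h1 : Nat.choose n.nv m < 2 ^ (n.nv + 1) :=
      (Nat.choose_le_two_pow n.nv m).trans_lt (Nat.pow_lt_pow_right (by omega) (by omega))
    have := succ_pow_le (B := B) j
    exact (Nat.size_le.mpr h1).trans (by omega)
  refine (Ok.loop (i₁ := 1) (k₁ := 1) (l := max k (2 * i + 2 * j + 3) + 3) ha ha' (Ok.ofNat 1)
    (fun m s => s = Nat.choose n.nv m) (by simp) ?_ ?_).mono le_rfl (by omega)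
  · intro m hm s hs
    have hs' : (s : ℕ) = Nat.choose n.nv m := hs
    refine ⟨?_, ?_⟩
    · simp only [val_eq_nv, nv_mul, nv_div, nv_sub, nv_add, nv_var, nv_one, hs']
      exact Nat.div_eq_of_eq_mul_left (Nat.succ_pos m) (Nat.choose_succ_right_eq _ _).symm
    · have h1 : Ok B (j + 1) 0 (.var s : Tm Ty.den Proc .nat) :=
        Ok.var (by change Nat.size s ≤ _; rw [hs']; exact key m)
      have h2 : Ok B j 0 (.var (τ := .nat) m : Tm Ty.den Proc .nat) := Ok.var (Bd.index hm ha')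
      exact (((h1.mul (hn.sub h2)).div (h2.add (Ok.ofNat 1))).mono le_rfl (by omega)).cost
  · intro s hs
    have hs' : (s : ℕ) = Nat.choose n.nv a.nv := hs
    rw [hs']; exact key _

theorem Ok.isPrime (hx : Ok B i k x) (hx' : x.nv ≤ B ^ j) :
    Ok B 0 (max k (i + j + 2) + j + 5) (isPrime x) := by
  refine (Ok.loop (l := max k (i + j + 2) + 3) hx hx' ((Ok.ofNat 1).lt hx)
    (fun _ s => Bd (B ^ 0) .nat s) ((Ok.ofNat 1).lt hx).bd ?_ (fun _ h => h)).mono le_rfl (by omega)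
  intro m hm s hs
  have h2 : Ok B j 0 (.var (τ := .nat) m : Tm Ty.den Proc .nat) := Ok.var (Bd.index hm hx')
  refine ⟨?_, (((Ok.ofNat 1).lt h2).cond (fun _ => (hx.mod h2).cond (fun _ => Ok.var hs)
    fun _ => Ok.ofNat 0) (fun _ => Ok.var hs) |>.mono le_rfl (by omega)).cost⟩
  rw [val_cond]
  split_ifs
  · rw [val_cond]
    split_ifs
    · exact hs
    · change Nat.size 0 ≤ _; simp
  · exact hs

/-- The prime must be small in value, because the starting value is a naive power with exponent `p -
2`; for the modulus a bound on its digits is enough, since Newton's iteration takes `size q` steps.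
-/
theorem Ok.inverse (hp : Ok B i k p) (hq : Ok B i k q) (hx : Ok B i k x) (hp' : p.nv ≤ B ^ j)
    (hp0 : 0 < p.nv) (hpq : p.nv ≤ q.nv) (hi : 1 ≤ i) :
    Ok B i (max k (2 * i + 2) + max i j + 15) (inverse p q x) := by
  have hq0 : 0 < q.nv := by omega
  refine (Ok.share (j := i) (l := max k (2 * i + 2) + max i j + 14) hx fun hx => ?_).mono
    le_rfl (by omega)
  have hx0 := Ok.var hx
  have e1 := Ok.powMod (k := max k (2 * i + 2) + 1) (hp.mono le_rfl (by omega))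
    ((hx0.mod hp).mono le_rfl (by omega)) ((hp.sub (Ok.ofNat 2)).mono le_rfl (by omega))
    (show (p - 2).nv ≤ B ^ j from (Nat.sub_le _ _).trans hp') hp0
  refine (Ok.loop (l := max k (2 * i + 2) + 8) hq.size
    ((show Nat.size q.nv ≤ B ^ i from hq.bd)) e1
    (fun _ s => Bd (B ^ i) .nat s) e1.bd ?_ (fun _ h => h)).mono le_rfl (by omega)
  intro m hm s hs
  have hy := Ok.var hs
  have e2 := (hy.mul (((Ok.ofNat 2).add (hq.sub ((hx0.mul hy).mod_pos hq hq0))).mod_pos hq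
    hq0)).mod_pos hq hq0
  exact ⟨e2.bd, (e2.mono le_rfl (by omega)).cost⟩

end Costs

end MME

namespace MME

/-! ## Polynomials given by arrays of coefficients -/

section Eval

open Finset

variable {A A' : Type*} [CommSemiring A] [CommSemiring A']

/-- The value at `x` of the polynomial in `m` variables of individual degrees less than `d` whose
coefficient of `∏ x_i ^ a_i` is `c (∑ a_i * d ^ i)`. -/
def ev (m d : ℕ) (c x : ℕ → A) : A :=
  ∑ k ∈ range (d ^ m), c k * ∏ i ∈ range m, x i ^ (k / d ^ i % d)

/-- The coefficients of the Hasse derivative with respect to the exponent vector `v`. -/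
def hasseC (m d : ℕ) (c : ℕ → A) (v : ℕ → ℕ) (k : ℕ) : A :=
  if ∀ i < m, k / d ^ i % d + v i < d then
    ((∏ i ∈ range m, Nat.choose (k / d ^ i % d + v i) (v i) : ℕ) : A) *
      c (∑ i ∈ range m, (k / d ^ i % d + v i) * d ^ i)
  else 0

theorem map_ev (φ : A →+* A') (m d : ℕ) (c x : ℕ → A) :
    φ (ev m d c x) = ev m d (fun k => φ (c k)) (fun i => φ (x i)) := by
  simp [ev, map_sum, map_prod]

theorem map_hasseC (φ : A →+* A') (m d : ℕ) (c : ℕ → A) (v : ℕ → ℕ) (k : ℕ) :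
    φ (hasseC m d c v k) = hasseC m d (fun k => φ (c k)) v k := by
  unfold hasseC
  split_ifs <;> simp

theorem ev_congr {m d : ℕ} {c c' x x' : ℕ → A} (hc : ∀ k < d ^ m, c k = c' k)
    (hx : ∀ i < m, x i = x' i) : ev m d c x = ev m d c' x' := by
  refine sum_congr rfl fun k hk => ?_
  rw [hc k (mem_range.mp hk)]
  congr 1
  exact prod_congr rfl fun i hi => by rw [hx i (mem_range.mp hi)]

theorem sum_range_mul (n d : ℕ) (g : ℕ → A) :
    ∑ k ∈ range (n * d), g k = ∑ i ∈ range n, ∑ j ∈ range d, g (i + n * j) := by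
  rw [sum_comm]
  induction d with
  | zero => simp
  | succ d ih =>
    rw [Nat.mul_succ, sum_range_add, ih, sum_range_succ]
    simp [add_comm]

theorem digit_low {d k l i j : ℕ} (hl : l < k) : (i + d ^ k * j) / d ^ l % d = i / d ^ l % d := by
  rcases Nat.eq_zero_or_pos d with rfl | hd
  · rcases Nat.eq_zero_or_pos k with rfl | hk
    · omega
    · simp [zero_pow hk.ne']
  obtain ⟨n, rfl⟩ := Nat.exists_eq_add_of_lt hl
  rw [show d ^ (l + n + 1) * j = d ^ l * (d * (d ^ n * j)) by ring,
    Nat.add_mul_div_left _ _ (by positivity), Nat.add_mul_mod_self_left]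

theorem digit_high {d k i j : ℕ} (hi : i < d ^ k) (hj : j < d) : (i + d ^ k * j) / d ^ k % d = j := by
  rw [Nat.add_mul_div_left _ _ (by omega), Nat.div_eq_of_lt hi, zero_add, Nat.mod_eq_of_lt hj]

/-- The leading base-`d` digit of an index is the exponent of the last variable, so substituting for
this variable combines `d` consecutive blocks of `d ^ m` cells. -/
theorem ev_succ (m d : ℕ) (c x : ℕ → A) :
    ev (m + 1) d c x = ev m d (fun i => ∑ j ∈ range d, c (i + d ^ m * j) * x m ^ j) x := by
  unfold ev
  rw [pow_succ, sum_range_mul]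
  refine sum_congr rfl fun i hi => ?_
  rw [sum_mul]
  refine sum_congr rfl fun j hj => ?_
  rw [prod_range_succ, digit_high (mem_range.mp hi) (mem_range.mp hj), mul_assoc,
    mul_comm (x m ^ j)]
  congr 2
  exact prod_congr rfl fun l hl => by rw [digit_low (mem_range.mp hl)]

/-- The exponent vectors with entries less than `d`. -/
def boxFun (m d : ℕ) : Finset (Fin m → ℕ) := Fintype.piFinset fun _ => range d

theorem mem_boxFun {m d : ℕ} {a : Fin m → ℕ} : a ∈ boxFun m d ↔ ∀ i, a i < d := by
  simp [boxFun]

theorem digit_index {m d : ℕ} (a : Fin m → Fin d) (i : Fin m) :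
    (∑ i, (a i : ℕ) * d ^ (i : ℕ)) / d ^ (i : ℕ) % d = a i := by
  rw [← finFunctionFinEquiv_apply]
  conv_rhs => rw [← finFunctionFinEquiv.symm_apply_apply a]
  rfl

theorem sum_digits (m d : ℕ) (g : ℕ → (Fin m → ℕ) → A) :
    ∑ k ∈ range (d ^ m), g k (fun i => k / d ^ (i : ℕ) % d)
      = ∑ a ∈ boxFun m d, g (∑ i, a i * d ^ (i : ℕ)) a := by
  rw [sum_range, ← Equiv.sum_comp (finFunctionFinEquiv (m := d) (n := m))]
  symm
  refine sum_bij' (fun a ha i => ⟨a i, mem_boxFun.mp ha i⟩) (fun a _ i => a i) (by simp)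
    (fun a _ => mem_boxFun.mpr fun i => (a i).2) (by simp) (by simp) ?_
  intro a ha
  rw [finFunctionFinEquiv_apply]
  congr 1
  funext i
  exact (digit_index (fun i => ⟨a i, mem_boxFun.mp ha i⟩) i).symm

theorem ev_eq_sum_box (m d : ℕ) (c x : ℕ → A) :
    ev m d c x = ∑ a ∈ boxFun m d, c (∑ i, a i * d ^ (i : ℕ)) * ∏ i : Fin m, x i ^ a i := by
  unfold ev
  rw [← sum_digits m d fun k a => c k * ∏ i : Fin m, x i ^ a i]
  simp only [prod_range]

/-- The shift `b ↦ b + v` matches the exponents of the derivative with those `a` of the polynomial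
that satisfy `v ≤ a`; for all other `a` a binomial coefficient vanishes. -/
theorem ev_hasseC (m d : ℕ) (c x : ℕ → A) (v : ℕ → ℕ) :
    ev m d (hasseC m d c v) x = ∑ a ∈ boxFun m d, c (∑ i, a i * d ^ (i : ℕ)) *
      ∏ i : Fin m, ((Nat.choose (a i) (v i) : ℕ) : A) * x i ^ (a i - v i) := by
  have h1 : ev m d (hasseC m d c v) x = ∑ b ∈ boxFun m d,
      if ∀ i : Fin m, b i + v i < d then c (∑ i, (b i + v i) * d ^ (i : ℕ)) *
        ∏ i : Fin m, ((Nat.choose (b i + v i) (v i) : ℕ) : A) * x i ^ b i else 0 := by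
    unfold ev
    rw [← sum_digits m d fun k b => if ∀ i : Fin m, b i + v i < d then
      c (∑ i, (b i + v i) * d ^ (i : ℕ)) *
        ∏ i : Fin m, ((Nat.choose (b i + v i) (v i) : ℕ) : A) * x i ^ b i else 0]
    refine sum_congr rfl fun k _ => ?_
    unfold hasseC
    simp only [prod_range, sum_range, prod_mul_distrib, Nat.cast_prod]
    have e : (∀ i < m, k / d ^ i % d + v i < d) ↔ ∀ i : Fin m, k / d ^ (i : ℕ) % d + v i < d :=
      ⟨fun h i => h i i.2, fun h i hi => h ⟨i, hi⟩⟩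
    simp only [e, ite_mul, zero_mul]
    congr 1
    ring
  rw [h1, ← sum_filter]
  have h2 : ∑ a ∈ boxFun m d, c (∑ i, a i * d ^ (i : ℕ)) *
      ∏ i : Fin m, ((Nat.choose (a i) (v i) : ℕ) : A) * x i ^ (a i - v i)
    = ∑ a ∈ (boxFun m d).filter (fun a => ∀ i : Fin m, v i ≤ a i), c (∑ i, a i * d ^ (i : ℕ)) *
      ∏ i : Fin m, ((Nat.choose (a i) (v i) : ℕ) : A) * x i ^ (a i - v i) := by
    refine (sum_subset (filter_subset _ _) fun a ha hn => ?_).symm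
    have : ∃ i : Fin m, a i < v i := by
      by_contra! hh; exact hn (mem_filter.mpr ⟨ha, hh⟩)
    obtain ⟨i, hi⟩ := this
    rw [prod_eq_zero (mem_univ i), mul_zero]
    rw [Nat.choose_eq_zero_of_lt hi]; simp
  rw [h2]
  refine sum_nbij' (fun b i => b i + v i) (fun a i => a i - v i) ?_ ?_ ?_ ?_ ?_
  · intro b hb
    rw [mem_filter] at hb
    exact mem_filter.mpr ⟨mem_boxFun.mpr hb.2, fun i => Nat.le_add_left _ _⟩
  · intro a ha
    rw [mem_filter, mem_boxFun] at ha
    refine mem_filter.mpr ⟨mem_boxFun.mpr fun i => (Nat.sub_le _ _).trans_lt (ha.1 i), fun i => ?_⟩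
    rw [Nat.sub_add_cancel (ha.2 i)]; exact ha.1 i
  · intro b _; funext i; simp
  · intro a ha
    funext i
    exact Nat.sub_add_cancel ((mem_filter.mp ha).2 i)
  · intro b _; simp

/-- The binomial theorem is applied in every variable, and the product of the `m` sums is multiplied
out. All exponents are below `d`, so the expansion runs over the same box for every monomial. -/
theorem ev_add (m d : ℕ) (c y h : ℕ → A) :
    ev m d c (fun i => y i + h i) = ∑ v ∈ boxFun m d,
      ev m d (hasseC m d c fun i => if hi : i < m then v ⟨i, hi⟩ else 0) y
        * ∏ i : Fin m, h i ^ v i := by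
  simp only [ev_hasseC, sum_mul]
  rw [sum_comm, ev_eq_sum_box]
  refine sum_congr rfl fun a ha => ?_
  simp only [mul_assoc, ← mul_sum]
  congr 1
  have : ∀ i : Fin m, (y i + h i) ^ a i
      = ∑ n ∈ range d, ((Nat.choose (a i) n : ℕ) : A) * y i ^ (a i - n) * h i ^ n := by
    intro i
    rw [add_comm, add_pow]
    refine (sum_subset (s₂ := range d) ?_ ?_).trans (sum_congr rfl fun n _ => by ring)
    · intro n hn
      have := mem_boxFun.mp ha i
      simp only [mem_range] at hn ⊢; omega
    · intro n _ hn
      rw [Nat.choose_eq_zero_of_lt (by simpa using hn)]; simp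
  rw [prod_congr rfl fun i _ => this i, prod_univ_sum]
  refine sum_congr rfl fun v _ => ?_
  rw [← prod_mul_distrib]
  exact prod_congr rfl fun i _ => by simp

/-- Taylor's formula, where the exponent vectors run through a list. -/
theorem taylor_formula (m d : ℕ) (c y h : ℕ → A) (L : List (List ℕ)) (hL : L.Nodup)
    (hlen : ∀ v ∈ L, v.length = m)
    (h0 : ∀ v : List ℕ, v.length = m → v ∉ L → ∏ i ∈ range m, h i ^ v.getD i 0 = 0) :
    ev m d c (fun i => y i + h i) = (L.map fun v =>
      ev m d (hasseC m d c fun i => v.getD i 0) y * ∏ i ∈ range m, h i ^ v.getD i 0).sum := by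
  classical
  have hg : ∀ (v : Fin m → ℕ) (i : ℕ), (List.ofFn v).getD i 0
      = if hi : i < m then v ⟨i, hi⟩ else 0 := by
    intro v i
    split_ifs with hi
    · rw [List.getD_eq_getElem _ _ (by simpa using hi)]; simp
    · rw [List.getD_eq_default _ _ (by simpa using hi)]
  rw [← List.sum_toFinset _ hL, ev_add]
  set g : List ℕ → A := fun v =>
    ev m d (hasseC m d c fun i => v.getD i 0) y * ∏ i ∈ range m, h i ^ v.getD i 0
  have h1 : ∑ v ∈ boxFun m d,
      ev m d (hasseC m d c fun i => if hi : i < m then v ⟨i, hi⟩ else 0) y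
        * ∏ i : Fin m, h i ^ v i = ∑ l ∈ (boxFun m d).image List.ofFn, g l := by
    rw [sum_image fun a _ b _ e => List.ofFn_injective e]
    refine sum_congr rfl fun v _ => ?_
    simp only [g, hg, prod_range]
    simp
  -- Both sums reduce to the vectors that lie in the box and in the list: a vector of the list with
  -- an entry at least `d` has a zero Hasse derivative, and a vector of the box outside the list
  -- contributes nothing by `h0`.
  rw [h1, ← sum_subset (s₁ := (boxFun m d).image List.ofFn ∩ L.toFinset) inter_subset_left,
    ← sum_subset (s₁ := (boxFun m d).image List.ofFn ∩ L.toFinset) inter_subset_right]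
  · intro l hl hn
    have hl' := List.mem_toFinset.mp hl
    have : ∃ i, i < m ∧ d ≤ l.getD i 0 := by
      by_contra! hh
      refine hn (mem_inter.mpr ⟨mem_image.mpr ⟨fun i => l.getD i 0,
        mem_boxFun.mpr fun i => hh i i.2, ?_⟩, hl⟩)
      refine List.ext_getElem (by simp [hlen l hl']) fun i h1 h2 => ?_
      simp [List.getElem?_eq_getElem h2]
    obtain ⟨i, hi, hd⟩ := this
    have : hasseC m d c (fun i => l.getD i 0) = fun _ => 0 := by
      funext k
      unfold hasseC
      rw [if_neg]
      intro hh
      exact absurd (hh i hi) (by dsimp only; omega)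
    simp only [this, ev]
    simp
  · intro l hl hn
    obtain ⟨v, -, rfl⟩ := mem_image.mp hl
    simp only [g]
    rw [h0 _ (by simp) fun hh => hn (mem_inter.mpr ⟨hl, List.mem_toFinset.mpr hh⟩), mul_zero]

end Eval

/-! ## Exponent vectors -/

/-- All vectors of `m` natural numbers with sum less than `s`. -/
def expo (s : ℕ) : ℕ → List (List ℕ)
  | 0 => [[]]
  | m + 1 => (expo s m).flatMap fun v => (List.range (s - v.sum)).map fun c => v ++ [c]

/-- Positivity of `s` is needed at `m = 0`, where the enumeration contains the empty vector for
every `s`. -/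
theorem mem_expo {s : ℕ} (hs : 0 < s) {m : ℕ} {v : List ℕ} :
    v ∈ expo s m ↔ v.length = m ∧ v.sum < s := by
  induction m generalizing v with
  | zero =>
    simp only [expo, List.mem_singleton, List.length_eq_zero_iff]
    exact ⟨fun h => by simp [h, hs], fun h => h.1⟩
  | succ m ih =>
    simp only [expo, List.mem_flatMap, List.mem_map, List.mem_range]
    constructor
    · rintro ⟨w, hw, c, hc, rfl⟩
      have := ih.mp hw
      simp; omega
    · rintro ⟨h1, h2⟩
      have hne : v ≠ [] := by rintro rfl; simp at h1
      have e := List.dropLast_append_getLast hne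
      refine ⟨v.dropLast, ih.mpr ⟨by simp [h1], ?_⟩, v.getLast hne, ?_, e⟩
      · rw [← e] at h2; simp at h2; omega
      · rw [← e] at h2; simp at h2; omega

theorem nodup_expo (s m : ℕ) : (expo s m).Nodup := by
  induction m with
  | zero => simp [expo]
  | succ m ih =>
    rw [expo, List.nodup_flatMap]
    refine ⟨fun v _ => List.Nodup.map (fun a b h => by simpa using h) List.nodup_range, ?_⟩
    refine ih.imp fun {a b} hab => ?_
    intro x hx hy
    simp only [List.mem_map] at hx hy
    obtain ⟨c, -, rfl⟩ := hx
    obtain ⟨c', -, h⟩ := hy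
    exact hab (List.append_inj_left' h rfl).symm

/-- A potential argument: give the vector `v` the weight `2 ^ (s - sum v) ≥ 1`. Appending one more
entry in all possible ways at most doubles the total weight, since the powers `2 ^ (n - c)` with `c
< n` sum to at most `2 * 2 ^ n`. The total starts at `2 ^ s`. -/
theorem length_expo_le (s m : ℕ) : (expo s m).length ≤ 2 ^ (m + s) := by
  have key : ((expo s m).map fun v => 2 ^ (s - v.sum)).sum ≤ 2 ^ (m + s) := by
    induction m with
    | zero => simp [expo]
    | succ m ih =>
      rw [expo, List.map_flatMap, List.flatMap, List.sum_flatten, List.map_map]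
      have : ∀ v : List ℕ, (List.map (fun v => 2 ^ (s - v.sum))
          ((List.range (s - v.sum)).map fun c => v ++ [c])).sum ≤ 2 * 2 ^ (s - v.sum) := by
        intro v
        rw [List.map_map]
        have : ∀ n : ℕ, ((List.range n).map fun c => 2 ^ (n - c)).sum ≤ 2 * 2 ^ n := by
          intro n
          induction n with
          | zero => simp
          | succ n ih =>
            rw [List.range_succ_eq_map, List.map_cons, List.map_map, List.sum_cons]
            simp only [Function.comp_def, Nat.succ_eq_add_one, Nat.add_sub_add_right]
            rw [pow_succ] at *
            simp only [Nat.sub_zero]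
            rw [pow_succ]
            omega
        refine le_trans (le_of_eq ?_) (this _)
        congr 1
        refine List.map_congr_left fun c _ => ?_
        simp [Nat.sub_sub]
      calc _ ≤ (List.map (fun v => 2 * 2 ^ (s - v.sum)) (expo s m)).sum :=
            List.sum_le_sum fun v _ => this v
        _ = 2 * (List.map (fun v => 2 ^ (s - v.sum)) (expo s m)).sum := List.sum_map_mul_left ..
        _ ≤ 2 * 2 ^ (m + s) := Nat.mul_le_mul_left _ ih
        _ = _ := by ring
  have h2 := List.card_nsmul_le_sum ((expo s m).map fun v => 2 ^ (s - v.sum)) 1 (by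
    simp only [List.mem_map]
    rintro _ ⟨v, -, rfl⟩
    exact Nat.one_le_two_pow)
  simp at h2
  omega

theorem sum_range_getD {A α : Type*} [AddCommMonoid A] (L : List α) (x : α) (g : α → A) :
    ∑ k ∈ Finset.range L.length, g (L.getD k x) = (L.map g).sum := by
  induction L with
  | nil => simp
  | cons a L ih => rw [List.length_cons, Finset.sum_range_succ']; simp [← ih, add_comm]

end MME

namespace MME

/-! ## Values of the programs for multivariate polynomials -/

theorem getD_map_range {α : Type*} {n i : ℕ} (g : ℕ → α) (x : α) (h : i < n) :
    ((List.range n).map g).getD i x = g i := by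
  rw [List.getD_eq_getElem _ _ (by simpa using h)]; simp

theorem map_range_getD {α β : Type*} (L : List α) (x : α) (g : α → β) :
    (List.range L.length).map (fun k => g (L.getD k x)) = L.map g := by
  refine List.ext_getElem (by simp) fun i h1 h2 => ?_
  simp only [List.length_map, List.length_range] at h1
  simp [List.getElem?_eq_getElem h1]

theorem sum_getD (v : List ℕ) : ∑ i ∈ Finset.range v.length, v.getD i 0 = v.sum := by
  simpa using sum_range_getD v 0 id

theorem eq_mod_of_cast {x y q : ℕ} (hx : x < q) (h : (x : ZMod q) = y) : x = y % q := by
  rw [ZMod.natCast_eq_natCast_iff] at h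
  rw [← h, Nat.mod_eq_of_lt hx]

theorem nv_loop_add (v : List ℕ) :
    (loop (len (.var (τ := .list .nat) v)) 0
      fun i w => w + get (.var (τ := .list .nat) v) i : Tm Ty.den Proc .nat).nv = v.sum := by
  rw [loop_nv_eq (fun i => ∑ j ∈ Finset.range i, v.getD j 0) (by simp) fun i _ => by
    simp [Finset.sum_range_succ]]
  simpa using sum_getD v

/-- One step of the enumeration of exponent vectors. -/
theorem val_exponents_step (s : ℕ) (S : Tm Ty.den Proc .nat) (hS : S.nv = s)
    (L : List (List ℕ)) :
    (flatten (tab (len (.var (τ := .list (.list .nat)) L)) fun k =>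
      share (get (.var (τ := .list (.list .nat)) L) k) fun v =>
      tab (S - loop (len v) 0 fun i w => w + get v i) fun c => append v (single c)) :
      Tm Ty.den Proc _).val
    = L.flatMap fun v => (List.range (s - v.sum)).map fun c => v ++ [c] := by
  rw [val_flatten, val_tab]
  simp only [val_share, val_get, val_tab, nv_sub, nv_loop_add, nv_len, val_var, val_append,
    val_single, nv_var, val_eq_nv, dflt_list, hS]
  rw [List.flatMap, ← map_range_getD L []]

theorem val_exponents (m s : Tm Ty.den Proc .nat) :
    (exponents m s).val = expo s.nv m.nv :=
  loop_val_eq (τ := .list (.list .nat)) (expo s.nv) (by simp [expo])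
    fun i _ => val_exponents_step _ _ rfl _

variable (m d r q : Tm Ty.den Proc .nat) (f v : Tm Ty.den Proc (.list .nat))

/-- The state is a product of binomial coefficients together with the index of the source cell. Once
an exponent reaches `d` the product is set to `0` and stays there, and the index becomes irrelevant.
The product is only claimed up to congruence, because the initial `1` is not reduced modulo `q`. -/
theorem hasse_state (k : ℕ) :
    let s := (loop m (pair 1 0) fun i s =>
      share (.var (τ := .nat) k / pow d i % d + get v i) fun a =>
      cond (lt a d)
        (pair (fst s * binom a (get v i) % q) (snd s + a * pow d i))
        (pair 0 (snd s)) : Tm Ty.den Proc (.prod .nat .nat)).val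
    if ∀ i < m.nv, k / d.nv ^ i % d.nv + List.getD (α := ℕ) v.val i 0 < d.nv then
      s.1 ≡ ∏ i ∈ Finset.range m.nv,
        Nat.choose (k / d.nv ^ i % d.nv + List.getD (α := ℕ) v.val i 0)
          (List.getD (α := ℕ) v.val i 0) [MOD q.nv] ∧
      s.2 = ∑ i ∈ Finset.range m.nv,
        (k / d.nv ^ i % d.nv + List.getD (α := ℕ) v.val i 0) * d.nv ^ i
    else s.1 = (0 : ℕ) := by
  refine loop_val (τ := .prod .nat .nat) (fun n (s : ℕ × ℕ) =>
    if ∀ i < n, k / d.nv ^ i % d.nv + List.getD (α := ℕ) v.val i 0 < d.nv then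
      s.1 ≡ ∏ i ∈ Finset.range n,
        Nat.choose (k / d.nv ^ i % d.nv + List.getD (α := ℕ) v.val i 0)
          (List.getD (α := ℕ) v.val i 0) [MOD q.nv] ∧
      s.2 = ∑ i ∈ Finset.range n,
        (k / d.nv ^ i % d.nv + List.getD (α := ℕ) v.val i 0) * d.nv ^ i
    else s.1 = (0 : ℕ)) ?_ ?_
  · simp [Nat.ModEq.refl]
  · rintro n - ⟨x, y⟩ h
    have e : (∀ i < n + 1, k / d.nv ^ i % d.nv + List.getD (α := ℕ) v.val i 0 < d.nv) ↔
        (∀ i < n, k / d.nv ^ i % d.nv + List.getD (α := ℕ) v.val i 0 < d.nv) ∧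
          k / d.nv ^ n % d.nv + List.getD (α := ℕ) v.val n 0 < d.nv :=
      ⟨fun h => ⟨fun j hj => h j (by omega), h n (by omega)⟩, fun h j hj =>
        (Nat.lt_succ_iff_lt_or_eq.mp hj).elim (h.1 j) fun e => e ▸ h.2⟩
    simp only [val_share, val_cond, val_pair, nv_lt, nv_var, val_eq_nv, nv_add, nv_mod, nv_div,
      nv_pow, nv_get, nv_fst, nv_snd, nv_mul, nv_binom, val_var, nv_zero, e,
      Finset.prod_range_succ, Finset.sum_range_succ]
    by_cases h1 : ∀ i < n, k / d.nv ^ i % d.nv + List.getD (α := ℕ) v.val i 0 < d.nv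
    · rw [if_pos h1] at h
      by_cases h2 : k / d.nv ^ n % d.nv + List.getD (α := ℕ) v.val n 0 < d.nv
      · rw [if_pos ⟨h1, h2⟩, if_pos h2, if_pos one_ne_zero]
        exact ⟨(Nat.mod_modEq _ _).trans (h.1.mul_right _), by rw [← h.2]⟩
      · rw [if_neg fun hh => h2 hh.2, if_neg h2, if_neg (by simp)]
    · rw [if_neg h1] at h
      rw [if_neg fun hh => h1 hh.1]
      have h : x = 0 := h
      split_ifs <;> simp [h]

theorem val_hasse : (hasse m d q f v).val = (List.range (d.nv ^ m.nv)).map fun k =>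
    hasseC m.nv d.nv (fun k => List.getD (α := ℕ) f.val k 0)
      (fun i => List.getD (α := ℕ) v.val i 0) k % q.nv := by
  unfold hasse
  rw [val_tab, nv_pow]
  refine List.map_congr_left fun k _ => ?_
  have := hasse_state m d q v k
  simp only [nv_share, val_eq_nv, nv_mod, nv_mul, nv_fst, nv_snd, nv_get, val_var] at this ⊢
  unfold hasseC
  split_ifs at this ⊢ with h
  · rw [this.2]
    exact this.1.mul_right _
  · rw [this]; simp

/-! ### Evaluation on a product set -/

section Recur

variable {σ τ : Ty} (n : Tm Ty.den Proc .nat) (x : Tm Ty.den Proc σ)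
  (base : Tm Ty.den Proc σ → Tm Ty.den Proc τ)
  (step : Proc σ τ → Tm Ty.den Proc .nat → Tm Ty.den Proc σ → Tm Ty.den Proc τ)

/-- The procedure that is run by `recur`, at depth `k`. -/
def recProc (k : ℕ) : Proc σ τ :=
  unroll (fun y => (base (.var y)).eval)
    (fun k self y => (step self (.var (τ := .nat) k) (.var y)).eval) k

theorem val_recur : (recur n x base step).val = (recProc base step n.nv x.val).1 := (rfl)

theorem cost_recur : (recur n x base step).cost
    = n.cost + x.cost + (recProc base step n.nv x.val).2 + 1 := (rfl)

theorem recProc_zero (y : σ.den) :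
    recProc base step 0 y = ((base (.var y)).val, (base (.var y)).cost) := (rfl)

theorem recProc_succ (k : ℕ) (y : σ.den) : recProc base step (k + 1) y
    = ((step (recProc base step k) (.var (τ := .nat) k) (.var y)).val,
      (step (recProc base step k) (.var (τ := .nat) k) (.var y)).cost) := (rfl)

@[simp] theorem val_call (p : Proc σ τ) (a : Tm Ty.den Proc σ) :
    (call p a).val = (p a.val).1 := (rfl)

theorem cost_call (p : Proc σ τ) (a : Tm Ty.den Proc σ) :
    (call p a).cost = a.cost + (p a.val).2 + 1 := (rfl)

end Recur

theorem flatten_map_range {α : Type*} (n k : ℕ) (g : ℕ → ℕ → α) (hn : 0 < n) :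
    ((List.range k).map fun a => (List.range n).map (g a)).flatten
      = (List.range (n * k)).map fun b => g (b / n) (b % n) := by
  induction k with
  | zero => simp
  | succ k ih =>
    rw [List.range_succ, List.map_append, List.flatten_append, ih, Nat.mul_succ, List.range_add,
      List.map_append]
    congr 1
    simp only [List.map_cons, List.map_nil, List.flatten_cons, List.flatten_nil, List.append_nil,
      List.map_map]
    refine List.map_congr_left fun b hb => ?_
    have hb := List.mem_range.mp hb
    simp [Nat.mul_add_div hn, Nat.div_eq_of_lt hb, Nat.mod_eq_of_lt hb]

/-- The procedure behind `evalGrid`. -/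
def gridProc (k : ℕ) : Proc (.list .nat) (.list .nat) :=
  recProc (fun f => f) (fun self k f =>
    flatten (tab r fun a =>
      call self (tab (pow d k) fun i =>
        sumMod q d fun c => get f (i + pow d k * c) * powMod q a c))) k

/-- The values with last coordinate `a` form the block of cells `b + r ^ k * a`, so concatenation
agrees with the numbering by base-`r` digits. The coefficients must be reduced beforehand, because
at depth `0` the array is returned unchanged. -/
theorem gridProc_val (hq : 1 < q.nv) (hr : 0 < r.nv) (k : ℕ) (f : List ℕ)
    (hf : f.length = d.nv ^ k) (hfq : ∀ x ∈ f, x < q.nv) :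
    (gridProc d r q k f).1 = (List.range (r.nv ^ k)).map fun b =>
      ev k d.nv (fun i => f.getD i 0) (fun i => b / r.nv ^ i % r.nv) % q.nv := by
  induction k generalizing f with
  | zero =>
    obtain ⟨x, rfl⟩ := List.length_eq_one_iff.mp (by simpa using hf)
    have hx := hfq x (by simp)
    simp [gridProc, recProc_zero, ev, Nat.mod_eq_of_lt hx]
  | succ k ih =>
    rw [gridProc, recProc_succ]
    simp only [val_flatten, val_tab, val_call]
    rw [pow_succ]
    refine Eq.trans ?_ ((flatten_map_range (r.nv ^ k) r.nv (fun a b =>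
      ev (k + 1) d.nv (fun i => f.getD i 0)
        (fun i => (b + r.nv ^ k * a) / r.nv ^ i % r.nv) % q.nv) (by positivity)).trans ?_)
    · congr 1
      refine List.map_congr_left fun a ha => ?_
      have ha := List.mem_range.mp ha
      refine (ih _ (by simp) ?_).trans ?_
      · intro x hx
        simp only [nv_pow, nv_var, List.mem_map, List.mem_range, val_eq_nv, nv_sumMod] at hx
        obtain ⟨i, -, rfl⟩ := hx
        exact Nat.mod_lt _ (by omega)
      · refine List.map_congr_left fun b hb => ?_
        have hb := List.mem_range.mp hb
        change _ ≡ _ [MOD q.nv]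
        rw [← ZMod.natCast_eq_natCast_iff, ev_succ]
        have hm : ∀ c x : ℕ → ℕ, ((ev k d.nv c x : ℕ) : ZMod q.nv)
            = ev k d.nv (fun i => (c i : ZMod q.nv)) (fun i => (x i : ZMod q.nv)) :=
          fun c x => map_ev (Nat.castRingHom (ZMod q.nv)) k d.nv c x
        rw [hm, hm]
        refine ev_congr (fun i hi => ?_) fun i hi => by rw [digit_low hi]
        rw [getD_map_range _ _ (by simpa using hi)]
        simp only [val_eq_nv, nv_sumMod, nv_mul, nv_get, nv_add, nv_var, nv_pow, val_var]
        rw [ZMod.natCast_mod]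
        push_cast
        refine Finset.sum_congr rfl fun j _ => ?_
        rw [nv_powMod _ _ _ hq, ZMod.natCast_mod, digit_high hb ha]
        simp
    · refine List.map_congr_left fun b _ => ?_
      rw [Nat.mod_add_div]

theorem val_evalGrid (hq : 1 < q.nv) (hr : 0 < r.nv)
    (hf : List.length (α := ℕ) f.val = d.nv ^ m.nv)
    (hfq : ∀ x ∈ (show List ℕ from f.val), x < q.nv) :
    (evalGrid m d r q f).val = (List.range (r.nv ^ m.nv)).map fun b =>
      ev m.nv d.nv (fun i => List.getD (α := ℕ) f.val i 0) (fun i => b / r.nv ^ i % r.nv)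
        % q.nv := by
  unfold evalGrid
  rw [val_recur]
  exact gridProc_val d r q hq hr m.nv f.val hf hfq

theorem index_lt {m d : ℕ} {a : ℕ → ℕ} (h : ∀ i < m, a i < d) :
    ∑ i ∈ Finset.range m, a i * d ^ i < d ^ m := by
  induction m with
  | zero => simp
  | succ m ih =>
    rw [Finset.sum_range_succ, pow_succ]
    have h1 := ih fun i hi => h i (by omega)
    have h2 := Nat.mul_le_mul_right (d ^ m) (Nat.succ_le_of_lt (h m (by omega)))
    rw [Nat.succ_mul] at h2
    linarith

theorem digit_index_range {m d : ℕ} {a : ℕ → ℕ} (h : ∀ i < m, a i < d) {i : ℕ} (hi : i < m) :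
    (∑ i ∈ Finset.range m, a i * d ^ i) / d ^ i % d = a i := by
  rw [Finset.sum_range]
  exact digit_index (fun i : Fin m => (⟨a i, h i i.2⟩ : Fin d)) ⟨i, hi⟩

theorem nv_gridCell (a : Tm Ty.den Proc (.list .nat)) : (gridCell m r a).nv
    = ∑ i ∈ Finset.range m.nv, List.getD (α := ℕ) a.val i 0 * r.nv ^ i :=
  loop_nv_eq (fun n => ∑ i ∈ Finset.range n, List.getD (α := ℕ) a.val i 0 * r.nv ^ i)
    (by simp) fun i _ => by simp [Finset.sum_range_succ]

/-- The program `taylor` evaluates Taylor's formula. -/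
theorem nv_taylor {Q : ℕ} (hQ : q.nv = Q) (hq : 1 < Q) {L : List (List ℕ)}
    {vs : Tm Ty.den Proc (.list (.list .nat))}
    (hvs : vs.val = L) (y : Tm Ty.den Proc .nat → Tm Ty.den Proc .nat)
    (a b : Tm Ty.den Proc (.list .nat)) (g : List ℕ → ℕ)
    (hy : ∀ k < L.length, ((y (.var (τ := .nat) k)).nv : ZMod Q) = g (L.getD k [])) :
    (taylor m q vs y a b).nv < Q ∧
    ((taylor m q vs y a b).nv : ZMod Q) = (L.map fun v => (g v : ZMod Q) *
      ∏ i ∈ Finset.range m.nv,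
        ((List.getD (α := ℕ) a.val i 0 - List.getD (α := ℕ) b.val i 0 : ℕ) : ZMod Q)
          ^ v.getD i 0).sum := by
  subst hQ
  unfold taylor
  rw [nv_sumMod]
  refine ⟨Nat.mod_lt _ (by omega), ?_⟩
  rw [ZMod.natCast_mod, Nat.cast_sum, nv_len, hvs, ← sum_range_getD L []]
  refine Finset.sum_congr rfl fun k hk => ?_
  simp only [nv_mul, Nat.cast_mul, nv_prodMod _ _ _ hq, ZMod.natCast_mod, Nat.cast_prod]
  rw [hy k (Finset.mem_range.mp hk)]
  congr 1
  refine Finset.prod_congr rfl fun c _ => ?_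
  rw [nv_powMod _ _ _ hq, ZMod.natCast_mod]
  simp [hvs]

/-- The correctness of Taylor's formula modulo `r ^ s`. -/
theorem taylor_correct {m d r s : ℕ} (hs : 0 < s) (c a : ℕ → ℕ) :
    ((ev m d c a : ℕ) : ZMod (r ^ s)) = ((expo s m).map fun v =>
      ((ev m d (hasseC m d c fun i => v.getD i 0) (fun i => a i % r) : ℕ) : ZMod (r ^ s)) *
        ∏ i ∈ Finset.range m, ((a i - a i % r : ℕ) : ZMod (r ^ s)) ^ v.getD i 0).sum := by
  have e : a = fun i => a i % r + (a i - a i % r) := by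
    funext i; have := Nat.mod_le (a i) r; omega
  have hm : ∀ c x : ℕ → ℕ, ((ev m d c x : ℕ) : ZMod (r ^ s))
      = ev m d (fun i => (c i : ZMod (r ^ s))) (fun i => (x i : ZMod (r ^ s))) :=
    fun c x => map_ev (Nat.castRingHom (ZMod (r ^ s))) m d c x
  conv_lhs => rw [e]
  rw [hm]
  simp only [Nat.cast_add]
  rw [taylor_formula m d _ (fun i => ((a i % r : ℕ) : ZMod (r ^ s)))
    (fun i => ((a i - a i % r : ℕ) : ZMod (r ^ s))) (expo s m) (nodup_expo s m)
    (fun v hv => ((mem_expo hs).mp hv).1)]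
  · congr 1
    refine List.map_congr_left fun v _ => ?_
    rw [hm]
    congr 2
    funext k
    exact (map_hasseC (Nat.castRingHom (ZMod (r ^ s))) m d c _ k).symm
  -- A vector outside the list has sum at least `s`. Each displacement is divisible by `r`, so the
  -- product of their powers is divisible by `r ^ sum v`, which is zero modulo `r ^ s`.
  · intro v hv hn
    have hsum : s ≤ v.sum := by
      by_contra hh; exact hn ((mem_expo hs).mpr ⟨hv, by omega⟩)
    have h1 : ∀ i ∈ Finset.range m, (r : ZMod (r ^ s)) ^ v.getD i 0 ∣
        ((a i - a i % r : ℕ) : ZMod (r ^ s)) ^ v.getD i 0 := fun i _ =>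
      pow_dvd_pow_of_dvd (Nat.cast_dvd_cast (Nat.dvd_sub_mod (a i))) _
    have h2 := Finset.prod_dvd_prod_of_dvd _ _ h1
    rw [Finset.prod_pow_eq_pow_sum, ← hv, sum_getD] at h2
    have h3 : (r : ZMod (r ^ s)) ^ v.sum = 0 := by
      rw [← Nat.add_sub_cancel' hsum, pow_add, ← Nat.cast_pow, ZMod.natCast_self, zero_mul]
    rw [h3, zero_dvd_iff] at h2
    rwa [← hv]

/-- The program `taylor` evaluates a polynomial modulo `r ^ s`. -/
theorem nv_taylor_eq_ev {r s M d : ℕ} (hM : m.nv = M) (hQ : q.nv = r ^ s) (hr : 1 < r)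
    (hs : 0 < s) {vs : Tm Ty.den Proc (.list (.list .nat))} (hvs : vs.val = expo s M)
    (y : Tm Ty.den Proc .nat → Tm Ty.den Proc .nat) (a b : Tm Ty.den Proc (.list .nat))
    (hb : ∀ i < M, List.getD (α := ℕ) b.val i 0 = List.getD (α := ℕ) a.val i 0 % r)
    (c : ℕ → ℕ)
    (hy : ∀ k < (expo s M).length, (y (.var (τ := .nat) k)).nv ≡
      ev M d (hasseC M d c fun i => ((expo s M).getD k []).getD i 0)
        (fun i => List.getD (α := ℕ) a.val i 0 % r) [MOD r ^ s]) :
    (taylor m q vs y a b).nv = ev M d c (fun i => List.getD (α := ℕ) a.val i 0) % r ^ s := by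
  subst hM
  obtain ⟨h1, h2⟩ := nv_taylor m q hQ (Nat.one_lt_pow hs.ne' hr) hvs y a b
    (fun v => ev m.nv d (hasseC m.nv d c fun i => v.getD i 0)
      (fun i => List.getD (α := ℕ) a.val i 0 % r))
    fun k hk => (ZMod.natCast_eq_natCast_iff _ _ _).mpr (hy k hk)
  refine eq_mod_of_cast h1 (h2.trans ?_)
  rw [taylor_correct hs]
  congr 1
  refine List.map_congr_left fun v _ => ?_
  congr 1
  exact Finset.prod_congr rfl fun i hi => by rw [hb i (Finset.mem_range.mp hi)]

theorem ev_mod_congr {q m d : ℕ} {c c' x x' : ℕ → ℕ} (hc : ∀ k < d ^ m, c k ≡ c' k [MOD q])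
    (hx : ∀ i < m, x i ≡ x' i [MOD q]) : ev m d c x ≡ ev m d c' x' [MOD q] := by
  rw [← ZMod.natCast_eq_natCast_iff]
  have hm : ∀ c x : ℕ → ℕ, ((ev m d c x : ℕ) : ZMod q)
      = ev m d (fun i => (c i : ZMod q)) (fun i => (x i : ZMod q)) :=
    fun c x => map_ev (Nat.castRingHom (ZMod q)) m d c x
  rw [hm, hm]
  exact ev_congr (fun k hk => (ZMod.natCast_eq_natCast_iff _ _ _).mpr (hc k hk))
    fun i hi => (ZMod.natCast_eq_natCast_iff _ _ _).mpr (hx i hi)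

theorem getD_val_hasse {k : ℕ} (hk : k < d.nv ^ m.nv) :
    List.getD (α := ℕ) (hasse m d q f v).val k 0 =
      hasseC m.nv d.nv (fun k => List.getD (α := ℕ) f.val k 0)
      (fun i => List.getD (α := ℕ) v.val i 0) k % q.nv := by
  rw [val_hasse]
  exact getD_map_range _ _ hk

/-- The cell for the point `x` in the array of values of a Hasse derivative. -/
theorem getD_evalGrid_hasse (hq : 1 < q.nv) (hr : 0 < r.nv) {x : ℕ → ℕ}
    (hx : ∀ i < m.nv, x i < r.nv) (F : Tm Ty.den Proc (.list .nat))
    (hF : F.val = (hasse m d q f v).val) :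
    List.getD (α := ℕ) (evalGrid m d r q F).val (∑ i ∈ Finset.range m.nv, x i * r.nv ^ i) 0
      ≡ ev m.nv d.nv (hasseC m.nv d.nv (fun k => List.getD (α := ℕ) f.val k 0)
          (fun i => List.getD (α := ℕ) v.val i 0)) x [MOD q.nv] := by
  have hv := val_hasse m d q f v
  rw [val_evalGrid m d r q F hq hr (by rw [hF, hv]; simp) (by
    rw [hF, hv]
    intro y hy
    obtain ⟨k, -, rfl⟩ := List.mem_map.mp hy
    exact Nat.mod_lt _ (by omega)), getD_map_range _ _ (index_lt hx)]
  refine (Nat.mod_modEq _ _).trans (ev_mod_congr (fun k hk => ?_) fun i hi => ?_)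
  · rw [hF, getD_val_hasse m d q f v hk]
    exact Nat.mod_modEq _ _
  · rw [digit_index_range hx hi]

theorem val_mmeProductSet (as : Tm Ty.den Proc (.list (.list .nat)))
    (s : Tm Ty.den Proc .nat) (hs : 0 < s.nv) (hr : 1 < r.nv) :
    (mmeProductSet m d f as r s).val
      = (List.range (List.length (α := List ℕ) as.val)).map fun i =>
        ev m.nv d.nv (fun k => List.getD (α := ℕ) f.val k 0)
          (fun c => (List.getD (α := List ℕ) as.val i []).getD c 0) % r.nv ^ s.nv := by
  have hq : 1 < r.nv ^ s.nv := Nat.one_lt_pow hs.ne' hr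
  unfold mmeProductSet
  simp only [val_share, val_tab, nv_len, val_var]
  refine List.map_congr_left fun i hi => ?_
  have hi : i < List.length (α := List ℕ) as.val := List.mem_range.mp hi
  have hcell : ∀ c, (List.getD (α := List ℕ) as.val i []).getD c 0 % r.nv < r.nv :=
    fun c => Nat.mod_lt _ (by omega)
  rw [val_eq_nv]
  refine nv_taylor_eq_ev m _ rfl ?_ hr hs ?_ _ (get as (.var (τ := .nat) i)) _
    ?_ _ ?_
  · simp only [val_eq_nv, nv_var, nv_pow]
  · exact val_exponents m s
  · intro c hc
    simp only [val_get, val_var, nv_var, dflt_list]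
    rw [getD_map_range _ _ hi, getD_map_range _ _ hc]
    simp
  intro k hk
  have hk' : k < List.length (α := List ℕ) (exponents m s).val := by rwa [val_exponents]
  simp only [nv_get, val_get, nv_gridCell, nv_var, val_var, val_eq_nv, dflt_list]
  rw [getD_map_range _ _ hk']
  have h := getD_evalGrid_hasse m d r (.var (τ := .nat) (pow r s).nv) f
    (get (.var (exponents m s).val) (.var (τ := .nat) k)) (by simpa using hq) (by omega)
    (x := fun c => (List.getD (α := List ℕ) as.val i []).getD c 0 % r.nv) (fun c _ => hcell c)
    (get (.var (List.map (fun i => (hasse m d (.var (τ := .nat) (pow r s).nv) f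
      (get (.var (exponents m s).val) (.var (τ := .nat) i))).val)
      (List.range (List.length (α := List ℕ) (exponents m s).val)))) (.var (τ := .nat) k)) ?_
  · simp only [nv_var, nv_pow, val_get, val_var, val_exponents, dflt_list] at h ⊢
    convert h using 2
    refine Finset.sum_congr rfl fun c hc => ?_
    rw [getD_map_range _ _ hi, getD_map_range _ _ (Finset.mem_range.mp hc)]
    simp
  · simp only [val_get, val_var, nv_var, dflt_list]
    rw [getD_map_range _ _ hk']

end MME

namespace MME

/-! ## Small primes -/

section Primorial

open Real Chebyshev

/-- The explicit Chebyshev bound `theta_ge` gives about `16 * k * log 2` with an error of order `√k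
* log k`. With `x = √k` and the tangent of the logarithm at `8`, the claim becomes a quadratic
inequality in `x` that holds for `x ≥ 6`. -/
theorem two_pow_le_primorial_of_large {k : ℕ} (hk : 38 ≤ k) : 2 ^ k ≤ primorial (16 * k - 1) := by
  set n := 16 * k - 1 with hn
  have hn1 : ((n : ℕ) : ℝ) + 1 = 16 * k := by
    have : n + 1 = 16 * k := by omega
    exact_mod_cast this
  have hk' : (38 : ℝ) ≤ k := by exact_mod_cast hk
  have h := theta_ge n
  rw [theta_eq_log_primorial, Nat.floor_natCast] at h
  set x := √(k : ℝ) with hx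
  have hxk : x ^ 2 = k := Real.sq_sqrt (by positivity)
  have hx6 : 6 ≤ x := Real.le_sqrt_of_sq_le (by norm_num; linarith)
  have hsn : √(n : ℝ) ≤ 4 * x := by
    rw [Real.sqrt_le_left (by positivity), mul_pow, hxk]; linarith
  have hL1 := Real.log_two_gt_d9
  have hL2 := Real.log_two_lt_d9
  have hlogx : log x ≤ 3 * log 2 + x / 8 - 1 := by
    have h1 := Real.log_le_sub_one_of_pos (show 0 < x / 8 by positivity)
    rw [Real.log_div (by positivity) (by norm_num), show (8 : ℝ) = 2 ^ 3 by norm_num,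
      Real.log_pow] at h1
    norm_num at h1 ⊢
    linarith
  have hlog : log (16 * (k : ℝ)) = 4 * log 2 + 2 * log x := by
    rw [Real.log_mul (by norm_num) (by positivity), ← hxk, show (16 : ℝ) = 2 ^ 4 by norm_num,
      Real.log_pow, Real.log_pow]
    norm_num
  have hlogn : log (n : ℝ) ≤ log (16 * k) := Real.log_le_log (by linarith) (by linarith)
  have hlogn0 : 0 ≤ log (16 * (k : ℝ)) := Real.log_nonneg (by linarith)
  have h2 : 2 * √(n : ℝ) * log n ≤ 2 * (4 * x) * log (16 * k) :=
    (mul_le_mul_of_nonneg_left hlogn (by positivity)).trans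
      (mul_le_mul_of_nonneg_right (by linarith) hlogn0)
  rw [hn1] at h
  have hn2 : (n : ℝ) = 16 * x ^ 2 - 1 := by rw [hxk]; linarith
  have key : k * log 2 ≤ log (primorial n : ℝ) := by
    refine le_trans ?_ h
    have h3 : log (16 * (k : ℝ)) ≤ 10 * log 2 + x / 4 - 2 := by rw [hlog]; linarith
    have h4 : 2 * (4 * x) * log (16 * (k : ℝ)) ≤ 2 * (4 * x) * (10 * log 2 + x / 4 - 2) :=
      mul_le_mul_of_nonneg_left h3 (by positivity)
    have h5 : 0 ≤ (15 * x ^ 2 - 80 * x - 11) * (log 2 - 0.69) :=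
      mul_nonneg (by nlinarith) (by linarith)
    have h6 : (n : ℝ) * log 2 = (16 * x ^ 2 - 1) * log 2 := by rw [hn2]
    have h7 : (k : ℝ) * log 2 = x ^ 2 * log 2 := by rw [hxk]
    nlinarith
  have : ((2 ^ k : ℕ) : ℝ) ≤ primorial n := by
    have hp : (0 : ℝ) < primorial n := by exact_mod_cast primorial_pos n
    rw [← Real.log_le_log_iff (by positivity) hp]
    push_cast
    rw [Real.log_pow]
    exact key
  exact_mod_cast this

theorem two_pow_le_primorial {k : ℕ} (hk : 0 < k) : 2 ^ k ≤ primorial (16 * k - 1) := by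
  rcases le_or_gt 38 k with h | h
  · exact two_pow_le_primorial_of_large h
  rcases Nat.lt_or_ge 1 k with h1 | h1
  -- For `2 ≤ k` one has `16 * k - 1 ≥ 31`, and the product of the primes up to `31` exceeds `2 ^
  -- 37` but not `2 ^ 38`; this is where the threshold `38` comes from.
  · calc 2 ^ k ≤ 2 ^ 37 := Nat.pow_le_pow_right (by norm_num) (by omega)
      _ ≤ primorial 31 := by decide +kernel
      _ ≤ _ := primorial_mono (by omega)
  · obtain rfl : k = 1 := by omega
    exact le_trans (by decide +kernel : 2 ^ 1 ≤ primorial 2) (primorial_mono (by norm_num))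

end Primorial

/-- What the loop in `smallPrimes` preserves. -/
structure PrimeState (M x : ℕ) (s : ℕ × List ℕ) : Prop where
  prod : s.1 = s.2.prod
  prime : ∀ p ∈ s.2, p.Prime ∧ p < x
  nodup : s.2.Nodup
  all : s.1 ≤ M → ∀ p < x, p.Prime → p ∈ s.2
  length : s.2.length ≤ Nat.size M
  le : s.1 ≤ M * x + 1

theorem PrimeState.step_prime {M x : ℕ} {s : ℕ × List ℕ} (h : PrimeState M x s) (hM : s.1 ≤ M)
    (hx : x.Prime) : PrimeState M (x + 1) (s.1 * x, s.2 ++ [x]) := by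
  refine ⟨by simp [h.prod], ?_, ?_, ?_, ?_, ?_⟩
  · intro p hp
    rcases List.mem_append.mp hp with hp | hp
    · exact ⟨(h.prime p hp).1, by have := (h.prime p hp).2; omega⟩
    · rw [List.mem_singleton.mp hp]; exact ⟨hx, by omega⟩
  · refine List.Nodup.append h.nodup (by simp) ?_
    intro a ha hb
    rw [List.mem_singleton.mp hb] at ha
    exact absurd (h.prime x ha).2 (lt_irrefl x)
  · intro _ p hp hpp
    rcases Nat.lt_succ_iff_lt_or_eq.mp hp with hp | rfl
    · exact List.mem_append_left _ (h.all hM p hp hpp)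
    · simp
  -- Before the new prime is appended the product is still at most `M`, so there are fewer than
  -- `size M` primes in the list.
  · have h1 : 2 ^ s.2.length ≤ s.2.prod := by
      apply List.pow_card_le_prod
      exact fun p hp => (h.prime p hp).1.two_le
    have h2 := Nat.lt_size.mpr (h1.trans (h.prod ▸ hM))
    simp; omega
  · have := Nat.mul_le_mul_right x hM
    simp only
    rw [Nat.mul_succ]; omega

theorem PrimeState.mono {M x : ℕ} {s : ℕ × List ℕ} (h : PrimeState M x s)
    (hs : M < s.1 ∨ ¬ x.Prime) : PrimeState M (x + 1) s := by
  refine ⟨h.prod, fun p hp => ⟨(h.prime p hp).1, by have := (h.prime p hp).2; omega⟩, h.nodup, ?_,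
    h.length, h.le.trans (by rw [Nat.mul_succ]; omega)⟩
  intro hM p hp hpp
  rcases Nat.lt_succ_iff_lt_or_eq.mp hp with hp | rfl
  · exact h.all hM p hp hpp
  · rcases hs with hs | hs
    · omega
    · exact absurd hpp hs

theorem PrimeState.init {M : ℕ} : PrimeState M 0 (1, []) :=
  ⟨by simp, by simp, by simp, by simp, by simp, by simp⟩

theorem primeState_step (M : Tm Ty.den Proc .nat) (x : ℕ) (s : ℕ × List ℕ)
    (h : PrimeState M.nv x s) :
    PrimeState M.nv (x + 1) (show ℕ × List ℕ from (cond (lt M (fst (.var (τ := .prod .nat (.list .nat)) s)))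
      (.var (τ := .prod .nat (.list .nat)) s)
      (cond (isPrime (.var (τ := .nat) x)) (pair (fst (.var (τ := .prod .nat (.list .nat)) s)
        * (.var (τ := .nat) x)) (append (snd (.var (τ := .prod .nat (.list .nat)) s))
          (single (.var (τ := .nat) x)))) (.var (τ := .prod .nat (.list .nat)) s))).val) := by
  simp only [val_cond, nv_lt, nv_isPrime, nv_fst, val_var, nv_var, val_pair, val_append,
    val_single, val_eq_nv, nv_mul, val_snd]
  by_cases h1 : M.nv < s.1
  · simpa [h1] using h.mono (Or.inl h1)
  · by_cases h2 : x.Prime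
    · simpa [h1, h2] using h.step_prime (by omega) h2
    · simpa [h1, h2] using h.mono (Or.inr h2)

/-- If the product had not passed `M`, the list would contain every prime below `16 * size M`, and
its product would be at least `2 ^ size M > M`. -/
theorem val_smallPrimes (M : Tm Ty.den Proc .nat) (hM : 0 < M.nv) :
    ∃ P : ℕ, PrimeState M.nv (16 * Nat.size M.nv) (P, (smallPrimes M).val) ∧ M.nv < P := by
  have h := loop_val (n := 16 * size M) (x := pair 1 nil) (b := fun x s =>
    cond (lt M (fst s)) s
      (cond (isPrime x) (pair (fst s * x) (append (snd s) (single x))) s))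
    (PrimeState M.nv) (by simpa using PrimeState.init) (fun x _ s hs => primeState_step M x s hs)
  have hsp : (smallPrimes M).val = (loop (16 * size M) (pair 1 nil) fun x s =>
    cond (lt M (fst s)) s
      (cond (isPrime x) (pair (fst s * x) (append (snd s) (single x))) s)).val.2 := rfl
  rw [hsp]
  obtain ⟨P, L, hPL⟩ : ∃ P L, (loop (16 * size M) (pair 1 nil) fun x s =>
    cond (lt M (fst s)) s
      (cond (isPrime x) (pair (fst s * x) (append (snd s) (single x))) s)).val = (P, L) :=
    ⟨_, _, rfl⟩
  rw [hPL] at h ⊢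
  refine ⟨P, h, ?_⟩
  by_contra hP
  have hP : P ≤ M.nv := not_lt.mp hP
  have hs : 0 < Nat.size M.nv := Nat.size_pos.mpr hM
  have h1 := h.all hP
  have h2 : primorial (16 * Nat.size M.nv - 1) ≤ P := by
    have h3 : P = L.prod := h.prod
    rw [h3, primorial, ← List.map_id L, ← List.prod_toFinset _ h.nodup]
    have h4 : (0 : ℕ) < ∏ p ∈ L.toFinset, id p := Finset.prod_pos fun p hp =>
      (h.prime p (List.mem_toFinset.mp hp)).1.pos
    refine Nat.le_of_dvd h4 (Finset.prod_dvd_prod_of_subset _ _ _ fun p hp => ?_)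
    simp only [Finset.mem_filter, Finset.mem_range] at hp
    exact List.mem_toFinset.mpr (h1 p (by simp; omega) hp.2)
  have h3 := two_pow_le_primorial hs
  have h4 := Nat.lt_size_self M.nv
  omega

/-! ## Chinese remaindering -/

theorem sum_mod_of_crt {k X : ℕ} {n y w : ℕ → ℕ}
    (hco : ∀ i < k, ∀ j < k, i ≠ j → Nat.Coprime (n i) (n j))
    (h1 : ∀ j < k, w j ≡ 1 [MOD n j]) (h0 : ∀ i < k, ∀ j < k, i ≠ j → n i ∣ w j)
    (hy : ∀ j < k, y j ≡ X [MOD n j]) (hX : X < ∏ j ∈ Finset.range k, n j) :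
    (∑ j ∈ Finset.range k, y j * w j) % ∏ j ∈ Finset.range k, n j = X := by
  have : (∑ j ∈ Finset.range k, y j * w j) ≡ X [MOD ∏ j ∈ Finset.range k, n j] := by
    rw [Nat.modEq_iff_dvd]
    push_cast
    refine Finset.prod_dvd_of_coprime ?_ ?_
    · intro i hi j hj hij
      exact Nat.isCoprime_iff_coprime.mpr (hco i (by simpa using hi) j (by simpa using hj) hij)
    · intro i hi
      rw [Finset.mem_range] at hi
      have e : (∑ j ∈ Finset.range k, y j * w j) ≡ X [MOD n i] := by
        rw [← ZMod.natCast_eq_natCast_iff]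
        push_cast
        rw [Finset.sum_eq_single_of_mem i (Finset.mem_range.mpr hi)]
        · rw [(ZMod.natCast_eq_natCast_iff _ _ _).mpr (hy i hi),
            (ZMod.natCast_eq_natCast_iff _ _ _).mpr (h1 i hi)]
          simp
        · intro j hj hij
          rw [(ZMod.natCast_eq_zero_iff (w j) (n i)).mpr
            (h0 i hi j (Finset.mem_range.mp hj) (Ne.symm hij)), mul_zero]
      have := Nat.modEq_iff_dvd.mp e
      push_cast at this
      exact this
  rw [this, Nat.mod_eq_of_lt hX]

theorem ev_le {m d : ℕ} {c x : ℕ → ℕ} {Q r : ℕ} (hr : 0 < r) (hc : ∀ k < d ^ m, c k ≤ Q)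
    (hx : ∀ i < m, x i ≤ r) : ev m d c x ≤ d ^ m * (Q * r ^ (m * (d - 1))) := by
  unfold ev
  have : ∀ k ∈ Finset.range (d ^ m), c k * ∏ i ∈ Finset.range m, x i ^ (k / d ^ i % d)
      ≤ Q * r ^ (m * (d - 1)) := by
    intro k hk
    have hk := Finset.mem_range.mp hk
    refine Nat.mul_le_mul (hc k hk) ?_
    calc _ ≤ ∏ i ∈ Finset.range m, r ^ (d - 1) := Finset.prod_le_prod' fun i hi => by
          refine (Nat.pow_le_pow_left (hx i (Finset.mem_range.mp hi)) _).trans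
            (Nat.pow_le_pow_right hr ?_)
          rcases Nat.eq_zero_or_pos d with rfl | hd
          · rw [zero_pow (by have := Finset.mem_range.mp hi; omega)] at hk; omega
          · have := Nat.mod_lt (k / d ^ i) hd; omega
      _ = _ := by rw [Finset.prod_const, Finset.card_range, ← pow_mul, mul_comm]
  refine (Finset.sum_le_sum this).trans ?_
  simp

end MME

namespace MME

/-! ## The values delivered by MME-B -/

/-- This keeps the goals small: a shared value becomes a fresh variable, and the rest of the program
sees only what is proved about it. -/
theorem share_elim {σ τ : Ty} {a : Tm Ty.den Proc σ} {b : Tm Ty.den Proc σ → Tm Ty.den Proc τ}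
    {y : τ.den} (h : ∀ x, a.val = x → (b (.var x)).val = y) : (share a b).val = y := h _ rfl

theorem getD_tab {τ : Ty} {n : Tm Ty.den Proc .nat}
    {b : Tm Ty.den Proc .nat → Tm Ty.den Proc τ} {k : ℕ} {x : τ.den} (h : k < n.nv) :
    List.getD (α := τ.den) (tab n b).val k x = (b (.var (τ := .nat) k)).val := by
  rw [val_tab]; exact getD_map_range _ _ h

theorem getD_tab_len {σ τ : Ty} {a : List σ.den}
    {b : Tm Ty.den Proc .nat → Tm Ty.den Proc τ} {k : ℕ} {x : τ.den} (h : k < a.length) :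
    List.getD (α := τ.den) (tab (len (.var (τ := .list σ) a)) b).val k x
      = (b (.var (τ := .nat) k)).val := getD_tab h

/-- The body of the recursion in MME-B. -/
def mmeStep (m d : Tm Ty.den Proc .nat) (self : Proc Arg (.list .nat))
    (x : Tm Ty.den Proc Arg) : Tm Ty.den Proc (.list .nat) :=
  share (fst x) fun f =>
  share (fst (snd x)) fun as =>
  share (fst (snd (snd x))) fun r =>
  share (snd (snd (snd x))) fun s =>
  share (pow r s) fun q =>
  share (exponents m s) fun vs =>
  share (tab (len vs) fun k => hasse m d q f (get vs k)) fun fs =>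
  share (tab (len as) fun i => tab m fun c => get (get as i) c % r) fun bs =>
  share (smallPrimes (d * pow r d)) fun ps =>
  share (tab (len ps) fun j => pow (get ps j) m) fun ns =>
  share (tab (len vs) fun k => tab (len ps) fun j =>
    tab (len (get fs k)) fun i => get (get fs k) i % get ns j) fun fjs =>
  share (tab (len ps) fun j => tab (len bs) fun i =>
    tab m fun c => get (get bs i) c % get ns j) fun bjs =>
  share (tab (len vs) fun k => tab (len ps) fun j =>
    call self (pair (get (get fjs k) j) (pair (get bjs j) (pair (get ps j) m)))) fun ys =>
  share (loop (len ns) 1 fun j z => z * get ns j) fun n =>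
  share (tab (len ps) fun j =>
    share (n / get ns j) fun c => c * inverse (get ps j) (get ns j) (c % get ns j)) fun ws =>
  share (tab (len vs) fun k => tab (len as) fun i =>
    (sumMod n (len ps) fun j => get (get (get ys k) j) i * get ws j) % q) fun zs =>
  tab (len as) fun i => taylor m q vs (fun k => get (get zs k) i) (get as i) (get bs i)

/-- The procedure behind MME-B. -/
def mmeProc (m d : Tm Ty.den Proc .nat) (t : ℕ) : Proc Arg (.list .nat) :=
  recProc (σ := Arg)
    (fun x =>
      mmeProductSet m d (fst x) (fst (snd x)) (fst (snd (snd x))) (snd (snd (snd x))))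
    (fun self _ x => mmeStep m d self x) t

theorem val_mmeB (m d : Tm Ty.den Proc .nat) (f : Tm Ty.den Proc (.list .nat))
    (as : Tm Ty.den Proc (.list (.list .nat))) (r s t : Tm Ty.den Proc .nat) :
    (mmeB m d f as r s t).val = (mmeProc m d t.nv (f.val, as.val, r.val, s.val)).1 := (rfl)

theorem cost_mmeB (m d : Tm Ty.den Proc .nat) (f : Tm Ty.den Proc (.list .nat))
    (as : Tm Ty.den Proc (.list (.list .nat))) (r s t : Tm Ty.den Proc .nat) :
    (mmeB m d f as r s t).cost
      = t.cost + (f.cost + (as.cost + (r.cost + s.cost + 1) + 1) + 1)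
        + (mmeProc m d t.nv (f.val, as.val, r.val, s.val)).2 + 1 := (rfl)

/-- The specification of a procedure for multipoint evaluation. -/
def Evaluates (m d : ℕ) (p : Proc Arg (.list .nat)) : Prop :=
  ∀ (f : List ℕ) (as : List (List ℕ)) (r s : ℕ), 1 < r → 0 < s → s ≤ m →
    (p (f, as, r, s)).1 = (List.range as.length).map fun i =>
      ev m d (fun k => f.getD k 0) (fun c => (as.getD i []).getD c 0) % r ^ s

theorem nv_loop_mul (n : List ℕ) :
    (loop (len (.var (τ := .list .nat) n)) 1
      fun j z => z * get (.var (τ := .list .nat) n) j : Tm Ty.den Proc .nat).nv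
    = ∏ j ∈ Finset.range n.length, n.getD j 0 :=
  loop_nv_eq (fun i => ∏ j ∈ Finset.range i, n.getD j 0) (by simp) fun i _ => by
    simp [Finset.prod_range_succ]

/-- The cofactor of `n j` is the product of the other moduli. It is divisible by each of them and
prime to `p j`, so multiplying it by its inverse modulo `n j` gives the weight. The hypothesis on
`w` quantifies over programs because the inverse is known only as the result of a program. -/
theorem crt_weights {k m : ℕ} (hm : 0 < m) {p n w : ℕ → ℕ} (hp : ∀ j < k, (p j).Prime)
    (hinj : ∀ i < k, ∀ j < k, i ≠ j → p i ≠ p j) (hn : ∀ j < k, n j = p j ^ m)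
    (hw : ∀ j < k, ∃ P N X : Tm Ty.den Proc .nat, P.nv = p j ∧ N.nv = n j ∧
      X.nv = (∏ i ∈ Finset.range k, n i) / n j % n j ∧
      w j = (∏ i ∈ Finset.range k, n i) / n j * (inverse P N X).nv) :
    (∀ i < k, ∀ j < k, i ≠ j → Nat.Coprime (n i) (n j)) ∧
    (∀ j < k, w j ≡ 1 [MOD n j]) ∧ (∀ i < k, ∀ j < k, i ≠ j → n i ∣ w j) := by
  have hco : ∀ i < k, ∀ j < k, i ≠ j → Nat.Coprime (n i) (n j) := by
    intro i hi j hj hij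
    rw [hn i hi, hn j hj]
    exact Nat.Coprime.pow _ _ ((Nat.coprime_primes (hp i hi) (hp j hj)).mpr (hinj i hi j hj hij))
  have hpos : ∀ j < k, 0 < n j := fun j hj => by
    rw [hn j hj]; exact Nat.pow_pos (hp j hj).pos
  have hdiv : ∀ j < k, (∏ i ∈ Finset.range k, n i) / n j
      = ∏ i ∈ (Finset.range k).erase j, n i := by
    intro j hj
    rw [← Finset.mul_prod_erase _ _ (Finset.mem_range.mpr hj), Nat.mul_div_cancel_left _ (hpos j hj)]
  refine ⟨hco, fun j hj => ?_, fun i hi j hj hij => ?_⟩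
  · have hdvd : ¬ p j ∣ (∏ i ∈ Finset.range k, n i) / n j % n j := by
      rw [Nat.dvd_mod_iff (by rw [hn j hj]; exact dvd_pow_self _ hm.ne'), hdiv j hj,
        (hp j hj).prime.dvd_finsetProd_iff]
      rintro ⟨i, hi, hdvd⟩
      obtain ⟨hij, hi⟩ := Finset.mem_erase.mp hi
      have hi := Finset.mem_range.mp hi
      rw [hn i hi] at hdvd
      exact hinj i hi j hj hij
        ((Nat.prime_dvd_prime_iff_eq (hp j hj) (hp i hi)).mp ((hp j hj).dvd_of_dvd_pow hdvd)).symm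
    obtain ⟨P, N, X, hP, hN, hX, hwj⟩ := hw j hj
    have := nv_inverse P N X m (hP ▸ hp j hj) hm.ne' (by rw [hP, hN, hn j hj])
      (by rw [hP, hX]; exact hdvd)
    rw [hN, hX, ZMod.natCast_mod] at this
    rw [← ZMod.natCast_eq_natCast_iff, hwj, Nat.cast_mul, Nat.cast_one, mul_comm]
    exact this.2
  · obtain ⟨P, N, X, hP, hN, hX, hwj⟩ := hw j hj
    rw [hwj, hdiv j hj]
    exact Dvd.dvd.mul_right (Finset.dvd_prod_of_mem _
      (Finset.mem_erase.mpr ⟨hij, Finset.mem_range.mpr hi⟩)) _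

/-- The value at a point modulo `r` is recovered from the values modulo the `p j ^ m`. -/
theorem crt_recover {d m r s k : ℕ} (hd : 0 < d) (hr : 0 < r) (hsm : s ≤ m) {p : ℕ → ℕ}
    (hM : d * r ^ d < ∏ j ∈ Finset.range k, p j) (hm : 0 < m) {c x : ℕ → ℕ}
    (hc : ∀ k < d ^ m, c k < r ^ s) (hx : ∀ i < m, x i < r) :
    ev m d c x < ∏ j ∈ Finset.range k, p j ^ m := by
  rw [Finset.prod_pow]
  refine lt_of_le_of_lt ?_ (Nat.pow_lt_pow_left hM hm.ne')
  refine (ev_le hr (fun k hk => (hc k hk).le) fun i hi => (hx i hi).le).trans ?_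
  -- The coefficients contribute the factor `r ^ s` and the monomials `r ^ (m * (d - 1))`; because
  -- `s ≤ m` this is at most `r ^ (m * d)`, and with `d ^ m` terms the value is at most `(d * r ^ d)
  -- ^ m`.
  rw [mul_pow, ← pow_mul, ← pow_add]
  refine Nat.mul_le_mul_left _ (Nat.pow_le_pow_right hr ?_)
  obtain ⟨d, rfl⟩ := Nat.exists_eq_add_of_lt hd
  have : s + m * d ≤ m + m * d := Nat.add_le_add_right hsm _
  simp only [Nat.zero_add, Nat.add_sub_cancel]
  linarith [Nat.succ_mul d m, mul_comm m d]

/-- The recursive results are residues of exact natural numbers, namely the values of the lifted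
Hasse derivatives at the reduced points. Chinese remaindering recovers these numbers, and Taylor's
formula modulo `r ^ s` combines them. The procedure is only called with exponent `m`, so the
condition `s ≤ m` in `Evaluates` is preserved. -/
theorem Evaluates.step {m d : Tm Ty.den Proc .nat} (hd : 0 < d.nv) (hm : 0 < m.nv)
    {self : Proc Arg (.list .nat)} (h : Evaluates m.nv d.nv self) :
    Evaluates m.nv d.nv fun x => ((mmeStep m d self (.var x)).val,
      (mmeStep m d self (.var x)).cost) := by
  intro f as r s hr hs hsm
  have hr0 : 0 < r := by omega
  change (mmeStep m d self (.var (τ := Arg) (f, as, r, s))).val = _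
  unfold mmeStep
  refine share_elim fun f' hf' => ?_
  obtain rfl : f = f' := hf'
  refine share_elim fun as' has' => ?_
  obtain rfl : as = as' := has'
  refine share_elim fun r' hr' => ?_
  obtain rfl : r = r' := hr'
  refine share_elim fun s' hs' => ?_
  obtain rfl : s = s' := hs'
  refine share_elim fun (q : ℕ) hq => ?_
  have hq : r ^ s = q := by rw [← hq]; simp
  have hq1 : 1 < q := hq ▸ Nat.one_lt_pow hs.ne' hr
  refine share_elim fun (vs : List (List ℕ)) hvs => ?_
  rw [val_exponents] at hvs
  have hvs : expo s m.nv = vs := hvs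
  refine share_elim fun (fs : List (List ℕ)) hfs => ?_
  have hfs : ∀ k < vs.length, (fs.getD k []).length = d.nv ^ m.nv ∧ ∀ i < d.nv ^ m.nv,
      (fs.getD k []).getD i 0 = hasseC m.nv d.nv (fun k => f.getD k 0)
        (fun i => (vs.getD k []).getD i 0) i % q := by
    intro k hk
    rw [← hfs, getD_tab_len hk]
    refine ⟨by rw [val_hasse]; simp, fun i hi => ?_⟩
    rw [getD_val_hasse _ _ _ _ _ hi]
    rfl
  refine share_elim fun (bs : List (List ℕ)) hbs => ?_
  have hbl : bs.length = as.length := by rw [← hbs, val_tab]; simp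
  have hbs : ∀ i < as.length, ∀ c < m.nv, (bs.getD i []).getD c 0 = (as.getD i []).getD c 0 % r := by
    intro i hi c hc
    rw [← hbs, getD_tab_len hi, getD_tab hc]
    rfl
  refine share_elim fun (ps : List ℕ) hps => ?_
  obtain ⟨P, hP, hMP⟩ := val_smallPrimes (d * pow (.var (τ := .nat) r) d)
    (by simp only [nv_mul, nv_pow, nv_var]; positivity)
  rw [hps] at hP
  simp only [nv_mul, nv_pow, nv_var] at hMP hP
  have hpp : ∀ j < ps.length, (ps.getD j 0).Prime := fun j hj => by
    rw [List.getD_eq_getElem _ _ hj]; exact (hP.prime _ (List.getElem_mem hj)).1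
  have hinj : ∀ i < ps.length, ∀ j < ps.length, i ≠ j → ps.getD i 0 ≠ ps.getD j 0 := by
    intro i hi j hj hij
    rw [List.getD_eq_getElem _ _ hi, List.getD_eq_getElem _ _ hj]
    exact fun e => hij ((List.Nodup.getElem_inj_iff hP.nodup).mp e)
  have hprod : d.nv * r ^ d.nv < ∏ j ∈ Finset.range ps.length, ps.getD j 0 := by
    have h1 := hP.prod
    simp only at h1
    have h2 : ∏ j ∈ Finset.range ps.length, ps.getD j 0 = ps.prod := by
      clear * -
      induction ps with
      | nil => simp
      | cons a L ih => rw [List.length_cons, Finset.prod_range_succ']; simp [← ih, mul_comm]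
    rw [h2, ← h1]; exact hMP
  refine share_elim fun (ns : List ℕ) hns => ?_
  have hnl : ns.length = ps.length := by rw [← hns, val_tab]; simp
  have hns : ∀ j < ps.length, ns.getD j 0 = ps.getD j 0 ^ m.nv := by
    intro j hj
    rw [← hns, getD_tab_len hj]
    simp
  refine share_elim fun (fjs : List (List (List ℕ))) hfjs => ?_
  have hfjs : ∀ k < vs.length, ∀ j < ps.length, ∀ i < d.nv ^ m.nv,
      ((fjs.getD k []).getD j []).getD i 0 = (fs.getD k []).getD i 0 % ns.getD j 0 := by
    intro k hk j hj i hi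
    rw [← hfjs, getD_tab_len hk, getD_tab_len hj,
      getD_tab (lt_of_lt_of_eq hi (hfs k hk).1.symm :
        i < (len (get (.var (τ := .list (.list .nat)) fs) (.var (τ := .nat) k))).nv)]
    rfl
  refine share_elim fun (bjs : List (List (List ℕ))) hbjs => ?_
  have hbjs : ∀ j < ps.length, (bjs.getD j []).length = as.length ∧ ∀ i < as.length, ∀ c < m.nv,
      ((bjs.getD j []).getD i []).getD c 0 = (bs.getD i []).getD c 0 % ns.getD j 0 := by
    intro j hj
    rw [← hbjs, getD_tab_len hj]
    refine ⟨by rw [val_tab]; simp [hbl], fun i hi c hc => ?_⟩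
    rw [getD_tab_len (lt_of_lt_of_eq hi hbl.symm), getD_tab hc]
    rfl
  refine share_elim fun (ys : List (List (List ℕ))) hys => ?_
  -- Reducing coefficients and coordinates modulo `n_j` does not change the value modulo `n_j`, so
  -- the recursive result is congruent to the value of the unreduced lift.
  have hys : ∀ k < vs.length, ∀ j < ps.length, ∀ i < as.length,
      ((ys.getD k []).getD j []).getD i 0
        ≡ ev m.nv d.nv (fun i => (fs.getD k []).getD i 0)
          (fun c => (as.getD i []).getD c 0 % r) [MOD ns.getD j 0] := by
    intro k hk j hj i hi
    rw [← hys, getD_tab_len hk, getD_tab_len hj, val_call]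
    have h1 := h ((fjs.getD k []).getD j []) (bjs.getD j []) (ps.getD j 0) m.nv
      (hpp j hj).one_lt hm le_rfl
    rw [show (self (pair (get (get (.var (τ := .list (.list (.list .nat))) fjs)
        (.var (τ := .nat) k)) (.var (τ := .nat) j)) (pair (get (.var (τ := .list (.list
        (.list .nat))) bjs) (.var (τ := .nat) j)) (pair (get (.var (τ := .list .nat) ps)
        (.var (τ := .nat) j)) m))).val).1 = _ from h1,
      getD_map_range _ _ (lt_of_lt_of_eq hi (hbjs j hj).1.symm), ← hns j hj]
    refine (Nat.mod_modEq _ _).trans (ev_mod_congr (fun l hl => ?_) fun c hc => ?_)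
    · rw [hfjs k hk j hj l hl]; exact Nat.mod_modEq _ _
    · rw [(hbjs j hj).2 i hi c hc, hbs i hi c hc]; exact Nat.mod_modEq _ _
  refine share_elim fun (n : ℕ) hn => ?_
  have hn : n = ∏ j ∈ Finset.range ps.length, ns.getD j 0 := by
    rw [← hn, ← hnl]; exact nv_loop_mul ns
  refine share_elim fun (ws : List ℕ) hws => ?_
  obtain ⟨hco, hw1, hw0⟩ := crt_weights (k := ps.length) (n := fun j => ns.getD j 0)
    (w := fun j => ws.getD j 0) hm hpp hinj hns (by
      intro j hj
      refine ⟨get (.var (τ := .list .nat) ps) (.var (τ := .nat) j),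
        get (.var (τ := .list .nat) ns) (.var (τ := .nat) j),
        .var (τ := .nat) (n / ns.getD j 0) % get (.var (τ := .list .nat) ns) (.var (τ := .nat) j),
        rfl, rfl, by rw [← hn]; rfl, ?_⟩
      rw [← hn, ← hws, getD_tab_len hj, val_eq_nv, nv_share, nv_mul]
      rfl)
  refine share_elim fun (zs : List (List ℕ)) hzs => ?_
  -- The value of the lift is smaller than the product of the moduli, so remaindering returns the
  -- natural number itself, and reducing it modulo `q` is legitimate.
  have hzs : ∀ k < vs.length, ∀ i < as.length, (zs.getD k []).getD i 0 =
      ev m.nv d.nv (fun i => (fs.getD k []).getD i 0)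
        (fun c => (as.getD i []).getD c 0 % r) % q := by
    intro k hk i hi
    rw [← hzs, getD_tab_len hk, getD_tab_len hi, val_eq_nv, nv_mod,
      nv_sumMod]
    simp only [nv_var, nv_len, val_var, nv_mul, nv_get, val_get, dflt_list]
    congr 1
    have hlt := crt_recover (k := ps.length) (p := fun j => ps.getD j 0) (m := m.nv) hd hr0 hsm
      hprod hm (c := fun i => (fs.getD k []).getD i 0)
      (x := fun c => (as.getD i []).getD c 0 % r) (fun l hl => by
        rw [(hfs k hk).2 l hl, hq]; exact Nat.mod_lt _ (by omega)) (fun c _ => Nat.mod_lt _ hr0)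
    have e : ∏ j ∈ Finset.range ps.length, ps.getD j 0 ^ m.nv
        = ∏ j ∈ Finset.range ps.length, ns.getD j 0 :=
      Finset.prod_congr rfl fun j hj => (hns j (Finset.mem_range.mp hj)).symm
    rw [e] at hlt
    have := sum_mod_of_crt hco hw1 hw0 (fun j hj => hys k hk j hj i hi) hlt
    rw [hn]
    exact this
  rw [val_tab]
  refine List.map_congr_left fun i hi => ?_
  have hi : i < as.length := List.mem_range.mp hi
  rw [val_eq_nv]
  refine nv_taylor_eq_ev m _ rfl ?_ hr hs ?_ _ (get _ (.var (τ := .nat) i)) _ ?_ _ ?_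
  · exact hq.symm
  · exact hvs.symm
  · intro c hc
    exact hbs i hi c hc
  · intro k hk
    rw [hvs] at hk
    change (zs.getD k []).getD i 0 ≡ _ [MOD _]
    rw [hzs k hk i hi, hq]
    refine (Nat.mod_modEq _ _).trans (ev_mod_congr (fun l hl => ?_) fun c hc => Nat.ModEq.refl _)
    rw [(hfs k hk).2 l hl, hvs]
    exact Nat.mod_modEq _ _

theorem evaluates_mmeProc (m d : Tm Ty.den Proc .nat) (hd : 0 < d.nv) (hm : 0 < m.nv) (t : ℕ) :
    Evaluates m.nv d.nv (mmeProc m d t) := by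
  induction t with
  | zero =>
    intro f as r s hr hs _
    rw [mmeProc, recProc_zero]
    exact val_mmeProductSet _ _ _ _ _ _ (show 0 < s from hs) (show 1 < r from hr)
  | succ t ih => exact ih.step hd hm

end MME

namespace MME

/-! ## Programs whose number of steps has an exponential factor -/

/-- The numbers in the result have at most `B ^ i` digits, and there are at most `W * B ^ k` steps. -/
structure OkW (B W i k : ℕ) {τ : Ty} (t : Tm Ty.den Proc τ) : Prop where
  bd : Bd (B ^ i) τ t.val
  cost : t.cost ≤ W * B ^ k

section Weighted

variable {B : ℕ} [hB : Fact (8 ≤ B)] {σ τ : Ty} {i j k l W : ℕ}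

theorem OkW.mono {t : Tm Ty.den Proc τ} (h : OkW B W i k t) (hi : i ≤ j) (hk : k ≤ l) :
    OkW B W j l t :=
  ⟨h.bd.mono (pow_mono_exp hi), h.cost.trans (Nat.mul_le_mul_left _ (pow_mono_exp hk))⟩

omit hB in
theorem OkW.mono_weight {t : Tm Ty.den Proc τ} {W' : ℕ} (h : OkW B W i k t) (hW : W ≤ W') :
    OkW B W' i k t :=
  ⟨h.bd, h.cost.trans (Nat.mul_le_mul_right _ hW)⟩

omit hB in
theorem Ok.weight {t : Tm Ty.den Proc τ} (h : Ok B i k t) (hW : 1 ≤ W) : OkW B W i k t :=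
  ⟨h.bd, h.cost.trans (Nat.le_mul_of_pos_left _ hW)⟩

/-- The exponentially large parts of the length and of the cost of a cell multiply, while the
polynomial parts only add exponents of `B`. -/
theorem OkW.tab {a : Tm Ty.den Proc .nat} {x : Tm Ty.den Proc .nat → Tm Ty.den Proc τ}
    {j₁ W₁ W₂ : ℕ} (ha : Ok B i k a) (hn : a.nv ≤ W₁ * B ^ j₁) (hW : W₁ * W₂ ≤ W) (hW0 : 1 ≤ W)
    (hW2 : 1 ≤ W₂)
    (hx : ∀ n < a.nv, OkW B W₂ j l (x (.var (τ := .nat) n))) :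
    OkW B W j (max k (j₁ + (l + 1)) + 1) (tab a x) := by
  refine ⟨?_, ?_⟩
  · rw [val_tab]
    intro y hy
    obtain ⟨n, hn, rfl⟩ := List.mem_map.mp hy
    exact (hx n (List.mem_range.mp hn)).bd
  · refine (cost_tab_le fun n hn => (hx n hn).cost).trans ?_
    have h1 := ha.cost.trans (pow_mono_exp (B := B) (show k ≤ max k (j₁ + (l + 1)) by omega))
    have h0 : W₂ * B ^ l + 1 ≤ W₂ * B ^ (l + 1) := by
      have h7 := Nat.mul_le_mul_left W₂ (eight_mul_pow_le (B := B) l)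
      have h8 := Nat.mul_le_mul hW2 (one_le_pow_base (B := B) l)
      rw [Nat.mul_left_comm] at h7
      omega
    have h2 : a.nv * (W₂ * B ^ l + 1) ≤ W * B ^ max k (j₁ + (l + 1)) :=
      calc _ ≤ (W₁ * B ^ j₁) * (W₂ * B ^ (l + 1)) := Nat.mul_le_mul hn h0
        _ = (W₁ * W₂) * B ^ (j₁ + (l + 1)) := by rw [pow_add]; ring
        _ ≤ _ := Nat.mul_le_mul hW (pow_mono_exp (by omega))
    have h3 := Nat.mul_le_mul_right (B ^ max k (j₁ + (l + 1))) hW0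
    have h7 := Nat.mul_le_mul_left W (eight_mul_pow_le (B := B) (max k (j₁ + (l + 1))))
    have h8 := Nat.mul_le_mul hW0 (one_le_pow_base (B := B) (max k (j₁ + (l + 1))))
    rw [Nat.mul_left_comm] at h7
    omega

theorem size_two_pow_le (n : ℕ) : Nat.size (2 ^ n) ≤ n + 1 := by
  rw [Nat.size_pow]

end Weighted

/-! ### Cost of the enumeration of exponent vectors. -/

section Costs

variable {B : ℕ} [hB : Fact (8 ≤ B)] {m d r q s : Tm Ty.den Proc .nat}

theorem Ok.loop_add {v : List ℕ} {j : ℕ} (hl : v.length ≤ B ^ 1) (hs : v.sum ≤ B ^ j)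
    (hj : 1 ≤ j) :
    Ok B j (2 * j + 5) (MME.loop (MME.len (.var (τ := .list .nat) v)) 0
      fun i w => w + MME.get (.var (τ := .list .nat) v) i : Tm Ty.den Proc .nat) := by
  have hv : Bd (B ^ j) (.list .nat) v := fun x hx =>
    (size_self_le x).trans ((List.single_le_sum (by simp) _ hx).trans hs)
  refine (Ok.loop (l := 2 * j + 1) (Ok.len (j := 1) (Ok.var hv) hl) hl
    (Ok.ofNat 0) (fun i w => w = ∑ j ∈ Finset.range i, v.getD j 0 ∧ i ≤ v.length)
    ⟨by simp, by omega⟩ ?_ ?_).mono le_rfl (by omega)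
  · rintro i hi w ⟨rfl, hi'⟩
    have hle : ∀ i ≤ v.length, ∑ j ∈ Finset.range i, v.getD j 0 ≤ B ^ j := fun i hi =>
      ((Finset.sum_le_sum_of_subset (Finset.range_mono hi)).trans_eq (sum_getD v)).trans hs
    have h1 : Ok B j 0 (.var (τ := .nat) i : Tm Ty.den Proc .nat) :=
      (Ok.var (Bd.index (j := 1) hi hl)).mono hj le_rfl
    have h2 : Ok B j 0 (.var (τ := .nat) (∑ j ∈ Finset.range i, v.getD j 0) :
      Tm Ty.den Proc .nat) := Ok.var ((size_self_le _).trans (hle i hi'))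
    refine ⟨⟨by simp [Finset.sum_range_succ], hi⟩, ?_⟩
    exact ((h2.add ((Ok.var hv).get h1)).mono le_rfl (by omega)).cost
  · rintro w ⟨rfl, hi'⟩
    exact (size_self_le _).trans (((Finset.sum_le_sum_of_subset
      (Finset.range_mono hi')).trans_eq (sum_getD v)).trans hs)

omit hB in
theorem bd_expo {s m : ℕ} (hs : 0 < s) (h : s ≤ B ^ 1) :
    Bd (B ^ 1) (.list (.list .nat)) (expo s m) := by
  intro v hv x hx
  have := ((mem_expo hs).mp hv).2
  have h2 : x ≤ v.sum := List.single_le_sum (by simp) _ hx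
  exact (size_self_le x).trans (h2.trans (this.le.trans h))

/-- Every intermediate list has at most `2 ^ (m + s)` vectors, and each of the at most `B` passes
spends polynomial time per vector. -/
theorem OkW.exponents (hm : Ok B 1 1 m) (hs : Ok B 1 1 s) (hm' : m.nv ≤ B ^ 1)
    (hs' : s.nv ≤ B ^ 1) (hs0 : 0 < s.nv) :
    OkW B (2 ^ (m.nv + s.nv)) 1 16 (exponents m s) := by
  refine ⟨by rw [val_exponents]; exact bd_expo hs0 hs', ?_⟩
  have hVB : m.nv + s.nv + 1 ≤ B ^ 2 := by
    have := eight_mul_pow_le (B := B) 1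
    have := one_le_pow_base (B := B) 1
    simp only [Nat.reduceAdd] at *
    omega
  set V := 2 ^ (m.nv + s.nv) with hV
  have hV1 : 1 ≤ V := Nat.one_le_two_pow
  have key := (loop_spec (n := m) (x := single nil) (c := V * B ^ 13)
    (b := fun _ L => flatten (MME.tab (MME.len L) fun k =>
      MME.share (MME.get L k) fun v =>
      MME.tab (s - MME.loop (MME.len v) 0 fun i w => w + MME.get v i) fun c =>
        MME.append v (MME.single c)))
    (fun i (L : List (List ℕ)) => L = expo s.nv i) (by simp [expo]) ?_).2
  · refine key.trans ?_
    have h1 : (MME.single MME.nil : Tm Ty.den Proc (.list (.list .nat))).cost ≤ B ^ 6 :=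
      Ok.cost (Ok.single (Ok.nil (B := B)))
    have h2 := hm.cost.trans (pow_mono_exp (B := B) (show 1 ≤ 15 by omega))
    have h3 := h1.trans (pow_mono_exp (B := B) (show 6 ≤ 15 by omega))
    have h4 : m.nv * (V * B ^ 13 + 1) ≤ V * B ^ 15 := by
      have h5 : V * B ^ 13 + 1 ≤ V * B ^ 14 := by
        have h7 := Nat.mul_le_mul_left V (eight_mul_pow_le (B := B) 13)
        have h8 := Nat.mul_le_mul hV1 (one_le_pow_base (B := B) 13)
        rw [Nat.mul_left_comm] at h7
        simp only [Nat.reduceAdd] at *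
        omega
      calc _ ≤ B ^ 1 * (V * B ^ 14) := Nat.mul_le_mul hm' h5
        _ = _ := by ring
    have h5 : B ^ 15 ≤ V * B ^ 15 := Nat.le_mul_of_pos_left _ hV1
    have h7 := Nat.mul_le_mul_left V (eight_mul_pow_le (B := B) 15)
    have h8 := Nat.mul_le_mul hV1 (one_le_pow_base (B := B) 15)
    rw [Nat.mul_left_comm] at h7
    simp only [Nat.reduceAdd] at *
    omega
  · rintro i hi L rfl
    refine ⟨val_exponents_step _ _ rfl _, ?_⟩
    have hlen : ∀ j ≤ m.nv, (expo s.nv j).length ≤ V := fun j hj =>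
      (length_expo_le s.nv j).trans (Nat.pow_le_pow_right two_pos (by omega))
    rw [cost_flatten]
    have hval := val_exponents_step s.nv s rfl (expo s.nv i)
    rw [val_flatten] at hval
    rw [hval]
    have h2 := hlen (i + 1) (by omega)
    rw [expo] at h2
    have htab : (MME.tab (MME.len (.var (τ := .list (.list .nat)) (expo s.nv i))) fun k =>
        MME.share (MME.get (.var (τ := .list (.list .nat)) (expo s.nv i)) k) fun v =>
        MME.tab (s - MME.loop (MME.len v) 0 fun i w => w + MME.get v i) fun c =>
          MME.append v (MME.single c)).cost ≤ V * B ^ 12 := by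
      refine (OkW.tab (i := 2) (k := 1) (W₁ := V) (W₂ := 1) (j₁ := 0) (j := 1) (l := 10) ?_ ?_
        (by simp) hV1 le_rfl ?_).cost.trans (Nat.mul_le_mul_left _ (pow_mono_exp (by omega)))
      · refine ⟨?_, by rw [cost_len, cost_var, pow_one]; have := hB.out; omega⟩
        change Nat.size (expo s.nv i).length ≤ B ^ 2
        exact (Nat.size_le_size (hlen i hi.le)).trans ((size_two_pow_le _).trans hVB)
      · simpa using hlen i hi.le
      · intro k hk
        -- The index ranges over an exponentially long array, but it has only about `m + s` binary
        -- digits.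
        have hk' : k < (expo s.nv i).length := hk
        have hk2 : Nat.size k ≤ B ^ 2 :=
          (Nat.size_le_size (hk'.le.trans (hlen i hi.le))).trans ((size_two_pow_le _).trans hVB)
        refine Ok.weight ?_ le_rfl
        refine (Ok.share ((Ok.var (bd_expo hs0 hs')).mono (j := 1) le_rfl le_rfl |>.get
          (Ok.var (τ := .nat) hk2)) fun hv => ?_).mono (j := 1) le_rfl (show max (max 0 0 + 1) 9 + 1 ≤ 10 by decide)
        obtain ⟨v, hv1⟩ : ∃ v : List ℕ, v = (MME.get (.var (τ := .list (.list .nat))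
          (expo s.nv i)) (.var (τ := .nat) k) : Tm Ty.den Proc _).val := ⟨_, rfl⟩
        rw [← hv1] at hv ⊢
        have hmem : v ∈ expo s.nv i := by
          rw [hv1]
          change List.getD (expo s.nv i) k [] ∈ _
          rw [List.getD_eq_getElem _ _ hk']; exact List.getElem_mem hk'
        obtain ⟨hvl, hvs⟩ := (mem_expo hs0).mp hmem
        have hsum := Ok.loop_add (B := B) (v := v) (j := 1) (by omega) (by omega) le_rfl
        refine (Ok.tab (j₁ := 1) (l := 4) (hs.sub hsum) ((Nat.sub_le _ _).trans hs') fun c hc => ?_).mono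
          (j := 1) le_rfl (show _ ≤ 9 by decide)
        have hc' : c < s.nv := lt_of_lt_of_le hc (Nat.sub_le _ _)
        exact (Ok.append (j₁ := 1) (j₂ := 0) (Ok.var hv) (Ok.single (Ok.var (Bd.index hc' hs')))
          (by change v.length ≤ _; omega) (by simp)).mono le_rfl (by decide)
    have h3 : List.length (α := List (List ℕ)) (MME.tab (MME.len (.var (τ := .list (.list .nat)) (expo s.nv i))) fun k =>
        MME.share (MME.get (.var (τ := .list (.list .nat)) (expo s.nv i)) k) fun v =>
        MME.tab (s - MME.loop (MME.len v) 0 fun i w => w + MME.get v i) fun c =>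
          MME.append v (MME.single c)).val ≤ V := by
      rw [val_tab, List.length_map, List.length_range]
      exact hlen i hi.le
    have h7 := Nat.mul_le_mul_left V (eight_mul_pow_le (B := B) 12)
    have h8 := Nat.mul_le_mul_left V (one_le_pow_base (B := B) 12)
    rw [Nat.mul_left_comm] at h7
    simp only [Nat.reduceAdd] at *
    omega

end Costs

end MME

namespace MME

/-! ### Cost of Hasse derivatives, cell numbers and Taylor sums. -/

section Costs

variable {B : ℕ} [hB : Fact (8 ≤ B)] {m d r q s : Tm Ty.den Proc .nat}

/-- The cells of Hasse derivatives. -/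
theorem OkW.hasse {f v : Tm Ty.den Proc (.list .nat)} (hm : Ok B 1 2 m) (hm' : m.nv ≤ B ^ 1)
    (hd : Ok B 1 2 d) (hd' : d.nv ≤ B ^ 1) (hd0 : 0 < d.nv) (hq : Ok B 1 2 q) (hq0 : 0 < q.nv)
    (hf : Ok B 1 2 f) (hv : Ok B 1 2 v) (hdm : Nat.size (d.nv ^ m.nv) ≤ B ^ 1) :
    OkW B (d.nv ^ m.nv) 1 40 (hasse m d q f v) := by
  have hW : 1 ≤ d.nv ^ m.nv := Nat.one_le_pow _ _ hd0
  have hdm' : Ok B 1 9 (MME.pow d m) :=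
    ⟨by change Nat.size (MME.pow d m).nv ≤ _; rw [nv_pow]; exact hdm,
      ((Ok.pow (j := 1) hd hm hm').mono le_rfl (by decide)).cost⟩
  refine (OkW.tab (W₁ := d.nv ^ m.nv) (W₂ := 1) (j₁ := 0) (l := 36) hdm' (by simp) (by simp) hW
    le_rfl fun k hk => Ok.weight ?_ le_rfl).mono (i := 1) le_rfl (by decide)
  have hk' : k < d.nv ^ m.nv := by simpa using hk
  have hk1 : Ok B 1 0 (.var (τ := .nat) k : Tm Ty.den Proc .nat) :=
    Ok.var ((Nat.size_le_size hk'.le).trans hdm)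
  have key : Ok B 1 30 (MME.loop m (MME.pair 1 0) fun i s =>
      MME.share (.var (τ := .nat) k / MME.pow d i % d + MME.get v i) fun a =>
      MME.cond (MME.lt a d)
        (MME.pair (MME.fst s * MME.binom a (MME.get v i) % q) (MME.snd s + a * MME.pow d i))
        (MME.pair 0 (MME.snd s)) : Tm Ty.den Proc (.prod .nat .nat)) := by
    -- The product is reduced modulo `q`, and the partial index has `i` digits in base `d`, hence is
    -- below `d ^ i`. Both bounds are uniform in the number of passes.
    refine (Ok.loop (j := 1) (j₁ := 1) (l := 26) hm hm' ((Ok.ofNat 1).pair (Ok.ofNat 0))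
      (fun i (s : ℕ × ℕ) => Nat.size s.1 ≤ B ^ 1 ∧ s.2 < d.nv ^ i)
      ⟨one_size_le 1, by simp⟩ ?_ ?_).mono le_rfl (by decide)
    · rintro i hi ⟨x, y⟩ ⟨hx, hy⟩
      have hx : Nat.size x ≤ B ^ 1 := hx
      have hy : y < d.nv ^ i := hy
      have hi1 : Ok B 1 2 (.var (τ := .nat) i : Tm Ty.den Proc .nat) :=
        (Ok.var (Bd.index hi hm')).mono le_rfl (by decide)
      have hs : Ok B 1 0 (.var (τ := .prod .nat .nat) (x, y) : Tm Ty.den Proc _) :=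
        Ok.var ⟨hx, (Nat.size_le_size (hy.le.trans (Nat.pow_le_pow_right hd0 hi.le))).trans hdm⟩
      have hpow : Ok B 3 8 (MME.pow d (.var (τ := .nat) i)) :=
        (Ok.pow (j := 1) hd hi1 (hi.le.trans hm')).mono le_rfl (by decide)
      have ha : Ok B 2 12 (.var (τ := .nat) k / MME.pow d (.var (τ := .nat) i) % d
          + MME.get v (.var (τ := .nat) i)) :=
        (((hk1.div hpow).mod hd).add (hv.get hi1)).mono le_rfl (by decide)
      refine ⟨?_, ?_⟩
      · simp only [val_share, val_cond, val_pair, nv_lt, nv_var, val_eq_nv, nv_add, nv_mod, nv_div,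
          nv_pow, nv_get, nv_fst, nv_snd, nv_mul, nv_binom, val_var, nv_zero]
        by_cases h : k / d.nv ^ i % d.nv + List.getD (α := ℕ) v.val i 0 < d.nv
        · rw [if_pos h, if_pos one_ne_zero]
          refine ⟨(Nat.size_le_size (Nat.mod_lt _ hq0).le).trans hq.bd, ?_⟩
          have := Nat.mul_le_mul_right (d.nv ^ i) (Nat.succ_le_of_lt h)
          rw [Nat.succ_mul] at this
          have goal : ∀ y < d.nv ^ i, y + (k / d.nv ^ i % d.nv + List.getD (α := ℕ) v.val i 0)
              * d.nv ^ i < d.nv ^ (i + 1) := by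
            intro y hy
            rw [pow_succ, mul_comm (d.nv ^ i)]
            omega
          exact goal y hy
        · rw [if_neg h, if_neg (by simp)]
          exact ⟨by simp, hy.trans_le (Nat.pow_le_pow_right hd0 (by omega))⟩
      · refine ((Ok.share ha fun hb => ?_).mono (j := 6) (l := 26) le_rfl
          (show max 12 24 + 1 ≤ 26 by decide)).cost
        have ha' := Ok.var hb
        refine ((ha'.lt hd).cond (i₁ := 6) (k₁ := 20) (i₂ := 1) (k₂ := 3) (fun hc => ?_) fun _ => ?_).mono
          (by decide) (by decide)
        · rw [val_eq_nv] at hc ha' ⊢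
          -- The binomial coefficient is computed only in the branch where its upper argument is
          -- below `d`; its cost needs such a bound on values, not merely on digits.
          have hlt : (.var (τ := .nat) k / MME.pow d (.var (τ := .nat) i) % d
              + MME.get v (.var (τ := .nat) i)).nv < d.nv := by
            by_contra hh
            exact hc (by rw [nv_lt, nv_var, if_neg hh])
          have hbin := Ok.binom (j := 1) (i := 2) (k := 3) (ha'.mono le_rfl (by decide))
            ((hv.get hi1).mono (by decide) le_rfl) (by rw [nv_var]; omega)
            ((show (MME.get v (.var (τ := .nat) i)).nv ≤ (.var (τ := .nat) k /
              MME.pow d (.var (τ := .nat) i) % d + MME.get v (.var (τ := .nat) i)).nv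
              from Nat.le_add_left _ _).trans (by omega))
          exact (((hs.fst.mul hbin).mod_pos hq hq0).pair (hs.snd.add (ha'.mul hpow))).mono
            (by decide) (by decide)
        · exact ((Ok.ofNat 0).pair hs.snd).mono (by decide) (by decide)
    · rintro ⟨x, y⟩ ⟨hx, hy⟩
      exact ⟨hx, (Nat.size_le_size (le_of_lt hy)).trans hdm⟩
  refine (Ok.share key fun hs => ?_).mono le_rfl (show max 30 6 + 1 ≤ 36 by decide)
  have hs := Ok.var hs
  exact ((hs.fst.mul (hf.get hs.snd)).mod_pos hq hq0).mono le_rfl (by decide)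

theorem Ok.gridCell {a : Tm Ty.den Proc (.list .nat)} (hm : Ok B 1 3 m) (hm' : m.nv ≤ B ^ 1)
    (hr : Ok B 1 3 r) (ha : Ok B 1 3 a) (hrm : Nat.size (r.nv ^ m.nv) ≤ B ^ 1) (hr0 : 0 < r.nv)
    (har : ∀ i < m.nv, List.getD (α := ℕ) a.val i 0 < r.nv) : Ok B 1 16 (gridCell m r a) := by
  refine (Ok.loop (j := 1) (j₁ := 1) (l := 12) hm hm' (Ok.ofNat 0)
      (fun i (s : ℕ) => s < r.nv ^ i)
      (by simp) ?_ ?_).mono le_rfl (by decide)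
  · rintro i hi (s : ℕ) (hs : s < r.nv ^ i)
    have hi1 : Ok B 1 3 (.var (τ := .nat) i : Tm Ty.den Proc .nat) :=
      (Ok.var (Bd.index hi hm')).mono le_rfl (by decide)
    have hs1 : Ok B 1 0 (.var (τ := .nat) s : Tm Ty.den Proc .nat) :=
      Ok.var ((Nat.size_le_size (hs.le.trans (Nat.pow_le_pow_right hr0 hi.le))).trans hrm)
    refine ⟨?_, ?_⟩
    · have := Nat.mul_le_mul_right (r.nv ^ i) (Nat.succ_le_of_lt (har i hi))
      rw [Nat.succ_mul] at this
      simp only [val_eq_nv, nv_add, nv_mul, nv_get, nv_pow, nv_var]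
      rw [pow_succ, mul_comm (r.nv ^ i)]
      omega
    · exact ((hs1.add ((ha.get hi1).mul (Ok.pow (j := 1) hr hi1 (hi.le.trans hm')))).mono le_rfl
        (by decide : _ ≤ 12)).cost
  · intro s hs
    exact (Nat.size_le_size (le_of_lt hs)).trans hrm

/-- The number of summands may be exponential and goes into the weight; of the program that computes
it only the cost matters. The modulus bounds every partial sum. -/
theorem OkW.sumMod {W i j k : ℕ} {n : Tm Ty.den Proc .nat}
    {b : Tm Ty.den Proc .nat → Tm Ty.den Proc .nat} (hq : Ok B i k q)
    (hn : n.cost ≤ B ^ k) (hn' : n.nv ≤ W) (hW : 1 ≤ W) (hq' : 0 < q.nv)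
    (hb : ∀ m < n.nv, Ok B j k (b (.var (τ := .nat) m))) :
    OkW B W i (k + 2 * i + 2 * j + 6) (sumMod q n b) := by
  set M := k + 2 * i + 2 * j + 4 with hM
  obtain ⟨h1, h2⟩ := loop_spec (n := n) (x := (0 : Tm Ty.den Proc .nat))
    (b := fun i s => (s + b i) % q) (c := B ^ M)
    (fun _ s => Bd (B ^ i) .nat s) (by change Nat.size 0 ≤ _; simp) (by
      intro m hm s hs
      have := ((Ok.var hs).add (hb m hm)).mod_pos hq hq'
      exact ⟨this.bd, (this.mono le_rfl (by omega)).cost⟩)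
  refine ⟨h1, h2.trans ?_⟩
  have h3 : Tm.cost (0 : Tm Ty.den Proc .nat) = 1 := by rw [cost_ofNat]; rfl
  rw [h3]
  have h4 := Nat.mul_le_mul hn' (succ_pow_le (B := B) M)
  have h5 := hn.trans (pow_mono_exp (show k ≤ M + 1 by omega))
  have h6 := Nat.le_mul_of_pos_left (B ^ (M + 1)) hW
  have h7 := Nat.mul_le_mul_left W (eight_mul_pow_le (B := B) (M + 1))
  have h8 := one_le_pow_base (B := B) (M + 1)
  rw [Nat.mul_left_comm] at h7
  change _ ≤ W * B ^ (M + 1 + 1)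
  omega

theorem OkW.taylor {W : ℕ} {vs : Tm Ty.den Proc (.list (.list .nat))}
    {y : Tm Ty.den Proc .nat → Tm Ty.den Proc .nat} {a b : Tm Ty.den Proc (.list .nat)}
    (hm : Ok B 1 3 m) (hm' : m.nv ≤ B ^ 1) (hq : Ok B 1 3 q) (hq0 : 0 < q.nv) {L : List (List ℕ)}
    (hvs : vs = .var (τ := .list (.list .nat)) L) (hL : L.length ≤ W) (hW : 1 ≤ W)
    (hWB : Nat.size W ≤ B ^ 2) (hLB : ∀ v ∈ L, ∀ x ∈ v, x ≤ B ^ 1)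
    (hy : ∀ k < L.length, Ok B 1 20 (y (.var (τ := .nat) k)))
    (ha : Ok B 1 3 a) (hb : Ok B 1 3 b) : OkW B W 1 40 (taylor m q vs y a b) := by
  subst hvs
  have hL1 : Bd (B ^ 1) (.list (.list .nat)) L := fun v hv x hx =>
    (size_self_le x).trans (hLB v hv x hx)
  have hv := Ok.var hL1
  refine ((OkW.sumMod (j := 2) (k := 24) (hq.mono le_rfl (by decide)) (by
    rw [cost_len, cost_var]
    exact (show 1 + 1 ≤ B ^ 1 by rw [pow_one]; have := hB.out; omega).trans (pow_mono_exp (by decide)))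
    hL hW hq0 fun k hk => ?_)).mono le_rfl (by decide)
  have hk' : k < L.length := hk
  have hk1 : Ok B 2 0 (.var (τ := .nat) k : Tm Ty.den Proc .nat) :=
    Ok.var ((Nat.size_le_size (hk'.le.trans hL)).trans hWB)
  have hprod := Ok.prodMod (j := 1) (k := 12) (hq.mono le_rfl (by decide))
    (hm.mono le_rfl (by decide)) hm' hq0
    (b := fun c => MME.powMod q (MME.get a c - MME.get b c)
      (MME.get (MME.get (.var (τ := .list (.list .nat)) L) (.var (τ := .nat) k)) c))
    (fun c hc => by
      have hc1 : Ok B 1 3 (.var (τ := .nat) c : Tm Ty.den Proc .nat) :=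
        (Ok.var (Bd.index hc hm')).mono le_rfl (by decide)
      refine (Ok.powMod (j := 1) (k := 5) (hq.mono le_rfl (by decide))
        (((ha.get hc1).sub (hb.get hc1)).mono le_rfl (by decide))
        (((hv.get (hk1.mono (i := 2) (j := 2) le_rfl le_rfl) |>.get hc1)).mono le_rfl (by decide)) ?_ hq0).mono
        le_rfl (by decide)
      change ((L.getD k []).getD c 0 : ℕ) ≤ _
      have hmem : L.getD k [] ∈ L := by
        rw [List.getD_eq_getElem _ _ hk']; exact List.getElem_mem hk'
      by_cases h : c < (L.getD k []).length
      · rw [List.getD_eq_getElem _ _ h]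
        exact hLB _ hmem _ (List.getElem_mem h)
      · rw [List.getD_eq_default _ _ (not_lt.mp h)]; exact Nat.zero_le _)
  have hk2 := (hy k hk).mul hprod
  exact hk2.mono le_rfl (by decide)

end Costs

end MME

namespace MME

/-! ### Cost of the evaluation on a product set. -/

section Costs

variable {B : ℕ} [hB : Fact (8 ≤ B)]

theorem Ok.sumMod_mixed {i j k l : ℕ} {q n : Tm Ty.den Proc .nat}
    {b : Tm Ty.den Proc .nat → Tm Ty.den Proc .nat} (hq : Ok B i k q)
    (hn : n.cost ≤ B ^ k) (hn' : n.nv ≤ B ^ l) (hq' : 0 < q.nv)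
    (hb : ∀ m < n.nv, Ok B j k (b (.var (τ := .nat) m))) :
    Ok B i (k + 2 * i + 2 * j + 6 + l) (MME.sumMod q n b) := by
  have := OkW.sumMod hq hn hn' (one_le_pow_base l) hq' hb
  refine ⟨this.bd, this.cost.trans_eq ?_⟩
  rw [← pow_add]
  congr 1
  omega

/-- The digits of the index do not occur in the conclusion of `Ok.get`, so any exponent may be used
for them. Hence indices into exponentially long arrays need no size bound. -/
theorem Ok.get_of_cost {τ : Ty} {i k l : ℕ} {x : Tm Ty.den Proc (.list τ)}
    {a : Tm Ty.den Proc .nat} (hx : Ok B i k x) (ha : a.cost ≤ B ^ l) :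
    Ok B i (max k l + 1) (MME.get x a) :=
  Ok.get (j := Nat.size a.nv) hx ⟨(Nat.lt_pow_self (by have := hB.out; omega)).le, ha⟩

theorem Ok.get_var {τ : Ty} {i k : ℕ} {x : Tm Ty.den Proc (.list τ)} (hx : Ok B i k x)
    (n : ℕ) : Ok B i (k + 1) (MME.get x (.var (τ := .nat) n)) := by
  have := Ok.get_of_cost (l := 0) hx (a := .var (τ := .nat) n) (by simp)
  rwa [max_eq_left (Nat.zero_le _)] at this

theorem OkW.tab_len {σ τ : Ty} {j l W W₁ W₂ : ℕ} {a : List σ.den}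
    {x : Tm Ty.den Proc .nat → Tm Ty.den Proc τ} (hn : a.length ≤ W₁) (hW : W₁ * W₂ ≤ W)
    (hW0 : 1 ≤ W) (hW2 : 1 ≤ W₂)
    (hx : ∀ n < a.length, OkW B W₂ j l (x (.var (τ := .nat) n))) :
    OkW B W j (l + 3) (MME.tab (MME.len (.var (τ := .list σ) a)) x) := by
  refine (OkW.tab (a := MME.len (.var (τ := .list σ) a)) (x := x) (i := Nat.size a.length) (k := 1)
    (j₁ := 0) (l := l) (j := j) ⟨(Nat.lt_pow_self (by have := hB.out; omega)).le, ?_⟩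
    (by simpa using hn) hW hW0 hW2 hx).mono le_rfl (by omega)
  rw [cost_len, cost_var, pow_one]
  have := hB.out
  omega

variable {m d r q : Tm Ty.den Proc .nat}

/-- The coefficients of the polynomial obtained by substituting `a` for the last variable. -/
def substLast (d q : Tm Ty.den Proc .nat) (k : ℕ) (f : List ℕ) (a : Tm Ty.den Proc .nat) :
    Tm Ty.den Proc (.list .nat) :=
  tab (pow d (.var (τ := .nat) k)) fun i => MME.sumMod q d fun c =>
    get (.var (τ := .list .nat) f) (i + pow d (.var (τ := .nat) k) * c) * powMod q a c

theorem gridProc_succ (k : ℕ) (f : List ℕ) : gridProc d r q (k + 1) f =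
    ((flatten (tab r fun a => call (gridProc d r q k) (substLast d q k f a))).val,
      (flatten (tab r fun a => call (gridProc d r q k) (substLast d q k f a))).cost) := (rfl)

theorem length_substLast (k : ℕ) (f : List ℕ) (a : Tm Ty.den Proc .nat) :
    List.length (α := ℕ) (substLast d q k f a).val = d.nv ^ k := by
  rw [substLast, val_tab, List.length_map, List.length_range, nv_pow, nv_var]

theorem OkW.substLast {k : ℕ} {f : List ℕ} {a : Tm Ty.den Proc .nat} (hm' : m.nv ≤ B ^ 1)
    (hd : Ok B 1 3 d) (hd' : d.nv ≤ B ^ 1) (hq : Ok B 1 3 q) (hq0 : 0 < q.nv) (hd0 : 0 < d.nv)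
    (hdm : Nat.size (d.nv ^ m.nv) ≤ B ^ 1) (hk : k < m.nv) (hfb : Bd (B ^ 1) (.list .nat) f)
    (ha : Ok B 1 3 a) : OkW B (d.nv ^ k) 1 31 (substLast d q k f a) := by
  have hk1 : Ok B 1 3 (.var (τ := .nat) k : Tm Ty.den Proc .nat) :=
    (Ok.var (Bd.index hk hm')).mono le_rfl (by decide)
  refine (OkW.tab (W₁ := d.nv ^ k) (W₂ := 1) (j₁ := 0) (j := 1) (l := 28)
    (Ok.pow (j := 1) hd hk1 (hk.le.trans hm')) (by simp) (by simp)
    (Nat.one_le_pow _ _ hd0) le_rfl fun i hi => Ok.weight ?_ le_rfl).mono le_rfl (by decide)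
  have hi : i < d.nv ^ k := by simpa using hi
  have hi1 : Ok B 1 0 (.var (τ := .nat) i : Tm Ty.den Proc .nat) :=
    Ok.var ((Nat.size_le_size (hi.le.trans (Nat.pow_le_pow_right hd0 (by omega)))).trans hdm)
  refine (Ok.sumMod_mixed (j := 2) (k := 12) (l := 1) (hq.mono le_rfl (by decide))
    (hd.mono (j := 1) le_rfl (by decide)).cost hd' hq0 fun c hc => ?_).mono le_rfl (by decide)
  have hc1 : Ok B 1 3 (.var (τ := .nat) c : Tm Ty.den Proc .nat) :=
    (Ok.var (Bd.index hc hd')).mono le_rfl (by decide)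
  have hpow := Ok.powMod (j := 1) (k := 3) hq ha hc1 (hc.le.trans hd') hq0
  have hidx := hi1.add ((Ok.pow (j := 1) hd hk1 (hk.le.trans hm')).mul hc1)
  exact (((Ok.var hfb).get hidx).mul hpow).mono (by decide) (by decide)

/-- At depth `k + 1` there are `r` substitutions, each producing `d ^ k` coefficients at polynomial
cost, followed by `r` calls at depth `k`. With `D = max r d`, one level adds at most `B ^ 32 * D ^
(k + 1)`, so the levels contribute a factor `k` instead of multiplying. -/
theorem gridProc_cost (hm' : m.nv ≤ B ^ 1) (hd : Ok B 1 3 d) (hd' : d.nv ≤ B ^ 1)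
    (hr : Ok B 1 3 r) (hq : Ok B 1 3 q) (hq0 : 0 < q.nv) (hd0 : 0 < d.nv)
    (hdm : Nat.size (d.nv ^ m.nv) ≤ B ^ 1)
    (k : ℕ) (hk : k ≤ m.nv) (f : List ℕ) (hf : f.length = d.nv ^ k)
    (hfb : Bd (B ^ 1) (.list .nat) f) :
    Bd (B ^ 1) (.list .nat) (gridProc d r q k f).1 ∧
    List.length (α := ℕ) (gridProc d r q k f).1 = r.nv ^ k ∧
    (gridProc d r q k f).2 ≤ (k * B ^ 32 + 1) * (max r.nv d.nv) ^ k := by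
  induction k generalizing f with
  | zero => exact ⟨hfb, hf.trans (by simp), by simp [gridProc, recProc_zero]⟩
  | succ k ih =>
    have hsub : ∀ a < r.nv, OkW B (d.nv ^ k) 1 31 (MME.substLast d q k f (.var (τ := .nat) a)) :=
      fun a ha => OkW.substLast hm' hd hd' hq hq0 hd0 hdm hk hfb
        ((Ok.var (τ := .nat) ((Nat.size_le_size ha.le).trans hr.bd)).mono le_rfl (by decide))
    have hval : ∀ a < r.nv, _ := fun a ha =>
      ih (by omega) _ (length_substLast k f (.var (τ := .nat) a)) (hsub a ha).bd
    have hL : List.length (α := ℕ) (flatten (tab r fun a =>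
        call (gridProc d r q k) (MME.substLast d q k f a))).val = r.nv ^ (k + 1) := by
      rw [val_flatten, List.length_flatten, val_tab, List.map_map]
      refine (congrArg List.sum (List.map_congr_left (g := fun _ => r.nv ^ k) fun a ha => ?_)).trans ?_
      · exact (hval a (List.mem_range.mp ha)).2.1
      · simp [pow_succ, mul_comm]
    rw [gridProc_succ]
    refine ⟨?_, hL, ?_⟩
    · intro x hx
      change x ∈ List.flatten (α := ℕ) (tab r fun a =>
        call (gridProc d r q k) (MME.substLast d q k f a)).val at hx
      obtain ⟨l, hl, hx⟩ := List.mem_flatten.mp hx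
      rw [val_tab] at hl
      obtain ⟨a, ha, rfl⟩ := List.mem_map.mp hl
      exact (hval a (List.mem_range.mp ha)).1 x hx
    · set D := max r.nv d.nv with hD
      have hrD : r.nv ≤ D := le_max_left _ _
      have hdD : d.nv ≤ D := le_max_right _ _
      have hD1 : 1 ≤ D := by omega
      have hc := cost_tab_le (n := r) (b := fun a =>
        call (gridProc d r q k) (MME.substLast d q k f a))
        (c := d.nv ^ k * B ^ 31 + (k * B ^ 32 + 1) * D ^ k + 1) (fun a ha => by
          rw [cost_call]
          have h1 := (hsub a ha).cost
          have h2 := (hval a ha).2.2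
          omega)
      have hfl := cost_flatten (tab r fun a => call (gridProc d r q k) (MME.substLast d q k f a))
      rw [val_flatten] at hL
      rw [hL] at hfl
      refine (le_of_eq hfl).trans ?_
      rw [val_tab, List.length_map, List.length_range]
      refine (Nat.add_le_add_right (Nat.add_le_add_right (Nat.add_le_add_right hc _) _) _).trans ?_
      have e1 : d.nv ^ k ≤ D ^ k := Nat.pow_le_pow_left hdD k
      have e2 : r.nv ^ (k + 1) ≤ D ^ (k + 1) := Nat.pow_le_pow_left hrD (k + 1)
      have e3 : r.nv * (d.nv ^ k * B ^ 31 + (k * B ^ 32 + 1) * D ^ k + 1 + 1)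
          ≤ D * (D ^ k * B ^ 31 + (k * B ^ 32 + 1) * D ^ k + 1 + 1) := by gcongr
      have e4 : D ≤ D ^ (k + 1) := Nat.le_self_pow (by omega) D
      have e5 : 1 ≤ D ^ (k + 1) := Nat.one_le_pow _ _ hD1
      have e6 := hr.cost.trans (pow_mono_exp (B := B) (show 3 ≤ 31 by omega))
      have e7 := eight_mul_pow_le (B := B) 31
      have e8 := one_le_pow_base (B := B) 31
      have e9 := Nat.mul_le_mul_left (D ^ (k + 1)) e7
      have e10 := Nat.mul_le_mul_left (D ^ (k + 1)) e8
      have e11 := Nat.mul_le_mul_right (B ^ 31) e5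
      have e12 : D * (D ^ k * B ^ 31 + (k * B ^ 32 + 1) * D ^ k + 1 + 1)
        = D ^ (k + 1) * B ^ 31 + (k * B ^ 32 + 1) * D ^ (k + 1) + 2 * D := by ring
      have e13 : ((k + 1) * B ^ 32 + 1) * D ^ (k + 1)
        = (k * B ^ 32 + 1) * D ^ (k + 1) + D ^ (k + 1) * B ^ 32 := by ring
      rw [e13]
      simp only [Nat.reduceAdd] at *
      rw [Nat.mul_left_comm] at e9
      omega

theorem OkW.evalGrid {f : Tm Ty.den Proc (.list .nat)} (hm : Ok B 1 3 m) (hm' : m.nv ≤ B ^ 1)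
    (hd : Ok B 1 3 d) (hd' : d.nv ≤ B ^ 1)
    (hr : Ok B 1 3 r) (hq : Ok B 1 3 q) (hq0 : 0 < q.nv) (hd0 : 0 < d.nv)
    (hdm : Nat.size (d.nv ^ m.nv) ≤ B ^ 1) (hf : Ok B 1 3 f)
    (hfl : List.length (α := ℕ) f.val = d.nv ^ m.nv) :
    OkW B (r.nv ^ m.nv + d.nv ^ m.nv) 1 36 (evalGrid m d r q f) := by
  obtain ⟨h1, -, h3⟩ := gridProc_cost hm' hd hd' hr hq hq0 hd0 hdm m.nv le_rfl f.val hfl hf.bd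
  refine ⟨by exact h1, ?_⟩
  have h4 : (max r.nv d.nv) ^ m.nv ≤ r.nv ^ m.nv + d.nv ^ m.nv := by
    rcases le_total r.nv d.nv with h | h
    · rw [max_eq_right h]; omega
    · rw [max_eq_left h]; omega
  refine (le_of_eq (cost_recur ..)).trans ?_
  change m.cost + f.cost + (gridProc d r q m.nv f.val).2 + 1 ≤ _
  set G := r.nv ^ m.nv + d.nv ^ m.nv with hG
  have hG1 : 1 ≤ G := le_add_left (Nat.one_le_pow _ _ hd0)
  have h5 : (m.nv * B ^ 32 + 1) * (max r.nv d.nv) ^ m.nv ≤ B ^ 34 * G := by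
    refine Nat.mul_le_mul ?_ h4
    refine le_trans ?_ (succ_pow_le 33)
    have := Nat.mul_le_mul_right (B ^ 32) hm'
    rw [← pow_add] at this
    simp only [Nat.reduceAdd] at *
    omega
  have h6 := hm.cost.trans (pow_mono_exp (B := B) (show 3 ≤ 34 by omega))
  have h7 := hf.cost.trans (pow_mono_exp (B := B) (show 3 ≤ 34 by omega))
  have h8 := Nat.le_mul_of_pos_left (B ^ 34) hG1
  have h9 := Nat.mul_le_mul_left G (eight_mul_pow_le (B := B) 34)
  have h10 := Nat.mul_le_mul_left G (pow_mono_exp (B := B) (show 35 ≤ 36 by omega))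
  have h11 := Nat.mul_le_mul hG1 (one_le_pow_base (B := B) 34)
  rw [Nat.mul_left_comm] at h9
  rw [mul_comm _ G] at h5
  simp only [Nat.reduceAdd] at *
  omega

end Costs

end MME

namespace MME

/-! ### Costs with an additive term; the search for primes; smallness of the bases. -/

section Costs

variable {B : ℕ} [hB : Fact (8 ≤ B)]

/-- A program with at most `W * B ^ k + X` steps. -/
structure OkX (B W X i k : ℕ) {τ : Ty} (t : Tm Ty.den Proc τ) : Prop where
  bd : Bd (B ^ i) τ t.val
  cost : t.cost ≤ W * B ^ k + X

theorem OkX.bind {σ τ : Ty} {i j k l W X : ℕ} {a : Tm Ty.den Proc σ}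
    {b : Tm Ty.den Proc σ → Tm Ty.den Proc τ} (ha : OkW B W i k a) (hW : 1 ≤ W) (hkl : k ≤ l)
    (hb : ∀ x, a.val = x → Bd (B ^ i) σ x → OkX B W X j l (b (.var x))) :
    OkX B W X j (l + 1) (MME.share a b) := by
  have hb := hb _ rfl ha.bd
  refine ⟨hb.bd, ?_⟩
  rw [cost_share]
  have h1 := ha.cost
  have h2 := hb.cost
  have h3 := Nat.mul_le_mul_left W (pow_mono_exp (B := B) hkl)
  have h7 := Nat.mul_le_mul_left W (eight_mul_pow_le (B := B) l)
  have h8 := Nat.mul_le_mul hW (one_le_pow_base (B := B) l)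
  rw [Nat.mul_left_comm] at h7
  omega

/-- The binding of the recursive calls spends the whole extra term, and nothing of it is left for
the rest of the program. Thus it enters the recurrence with coefficient one. -/
theorem OkX.bind_extra {σ τ : Ty} {i j l W X : ℕ} {a : Tm Ty.den Proc σ}
    {b : Tm Ty.den Proc σ → Tm Ty.den Proc τ} (ha : Bd (B ^ i) σ a.val)
    (ha' : a.cost ≤ W * B ^ l + X) (hW : 1 ≤ W)
    (hb : ∀ x, a.val = x → Bd (B ^ i) σ x → OkX B W 0 j l (b (.var x))) :
    OkX B W X j (l + 1) (MME.share a b) := by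
  have hb := hb _ rfl ha
  refine ⟨hb.bd, ?_⟩
  rw [cost_share]
  have h2 := hb.cost
  have h7 := Nat.mul_le_mul_left W (eight_mul_pow_le (B := B) l)
  have h8 := Nat.mul_le_mul hW (one_le_pow_base (B := B) l)
  rw [Nat.mul_left_comm] at h7
  omega

omit hB in
theorem OkW.extra {τ : Ty} {W i k : ℕ} {t : Tm Ty.den Proc τ} (h : OkW B W i k t) (X : ℕ) :
    OkX B W X i k t := ⟨h.bd, h.cost.trans (Nat.le_add_right _ _)⟩

/-- The candidates stay below `16 * size M`, which is polynomially bounded in value, so trial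
division is affordable. The product overshoots `M` by at most one prime factor, so its size is under
control too. -/
theorem Ok.smallPrimes {M : Tm Ty.den Proc .nat} (hM : Ok B 1 10 M) :
    Ok B 3 30 (smallPrimes M) := by
  have h16 : Ok B 3 14 (16 * MME.size M) := by
    refine ⟨?_, (((Ok.ofNat 16).mul hM.size).mono (j := 2) (by decide)
      (by decide : _ ≤ 14)).cost⟩
    have h1 : Nat.size M.nv ≤ B ^ 1 := hM.bd
    refine (size_self_le _).trans ?_
    rw [val_eq_nv, nv_mul, nv_sixteen, nv_size]
    have := eight_mul_pow_le (B := B) 1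
    have := eight_mul_pow_le (B := B) 2
    simp only [Nat.reduceAdd] at *
    omega
  have hn : (16 * MME.size M).nv ≤ B ^ 3 := by
    have h1 : Nat.size M.nv ≤ B ^ 1 := hM.bd
    rw [nv_mul, nv_sixteen, nv_size]
    have := eight_mul_pow_le (B := B) 1
    have := eight_mul_pow_le (B := B) 2
    simp only [Nat.reduceAdd] at *
    omega
  have hbd : ∀ x ≤ (16 * MME.size M).nv, ∀ s : ℕ × List ℕ, PrimeState M.nv x s →
      Bd (B ^ 3) (.prod .nat (.list .nat)) s := by
    intro x hx s hs
    refine ⟨(Nat.size_le_size hs.le).trans ((size_add_le _ _).trans ?_), fun p hp => ?_⟩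
    · have h1 := size_mul_le M.nv x
      have h2 : Nat.size M.nv ≤ B ^ 1 := hM.bd
      have h3 : Nat.size x ≤ B ^ 2 := by
        refine (Nat.size_le_size (hx.trans hn)).trans ((size_pow_le B 3).trans ?_)
        have := size_self_le B
        have := hB.out
        have := eight_mul_pow_le (B := B) 1
        simp only [Nat.reduceAdd, pow_one] at *
        omega
      have := eight_mul_pow_le (B := B) 1
      have := eight_mul_pow_le (B := B) 2
      have := one_le_pow_base (B := B) 1
      simp only [Nat.reduceAdd, Nat.size_one] at *
      omega
    · exact (size_self_le p).trans ((hs.prime p hp).2.le.trans (hx.trans hn))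
  have key := Ok.loop (j := 3) (l := 20) (i₁ := 1) (k₁ := 4) h16 hn ((Ok.ofNat 1).pair Ok.nil |>.mono (j := 1) (l := 4) le_rfl (by decide))
    (b := fun x s => MME.cond (MME.lt M (MME.fst s)) s
      (MME.cond (MME.isPrime x) (MME.pair (MME.fst s * x)
        (MME.append (MME.snd s) (MME.single x))) s))
    (fun x s => x ≤ (16 * MME.size M).nv ∧ PrimeState M.nv x s)
    ⟨Nat.zero_le _, by simpa using PrimeState.init⟩ ?_ (fun s hs => hbd _ hs.1 s hs.2)
  · exact (key.snd).mono le_rfl (by decide)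
  · rintro x hx s ⟨hx', hs⟩
    refine ⟨⟨hx, primeState_step M x s hs⟩, ?_⟩
    have hs1 : Ok B 3 0 (.var (τ := .prod .nat (.list .nat)) s : Tm Ty.den Proc _) :=
      Ok.var (hbd x hx' s hs)
    have hx1 : Ok B 3 0 (.var (τ := .nat) x : Tm Ty.den Proc .nat) := Ok.var (Bd.index hx hn)
    refine ((hM.lt hs1.fst).cond (fun _ => hs1) fun _ => (Ok.isPrime hx1 (hx'.trans hn)).cond
      (fun _ => (hs1.fst.mul hx1).pair (hs1.snd.append (j₁ := 1) (j₂ := 0) hx1.single ?_ (by simp)))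
      fun _ => hs1).mono (j := 4) (by decide) (by decide : _ ≤ 20) |>.cost
    have h1 : Nat.size M.nv ≤ B ^ 1 := hM.bd
    exact hs.length.trans h1

/-- The parameters `m` and `d` are polynomially bounded. -/
structure Fits (B : ℕ) (m d : Tm Ty.den Proc .nat) : Prop where
  m_ok : Ok B 1 1 m
  d_ok : Ok B 1 1 d
  m_pos : 0 < m.nv
  d_pos : 0 < d.nv
  small : (m.nv + d.nv + 2) * (Nat.size B + 6) ≤ B

/-- The base `r` is small enough for `r ^ m` and `d * r ^ d` to be polynomially bounded. -/
def SmallBase (B : ℕ) (m d : Tm Ty.den Proc .nat) (r : ℕ) : Prop :=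
  (m.nv + d.nv + 2) * (Nat.size r + 1) ≤ B

variable {m d : Tm Ty.den Proc .nat}

omit hB in
theorem Fits.m_le (h : Fits B m d) : 6 * (m.nv + d.nv + 2) ≤ B ^ 1 := by
  have := h.small
  rw [pow_one]
  nlinarith [Nat.zero_le ((m.nv + d.nv + 2) * Nat.size B)]

omit hB in
theorem Fits.size_dm (h : Fits B m d) : Nat.size (d.nv ^ m.nv) ≤ B ^ 1 := by
  have h1 := h.small
  have h2 := h.m_le
  have h3 : Nat.size d.nv ≤ Nat.size B := Nat.size_le_size (by rw [pow_one] at h2; omega)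
  have h4 := size_pow_le d.nv m.nv
  rw [pow_one]
  nlinarith [Nat.mul_le_mul_left m.nv h3]

omit hB in
theorem SmallBase.size_pow {r s : ℕ} (h : SmallBase B m d r) (hs : s ≤ m.nv) :
    Nat.size (r ^ s) ≤ B ^ 1 := by
  have h4 := size_pow_le r s
  unfold SmallBase at h
  rw [pow_one]
  nlinarith [Nat.mul_le_mul_right (Nat.size r) hs]

omit hB in
theorem SmallBase.size_le {r : ℕ} (h : SmallBase B m d r) : Nat.size r ≤ B ^ 1 := by
  unfold SmallBase at h
  rw [pow_one]
  nlinarith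

omit hB in
theorem SmallBase.size_bound {r : ℕ} (h : SmallBase B m d r) :
    Nat.size (d.nv * r ^ d.nv) ≤ B ^ 1 := by
  have h4 := size_pow_le r d.nv
  have h5 := size_mul_le d.nv (r ^ d.nv)
  have h6 := size_self_le d.nv
  unfold SmallBase at h
  rw [pow_one]
  nlinarith

-- The primes of the next level are below `16 * size (d * r ^ d) ≤ 16 * B`, so smallness passes to
-- all levels of the recursion with the same `B`. The `6` in the field `small` consists of the five
-- digits of `16` and the `1` in `SmallBase`.
omit hB in
theorem Fits.smallBase (h : Fits B m d) {p : ℕ} (hp : p ≤ 16 * B) : SmallBase B m d p := by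
  have h1 := h.small
  have h2 := (Nat.size_le_size hp).trans (size_mul_le 16 B)
  have h3 : Nat.size 16 = 5 := by decide
  unfold SmallBase
  exact (Nat.mul_le_mul_left _ (by omega)).trans h1

end Costs

end MME

namespace MME

/-! ### Cost of MME-Product-Set. -/

section Costs

variable {B : ℕ} [hB : Fact (8 ≤ B)] {m d : Tm Ty.den Proc .nat}

omit hB in
theorem length_tab_len {σ τ : Ty} {a : List σ.den} {y : Tm Ty.den Proc .nat → Tm Ty.den Proc τ}
    {x : List τ.den} (hx : (tab (len (.var (τ := .list σ) a)) y).val = x) :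
    x.length = a.length := by
  rw [← hx, val_tab, List.length_map, List.length_range]; rfl

theorem OkW.reduce_points {W k : ℕ} {as : List (List ℕ)} {q : Tm Ty.den Proc .nat} (hF : Fits B m d)
    (has : Bd (B ^ 1) (.list (.list .nat)) as) (hq : Ok B 1 k q) (hW : as.length ≤ W) (hW1 : 1 ≤ W)
    (hq0 : 0 < q.nv) (hk : 2 ≤ k) :
    OkW B W 1 (k + 8) (MME.tab (MME.len (.var (τ := .list (.list .nat)) as)) fun i => MME.tab m fun c =>
      MME.get (MME.get (.var (τ := .list (.list .nat)) as) i) c % q) := by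
  refine (OkW.tab_len (W₂ := 1) (j := 1) (l := k + 5) hW (by simp) hW1 le_rfl fun i hi => Ok.weight ?_ le_rfl).mono
    le_rfl (by omega)
  have hm' : m.nv ≤ B ^ 1 := by have := hF.m_le; omega
  refine (Ok.tab (j₁ := 1) (j := 1) (l := k + 2) hF.m_ok hm' fun c hc => ?_).mono le_rfl (by omega)
  exact ((((Ok.var has).get_var i).get_var c).mod_pos hq hq0).mono le_rfl (by omega)

/-- For each of the at most `2 ^ (2 * m)` exponent vectors one computes `d ^ m` coefficients, a
table of `r ^ m` values, and one Taylor term for each point. -/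
theorem OkW.mmeProductSet {f : Tm Ty.den Proc (.list .nat)} {as : Tm Ty.den Proc (.list (.list .nat))}
    {r s : Tm Ty.den Proc .nat} (hF : Fits B m d) (hf : Ok B 1 1 f) (has : Ok B 1 1 as)
    (hr : Ok B 1 1 r) (hs : Ok B 1 1 s) (hr1 : 1 < r.nv) (hs0 : 0 < s.nv) (hsm : s.nv ≤ m.nv)
    (hrB : SmallBase B m d r.nv) :
    OkW B (2 ^ (2 * m.nv) * (r.nv ^ m.nv + d.nv ^ m.nv + List.length (α := List ℕ) as.val + 1)) 1 60
      (mmeProductSet m d f as r s) := by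
  set V := 2 ^ (2 * m.nv) with hV
  set N := List.length (α := List ℕ) as.val with hN
  set G := r.nv ^ m.nv + d.nv ^ m.nv + N + 1 with hG
  have hm' : m.nv ≤ B ^ 1 := by have := hF.m_le; omega
  have hd' : d.nv ≤ B ^ 1 := by have := hF.m_le; omega
  have hs' : s.nv ≤ B ^ 1 := hsm.trans hm'
  have hV1 : 1 ≤ V := Nat.one_le_two_pow
  have hG1 : 1 ≤ G := by omega
  have hVG : 1 ≤ V * G := Nat.mul_pos hV1 hG1
  have hVs : 2 ^ (m.nv + s.nv) ≤ V := Nat.pow_le_pow_right two_pos (by omega)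
  have hq : Ok B 1 8 (MME.pow r s) :=
    ⟨by change Nat.size (MME.pow r s).nv ≤ _; rw [nv_pow]; exact hrB.size_pow hsm,
      ((Ok.pow (j := 1) hr hs hs').mono le_rfl (by decide)).cost⟩
  have hVsize : Nat.size V ≤ B ^ 1 := by
    refine (size_two_pow_le _).trans ?_
    have := hF.m_le; omega
  refine (OkX.bind (l := 59) (X := 0) (hq.weight hVG) hVG (by decide) fun (q : ℕ) hqv hqb => ?_) |> fun h => ⟨h.bd, h.cost⟩
  have hq0 : 0 < q := by
    have : r.nv ^ s.nv = q := by rw [← hqv]; simp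
    rw [← this]; exact Nat.pow_pos (by omega)
  have hqv : Ok B 1 0 (.var (τ := .nat) q : Tm Ty.den Proc .nat) := Ok.var hqb
  refine OkX.bind ((OkW.exponents hF.m_ok hs hm' hs' hs0).mono_weight
    (hVs.trans (Nat.le_mul_of_pos_right _ hG1))) hVG (by decide) fun vs hvs hvb => ?_
  have hvs : expo s.nv m.nv = vs := by rw [← hvs, val_exponents]
  obtain ⟨vs, rfl⟩ : ∃ v : List (List ℕ), v = vs := ⟨vs, rfl⟩
  have hlen : vs.length ≤ V := hvs ▸ (length_expo_le s.nv m.nv).trans hVs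
  have hvs1 : Ok B 1 0 (.var (τ := .list (.list .nat)) vs : Tm Ty.den Proc _) := Ok.var hvb
  refine OkX.bind (i := 1) (k := 45) (OkW.mono_weight (W := V * d.nv ^ m.nv) ((OkW.tab_len (j := 1) (l := 40) hlen le_rfl
    (Nat.mul_pos hV1 (Nat.pow_pos hF.d_pos)) (Nat.pow_pos hF.d_pos) fun k hk => ?_).mono le_rfl
    (by decide)) (Nat.mul_le_mul_left _ (by omega))) hVG (by decide) fun fs hfs hfb => ?_
  · exact OkW.hasse (hF.m_ok.mono le_rfl (by decide)) hm' (hF.d_ok.mono le_rfl (by decide)) hd'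
      hF.d_pos (hqv.mono le_rfl (by decide)) hq0 (hf.mono le_rfl (by decide))
      ((hvs1.get_var k).mono le_rfl (by decide)) hF.size_dm
  obtain ⟨fs, rfl⟩ : ∃ v : List (List ℕ), v = fs := ⟨fs, rfl⟩
  have hfs1 : Ok B 1 0 (.var (τ := .list (.list .nat)) fs : Tm Ty.den Proc _) := Ok.var hfb
  refine OkX.bind (i := 1) (k := 45) (OkW.mono_weight (W := V * (r.nv ^ m.nv + d.nv ^ m.nv)) ((OkW.tab_len (j := 1) (l := 36) hlen le_rfl
    (Nat.mul_pos hV1 (Nat.add_pos_right _ (Nat.pow_pos hF.d_pos))) (Nat.add_pos_right _ (Nat.pow_pos hF.d_pos))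
    fun k hk => ?_).mono le_rfl
    (by decide)) (Nat.mul_le_mul_left _ (by omega))) hVG (by decide) fun ys hys hyb => ?_
  · refine OkW.evalGrid (hF.m_ok.mono le_rfl (by decide)) hm' (hF.d_ok.mono le_rfl (by decide)) hd'
      (hr.mono le_rfl (by decide)) (hqv.mono le_rfl (by decide)) hq0 hF.d_pos hF.size_dm
      ((hfs1.get_var k).mono le_rfl (by decide)) ?_
    change List.length (α := ℕ) (fs.getD k []) = _
    have : fs.getD k [] = _ := (congrArg (fun l : List (List ℕ) => l.getD k []) hfs).symm.trans
      (getD_tab_len (τ := .list .nat) hk)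
    rw [this, val_hasse]
    simp
  have hys1 : Ok B 1 0 (.var (τ := .list (.list .nat)) ys : Tm Ty.den Proc _) := Ok.var hyb
  have hn : (len as).nv = N := rfl
  have hlenas : Ok B N 2 (MME.len as) := (Ok.len (j := N) has (Nat.lt_pow_self (by have := hB.out; omega)).le)
  have hNW : N ≤ V * G * B ^ 0 := by
    simp only [pow_zero, mul_one]
    exact (show N ≤ G by omega).trans (Nat.le_mul_of_pos_left _ hV1)
  have hbs0 : OkW B (V * G) 1 20 (MME.tab (MME.len as) fun i => MME.tab m fun c =>
      MME.get (MME.get as i) c % r) := by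
    refine (OkW.tab (W₁ := V * G) (W₂ := 1) (j₁ := 0) (j := 1) (l := 12) hlenas hNW (by simp) hVG
      le_rfl fun i hi => Ok.weight ?_ le_rfl).mono le_rfl (by decide)
    refine (Ok.tab (j₁ := 1) (j := 1) (l := 5) hF.m_ok hm' fun c hc => ?_).mono le_rfl (by decide)
    exact (((has.get_var i).get_var c).mod_pos hr (by omega)).mono le_rfl (by decide)
  refine OkX.bind hbs0 hVG (by decide) fun bs hbs hbb => ?_
  obtain ⟨bs, rfl⟩ : ∃ v : List (List ℕ), v = bs := ⟨bs, rfl⟩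
  have hbs1 : Ok B 1 0 (.var (τ := .list (.list .nat)) bs : Tm Ty.den Proc _) := Ok.var hbb
  refine OkW.extra ((OkW.tab (W₁ := G) (W₂ := V) (j₁ := 0) (j := 1) (l := 40) hlenas
    (show N ≤ G * B ^ 0 by rw [pow_zero]; omega) (by rw [mul_comm]) hVG hV1
    fun i hi => ?_).mono le_rfl (by decide)) 0
  refine OkW.taylor (hF.m_ok.mono le_rfl (by decide)) hm' (hqv.mono le_rfl (by decide)) hq0 rfl hlen hV1
    (hVsize.trans (pow_mono_exp (by decide))) ?_ (fun k hk => ?_)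
    ((has.get_var i).mono le_rfl (by decide)) ((hbs1.get_var i).mono le_rfl (by decide))
  · intro v hv x hx
    rw [← hvs] at hv
    exact (List.single_le_sum (by simp) _ hx).trans (((mem_expo hs0).mp hv).2.le.trans hs')
  · have hcell := Ok.gridCell (hF.m_ok.mono le_rfl (by decide)) hm' (hr.mono le_rfl (by decide))
      ((hbs1.get_var i).mono le_rfl (by decide)) (hrB.size_pow le_rfl) (by omega) (fun c hc => by
        change (bs.getD i []).getD c 0 < r.nv
        have : bs.getD i [] = _ := (congrArg (fun l : List (List ℕ) => l.getD i []) hbs).symm.trans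
          (getD_tab (τ := .list .nat) hi)
        rw [this]
        refine lt_of_eq_of_lt (getD_tab (τ := .nat) hc) ?_
        exact Nat.mod_lt _ (show 0 < r.nv by omega))
    exact ((hys1.get_var k).get hcell).mono le_rfl (by decide)

end Costs

end MME

namespace MME

/-! ### Cost of one level of the recursion in MME-B. -/

section Costs

variable {B : ℕ} [hB : Fact (8 ≤ B)] {m d : Tm Ty.den Proc .nat}

theorem Ok.len_of_cost {τ : Ty} {x : Tm Ty.den Proc (.list τ)} {i k : ℕ} (hx : Ok B i k x) :
    Ok B (List.length (α := τ.den) x.val) (k + 1) (MME.len x) :=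
  Ok.len hx (Nat.lt_pow_self (by have := hB.out; omega)).le

theorem Ok.loop_mul {n : List ℕ} {i j : ℕ} (hn : ∀ x ∈ n, Nat.size x ≤ B ^ i)
    (hl : n.length ≤ B ^ j) : Ok B (i + j + 1) (2 * i + 2 * j + 6)
      (MME.loop (MME.len (.var (τ := .list .nat) n)) 1
        fun j z => z * MME.get (.var (τ := .list .nat) n) j : Tm Ty.den Proc .nat) := by
  have hnb : Bd (B ^ i) (.list .nat) n := hn
  have hz : ∀ x ≤ n.length, ∀ z : ℕ, Nat.size z ≤ x * B ^ i + 1 → Nat.size z ≤ B ^ (i + j + 1) := by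
    intro x hx z h
    have h1 := Nat.mul_le_mul_right (B ^ i) (hx.trans hl)
    rw [← pow_add, add_comm j] at h1
    have := succ_pow_le (B := B) (i + j)
    omega
  refine (Ok.loop (j := i + j + 1) (i₁ := 1) (k₁ := 1) (l := 2 * i + j + 3) (Ok.len (Ok.var hnb) hl) hl (Ok.ofNat 1)
    (fun x (z : ℕ) => x ≤ n.length ∧ Nat.size z ≤ x * B ^ i + 1) ⟨Nat.zero_le _, by simp⟩ ?_
    fun z hz' => hz _ hz'.1 z hz'.2).mono le_rfl (by omega)
  rintro x hx (z : ℕ) ⟨hx', hz'⟩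
  refine ⟨⟨hx, ?_⟩, ?_⟩
  · refine (size_mul_le _ _).trans ?_
    have h1 : Nat.size (n.getD x 0) ≤ B ^ i := hnb.getD (τ := .nat) x
    have h2 : Nat.size (n.getD x 0) + Nat.size z ≤ (x + 1) * B ^ i + 1 := by
      rw [Nat.succ_mul]; omega
    rw [add_comm] at h2
    exact h2
  · have h1 : Ok B (i + j + 1) 0 (.var (τ := .nat) z : Tm Ty.den Proc .nat) := Ok.var (hz x hx' z hz')
    exact ((h1.mul ((Ok.var hnb).get_var x)).mono le_rfl (by omega)).cost

/-- There is one recursive call for each exponent vector and each prime, at most `2 ^ (2 * m)` times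
`size (d * r ^ d)` of them. No table of `r ^ m` values is built on this level, so apart from the
calls only `d ^ m` coefficients and the points count. -/
theorem OkX.mmeStep {self : Proc Arg (.list .nat)} (hF : Fits B m d) {f : List ℕ}
    {as : List (List ℕ)} {r s T : ℕ} (hf : Bd (B ^ 1) (.list .nat) f)
    (has : Bd (B ^ 1) (.list (.list .nat)) as) (hr1 : 1 < r) (hs0 : 0 < s) (hsm : s ≤ m.nv)
    (hrB : SmallBase B m d r)
    (hself : ∀ (g : List ℕ) (bs : List (List ℕ)) (p : ℕ), 1 < p →
      p ≤ 16 * Nat.size (d.nv * r ^ d.nv) → Bd (B ^ 1) (.list .nat) g →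
      Bd (B ^ 1) (.list (.list .nat)) bs → bs.length = as.length →
      Bd (B ^ 1) (.list .nat) (self (g, bs, p, m.nv)).1 ∧ (self (g, bs, p, m.nv)).2 ≤ T) :
    OkX B (2 ^ (2 * m.nv) * (d.nv ^ m.nv + as.length + 1))
      (2 ^ (2 * m.nv) * Nat.size (d.nv * r ^ d.nv) * T) 1 80
      (mmeStep m d self (.var (τ := Arg) (f, as, r, s))) := by
  set V := 2 ^ (2 * m.nv) with hV
  set N := as.length with hN
  set G := d.nv ^ m.nv + N + 1 with hG
  set κ := Nat.size (d.nv * r ^ d.nv) with hκ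
  have hm' : m.nv ≤ B ^ 1 := by have := hF.m_le; omega
  have hd' : d.nv ≤ B ^ 1 := by have := hF.m_le; omega
  have hs' : s ≤ B ^ 1 := hsm.trans hm'
  have hr0 : 0 < r := by omega
  have hV1 : 1 ≤ V := Nat.one_le_two_pow
  have hdm1 : 0 < d.nv ^ m.nv := Nat.pow_pos hF.d_pos
  have hG1 : 1 ≤ G := by omega
  have hVG : 1 ≤ V * G := Nat.mul_pos hV1 hG1
  have hVs : 2 ^ (m.nv + s) ≤ V := Nat.pow_le_pow_right two_pos (by omega)
  have hκB : κ ≤ B ^ 1 := hrB.size_bound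
  have hVsize : Nat.size V ≤ B ^ 1 := by
    refine (size_two_pow_le _).trans ?_
    have := hF.m_le; omega
  have hx : Ok B 1 0 (.var (τ := Arg) (f, as, r, s) : Tm Ty.den Proc Arg) :=
    Ok.var ⟨hf, has, hrB.size_le, (size_self_le s).trans hs'⟩
  unfold MME.mmeStep
  refine OkX.bind (hx.fst.weight hVG) hVG (by decide) fun f' hf' _ => ?_
  obtain rfl : f = f' := hf'
  refine OkX.bind (hx.snd.fst.weight hVG) hVG (by decide) fun as' has' _ => ?_
  obtain rfl : as = as' := has'
  refine OkX.bind (hx.snd.snd.fst.weight hVG) hVG (by decide) fun r' hr' hrb => ?_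
  obtain rfl : r = r' := hr'
  refine OkX.bind (hx.snd.snd.snd.weight hVG) hVG (by decide) fun s' hs'' hsb => ?_
  obtain rfl : s = s' := hs''
  have hr : Ok B 1 1 (.var (τ := .nat) r : Tm Ty.den Proc .nat) := (Ok.var hrb).mono le_rfl (by decide)
  have hs : Ok B 1 1 (.var (τ := .nat) s : Tm Ty.den Proc .nat) := (Ok.var hsb).mono le_rfl (by decide)
  have hf1 : Ok B 1 0 (.var (τ := .list .nat) f : Tm Ty.den Proc _) := Ok.var hf
  have has1 : Ok B 1 0 (.var (τ := .list (.list .nat)) as : Tm Ty.den Proc _) := Ok.var has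
  have hq : Ok B 1 8 (MME.pow (.var (τ := .nat) r) (.var (τ := .nat) s)) :=
    ⟨by change Nat.size (MME.pow _ _).nv ≤ _; rw [nv_pow]; exact hrB.size_pow hsm,
      ((Ok.pow (j := 1) hr hs hs').mono le_rfl (by decide)).cost⟩
  refine OkX.bind (hq.weight hVG) hVG (by decide) fun (q : ℕ) hqv hqb => ?_
  have hq0 : 0 < q := by
    have : r ^ s = q := by rw [← hqv]; simp
    rw [← this]; exact Nat.pow_pos (by omega)
  have hq1 : Ok B 1 0 (.var (τ := .nat) q : Tm Ty.den Proc .nat) := Ok.var hqb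
  refine OkX.bind ((OkW.exponents hF.m_ok hs hm' hs' hs0).mono_weight
    (hVs.trans (Nat.le_mul_of_pos_right _ hG1))) hVG (by decide) fun vs hvs hvb => ?_
  have hvs : expo s m.nv = vs := by rw [← hvs, val_exponents]; rfl
  obtain ⟨vs, rfl⟩ : ∃ v : List (List ℕ), v = vs := ⟨vs, rfl⟩
  have hlen : vs.length ≤ V := hvs ▸ (length_expo_le s m.nv).trans hVs
  have hvs1 : Ok B 1 0 (.var (τ := .list (.list .nat)) vs : Tm Ty.den Proc _) := Ok.var hvb
  refine OkX.bind (i := 1) (k := 45) (OkW.mono_weight (W := V * d.nv ^ m.nv) ((OkW.tab_len (j := 1) (l := 40) hlen le_rfl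
    (Nat.mul_pos hV1 hdm1) hdm1 fun k hk => ?_).mono le_rfl
    (by decide)) (Nat.mul_le_mul_left _ (by omega))) hVG (by decide) fun fs hfs hfb => ?_
  · exact OkW.hasse (hF.m_ok.mono le_rfl (by decide)) hm' (hF.d_ok.mono le_rfl (by decide)) hd'
      hF.d_pos (hq1.mono le_rfl (by decide)) hq0 (hf1.mono le_rfl (by decide))
      ((hvs1.get_var k).mono le_rfl (by decide)) hF.size_dm
  obtain ⟨fs, rfl⟩ : ∃ v : List (List ℕ), v = fs := ⟨fs, rfl⟩
  have hfs1 : Ok B 1 0 (.var (τ := .list (.list .nat)) fs : Tm Ty.den Proc _) := Ok.var hfb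
  have hfsl : ∀ k < vs.length, (fs.getD k []).length = d.nv ^ m.nv := by
    intro k hk
    have : fs.getD k [] = _ := (congrArg (fun l : List (List ℕ) => l.getD k []) hfs).symm.trans
      (getD_tab_len (τ := .list .nat) hk)
    rw [this, val_hasse]
    simp
  refine OkX.bind (k := 10) ((OkW.reduce_points (W := V * G) (k := 2) hF has (hr.mono le_rfl (by decide))
    ((show N ≤ G by omega).trans (Nat.le_mul_of_pos_left _ hV1)) hVG hr0 le_rfl).mono le_rfl le_rfl) hVG (by decide) fun bs hbs hbb => ?_
  obtain ⟨bs, rfl⟩ : ∃ v : List (List ℕ), v = bs := ⟨bs, rfl⟩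
  have hbl : bs.length = N := length_tab_len hbs
  have hbs1 : Ok B 1 0 (.var (τ := .list (.list .nat)) bs : Tm Ty.den Proc _) := Ok.var hbb
  -- the primes
  have hMv : (d * MME.pow (.var (τ := .nat) r) d).nv = d.nv * r ^ d.nv := by simp
  have hM : Ok B 1 10 (d * MME.pow (.var (τ := .nat) r) d) :=
    ⟨by change Nat.size (d * MME.pow _ _).nv ≤ _; rw [hMv]; exact hκB,
      ((hF.d_ok.mul (Ok.pow (j := 1) hr hF.d_ok hd')).mono le_rfl (by decide)).cost⟩
  obtain ⟨P, hps, -⟩ := val_smallPrimes _ (show 0 < (d * MME.pow (.var (τ := .nat) r) d).nv by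
    rw [hMv]; exact Nat.mul_pos hF.d_pos (Nat.pow_pos hr0))
  rw [hMv] at hps
  -- Every prime of the list is a small base, so `p ^ m` has at most `B` digits; this is a sharper
  -- bound than the general one for the search.
  have hpB : ∀ p ∈ (show List ℕ from (smallPrimes (d * MME.pow (.var (τ := .nat) r) d)).val),
      SmallBase B m d p := fun p hp => hF.smallBase ((hps.prime p hp).2.le.trans (by
        rw [pow_one] at hκB; omega))
  have hpsb : Bd (B ^ 1) (.list .nat) (smallPrimes (d * MME.pow (.var (τ := .nat) r) d)).val :=
    fun p hp => (hpB p hp).size_le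
  refine OkX.bind (i := 1) (k := 30) ⟨hpsb, (hM.smallPrimes.weight hVG).cost⟩ hVG (by decide) fun ps hpsv hpsb => ?_
  obtain ⟨ps, rfl⟩ : ∃ v : List ℕ, v = ps := ⟨ps, rfl⟩
  have hpsv : (smallPrimes (d * MME.pow (.var (τ := .nat) r) d)).val = ps := hpsv
  rw [hpsv] at hps hpB
  have hpl : ps.length ≤ κ := hps.length
  have hps1 : Ok B 1 0 (.var (τ := .list .nat) ps : Tm Ty.den Proc _) := Ok.var hpsb
  have hplen : Ok B 1 1 (MME.len (.var (τ := .list .nat) ps)) := hps1.len (hpl.trans hκB)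
  have hgetp : ∀ j < ps.length, ps.getD j 0 ∈ ps := fun j hj => by
    rw [List.getD_eq_getElem _ _ hj]; exact List.getElem_mem hj
  refine OkX.bind (i := 1) (k := 20) (Ok.weight ?_ hVG) hVG (by decide) fun ns hns hnb => ?_
  · refine (Ok.tab (j₁ := 1) (j := 1) (l := 10) hplen (hpl.trans hκB) fun j hj => ?_).mono le_rfl (by decide)
    refine ⟨?_, ((Ok.pow (j := 1) (k := 1) (hps1.get_var j) (hF.m_ok.mono le_rfl (by decide)) hm').mono le_rfl (by decide)).cost⟩
    change Nat.size (MME.pow _ _).nv ≤ _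
    rw [nv_pow]
    exact (hpB _ (hgetp j hj)).size_pow le_rfl
  obtain ⟨ns, rfl⟩ : ∃ v : List ℕ, v = ns := ⟨ns, rfl⟩
  have hnl : ns.length = ps.length := length_tab_len hns
  have hns1 : Ok B 1 0 (.var (τ := .list .nat) ns : Tm Ty.den Proc _) := Ok.var hnb
  have hnv : ∀ j < ps.length, ns.getD j 0 = ps.getD j 0 ^ m.nv := fun j hj =>
    ((congrArg (fun l : List ℕ => l.getD j 0) hns).symm.trans
      (getD_tab_len (τ := .nat) hj)).trans (by simp)
  have hnpos : ∀ j < ps.length, 0 < ns.getD j 0 := fun j hj => by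
    rw [hnv j hj]; exact Nat.pow_pos (hps.prime _ (hgetp j hj)).1.pos
  -- everything modulo `n_j`
  refine OkX.bind (i := 1) (k := 20) (OkW.mono_weight (W := V * d.nv ^ m.nv) ((OkW.tab_len (j := 1) (l := 12) hlen le_rfl
    (Nat.mul_pos hV1 hdm1) hdm1 fun k hk => ?_).mono le_rfl
    (by decide)) (Nat.mul_le_mul_left _ (by omega))) hVG (by decide) fun fjs hfjs hfjb => ?_
  · refine (OkW.tab (W₁ := 1) (W₂ := d.nv ^ m.nv) (j₁ := 1) (l := 8) hplen (by rw [one_mul]; exact hpl.trans hκB) (by simp)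
      hdm1 hdm1 fun j hj => ?_).mono le_rfl (by decide)
    refine (OkW.tab (W₁ := d.nv ^ m.nv) (W₂ := 1) (j₁ := 0) (l := 5) (hfs1.get_var k).len_of_cost ?_
      (by simp) hdm1 le_rfl fun i hi => Ok.weight ?_ le_rfl).mono le_rfl (by decide)
    · rw [pow_zero, mul_one]; exact (hfsl k hk).le
    · exact (((hfs1.get_var k).get_var i).mod_pos (hns1.get_var j) (hnpos j hj)).mono le_rfl (by decide)
  have hbjs0 : OkW B (V * G) 1 20 (MME.tab (MME.len (.var (τ := .list .nat) ps)) fun j =>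
      MME.tab (MME.len (.var (τ := .list (.list .nat)) bs)) fun i => MME.tab m fun c =>
        MME.get (MME.get (.var (τ := .list (.list .nat)) bs) i) c
          % MME.get (.var (τ := .list .nat) ns) j) := by
    refine (OkW.tab (W₁ := 1) (W₂ := V * G) (j₁ := 1) (l := 10) hplen
      (by rw [one_mul]; exact hpl.trans hκB) (by simp) hVG hVG fun j hj => ?_).mono le_rfl (by decide)
    exact OkW.reduce_points (k := 2) hF hbb ((hns1.get_var j).mono le_rfl (by decide))
      ((show bs.length ≤ G by omega).trans (Nat.le_mul_of_pos_left _ hV1)) hVG (hnpos j hj) le_rfl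
  refine OkX.bind hbjs0 hVG (by decide) fun bjs hbjs hbjb => ?_
  obtain ⟨fjs, rfl⟩ : ∃ v : List (List (List ℕ)), v = fjs := ⟨fjs, rfl⟩
  obtain ⟨bjs, rfl⟩ : ∃ v : List (List (List ℕ)), v = bjs := ⟨bjs, rfl⟩
  have hfjs1 : Ok B 1 0 (.var (τ := .list (.list (.list .nat))) fjs : Tm Ty.den Proc _) :=
    Ok.var hfjb
  have hbjs1 : Ok B 1 0 (.var (τ := .list (.list (.list .nat))) bjs : Tm Ty.den Proc _) :=
    Ok.var hbjb
  have hbjl : ∀ j < ps.length, (bjs.getD j []).length = N := by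
    intro j hj
    have : bjs.getD j [] = _ :=
      (congrArg (fun l : List (List (List ℕ)) => l.getD j []) hbjs).symm.trans
      (getD_tab_len (τ := .list (.list .nat)) hj)
    rw [this, val_tab, List.length_map, List.length_range]
    exact hbl
  -- recursive calls
  have hcall : ∀ k < vs.length, ∀ j < ps.length,
      Bd (B ^ 1) (.list .nat) (call self (MME.pair (MME.get (MME.get
        (.var (τ := .list (.list (.list .nat))) fjs) (.var (τ := .nat) k)) (.var (τ := .nat) j))
        (MME.pair (MME.get (.var (τ := .list (.list (.list .nat))) bjs) (.var (τ := .nat) j))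
          (MME.pair (MME.get (.var (τ := .list .nat) ps) (.var (τ := .nat) j)) m)))).val ∧
      (call self (MME.pair (MME.get (MME.get
        (.var (τ := .list (.list (.list .nat))) fjs) (.var (τ := .nat) k)) (.var (τ := .nat) j))
        (MME.pair (MME.get (.var (τ := .list (.list (.list .nat))) bjs) (.var (τ := .nat) j))
          (MME.pair (MME.get (.var (τ := .list .nat) ps) (.var (τ := .nat) j)) m)))).cost
        ≤ B ^ 8 + T := by
    intro k hk j hj
    have harg := ((((hfjs1.get_var k).get_var j).pair ((hbjs1.get_var j).pair
      ((hps1.get_var j).pair hF.m_ok))).mono (j := 1) (l := 7) le_rfl (by decide))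
    have hp := hps.prime _ (hgetp j hj)
    obtain ⟨h1, h2⟩ := hself ((fjs.getD k []).getD j []) (bjs.getD j []) (ps.getD j 0)
      hp.1.one_lt hp.2.le ((hfjb.getD k).getD j) (hbjb.getD j) (hbjl j hj)
    refine ⟨h1, ?_⟩
    rw [cost_call]
    have h3 := harg.cost
    have h4 : B ^ 7 + 1 ≤ B ^ 8 := succ_pow_le 7
    exact (show _ + _ + 1 ≤ _ from by
      have h5 := Nat.add_le_add h3 h2
      refine (Nat.add_le_add_right h5 1).trans ?_
      omega)
  -- The overhead of a call is polynomial, so the whole table costs `V * κ * T` for the calls proper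
  -- plus `V` times a power of `B`.
  refine OkX.bind_extra (i := 1) (l := 67) ?_ ?_ hVG fun ys hys hyb => ?_
  · rw [val_tab]
    intro y hy
    obtain ⟨k, hk, rfl⟩ := List.mem_map.mp hy
    rw [val_tab]
    intro z hz
    obtain ⟨j, hj, rfl⟩ := List.mem_map.mp hz
    exact (hcall k (List.mem_range.mp hk) j (List.mem_range.mp hj)).1
  · refine (cost_tab_le (c := 1 + 1 + ps.length * (B ^ 8 + T + 1) + 1) ?_).trans ?_
    · intro k hk
      refine cost_tab_le (c := B ^ 8 + T) ?_
      intro j hj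
      exact (hcall k hk j hj).2
    simp only [cost_len, cost_var, nv_len, val_var]
    change 1 + 1 + vs.length * (1 + 1 + ps.length * (B ^ 8 + T + 1) + 1 + 1) + 1 ≤ _
    have h3 : vs.length * (1 + 1 + ps.length * (B ^ 8 + T + 1) + 1 + 1)
        ≤ V * (1 + 1 + κ * (B ^ 8 + T + 1) + 1 + 1) := by gcongr
    have h4 : V * (1 + 1 + κ * (B ^ 8 + T + 1) + 1 + 1) = V * (κ * (B ^ 8 + 1) + 4) + V * κ * T := by
      ring
    have h5 : κ * (B ^ 8 + 1) ≤ B ^ 10 :=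
      (Nat.mul_le_mul hκB (succ_pow_le 8)).trans_eq (by rw [← pow_add])
    have h6 : V * (κ * (B ^ 8 + 1) + 4) ≤ V * B ^ 11 := by
      refine Nat.mul_le_mul_left _ ?_
      have := eight_mul_pow_le (B := B) 10
      have := one_le_pow_base (B := B) 10
      simp only [Nat.reduceAdd] at *
      omega
    have h7 := Nat.mul_le_mul_left V (eight_mul_pow_le (B := B) 11)
    have h8 := Nat.mul_le_mul hV1 (one_le_pow_base (B := B) 11)
    have h9 := Nat.mul_le_mul (Nat.le_mul_of_pos_right V hG1) (pow_mono_exp (B := B) (show 12 ≤ 67 by omega))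
    rw [Nat.mul_left_comm] at h7
    simp only [Nat.reduceAdd] at *
    omega
  have hys1 : Ok B 1 0 (.var (τ := .list (.list (.list .nat))) ys : Tm Ty.den Proc _) := Ok.var hyb
  -- Chinese remaindering
  have hnl' : ns.length ≤ B ^ 1 := hnl.trans_le (hpl.trans hκB)
  refine OkX.bind ((Ok.loop_mul (i := 1) (j := 1) hnb hnl').weight hVG) hVG (by decide)
    fun n hn hnB => ?_
  obtain ⟨n, rfl⟩ : ∃ v : ℕ, v = n := ⟨n, rfl⟩
  have hn0 : 0 < n := by
    rw [← hn, val_eq_nv, nv_loop_mul]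
    exact Finset.prod_pos fun j hj => hnpos j (hnl ▸ Finset.mem_range.mp hj)
  have hn1 : Ok B 3 0 (.var (τ := .nat) n : Tm Ty.den Proc .nat) := Ok.var hnB
  refine OkX.bind (i := 4) (k := 35) (Ok.weight ?_ hVG) hVG (by decide) fun ws hws hwb => ?_
  · refine (Ok.tab (j₁ := 1) (j := 4) (l := 30) hplen (hpl.trans hκB) fun j hj => ?_).mono le_rfl (by decide)
    have hp := hps.prime _ (hgetp j hj)
    refine (Ok.share (j := 4) (l := 29) (hn1.div (hns1.get_var j)) fun hc => ?_).mono le_rfl (by decide)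
    have hc1 := Ok.var hc
    have hinv := Ok.inverse (i := 1) (k := 8) (j := 3) (p := MME.get (.var (τ := .list .nat) ps) (.var (τ := .nat) j))
      (q := MME.get (.var (τ := .list .nat) ns) (.var (τ := .nat) j))
      ((hps1.get_var j).mono le_rfl (by decide)) ((hns1.get_var j).mono le_rfl (by decide))
      ((hc1.mod_pos (hns1.get_var j) (hnpos j hj)).mono le_rfl (by decide)) (hp.2.le.trans (by
        have := eight_mul_pow_le (B := B) 1
        have := eight_mul_pow_le (B := B) 2
        simp only [Nat.reduceAdd] at *
        omega)) hp.1.pos (by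
        refine le_trans ?_ (hnv j hj).ge
        exact Nat.le_self_pow (by have := hF.m_pos; omega) _) le_rfl
    exact (hc1.mul hinv).mono (by decide) (by decide)
  have hws1 : Ok B 4 0 (.var (τ := .list .nat) ws : Tm Ty.den Proc _) := Ok.var hwb
  have hzs0 : OkW B (V * G) 1 50 (MME.tab (MME.len (.var (τ := .list (.list .nat)) vs)) fun k =>
      MME.tab (MME.len (.var (τ := .list (.list .nat)) as)) fun i =>
      (MME.sumMod (.var (τ := .nat) n) (MME.len (.var (τ := .list .nat) ps)) fun j =>
        MME.get (MME.get (MME.get (.var (τ := .list (.list (.list .nat))) ys) k) j) i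
          * MME.get (.var (τ := .list .nat) ws) j) % (.var (τ := .nat) q)) := by
    refine (OkW.tab_len (W₁ := V) (W₂ := G) (l := 47) hlen le_rfl hVG hG1 fun k hk => ?_).mono
      le_rfl (by decide)
    refine (OkW.tab_len (W₁ := G) (W₂ := 1) (l := 44) (by omega) (by simp) hG1 le_rfl
      fun i hi => Ok.weight ?_ le_rfl).mono le_rfl (by decide)
    have hsum := Ok.sumMod_mixed (j := 5) (k := 10) (l := 1) (hn1.mono le_rfl (by decide))
      (hplen.mono le_rfl (by decide : 1 ≤ 10)).cost (hpl.trans hκB) hn0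
      (b := fun j => MME.get (MME.get (MME.get (.var (τ := .list (.list (.list .nat))) ys)
        (.var (τ := .nat) k)) j) (.var (τ := .nat) i) * MME.get (.var (τ := .list .nat) ws) j)
      fun j hj => ((((hys1.get_var k).get_var j).get_var i).mul (hws1.get_var j)).mono (by decide)
        (by decide)
    exact (hsum.mod_pos hq1 hq0).mono le_rfl (by decide)
  refine OkX.bind hzs0 hVG (by decide) fun zs hzs hzb => ?_
  have hzs1 : Ok B 1 0 (.var (τ := .list (.list .nat)) zs : Tm Ty.den Proc _) := Ok.var hzb
  -- Taylor's formula
  refine OkW.extra ((OkW.tab_len (W₁ := G) (W₂ := V) (j := 1) (l := 40) (by omega)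
    (by rw [mul_comm]) hVG hV1 fun i hi => ?_).mono le_rfl (by decide)) 0
  refine OkW.taylor (hF.m_ok.mono le_rfl (by decide)) hm' (hq1.mono le_rfl (by decide)) hq0 rfl hlen
    hV1 (hVsize.trans (pow_mono_exp (by decide))) ?_
    (fun k hk => ((hzs1.get_var k).get_var i).mono le_rfl (by decide))
    ((has1.get_var i).mono le_rfl (by decide)) ((hbs1.get_var i).mono le_rfl (by decide))
  intro v hv x hx
  rw [← hvs] at hv
  exact (List.single_le_sum (by simp) _ hx).trans (((mem_expo hs0).mp hv).2.le.trans hs')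

end Costs

end MME

/-! ### The recurrence for the running time of MME-B and its solution. -/

namespace MME

/-- A bound for the number of primes that MME-B uses for the base `r`. -/
def primeCount (d r : ℕ) : ℕ := Nat.size (d * r ^ d)

/-- A bound for the primes that MME-B uses for the base `r`. -/
def nextBase (d r : ℕ) : ℕ := 16 * primeCount d r

theorem primeCount_mono (d : ℕ) : Monotone (primeCount d) := fun _ _ h =>
  Nat.size_le_size (Nat.mul_le_mul_left _ (Nat.pow_le_pow_left h _))

theorem nextBase_mono (d : ℕ) : Monotone (nextBase d) := fun _ _ h =>
  Nat.mul_le_mul_left _ (primeCount_mono d h)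

theorem primeCount_pos {d r : ℕ} (hd : 0 < d) (hr : 0 < r) : 0 < primeCount d r :=
  Nat.size_pos.mpr (Nat.mul_pos hd (Nat.pow_pos hr))

theorem iterate_nextBase_pos {d r : ℕ} (hd : 0 < d) (hr : 0 < r) (i : ℕ) :
    0 < (nextBase d)^[i] r := by
  induction i with
  | zero => exact hr
  | succ i ih =>
    rw [Function.iterate_succ_apply']
    exact Nat.mul_pos (by norm_num) (primeCount_pos hd ih)

/-- A bound for the number of steps of MME-B with recursion depth `t`. -/
def timeB (B m d : ℕ) : ℕ → ℕ → ℕ → ℕ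
  | 0, r, N => 2 ^ (2 * m) * (r ^ m + d ^ m + N + 1) * B ^ 80
  | t + 1, r, N => 2 ^ (2 * m) * (d ^ m + N + 1) * B ^ 80
      + 2 ^ (2 * m) * primeCount d r * timeB B m d t (nextBase d r) N

/-- Monotonicity allows all primes of one level to be replaced by their common bound `nextBase`. -/
theorem timeB_mono (B m d N t : ℕ) : Monotone fun r => timeB B m d t r N := by
  induction t with
  | zero =>
    intro r r' h
    have := Nat.pow_le_pow_left h m
    simp only [timeB]
    gcongr
  | succ t ih =>
    intro r r' h
    have h1 := primeCount_mono d h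
    have h2 := ih (nextBase_mono d h)
    simp only [timeB] at h2 ⊢
    gcongr

/-- Unrolling gives one summand for each of the `t + 1` levels, and each of them is at most the last
one, because all factors are at least `1`. -/
theorem timeB_le {B m d : ℕ} (hd : 0 < d) (N t : ℕ) {r : ℕ} (hr : 0 < r) :
    timeB B m d t r N ≤ (t + 1) * (2 ^ (2 * m)) ^ (t + 1)
      * (∏ i ∈ Finset.range t, primeCount d ((nextBase d)^[i] r))
      * (((nextBase d)^[t] r) ^ m + d ^ m + N + 1) * B ^ 80 := by
  induction t generalizing r with
  | zero => simp [timeB]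
  | succ t ih =>
    have hn : 0 < nextBase d r := iterate_nextBase_pos hd hr 1
    have h1 := ih hn
    rw [timeB, Finset.prod_range_succ', Function.iterate_zero_apply]
    simp only [Function.iterate_succ_apply]
    set V := 2 ^ (2 * m)
    set K := ∏ i ∈ Finset.range t, primeCount d ((nextBase d)^[i] (nextBase d r))
    set R := ((nextBase d)^[t] (nextBase d r)) ^ m
    have hK : 1 ≤ K := Finset.prod_pos fun i _ => primeCount_pos hd (iterate_nextBase_pos hd hn i)
    have hV : 1 ≤ V := Nat.one_le_two_pow
    have hc : 1 ≤ primeCount d r := primeCount_pos hd hr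
    have h2 := Nat.mul_le_mul_left (V * primeCount d r) h1
    have h3 : V * (d ^ m + N + 1) * B ^ 80
        ≤ (V ^ (t + 1 + 1) * (K * primeCount d r)) * (R + d ^ m + N + 1) * B ^ 80 := by
      have h5 : V ≤ V ^ (t + 1 + 1) * (K * primeCount d r) := by
        calc V = V * 1 := (mul_one _).symm
          _ ≤ _ := Nat.mul_le_mul (Nat.le_self_pow (by omega) V) (Nat.mul_pos hK hc)
      gcongr
      omega
    calc _ ≤ _ := Nat.add_le_add h3 h2
      _ = _ := by ring

/-! ### Induction on the recursion depth. -/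

section Costs

variable {B : ℕ} [hB : Fact (8 ≤ B)] {m d : Tm Ty.den Proc .nat}

omit hB in
theorem SmallBase.bd_range {r s : ℕ} (h : SmallBase B m d r) (hs : s ≤ m.nv) (hr : 1 < r) {n : ℕ}
    {g : ℕ → ℕ} : Bd (B ^ 1) (.list .nat) ((List.range n).map fun i => g i % r ^ s) := by
  intro x hx
  obtain ⟨i, -, rfl⟩ := List.mem_map.mp hx
  exact (Nat.size_le_size (Nat.mod_lt _ (Nat.pow_pos (by omega))).le).trans (h.size_pow hs)

/-- The induction on `t` works for all bases and exponents at once, since a call replaces `(r, s)`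
by `(p, m)` with `p` at most `nextBase d r`. -/
theorem cost_mmeProc (hF : Fits B m d) (t : ℕ) {f : List ℕ} {as : List (List ℕ)} {r s : ℕ}
    (hf : Bd (B ^ 1) (.list .nat) f) (has : Bd (B ^ 1) (.list (.list .nat)) as) (hr1 : 1 < r)
    (hs0 : 0 < s) (hsm : s ≤ m.nv) (hrB : SmallBase B m d r) :
    (mmeProc m d t (f, as, r, s)).2 ≤ timeB B m.nv d.nv t r as.length := by
  induction t generalizing f as r s with
  | zero =>
    have hm' : m.nv ≤ B ^ 1 := by have := hF.m_le; omega
    have hx : Ok B 1 0 (.var (τ := Arg) (f, as, r, s) : Tm Ty.den Proc Arg) :=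
      Ok.var ⟨hf, has, hrB.size_le, (size_self_le s).trans (hsm.trans hm')⟩
    have hc : ∀ {τ : Ty} (t : Tm Ty.den Proc τ), t.cost ≤ 8 → t.cost ≤ B ^ 1 := fun t h => by
      rw [pow_one]; exact h.trans hB.out
    exact (OkW.mmeProductSet (f := fst _) (as := fst (snd _)) (r := fst (snd (snd _)))
      (s := snd (snd (snd _))) hF ⟨hx.fst.bd, hc _ (by simp [cost_fst])⟩
      ⟨hx.snd.fst.bd, hc _ (by simp [cost_fst, cost_snd])⟩
      ⟨hx.snd.snd.fst.bd, hc _ (by simp [cost_fst, cost_snd])⟩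
      ⟨hx.snd.snd.snd.bd, hc _ (by simp [cost_snd])⟩ hr1 hs0 hsm hrB).cost.trans
      (Nat.mul_le_mul_left _ (pow_mono_exp (by decide)))
  | succ t ih =>
    refine (OkX.mmeStep (T := timeB B m.nv d.nv t (nextBase d.nv r) as.length) hF hf has hr1 hs0 hsm
      hrB fun g bs p hp hp' hg hbs hl => ?_).cost
    have hpB : SmallBase B m d p := hF.smallBase (hp'.trans (by
      have := hrB.size_bound; rw [pow_one] at this; omega))
    refine ⟨?_, (ih hg hbs hp hF.m_pos le_rfl hpB).trans ?_⟩
    -- The digits of the recursive results are bounded by correctness: the results are residues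
    -- modulo `p ^ m`.
    · refine (congrArg (Bd (B ^ 1) (.list .nat))
        (evaluates_mmeProc m d hF.d_pos hF.m_pos t g bs p m.nv hp hF.m_pos le_rfl)).mpr ?_
      exact hpB.bd_range le_rfl hp
    · rw [hl]
      exact timeB_mono _ _ _ _ _ hp'

/-- MME-B is correct and takes at most the time `timeB`. -/
theorem mmeB_spec {f : Tm Ty.den Proc (.list .nat)} {as : Tm Ty.den Proc (.list (.list .nat))}
    {r s t : Tm Ty.den Proc .nat} {k : ℕ} (hF : Fits B m d) (hf : Ok B 1 k f) (has : Ok B 1 k as)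
    (hr : Ok B 1 k r) (hs : Ok B 1 k s) (ht : t.cost ≤ B ^ k) (hr1 : 1 < r.nv) (hs0 : 0 < s.nv)
    (hsm : s.nv ≤ m.nv) (hrB : SmallBase B m d r.nv) :
    Bd (B ^ 1) (.list .nat) (mmeB m d f as r s t).val ∧
    (mmeB m d f as r s t).cost ≤ B ^ (k + 2)
      + timeB B m.nv d.nv t.nv r.nv (List.length (α := List ℕ) as.val) := by
  refine ⟨?_, ?_⟩
  · rw [val_mmeB]
    refine (congrArg (Bd (B ^ 1) (.list .nat))
      (evaluates_mmeProc m d hF.d_pos hF.m_pos t.nv _ _ _ _ hr1 hs0 hsm)).mpr ?_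
    exact hrB.bd_range hsm hr1
  · rw [cost_mmeB]
    have h := cost_mmeProc hF t.nv hf.bd has.bd hr1 hs0 hsm hrB
    have h1 := hf.cost
    have h2 := has.cost
    have h3 := hr.cost
    have h4 := hs.cost
    have h5 := eight_mul_pow_le (B := B) k
    have h6 := eight_mul_pow_le (B := B) (k + 1)
    have h7 := one_le_pow_base (B := B) k
    refine (Nat.add_le_add_right (Nat.add_le_add_left h _) 1).trans ?_
    simp only [Nat.add_assoc, Nat.reduceAdd] at *
    change _ ≤ B ^ (k + 2) + timeB B m.nv d.nv t.nv r.nv (List.length (α := List ℕ) as.val)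
    have h8 : timeB B m.nv d.nv t.nv r.val (List.length (α := List ℕ) as.val)
      = timeB B m.nv d.nv t.nv r.nv (List.length (α := List ℕ) as.val) := rfl
    omega

end Costs

end MME

namespace MME

open Polynomial

/-! ## Univariate polynomials -/

/-- The polynomial with a given list of coefficients. -/
noncomputable def toPoly (q : ℕ) (L : List ℕ) : (ZMod q)[X] :=
  ∑ i ∈ Finset.range L.length, monomial i (L.getD i 0 : ZMod q)

theorem coeff_toPoly (q : ℕ) (L : List ℕ) (k : ℕ) :
    (toPoly q L).coeff k = (L.getD k 0 : ZMod q) := by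
  simp only [toPoly, finsetSum_coeff, coeff_monomial, Finset.sum_ite_eq', Finset.mem_range]
  split_ifs with h
  · rfl
  · rw [List.getD_eq_default _ _ (not_lt.mp h), Nat.cast_zero]

theorem coeff_toPoly_of_length_le {q : ℕ} {L : List ℕ} {k : ℕ} (h : L.length ≤ k) :
    (toPoly q L).coeff k = 0 := by
  rw [coeff_toPoly, List.getD_eq_default _ _ h, Nat.cast_zero]

theorem toPoly_map_range {q n : ℕ} {g : ℕ → ℕ} {P : (ZMod q)[X]}
    (h : ∀ k < n, (g k : ZMod q) = P.coeff k) (h' : ∀ k, n ≤ k → P.coeff k = 0) :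
    toPoly q ((List.range n).map g) = P := by
  ext k
  rw [coeff_toPoly]
  rcases lt_or_ge k n with hk | hk
  · rw [getD_map_range _ _ hk, h k hk]
  · rw [List.getD_eq_default _ _ (by simpa using hk), Nat.cast_zero, h' k hk]

/-- A program that delivers the coefficients of the polynomial `P` modulo `q`, at most `n` of them, in
at most `B ^ k` steps. -/
structure PolyOk (B k q n : ℕ) (t : Tm Ty.den Proc (.list .nat)) (P : (ZMod q)[X]) : Prop where
  cost : t.cost ≤ B ^ k
  len : List.length (α := ℕ) t.val ≤ n
  le : ∀ x ∈ (show List ℕ from t.val), x ≤ q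
  poly : toPoly q t.val = P

section

variable {B : ℕ} [hB : Fact (8 ≤ B)] {q : ℕ}

omit hB in
theorem PolyOk.bd {k n : ℕ} {t : Tm Ty.den Proc (.list .nat)} {P : (ZMod q)[X]}
    (h : PolyOk B k q n t P) (hq : Nat.size q ≤ B ^ 1) : Bd (B ^ 1) (.list .nat) t.val :=
  fun x hx => (Nat.size_le_size (h.le x hx)).trans hq

omit hB in
theorem PolyOk.ok {k n : ℕ} {t : Tm Ty.den Proc (.list .nat)} {P : (ZMod q)[X]}
    (h : PolyOk B k q n t P) (hq : Nat.size q ≤ B ^ 1) : Ok B 1 k t := ⟨h.bd hq, h.cost⟩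

theorem PolyOk.mono {k l n n' : ℕ} {t : Tm Ty.den Proc (.list .nat)} {P : (ZMod q)[X]}
    (h : PolyOk B k q n t P) (hk : k ≤ l) (hn : n ≤ n') : PolyOk B l q n' t P :=
  ⟨h.cost.trans (pow_mono_exp hk), h.len.trans hn, h.le, h.poly⟩

omit hB in
theorem PolyOk.to_var {k n : ℕ} {t : Tm Ty.den Proc (.list .nat)} {P : (ZMod q)[X]}
    (h : PolyOk B k q n t P) {x : List ℕ} (hx : t.val = x) :
    PolyOk B 0 q n (.var (τ := .list .nat) x) P := by
  subst hx
  exact ⟨by simp, h.len, h.le, h.poly⟩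

theorem PolyOk.share {τ : Ty} {k l n : ℕ} {t : Tm Ty.den Proc τ}
    {b : Tm Ty.den Proc τ → Tm Ty.den Proc (.list .nat)} {P : (ZMod q)[X]}
    (ht : t.cost ≤ B ^ k) (hkl : k ≤ l) (hb : PolyOk B l q n (b (.var t.val)) P) :
    PolyOk B (l + 1) q n (share t b) P := by
  refine ⟨?_, hb.len, hb.le, hb.poly⟩
  rw [cost_share]
  have h1 := ht.trans (pow_mono_exp hkl)
  have h2 := hb.cost
  have h3 := eight_mul_pow_le (B := B) l
  have h4 := one_le_pow_base (B := B) l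
  omega

/-- Reads outside of an array deliver `0`, so the plain convolution sum needs no case distinction.
The length `n + n'` includes a superfluous leading zero. As all lengths are at most `B ^ 6`, the
cost of the operation itself has a fixed exponent. -/
theorem PolyOk.mul {k l n n' : ℕ} {a b : Tm Ty.den Proc (.list .nat)} {P Q : (ZMod q)[X]}
    (hq : Nat.size q ≤ B ^ 1) (hq0 : 0 < q) (ha : PolyOk B k q n a P) (hb : PolyOk B l q n' b Q)
    (hn : n + n' ≤ B ^ 6) :
    PolyOk B (max (max k l) 50 + 2) q (n + n') (polyMul (.var (τ := .nat) q) a b) (P * Q) := by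
  refine PolyOk.share ha.cost (by omega) ?_
  refine PolyOk.share hb.cost (by omega) ?_
  have ha1 : Ok B 1 0 (.var a.val) := Ok.var (ha.bd hq)
  have hb1 : Ok B 1 0 (.var b.val) := Ok.var (hb.bd hq)
  have hq1 : Ok B 1 0 (.var (τ := .nat) q : Tm Ty.den Proc .nat) := Ok.var hq
  have hla : Ok B 6 1 (MME.len (.var a.val)) := ha1.len (ha.len.trans (by omega))
  have hlb : Ok B 6 1 (MME.len (.var b.val)) := hb1.len (hb.len.trans (by omega))
  have hl : List.length (α := ℕ) a.val + List.length (α := ℕ) b.val ≤ B ^ 6 :=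
    (Nat.add_le_add ha.len hb.len).trans hn
  refine ⟨?_, ?_, ?_, ?_⟩
  · refine ((Ok.tab (j₁ := 6) (j := 1) (l := 42) (hla.add hlb) hl fun k hk => ?_).mono le_rfl
      (by omega : _ ≤ max (max k l) 50)).cost
    have hk1 : Ok B 6 0 (.var (τ := .nat) k : Tm Ty.den Proc .nat) := Ok.var (Bd.index hk hl)
    refine (Ok.sumMod_mixed (j := 2) (k := 20) (l := 6) (hq1.mono le_rfl (by decide))
      ((hk1.add (Ok.ofNat 1)).mono le_rfl (by decide : _ ≤ 20)).cost
      (Nat.succ_le_of_lt (lt_of_lt_of_le hk hl)) hq0 fun i hi => ?_).mono le_rfl (by decide)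
    have hi1 : Ok B 6 0 (.var (τ := .nat) i : Tm Ty.den Proc .nat) :=
      Ok.var (Bd.index hi (Nat.succ_le_of_lt (lt_of_lt_of_le hk hl)))
    exact ((ha1.get_var i).mul (hb1.get (hk1.sub hi1))).mono (by decide) (by decide)
  · rw [val_tab, List.length_map, List.length_range]
    exact Nat.add_le_add ha.len hb.len
  · intro x hx
    rw [val_tab] at hx
    obtain ⟨k, -, rfl⟩ := List.mem_map.mp hx
    rw [val_eq_nv, nv_sumMod]
    exact (Nat.mod_lt _ hq0).le
  · rw [val_tab]
    refine toPoly_map_range (fun k _ => ?_) fun k hk => ?_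
    · rw [val_eq_nv, nv_sumMod, nv_var, ZMod.natCast_mod, Nat.cast_sum, coeff_mul,
        Finset.Nat.sum_antidiagonal_eq_sum_range_succ fun i j => P.coeff i * Q.coeff j]
      refine Finset.sum_congr rfl fun i _ => ?_
      rw [nv_mul, Nat.cast_mul, ← ha.poly, ← hb.poly, coeff_toPoly, coeff_toPoly]
      rfl
    · have hk : List.length (α := ℕ) a.val + List.length (α := ℕ) b.val ≤ k := hk
      rw [coeff_mul, Finset.Nat.sum_antidiagonal_eq_sum_range_succ fun i j => P.coeff i * Q.coeff j]
      refine Finset.sum_eq_zero fun i _ => ?_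
      rw [← ha.poly, ← hb.poly]
      rcases lt_or_ge i (List.length (α := ℕ) a.val) with h | h
      · rw [coeff_toPoly_of_length_le (L := b.val) (by omega), mul_zero]
      · rw [coeff_toPoly_of_length_le (L := a.val) h, zero_mul]

/-- The step of long division. -/
theorem toPoly_reduce {n k c N : ℕ} {s g : List ℕ} {G : (ZMod q)[X]} (hg : toPoly q g = G)
    (hG : G.natDegree ≤ n) (hnk : n ≤ k) (hcq : c ≤ q) (hN : s.length = N)
    (hk : k < N) :
    toPoly q ((List.range N).map fun x => if x + n < k then s.getD x 0
        else (s.getD x 0 + (q - c) * g.getD (x + n - k) 0) % q)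
      = toPoly q s - C (c : ZMod q) * (X ^ (k - n) * G) := by
  have hG' : ∀ x, k < x → G.coeff (x - (k - n)) = 0 := fun x hx =>
    coeff_eq_zero_of_natDegree_lt (by omega)
  refine toPoly_map_range (fun x hx => ?_) fun x hx => ?_
  · rw [coeff_sub, coeff_C_mul, coeff_X_pow_mul', coeff_toPoly]
    by_cases h : x + n < k
    · rw [if_pos h, if_neg (by omega), mul_zero, sub_zero]
    · rw [if_neg h, if_pos (by omega), ZMod.natCast_mod, Nat.cast_add, Nat.cast_mul,
        Nat.cast_sub hcq, ZMod.natCast_self, zero_sub, ← hg, coeff_toPoly,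
        show x + n - k = x - (k - n) by omega]
      ring
  · rw [coeff_sub, coeff_C_mul, coeff_X_pow_mul', coeff_toPoly, if_pos (by omega), hG' x (by omega),
      List.getD_eq_default _ _ (by omega)]
    simp

/-- The body of the loop in `polyRem`. -/
def remStep (q : ℕ) (g : List ℕ) (n i : Tm Ty.den Proc .nat) (s : Tm Ty.den Proc (.list .nat)) :
    Tm Ty.den Proc (.list .nat) :=
  MME.share (len s - 1 - i) fun k =>
  MME.share (get s k) fun c =>
  tab (len s) fun x => cond (lt (x + n) k) (get s x)
    ((get s x + (.var (τ := .nat) q - c) * get (.var (τ := .list .nat) g) (x + n - k))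
      % .var (τ := .nat) q)

theorem val_remStep (g s : List ℕ) (n : Tm Ty.den Proc .nat) (i : ℕ) :
    (remStep q g n (.var (τ := .nat) i) (.var (τ := .list .nat) s)).val
      = (List.range s.length).map fun x => if x + n.nv < s.length - 1 - i then s.getD x 0
        else (s.getD x 0 + (q - s.getD (s.length - 1 - i) 0)
          * g.getD (x + n.nv - (s.length - 1 - i)) 0) % q := by
  simp only [remStep, val_share, val_tab]
  refine List.map_congr_left fun x _ => ?_
  rw [val_eq_nv, nv_cond, nv_lt, nv_add, nv_var, nv_var, nv_mod, nv_add, nv_mul, nv_sub]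
  split_ifs <;> simp_all

/-- A step subtracts a multiple of `G`, so the class modulo `G` is preserved. Since `G` is monic of
degree `n`, the chosen multiple kills the coefficient of index `N - 1 - i` and leaves the higher
ones zero. The array keeps its length. -/
theorem remStep_inv {g s : List ℕ} {n : Tm Ty.den Proc .nat} {N i : ℕ} {P G : (ZMod q)[X]}
    (hq0 : 0 < q) (hg : toPoly q g = G) (hG : G.Monic) (hGn : G.natDegree = n.nv)
    (hi : i < N - n.nv) (hs : s.length = N) (hsq : ∀ x ∈ s, x ≤ q) (hdvd : G ∣ P - toPoly q s)
    (h0 : ∀ x, N - i ≤ x → (toPoly q s).coeff x = 0) :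
    ∀ s' : List ℕ, s' = (remStep q g n (.var (τ := .nat) i) (.var (τ := .list .nat) s)).val →
      s'.length = N ∧ (∀ x ∈ s', x ≤ q) ∧ G ∣ P - toPoly q s' ∧
      ∀ x, N - (i + 1) ≤ x → (toPoly q s').coeff x = 0 := by
  intro s' hs'
  rw [val_remStep, hs] at hs'
  have hle : ∀ x, s.getD x 0 ≤ q := by
    intro k
    by_cases hk : k < s.length
    · rw [List.getD_eq_getElem _ _ hk]; exact hsq _ (List.getElem_mem hk)
    · rw [List.getD_eq_default _ _ (not_lt.mp hk)]; exact Nat.zero_le _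
  have key := toPoly_reduce (N := N) (c := s.getD (N - 1 - i) 0) (k := N - 1 - i) hg hGn.le
    (by omega) (hle _) hs (by omega)
  rw [← hs'] at key
  refine ⟨by simp [hs'], ?_, ?_, ?_⟩
  · intro x hx
    rw [hs'] at hx
    obtain ⟨k, -, rfl⟩ := List.mem_map.mp hx
    split_ifs
    · exact hle k
    · exact (Nat.mod_lt _ hq0).le
  · rw [key, ← sub_add]
    exact dvd_add hdvd (Dvd.intro_left _ (by rw [mul_assoc]))
  · intro x hx
    rw [key, coeff_sub, coeff_C_mul, coeff_X_pow_mul', if_pos (by omega)]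
    rcases Nat.lt_or_ge (N - 1 - i) x with h | h
    · rw [h0 x (by omega), coeff_eq_zero_of_natDegree_lt (by omega)]; simp
    · obtain rfl : x = N - 1 - i := by omega
      rw [show N - 1 - i - (N - 1 - i - n.nv) = G.natDegree by omega, hG.coeff_natDegree,
        coeff_toPoly]
      simp

theorem remStep_cost {g s : List ℕ} {n : Tm Ty.den Proc .nat} {i : ℕ} (hq : Nat.size q ≤ B ^ 1)
    (hq0 : 0 < q) (hgb : Bd (B ^ 1) (.list .nat) g) (hsb : Bd (B ^ 1) (.list .nat) s)
    (hn : Ok B 6 10 n) (hs : s.length ≤ B ^ 6) (hi : i < B ^ 6) :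
    (remStep q g n (.var (τ := .nat) i) (.var (τ := .list .nat) s)).cost ≤ B ^ 36 := by
  have hs1 := Ok.var hsb
  have hg1 := Ok.var hgb
  have hq1 : Ok B 1 0 (.var (τ := .nat) q : Tm Ty.den Proc .nat) := Ok.var hq
  have hi1 : Ok B 6 0 (.var (τ := .nat) i : Tm Ty.den Proc .nat) := Ok.var (Bd.index hi le_rfl)
  have hl : Ok B 6 1 (MME.len (.var (τ := .list .nat) s)) := hs1.len hs
  refine ((Ok.share (j := 1) (l := 34) ((hl.sub (Ok.ofNat 1)).sub hi1) fun hk => ?_).mono le_rfl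
    (by decide)).cost
  have hk1 := Ok.var hk
  refine (Ok.share (j := 1) (l := 32) (hs1.get hk1) fun hc => ?_).mono le_rfl (by decide)
  have hc1 := Ok.var hc
  refine (Ok.tab (j₁ := 6) (j := 1) (l := 24) hl hs fun x hx => ?_).mono le_rfl (by decide)
  have hx1 : Ok B 6 0 (.var (τ := .nat) x : Tm Ty.den Proc .nat) := Ok.var (Bd.index hx hs)
  have hidx := hx1.add hn
  exact ((hidx.lt hk1).cond (fun _ => hs1.get_var x) fun _ =>
    (((hs1.get_var x).add ((hq1.sub hc1).mul (hg1.get (hidx.sub hk1)))).mod_pos hq1 hq0)).mono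
    (by decide) (by decide)

/-- After `N - n` steps the state has degree less than `n` and is congruent to `P` modulo `G`, so it
is the remainder by uniqueness of division with remainder. -/
theorem PolyOk.rem {k l n' : ℕ} {a g : Tm Ty.den Proc (.list .nat)} {n : Tm Ty.den Proc .nat}
    {P G : (ZMod q)[X]} {n₁ : ℕ} (hq : Nat.size q ≤ B ^ 1) (hq1 : 1 < q) (ha : PolyOk B k q n' a P)
    (hg : PolyOk B l q n₁ g G) (hn : Ok B 6 10 n) (hnB : n.nv ≤ B ^ 6) (hn' : n' ≤ B ^ 6)
    (hG : G.Monic) (hGn : G.natDegree = n.nv) :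
    PolyOk B (max (max k l) 50 + 3) q n.nv (polyRem (.var (τ := .nat) q) a g n) (P %ₘ G) ∧
    List.length (α := ℕ) (polyRem (.var (τ := .nat) q) a g n).val = n.nv := by
  have hq0 : 0 < q := by omega
  have : Nontrivial (ZMod q) := ZMod.nontrivial_iff.mpr (by omega)
  have ha1 : Ok B 1 0 (.var a.val) := Ok.var (ha.bd hq)
  obtain ⟨N, hN⟩ : ∃ N, N = List.length (α := ℕ) a.val := ⟨_, rfl⟩
  have hNB : N ≤ B ^ 6 := hN ▸ ha.len.trans hn'
  have hla : Ok B 6 1 (MME.len (.var a.val)) := ha1.len (ha.len.trans hn')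
  have hcnt : (MME.len (.var a.val) - n : Tm Ty.den Proc .nat).nv = N - n.nv := by
    rw [nv_sub, nv_len, val_var, hN]
  have hloop := loop_spec (n := MME.len (.var a.val) - n) (x := .var a.val)
    (b := remStep q g.val n) (c := B ^ 36)
    (fun i (s : List ℕ) => s.length = N ∧ (∀ x ∈ s, x ≤ q) ∧ G ∣ P - toPoly q s ∧
      ∀ x, N - i ≤ x → (toPoly q s).coeff x = 0)
    ⟨hN.symm, ha.le, by
      rw [show toPoly q (Tm.var a.val : Tm Ty.den Proc (.list .nat)).val = P from ha.poly, sub_self]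
      exact dvd_zero _, fun x hx => coeff_toPoly_of_length_le (L := a.val) (by omega)⟩
    (fun i hi s hs => by
      obtain ⟨h1, h2, h3, h4⟩ := hs
      rw [hcnt] at hi
      exact ⟨remStep_inv hq0 hg.poly hG hGn hi h1 h2 h3 h4 _ rfl, remStep_cost hq hq0 (hg.bd hq)
        (fun x hx => (Nat.size_le_size (h2 x hx)).trans hq) hn (h1.trans_le hNB) (by omega)⟩)
  obtain ⟨⟨h1, h2, h3, h4⟩, h5⟩ := hloop
  rw [hcnt] at h4
  have h5 : (MME.loop (MME.len (.var a.val) - n) (.var a.val) (remStep q g.val n)).cost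
      ≤ B ^ 44 := by
    refine h5.trans ?_
    rw [hcnt, cost_var]
    have e1 : (N - n.nv) * (B ^ 36 + 1) ≤ B ^ 43 :=
      (Nat.mul_le_mul ((Nat.sub_le _ _).trans hNB) (succ_pow_le 36)).trans_eq (by rw [← pow_add])
    have e2 := ((hla.sub hn).mono le_rfl (by decide : _ ≤ 43)).cost
    have e3 := eight_mul_pow_le (B := B) 43
    have e4 := one_le_pow_base (B := B) 43
    simp only [Nat.reduceAdd] at *
    omega
  refine ⟨?_, ?_⟩
  · refine PolyOk.share ha.cost (by omega) (PolyOk.share hg.cost (by omega) (PolyOk.share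
      (l := max (max k l) 50) h5 (by omega) ?_))
    obtain ⟨s, hs⟩ : ∃ s : List ℕ, s = (MME.loop (MME.len (.var a.val) - n) (.var a.val)
      (remStep q g.val n)).val := ⟨_, rfl⟩
    change PolyOk B (max (max k l) 50) q n.nv (tab n fun x => get (.var (MME.loop
      (MME.len (.var a.val) - n) (.var a.val) (remStep q g.val n)).val) x) (P %ₘ G)
    rw [← hs] at h1 h2 h3 h4 ⊢
    have hs1 : Ok B 1 0 (.var (τ := .list .nat) s : Tm Ty.den Proc _) :=
      Ok.var fun x hx => (Nat.size_le_size (h2 x hx)).trans hq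
    -- If the array is no longer than `n`, the truncated difference `N - n` is zero, nothing is
    -- divided, and the coefficients in question lie outside of the array.
    have hs0 : ∀ x, n.nv ≤ x → (toPoly q s).coeff x = 0 := by
      intro x hx
      rcases le_or_gt N n.nv with h | h
      · exact coeff_toPoly_of_length_le (by omega)
      · exact h4 x (by omega)
    have hrem : toPoly q s = P %ₘ G := by
      obtain ⟨Q, hQ⟩ := h3
      refine ((div_modByMonic_unique Q (toPoly q s) hG ⟨by rw [← hQ]; ring, ?_⟩).2).symm
      rw [degree_eq_natDegree hG.ne_zero, hGn]
      exact (degree_lt_iff_coeff_zero _ _).mpr hs0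
    refine ⟨?_, ?_, ?_, ?_⟩
    · exact ((Ok.tab (j₁ := 6) (j := 1) (l := 1) hn hnB fun x hx =>
        hs1.get_var x).mono le_rfl (by omega : _ ≤ max (max k l) 50)).cost
    · rw [val_tab, List.length_map, List.length_range]
    · intro x hx
      rw [val_tab] at hx
      obtain ⟨k, -, rfl⟩ := List.mem_map.mp hx
      change s.getD k 0 ≤ q
      by_cases hk : k < s.length
      · rw [List.getD_eq_getElem _ _ hk]; exact h2 _ (List.getElem_mem hk)
      · rw [List.getD_eq_default _ _ (not_lt.mp hk)]; exact Nat.zero_le _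
    · rw [val_tab, ← hrem]
      exact toPoly_map_range (fun x hx => by rw [coeff_toPoly]; rfl) hs0
  · refine (congrArg (List.length (α := ℕ)) (val_tab (τ := .nat) n _)).trans ?_
    rw [List.length_map, List.length_range]

end

end MME

namespace MME

open Polynomial

/-! ## Hermite interpolation -/

theorem monic_prod_X_sub_C_pow {R : Type*} [CommRing R] (s : Finset ℕ) (n : ℕ) :
    (∏ k ∈ s, (X - C (k : R)) ^ n).Monic :=
  monic_prod_of_monic _ _ fun _ _ => (monic_X_sub_C _).pow n

theorem natDegree_prod_X_sub_C_pow {R : Type*} [CommRing R] [Nontrivial R] (l n : ℕ) :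
    (∏ k ∈ Finset.range l, (X - C (k : R)) ^ n).natDegree = l * n := by
  rw [natDegree_prod_of_monic _ _ fun k _ => (monic_X_sub_C _).pow n,
    Finset.sum_congr rfl fun k _ => by
      rw [(monic_X_sub_C (k : R)).natDegree_pow, natDegree_X_sub_C, mul_one]]
  simp

/-- Modulo each `(X - k) ^ n` only the summand `k` survives, and it is congruent to `A`. The powers
are pairwise coprime because the nodes differ by units, so the congruence holds modulo their
product, whose degree `l * n` exceeds that of `A`. -/
theorem sum_modByMonic_eq_of_congruences {R : Type*} [CommRing R] [Nontrivial R] {l n : ℕ}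
    (hu : ∀ j < l, ∀ k < l, j ≠ k → IsUnit ((j : R) - (k : R))) {D b : ℕ → R[X]} {A : R[X]}
    (h1 : ∀ j < l, (X - C (j : R)) ^ n ∣ D j - 1)
    (h0 : ∀ j < l, ∀ k < l, k ≠ j → (X - C (k : R)) ^ n ∣ D j)
    (hb : ∀ j < l, (X - C (j : R)) ^ n ∣ A - b j) (hA : A.degree < (l * n : ℕ)) :
    ∑ j ∈ Finset.range l, (D j * b j) %ₘ (∏ k ∈ Finset.range l, (X - C (k : R)) ^ n) = A := by
  set G := ∏ k ∈ Finset.range l, (X - C (k : R)) ^ n with hG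
  have hGm : G.Monic := monic_prod_X_sub_C_pow _ _
  have hGd : G.degree = (l * n : ℕ) := by
    rw [degree_eq_natDegree hGm.ne_zero, natDegree_prod_X_sub_C_pow]
  have hdvd : G ∣ (∑ j ∈ Finset.range l, D j * b j) - A := by
    refine Finset.prod_dvd_of_coprime ?_ ?_
    · intro j hj k hk hjk
      exact (isCoprime_X_sub_C_of_isUnit_sub (hu j (by simpa using hj) k (by simpa using hk)
        hjk)).pow
    · intro k hk
      rw [← Finset.add_sum_erase _ _ hk]
      have hk := Finset.mem_range.mp hk
      have e : D k * b k + ∑ j ∈ (Finset.range l).erase k, D j * b j - A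
          = (D k - 1) * b k - (A - b k) + ∑ j ∈ (Finset.range l).erase k, D j * b j := by ring
      rw [e]
      refine dvd_add (dvd_sub (Dvd.dvd.mul_right (h1 k hk) _) (hb k hk)) (Finset.dvd_sum ?_)
      intro j hj
      obtain ⟨hjk, hj⟩ := Finset.mem_erase.mp hj
      exact Dvd.dvd.mul_right (h0 j (Finset.mem_range.mp hj) k hk hjk.symm) _
  have h2 : ∑ j ∈ Finset.range l, (D j * b j) %ₘ G = (∑ j ∈ Finset.range l, D j * b j) %ₘ G :=
    (map_sum (modByMonicHom G) _ _).symm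
  rw [h2, modByMonic_eq_of_dvd_sub hGm hdvd, (modByMonic_eq_self_iff hGm).mpr (by rwa [hGd])]

/-- Write `G` for the product. As `u = G(j)`, the polynomial `u - G` vanishes at `j`, so its `n`-th
power is divisible by `(X - j) ^ n`. On the other hand `w * (u - G) = 1 - w * G`, and `1 - (1 - w *
G) ^ n` is divisible by `G`. This gives the interpolation basis without Euclid's algorithm over a
ring that is not a field. -/
theorem hermite_basis_dvd {R : Type*} [CommRing R] {s : Finset ℕ} {j n : ℕ} {u w : R}
    (hw : w * u = 1) (hu : u = ∏ k ∈ s, ((j : R) - k) ^ n) :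
    (X - C (j : R)) ^ n ∣ 1 - (C w * (C u - ∏ k ∈ s, (X - C (k : R)) ^ n)) ^ n - 1 ∧
    ∀ k ∈ s, (X - C (k : R)) ^ n ∣
      1 - (C w * (C u - ∏ k ∈ s, (X - C (k : R)) ^ n)) ^ n := by
  set G := ∏ k ∈ s, (X - C (k : R)) ^ n with hG
  constructor
  · rw [sub_sub_cancel_left, dvd_neg]
    refine pow_dvd_pow_of_dvd (Dvd.dvd.mul_left ?_ _) n
    rw [dvd_iff_isRoot, IsRoot.def, hG, hu]
    simp [eval_prod]
  · intro k hk
    refine (Finset.dvd_prod_of_mem (fun k : ℕ => (X - C (k : R)) ^ n) hk).trans ?_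
    have e : C w * (C u - G) = 1 - C w * G := by rw [mul_sub, ← C_mul, hw, C_1]
    rw [e]
    have := sub_dvd_pow_sub_pow (1 : R[X]) (1 - C w * G) n
    rw [one_pow, sub_sub_cancel] at this
    exact (Dvd.intro_left _ rfl).trans this

section

variable {B : ℕ} [hB : Fact (8 ≤ B)] {q : ℕ}

/-- Length bound and represented polynomial may depend on the pass, whereas the cost bound for the
body is uniform. -/
theorem PolyOk.loop {k l j : ℕ} {cnt : Tm Ty.den Proc .nat} {x : Tm Ty.den Proc (.list .nat)}
    {b : Tm Ty.den Proc .nat → Tm Ty.den Proc (.list .nat) → Tm Ty.den Proc (.list .nat)}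
    (N : ℕ → ℕ) (P : ℕ → (ZMod q)[X]) (hc : cnt.cost ≤ B ^ k) (hcB : cnt.nv ≤ B ^ j)
    (hx : PolyOk B k q (N 0) x (P 0))
    (hs : ∀ i < cnt.nv, ∀ s : List ℕ, PolyOk B 0 q (N i) (.var (τ := .list .nat) s) (P i) →
      PolyOk B l q (N (i + 1)) (b (.var (τ := .nat) i) (.var (τ := .list .nat) s)) (P (i + 1))) :
    PolyOk B (max k (j + l + 1) + 1) q (N cnt.nv) (loop cnt x b) (P cnt.nv) := by
  obtain ⟨h1, h2⟩ := loop_spec (n := cnt) (x := x) (b := b) (c := B ^ l)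
    (fun i (s : List ℕ) => PolyOk B 0 q (N i) (.var (τ := .list .nat) s) (P i)) (hx.to_var rfl)
    (fun i hi s h => ⟨(hs i hi s h).to_var rfl, (hs i hi s h).cost⟩)
  refine ⟨h2.trans ?_, h1.len, h1.le, h1.poly⟩
  have e1 : cnt.nv * (B ^ l + 1) ≤ B ^ (j + l + 1) :=
    (Nat.mul_le_mul hcB (succ_pow_le l)).trans_eq (by rw [← pow_add, add_assoc])
  have e2 := e1.trans (pow_mono_exp (le_max_right k (j + l + 1)))
  have e3 := hc.trans (pow_mono_exp (le_max_left k (j + l + 1)))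
  have e4 := hx.cost.trans (pow_mono_exp (le_max_left k (j + l + 1)))
  have e5 := eight_mul_pow_le (B := B) (max k (j + l + 1))
  have e6 := one_le_pow_base (B := B) (max k (j + l + 1))
  omega

theorem PolyOk.cond {k n : ℕ} {c : Tm Ty.den Proc .nat} {x y : Tm Ty.den Proc (.list .nat)}
    {P : (ZMod q)[X]} (hc : c.cost ≤ B ^ k) (hx : c.nv ≠ 0 → PolyOk B k q n x P)
    (hy : c.nv = 0 → PolyOk B k q n y P) : PolyOk B (k + 1) q n (cond c x y) P := by
  have h1 := eight_mul_pow_le (B := B) k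
  have h2 := one_le_pow_base (B := B) k
  by_cases h : c.nv ≠ 0
  · have h3 := hx h
    have hv : (MME.cond c x y).val = x.val := by rw [val_cond, if_pos h]
    refine ⟨?_, hv ▸ h3.len, hv ▸ h3.le, hv ▸ h3.poly⟩
    have h4 := h3.cost
    rw [cost_cond, if_pos h]
    omega
  · have h3 := hy (not_not.mp h)
    have hv : (MME.cond c x y).val = y.val := by rw [val_cond, if_neg h]
    refine ⟨?_, hv ▸ h3.len, hv ▸ h3.le, hv ▸ h3.poly⟩
    have h4 := h3.cost
    rw [cost_cond, if_neg h]
    omega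

theorem PolyOk.one {k : ℕ} (hq0 : 0 < q) (hk : 4 ≤ k) :
    PolyOk B k q 1 (single 1) 1 := by
  refine ⟨(Ok.single (Ok.ofNat 1)).cost.trans (pow_mono_exp hk), by simp, ?_, ?_⟩
  · intro x hx
    rw [val_single] at hx
    rw [List.mem_singleton.mp hx]
    exact hq0
  · ext k
    rw [val_single, coeff_toPoly, coeff_one]
    rcases k with _ | k <;> simp

theorem PolyOk.linPow {j n : ℕ} (hq : Nat.size q ≤ B ^ 1) (hq0 : 0 < q) (hj : j ≤ q)
    (hn : n ≤ B ^ 1) :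
    PolyOk B 60 q (1 + 2 * n) (linPow (.var (τ := .nat) q) (.var (τ := .nat) j)
      (.var (τ := .nat) n)) ((X - C (j : ZMod q)) ^ n) := by
  have hlin : PolyOk B 10 q 2 (append (single (.var (τ := .nat) q - .var (τ := .nat) j))
      (single 1)) (X - C (j : ZMod q)) := by
    have hq1 : Ok B 1 0 (.var (τ := .nat) q : Tm Ty.den Proc .nat) := Ok.var hq
    have hj1 : Ok B 1 0 (.var (τ := .nat) j : Tm Ty.den Proc .nat) :=
      Ok.var ((Nat.size_le_size hj).trans hq)
    refine ⟨((Ok.append (j₁ := 1) (j₂ := 1) (hq1.sub hj1).single (Ok.ofNat 1).single ?_ ?_).mono le_rfl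
      (by decide : _ ≤ 10)).cost, by simp, ?_, ?_⟩
    · simp only [val_single, List.length_singleton]; exact one_le_pow_base 1
    · simp only [val_single, List.length_singleton]; exact one_le_pow_base 1
    · intro x hx
      rw [val_append, val_single, val_single] at hx
      -- For `j = 0` the entry is `q` itself, not reduced; this is why `PolyOk` admits entries equal
      -- to `q`.
      have hx : x = q - j ∨ x = 1 := by simpa using hx
      omega
    · ext k
      rw [val_append, val_single, val_single, coeff_toPoly]
      rcases k with _ | _ | k
      · simp [Nat.cast_sub hj]
      · simp [coeff_X]
      · simp [coeff_X]
  refine (PolyOk.loop (k := 10) (l := 52) (j := 1) (fun i => 1 + 2 * i)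
    (fun i => (X - C (j : ZMod q)) ^ i)
    (by simp [one_le_pow_base]) hn (by simpa using PolyOk.one hq0 (by decide)) fun i hi s hs => ?_).mono
    (by decide) le_rfl
  rw [pow_succ]
  have hi : i < n := hi
  refine (hs.mul hq hq0 hlin ?_).mono (by decide) (by omega)
  have := eight_mul_pow_le (B := B) 1
  have := pow_mono_exp (B := B) (show 2 ≤ 6 by decide)
  have := hB.out
  simp only [Nat.reduceAdd, pow_one] at *
  omega

theorem PolyOk.prodExcept {l j n : ℕ} {ls : List (List ℕ)} (hq : Nat.size q ≤ B ^ 1) (hq0 : 0 < q)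
    (hj : j ≤ B ^ 1) (hl : l ≤ B ^ 1) (hn : n ≤ B ^ 1)
    (hls : ∀ k < l, PolyOk B 0 q (1 + 2 * n) (.var (τ := .list .nat) (ls.getD k []))
      ((X - C (k : ZMod q)) ^ n)) :
    PolyOk B 62 q (1 + l * (1 + 2 * n)) (prodExcept (.var (τ := .nat) q) (.var (τ := .nat) l)
      (.var (τ := .nat) j) (.var (τ := .list (.list .nat)) ls))
      (∏ k ∈ (Finset.range l).erase j, (X - C (k : ZMod q)) ^ n) := by
  have hle : ∀ i ≤ l, 1 + (i + 1) * (1 + 2 * n) + (1 + 2 * n) ≤ B ^ 6 := by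
    intro i hi
    have h1 : 1 + 2 * n ≤ B ^ 2 := by
      have := eight_mul_pow_le (B := B) 1
      have := one_le_pow_base (B := B) 1
      simp only [Nat.reduceAdd] at *
      omega
    have h2 : i + 1 ≤ B ^ 2 := by
      have := eight_mul_pow_le (B := B) 1
      have := one_le_pow_base (B := B) 1
      simp only [Nat.reduceAdd] at *
      omega
    have h3 := (Nat.mul_le_mul h2 h1).trans_eq (by rw [← pow_add])
    have := eight_mul_pow_le (B := B) 4
    have := pow_mono_exp (B := B) (show 2 ≤ 4 by decide)
    have := pow_mono_exp (B := B) (show 5 ≤ 6 by decide)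
    have := one_le_pow_base (B := B) 4
    simp only [Nat.reduceAdd] at *
    omega
  refine (PolyOk.loop (k := 10) (l := 54) (j := 1) (fun i => 1 + i * (1 + 2 * n))
    (fun i => ∏ k ∈ (Finset.range i).erase j, (X - C (k : ZMod q)) ^ n)
    (by simp [one_le_pow_base]) hl (by simpa using PolyOk.one hq0 (by decide)) fun i hi s hs => ?_).mono
    (by decide) le_rfl
  have hi : i < l := hi
  have hg : PolyOk B 1 q (1 + 2 * n) (get (.var (τ := .list (.list .nat)) ls) (.var (τ := .nat) i))
      ((X - C (i : ZMod q)) ^ n) :=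
    ⟨by rw [cost_get, cost_var, cost_var, pow_one]; have := hB.out; omega, (hls i hi).len,
      (hls i hi).le, (hls i hi).poly⟩
  have hmul := hs.mul hq hq0 hg ((by have := hle i hi.le; rw [Nat.succ_mul i] at this; omega))
  have heq : (MME.eq (.var (τ := .nat) i) (.var (τ := .nat) j) : Tm Ty.den Proc .nat).cost ≤ B ^ 4 :=
    (Ok.eq (i := 1) (j := 1) (k := 0) (l := 0) (Ok.var (Bd.index hi hl)) (Ok.var (τ := .nat) ((size_self_le j).trans hj))).cost.trans
      (pow_mono_exp (by decide))
  refine PolyOk.cond (k := 53) (heq.trans (pow_mono_exp (by decide))) (fun hij => ?_) fun hij => ?_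
  · have hij : i = j := by simpa using hij
    have e : (Finset.range (i + 1)).erase j = (Finset.range i).erase j := by
      ext x; simp; omega
    rw [e]
    exact hs.mono (by decide) (by rw [Nat.succ_mul i]; omega)
  · have hij : i ≠ j := by simpa using hij
    have e : (Finset.range (i + 1)).erase j = insert i ((Finset.range i).erase j) := by
      ext x; simp; omega
    rw [e, Finset.prod_insert (by simp), mul_comm ((X - C (i : ZMod q)) ^ n)]
    exact PolyOk.mono (l := 53) (n' := 1 + (i + 1) * (1 + 2 * n)) hmul (by decide)
      (by rw [Nat.succ_mul i]; omega)

/-- The member of the Hermite basis for the node `j`. -/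
def hermiteCell (p q l n : Tm Ty.den Proc .nat) (ls : Tm Ty.den Proc (.list (.list .nat)))
    (j : Tm Ty.den Proc .nat) : Tm Ty.den Proc (.list .nat) :=
  share (prodExcept q l j ls) fun g =>
  share (prodMod q l fun k => MME.cond (eq k j) 1 (powMod q ((j + (q - k)) % q) n)) fun u =>
  share (inverse p q u) fun w =>
  share (tab (len g) fun k => w * (MME.cond (eq k 0) u 0 + (q - get g k)) % q) fun h =>
  share (MME.loop n (single 1) fun _ s => polyMul q s h) fun h' =>
  tab (len h') fun k => (MME.cond (eq k 0) 1 0 + (q - get h' k)) % q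

theorem hermiteBasis_eq (p q l n : Tm Ty.den Proc .nat)
    (ls : Tm Ty.den Proc (.list (.list .nat))) :
    hermiteBasis p q l n ls = tab l (hermiteCell p q l n ls) := (rfl)

-- The difference of two nodes is nonzero and smaller than `p` in absolute value, hence prime to `p`
-- and to every power of `p`.
omit hB in
theorem isUnit_sub_of_lt {p R j k : ℕ} (hp : p.Prime) (hqR : q = p ^ R) (hj : j < p) (hk : k < p)
    (hjk : j ≠ k) : IsUnit ((j : ZMod q) - (k : ZMod q)) := by
  wlog h : k < j generalizing j k
  · rw [← neg_sub, IsUnit.neg_iff]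
    exact this hk hj hjk.symm (by omega)
  rw [← Nat.cast_sub h.le, ZMod.isUnit_iff_coprime, hqR]
  refine Nat.Coprime.pow_right _ ((Nat.Prime.coprime_iff_not_dvd hp).mpr fun hd => ?_).symm
  exact absurd (Nat.le_of_dvd (by omega) hd) (by omega)

theorem PolyOk.tab_len {n : ℕ} {g : List ℕ} {b : Tm Ty.den Proc .nat → Tm Ty.den Proc .nat}
    {P : (ZMod q)[X]} (hg : Bd (B ^ 1) (.list .nat) g) (hl : g.length ≤ n) (hn : n ≤ B ^ 6)
    (hb : ∀ k < g.length, (b (.var (τ := .nat) k)).cost ≤ B ^ 30)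
    (hq : ∀ k < g.length, (b (.var (τ := .nat) k)).nv ≤ q)
    (hP : ∀ k < g.length, ((b (.var (τ := .nat) k)).nv : ZMod q) = P.coeff k)
    (h0 : ∀ k, g.length ≤ k → P.coeff k = 0) :
    PolyOk B 40 q n (MME.tab (MME.len (.var (τ := .list .nat) g)) b) P := by
  refine ⟨?_, ?_, ?_, ?_⟩
  · refine (cost_tab_le (n := MME.len (.var (τ := .list .nat) g)) hb).trans ?_
    have h1 := ((Ok.var hg).len (hl.trans hn)).cost
    have h2 := (Nat.mul_le_mul (hl.trans hn) (succ_pow_le (B := B) 30)).trans_eq (by rw [← pow_add])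
    have h3 := pow_mono_exp (B := B) (show 1 ≤ 37 by decide)
    have h4 := eight_mul_pow_le (B := B) 37
    have h5 := one_le_pow_base (B := B) 37
    have h6 := pow_mono_exp (B := B) (show 38 ≤ 40 by decide)
    rw [nv_len, val_var]
    simp only [Nat.reduceAdd] at *
    omega
  · rw [val_tab, List.length_map, List.length_range]; exact hl
  · intro x hx
    rw [val_tab] at hx
    obtain ⟨k, hk, rfl⟩ := List.mem_map.mp hx
    exact hq k (List.mem_range.mp hk)
  · rw [val_tab]
    exact toPoly_map_range hP h0

omit hB in
theorem one_add_mul_pow_le {n : ℕ} (hn : n ≤ B ^ 1) : 1 + n * B ^ 4 ≤ 1 + B ^ 5 := by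
  have e2 := Nat.mul_le_mul_right (B ^ 4) hn
  rw [← pow_add] at e2
  exact Nat.add_le_add_left e2 1

/-- That the array is not empty is recorded because the constant `1` of `1 - H ^ n` is later added
in cell `0`, which has to exist. -/
theorem PolyOk.pow {n : ℕ} {h : List ℕ} {H : (ZMod q)[X]} (hq : Nat.size q ≤ B ^ 1) (hq0 : 0 < q)
    (hn : n ≤ B ^ 1) (hh : PolyOk B 0 q (B ^ 4) (.var (τ := .list .nat) h) H) :
    PolyOk B 60 q (1 + n * B ^ 4) (MME.loop (.var (τ := .nat) n) (single 1) fun _ s =>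
      polyMul (.var (τ := .nat) q) s (.var (τ := .list .nat) h)) (H ^ n) ∧
    1 ≤ List.length (α := ℕ) (MME.loop (.var (τ := .nat) n) (single 1) fun _ s =>
      polyMul (.var (τ := .nat) q) s (.var (τ := .list .nat) h)).val := by
  constructor
  · refine (PolyOk.loop (k := 10) (l := 52) (j := 1) (fun i => 1 + i * B ^ 4) (fun i => H ^ i)
      (by simp [one_le_pow_base]) hn (by simpa using PolyOk.one hq0 (by decide))
      fun i hi s hs => ?_).mono (by decide) le_rfl
    rw [pow_succ]
    have e1 : 1 + i * B ^ 4 + B ^ 4 ≤ B ^ 6 := by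
      have e2 := Nat.mul_le_mul_right (B ^ 4) (Nat.succ_le_of_lt (lt_of_lt_of_le hi hn))
      rw [Nat.succ_mul, ← pow_add] at e2
      have := succ_pow_le (B := B) 5
      simp only [Nat.reduceAdd] at *
      omega
    exact PolyOk.mono (l := 52) (n' := 1 + (i + 1) * B ^ 4) (hs.mul hq hq0 hh e1) (by decide)
      (by rw [Nat.succ_mul i]; omega)
  · refine loop_val (τ := .list .nat) (fun _ (s : List ℕ) => 1 ≤ s.length) (by simp) ?_
    intro i _ s hs
    refine hs.trans (le_of_le_of_eq (Nat.le_add_right _ h.length) ?_)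
    refine Eq.trans ?_ (congrArg (List.length (α := ℕ)) (val_tab (τ := .nat) _ _)).symm
    rw [List.length_map, List.length_range]
    rfl

theorem PolyOk.one_sub {h : List ℕ} {H : (ZMod q)[X]} (hq : Nat.size q ≤ B ^ 1) (hq0 : 0 < q)
    (hh : PolyOk B 0 q (1 + B ^ 5) (.var (τ := .list .nat) h) H) (h1 : 1 ≤ h.length) :
    PolyOk B 40 q (1 + B ^ 5) (MME.tab (MME.len (.var (τ := .list .nat) h)) fun k =>
      (MME.cond (eq k 0) 1 0 + (.var (τ := .nat) q - get (.var (τ := .list .nat) h) k))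
        % .var (τ := .nat) q) (1 - H) := by
  have hpB6 : 1 + B ^ 5 ≤ B ^ 6 := by
    have := succ_pow_le (B := B) 5
    simp only [Nat.reduceAdd] at *
    omega
  have hp1 := hh.ok hq
  have hqv : Ok B 1 0 (.var (τ := .nat) q : Tm Ty.den Proc .nat) := Ok.var hq
  refine PolyOk.tab_len (hh.bd hq) hh.len hpB6
    (fun k hk => ?_) (fun k hk => (Nat.mod_lt _ hq0).le) (fun k hk => ?_) fun k hk => ?_
  · have hkv : Ok B 6 0 (.var (τ := .nat) k : Tm Ty.den Proc .nat) :=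
      Ok.var (Bd.index hk (hh.len.trans hpB6))
    exact ((((Ok.eq hkv (Ok.ofNat 0)).cond (fun _ => Ok.ofNat 1) fun _ => Ok.ofNat 0).add
      (hqv.sub (hp1.get_var k))).mod_pos hqv hq0 |>.mono le_rfl (by decide : _ ≤ 30)).cost
  · have hle : h.getD k 0 ≤ q := by
      rw [List.getD_eq_getElem _ _ hk]; exact hh.le _ (List.getElem_mem hk)
    rw [nv_mod, nv_add, nv_cond, nv_eq, nv_sub, nv_get]
    simp only [nv_var, nv_zero, nv_one, val_var]
    rw [ZMod.natCast_mod, Nat.cast_add, Nat.cast_sub hle, ZMod.natCast_self,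
      coeff_sub, ← hh.poly, val_var, coeff_toPoly, coeff_one]
    split_ifs <;> simp_all [sub_eq_add_neg]
  · rw [coeff_sub, ← hh.poly, val_var, coeff_toPoly_of_length_le (L := h) hk, coeff_one,
      if_neg (by omega)]
    simp

theorem PolyOk.one_sub_pow {n : ℕ} {h : List ℕ} {H : (ZMod q)[X]} (hq : Nat.size q ≤ B ^ 1)
    (hq0 : 0 < q) (hn : n ≤ B ^ 1) (hh : PolyOk B 0 q (B ^ 4) (.var (τ := .list .nat) h) H) :
    PolyOk B 76 q (1 + B ^ 5)
      (MME.share (MME.loop (.var (τ := .nat) n) (single 1) fun _ s =>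
        polyMul (.var (τ := .nat) q) s (.var (τ := .list .nat) h)) fun h' =>
        MME.tab (MME.len h') fun k =>
          (MME.cond (eq k 0) 1 0 + (.var (τ := .nat) q - get h' k)) % .var (τ := .nat) q)
      (1 - H ^ n) := by
  obtain ⟨hpow, hlen⟩ := PolyOk.pow hq hq0 hn hh
  refine PolyOk.share (l := 75) hpow.cost (by decide) ?_
  exact (PolyOk.one_sub hq hq0 ((hpow.to_var rfl).mono le_rfl (one_add_mul_pow_le hn)) hlen).mono
    (by decide) le_rfl

/-- The number `u = G(j)` is a product of powers of differences of nodes. These are units because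
all nodes lie below `p`, so the inverse exists and `hermite_basis_dvd` applies. -/
theorem hermiteCell_spec {p R l n j : ℕ} {ls : List (List ℕ)} (hp : p.Prime) (hR : R ≠ 0)
    (hqR : q = p ^ R) (hq : Nat.size q ≤ B ^ 1) (hj : j < l) (hlp : l ≤ p) (hpB : p ≤ B ^ 2)
    (hl : l ≤ B ^ 1) (hn : n ≤ B ^ 1)
    (hls : ∀ k < l, PolyOk B 0 q (1 + 2 * n) (.var (τ := .list .nat) (ls.getD k []))
      ((X - C (k : ZMod q)) ^ n)) :
    ∃ D, PolyOk B 80 q (1 + B ^ 5) (hermiteCell (.var (τ := .nat) p) (.var (τ := .nat) q)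
      (.var (τ := .nat) l) (.var (τ := .nat) n) (.var (τ := .list (.list .nat)) ls)
      (.var (τ := .nat) j)) D ∧ (X - C (j : ZMod q)) ^ n ∣ D - 1 ∧
      ∀ k < l, k ≠ j → (X - C (k : ZMod q)) ^ n ∣ D := by
  have hq1 : 1 < q := hqR ▸ Nat.one_lt_pow hR hp.one_lt
  have hq0 : 0 < q := by omega
  have hpq : p ≤ q := hqR ▸ Nat.le_self_pow hR p
  have : Nontrivial (ZMod q) := ZMod.nontrivial_iff.mpr (by omega)
  set S := (Finset.range l).erase j with hS
  set G := ∏ k ∈ S, (X - C (k : ZMod q)) ^ n with hG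
  have hqv : Ok B 1 0 (.var (τ := .nat) q : Tm Ty.den Proc .nat) := Ok.var hq
  have hpv : Ok B 1 0 (.var (τ := .nat) p : Tm Ty.den Proc .nat) :=
    Ok.var ((Nat.size_le_size hpq).trans hq)
  have hlv : Ok B 1 0 (.var (τ := .nat) l : Tm Ty.den Proc .nat) := Ok.var ((size_self_le l).trans hl)
  have hnv : Ok B 1 0 (.var (τ := .nat) n : Tm Ty.den Proc .nat) := Ok.var ((size_self_le n).trans hn)
  have hjv : Ok B 1 0 (.var (τ := .nat) j : Tm Ty.den Proc .nat) := Ok.var (Bd.index hj hl)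
  have hg : PolyOk B 62 q (1 + l * (1 + 2 * n)) (prodExcept (.var (τ := .nat) q)
      (.var (τ := .nat) l) (.var (τ := .nat) j) (.var (τ := .list (.list .nat)) ls)) G :=
    PolyOk.prodExcept hq hq0 (hj.le.trans hl) hl hn hls
  -- the number `u = G(j)`
  set ut : Tm Ty.den Proc .nat := prodMod (.var (τ := .nat) q) (.var (τ := .nat) l) fun k =>
    MME.cond (eq k (.var (τ := .nat) j)) 1
      (powMod (.var (τ := .nat) q) ((.var (τ := .nat) j + (.var (τ := .nat) q - k))
        % .var (τ := .nat) q) (.var (τ := .nat) n)) with hut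
  have hu : (ut.nv : ZMod q) = ∏ k ∈ S, ((j : ZMod q) - k) ^ n := by
    rw [hut, nv_prodMod (.var (τ := .nat) q) _ _ hq1, nv_var, nv_var, ZMod.natCast_mod, Nat.cast_prod,
      ← Finset.mul_prod_erase _ _ (Finset.mem_range.mpr hj), nv_cond, if_pos (by simp), nv_one,
      Nat.cast_one, one_mul]
    refine Finset.prod_congr rfl fun k hk => ?_
    obtain ⟨hkj, hk⟩ := Finset.mem_erase.mp hk
    have hk := Finset.mem_range.mp hk
    rw [nv_cond, if_neg (by simp [hkj]), nv_powMod (.var (τ := .nat) q) _ _ hq1]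
    simp only [nv_var, nv_mod, nv_add, nv_sub, ZMod.natCast_mod, Nat.cast_pow, Nat.cast_add]
    rw [Nat.cast_sub (by omega), ZMod.natCast_self, zero_sub, sub_eq_add_neg]
  have huok : Ok B 1 40 ut := by
    refine (Ok.prodMod (j := 1) (k := 25) (hqv.mono le_rfl (by decide)) (hlv.mono le_rfl (by decide))
      hl hq0 fun k hk => ?_).mono le_rfl (by decide)
    have hkv : Ok B 1 0 (.var (τ := .nat) k : Tm Ty.den Proc .nat) := Ok.var (Bd.index hk hl)
    refine ((Ok.eq hkv hjv).cond (fun _ => Ok.ofNat 1) fun _ => Ok.powMod (j := 1) (k := 12)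
      (hqv.mono le_rfl (by decide)) (((hjv.add (hqv.sub hkv)).mod_pos hqv hq0).mono le_rfl
        (by decide)) (hnv.mono le_rfl (by decide)) hn hq0).mono le_rfl (by decide)
  have hunit : IsUnit (ut.nv : ZMod q) := by
    rw [hu]
    exact IsUnit.prod_iff.mpr fun k hk => by
      obtain ⟨hkj, hk⟩ := Finset.mem_erase.mp hk
      exact (isUnit_sub_of_lt hp hqR (by omega) ((Finset.mem_range.mp hk).trans_le hlp)
        hkj.symm).pow n
  have hpu : ¬ p ∣ ut.nv := by
    intro hd
    rw [ZMod.isUnit_iff_coprime, hqR] at hunit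
    have := Nat.dvd_gcd hd (dvd_pow_self p hR)
    rw [hunit] at this
    exact hp.one_lt.ne' (Nat.dvd_one.mp this)
  refine ⟨1 - (C ((inverse (.var (τ := .nat) p) (.var (τ := .nat) q)
    (.var (τ := .nat) ut.nv)).nv : ZMod q) * (C (ut.nv : ZMod q) - G)) ^ n, ?_, ?_⟩
  · refine PolyOk.share (l := 79) hg.cost (by decide) ?_
    have hg0 := hg.to_var rfl
    refine PolyOk.share (l := 78) huok.cost (by decide) ?_
    have huv : Ok B 1 0 (.var (τ := .nat) ut.nv : Tm Ty.den Proc .nat) := Ok.var huok.bd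
    have hwok := Ok.inverse (k := 0) (j := 2) hpv hqv huv hpB hp.pos hpq le_rfl
    refine PolyOk.share (l := 77) hwok.cost (by decide) ?_
    set wt : Tm Ty.den Proc .nat := inverse (.var (τ := .nat) p) (.var (τ := .nat) q)
      (.var (τ := .nat) ut.nv) with hwt
    have hwv : Ok B 1 0 (.var (τ := .nat) wt.nv : Tm Ty.den Proc .nat) := Ok.var hwok.bd
    obtain ⟨g, hgv⟩ : ∃ g : List ℕ, g = (prodExcept (.var (τ := .nat) q) (.var (τ := .nat) l)
      (.var (τ := .nat) j) (.var (τ := .list (.list .nat)) ls)).val := ⟨_, rfl⟩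
    rw [← hgv] at hg0
    have hgB : 1 + l * (1 + 2 * n) ≤ B ^ 4 := by
      have h1 : 1 + 2 * n ≤ B ^ 2 := by
        have := eight_mul_pow_le (B := B) 1
        have := one_le_pow_base (B := B) 1
        simp only [Nat.reduceAdd] at *
        omega
      have h3 := (Nat.mul_le_mul hl h1).trans_eq (by rw [← pow_add])
      have := succ_pow_le (B := B) 3
      simp only [Nat.reduceAdd] at *
      omega
    have hglen : ∀ k, g.length ≤ k → G.coeff k = 0 := fun k hk => by
      rw [← hg0.poly]; exact coeff_toPoly_of_length_le hk
    -- The constant `u` is placed in cell `0`, so the array must not be empty. An empty array would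
    -- mean `G = 0`, while `G(j) = u` is a unit.
    have hg1 : 0 < g.length := by
      rw [Nat.pos_iff_ne_zero]
      intro h0
      have hG0 : G = 0 := by ext k; rw [hglen k (by omega), coeff_zero]
      refine hunit.ne_zero ?_
      rw [hu]
      have := congrArg (eval (j : ZMod q)) hG0
      rw [hG, eval_prod] at this
      simpa using this
    have hgb : Ok B 1 0 (.var (τ := .list .nat) g) := hg0.ok hq
    have hh : PolyOk B 40 q (B ^ 4) (tab (len (.var (τ := .list .nat) g)) fun k =>
        .var (τ := .nat) wt.nv * (MME.cond (eq k 0) (.var (τ := .nat) ut.nv) 0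
          + (.var (τ := .nat) q - get (.var (τ := .list .nat) g) k)) % .var (τ := .nat) q)
        (C (wt.nv : ZMod q) * (C (ut.nv : ZMod q) - G)) := by
      refine PolyOk.tab_len (hg0.bd hq) (hg0.len.trans hgB) (pow_mono_exp (by decide))
        (fun k hk => ?_) (fun k hk => (Nat.mod_lt _ hq0).le) (fun k hk => ?_) fun k hk => ?_
      · have hkv : Ok B 4 0 (.var (τ := .nat) k : Tm Ty.den Proc .nat) :=
          Ok.var (Bd.index hk (hg0.len.trans hgB))
        exact ((hwv.mul (((Ok.eq hkv (Ok.ofNat 0)).cond (fun _ => huv) fun _ => Ok.ofNat 0).add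
          (hqv.sub (hgb.get_var k)))).mod_pos hqv hq0 |>.mono le_rfl (by decide : _ ≤ 30)).cost
      · have hle : g.getD k 0 ≤ q := by
          rw [List.getD_eq_getElem _ _ hk]; exact hg0.le _ (List.getElem_mem hk)
        rw [nv_mod, nv_mul, nv_add, nv_cond, nv_eq, nv_sub, nv_get]
        simp only [nv_var, nv_zero, val_var]
        rw [ZMod.natCast_mod, Nat.cast_mul, Nat.cast_add, Nat.cast_sub hle, ZMod.natCast_self,
          coeff_C_mul, coeff_sub, ← hg0.poly, coeff_toPoly, coeff_C]
        split_ifs <;> simp_all [sub_eq_add_neg]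
      · rw [coeff_C_mul, coeff_sub, hglen k hk, coeff_C, if_neg (by omega)]
        simp
    refine PolyOk.share (l := 76) (k := 40) (by rw [hgv] at hh; exact hh.cost) (by decide) ?_
    have hh0 := hh.to_var rfl
    rw [hgv] at hh0
    exact PolyOk.one_sub_pow hq hq0 hn hh0
  · have := hermite_basis_dvd (s := S) (j := j) (n := n) 
      (nv_inverse (.var (τ := .nat) p) (.var (τ := .nat) q) (.var (τ := .nat) ut.nv) R hp hR hqR hpu).2 hu
    refine ⟨this.1, fun k hk hkj => this.2 k ?_⟩
    exact Finset.mem_erase.mpr ⟨hkj, Finset.mem_range.mpr hk⟩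

/-- Hermite interpolation recovers the polynomial that satisfies the given congruences. -/
theorem hermite_spec {l n : ℕ} {ds : List (List ℕ)} {D b : ℕ → (ZMod q)[X]} {g : List ℕ}
    {bs : Tm Ty.den Proc (.list (.list .nat))} {A : (ZMod q)[X]} (hq : Nat.size q ≤ B ^ 1)
    (hq1 : 1 < q) (hl : l ≤ B ^ 1) (hn : n ≤ B ^ 1)
    (hD : ∀ j < l, PolyOk B 0 q (1 + B ^ 5) (.var (τ := .list .nat) (ds.getD j [])) (D j))
    (hb : ∀ j < l, PolyOk B 10 q n (get bs (.var (τ := .nat) j)) (b j))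
    (hg : PolyOk B 0 q (B ^ 4) (.var (τ := .list .nat) g)
      (∏ k ∈ Finset.range l, (X - C (k : ZMod q)) ^ n))
    (hu : ∀ j < l, ∀ k < l, j ≠ k → IsUnit ((j : ZMod q) - (k : ZMod q)))
    (h1 : ∀ j < l, (X - C (j : ZMod q)) ^ n ∣ D j - 1)
    (h0 : ∀ j < l, ∀ k < l, k ≠ j → (X - C (k : ZMod q)) ^ n ∣ D j)
    (hA : ∀ j < l, (X - C (j : ZMod q)) ^ n ∣ A - b j) (hAd : A.degree < (l * n : ℕ)) :
    PolyOk B 70 q (l * n) (hermite (.var (τ := .nat) q) (.var (τ := .nat) l) (.var (τ := .nat) n)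
      (.var (τ := .list (.list .nat)) ds) (.var (τ := .list .nat) g) bs) A ∧
    ∀ x ∈ (show List ℕ from (hermite (.var (τ := .nat) q) (.var (τ := .nat) l) (.var (τ := .nat) n)
      (.var (τ := .list (.list .nat)) ds) (.var (τ := .list .nat) g) bs).val), x < q := by
  have hq0 : 0 < q := by omega
  have : Nontrivial (ZMod q) := ZMod.nontrivial_iff.mpr (by omega)
  have hqv : Ok B 1 0 (.var (τ := .nat) q : Tm Ty.den Proc .nat) := Ok.var hq
  have hlv : Ok B 1 0 (.var (τ := .nat) l : Tm Ty.den Proc .nat) := Ok.var ((size_self_le l).trans hl)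
  have hnv : Ok B 1 0 (.var (τ := .nat) n : Tm Ty.den Proc .nat) := Ok.var ((size_self_le n).trans hn)
  have hln : l * n ≤ B ^ 2 := (Nat.mul_le_mul hl hn).trans_eq (by rw [← pow_add])
  have hlnv : Ok B 6 10 (.var (τ := .nat) l * .var (τ := .nat) n : Tm Ty.den Proc .nat) :=
    (hlv.mul hnv).mono (by decide) (by decide)
  set G := ∏ k ∈ Finset.range l, (X - C (k : ZMod q)) ^ n with hG
  have hGm : G.Monic := monic_prod_X_sub_C_pow _ _
  refine ⟨?_, ?_⟩
  -- Each summand is reduced on its own, so the loop invariant is a partial sum of remainders; all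
  -- of them have length `l * n`.
  · rw [← sum_modByMonic_eq_of_congruences hu h1 h0 hA hAd]
    refine (PolyOk.loop (k := 20) (l := 60) (j := 1) (fun _ => l * n)
      (fun i => ∑ j ∈ Finset.range i, (D j * b j) %ₘ G) (by simp [one_le_pow_base]) hl ?_
      fun i hi s hs => ?_).mono (by decide) le_rfl
    · refine ⟨((Ok.tab (j₁ := 2) (j := 1) (l := 1) hlnv hln fun _ _ => Ok.ofNat 0).mono le_rfl
        (by decide : _ ≤ 20)).cost, ?_, ?_, ?_⟩
      · rw [val_tab, List.length_map, List.length_range]; exact le_rfl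
      · intro x hx
        rw [val_tab] at hx
        obtain ⟨k, hk, rfl⟩ := List.mem_map.mp hx
        exact Nat.zero_le _
      · rw [val_tab, Finset.range_zero, Finset.sum_empty]
        exact toPoly_map_range (fun k _ => by simp) fun k _ => by simp
    · have hi : i < l := hi
      have hd : PolyOk B 1 q (1 + B ^ 5) (get (.var (τ := .list (.list .nat)) ds)
          (.var (τ := .nat) i)) (D i) :=
        ⟨by rw [cost_get, cost_var, cost_var, pow_one]; have := hB.out; omega, (hD i hi).len,
          (hD i hi).le, (hD i hi).poly⟩
      have hB6 : 1 + B ^ 5 + n ≤ B ^ 6 := by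
        have := eight_mul_pow_le (B := B) 5
        have := one_le_pow_base (B := B) 5
        have := pow_mono_exp (B := B) (show 1 ≤ 5 by decide)
        simp only [Nat.reduceAdd] at *
        omega
      obtain ⟨hr, hrl⟩ := (hd.mul hq hq0 (hb i hi) hB6).rem hq hq1 hg hlnv
        (hln.trans (pow_mono_exp (by decide))) hB6 hGm (natDegree_prod_X_sub_C_pow _ _)
      refine PolyOk.share (l := 59) hr.cost (by decide) ?_
      rw [Finset.sum_range_succ]
      have hr0 := hr.to_var rfl
      generalize Tm.val _ = h at hr0 ⊢
      have hs1 := hs.ok hq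
      have hr1 := hr0.ok hq
      refine ⟨?_, ?_, ?_, ?_⟩
      · exact ((Ok.tab (j₁ := 2) (j := 1) (l := 20) hlnv hln fun x _ =>
          (((hs1.get_var x).add (hr1.get_var x)).mod_pos hqv hq0).mono le_rfl (by decide)).mono le_rfl
          (by decide : _ ≤ 59)).cost
      · rw [val_tab, List.length_map, List.length_range]; exact le_rfl
      · intro x hx
        rw [val_tab] at hx
        obtain ⟨k, hk, rfl⟩ := List.mem_map.mp hx
        exact (Nat.mod_lt _ hq0).le
      · rw [val_tab]
        refine toPoly_map_range (fun k _ => ?_) fun k hk => ?_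
        · rw [val_eq_nv, nv_mod, nv_add, nv_get, nv_get, nv_var, nv_var, ZMod.natCast_mod, Nat.cast_add,
            coeff_add, ← hs.poly, ← hr0.poly, coeff_toPoly, coeff_toPoly]
        · rw [coeff_add, ← hs.poly, ← hr0.poly, coeff_toPoly_of_length_le (hs.len.trans hk),
            coeff_toPoly_of_length_le (hr0.len.trans hk), add_zero]
  · refine loop_val (τ := .list .nat) (fun _ (s : List ℕ) => ∀ x ∈ s, x < q) ?_ ?_
    · intro x hx
      rw [val_tab] at hx
      obtain ⟨k, hk, rfl⟩ := List.mem_map.mp hx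
      exact hq0
    · intro i _ s _ x hx
      rw [val_share, val_tab] at hx
      obtain ⟨k, hk, rfl⟩ := List.mem_map.mp hx
      exact Nat.mod_lt _ hq0

end

end MME

namespace MME

open Polynomial

variable {B : ℕ} [hB : Fact (8 ≤ B)] {q : ℕ}

/-! ## The prime and its power -/

-- Bertrand's postulate ensures that the search succeeds. The state `0` means that no prime has been
-- found yet, which is unambiguous since `0` is not prime.
omit hB in
theorem nv_primeAbove (l : ℕ) (hl : 1 ≤ l) :
    (primeAbove (.var (τ := .nat) l)).nv.Prime ∧ l ≤ (primeAbove (.var (τ := .nat) l)).nv ∧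
      (primeAbove (.var (τ := .nat) l)).nv ≤ 2 * l := by
  have h := loop_nv (n := .var (τ := .nat) l + 1) (x := 0)
    (b := fun i s => MME.cond s s
      (MME.cond (isPrime (.var (τ := .nat) l + i)) (.var (τ := .nat) l + i) 0))
    (fun i s => (s.Prime ∧ l ≤ s ∧ s ≤ 2 * l) ∨ (s = 0 ∧ ∀ j < i, ¬ (l + j).Prime))
    (Or.inr ⟨rfl, by simp⟩) ?_
  · rcases h with h | ⟨-, h⟩
    · exact h
    · exfalso
      rcases hl.eq_or_lt with rfl | hl
      · exact h 1 (by simp) (by norm_num)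
      · obtain ⟨p, hp, h1, h2⟩ := Nat.exists_prime_lt_and_le_two_mul l (by omega)
        refine h (p - l) (by simp; omega) ?_
        rwa [Nat.add_sub_cancel' h1.le]
  · intro i hi s hs
    simp only [nv_add, nv_var, nv_one] at hi
    rw [nv_cond, nv_cond, nv_isPrime]
    simp only [nv_add, nv_var, nv_zero]
    rcases hs with hs | ⟨rfl, hs⟩
    · rw [if_pos hs.1.ne_zero]; exact Or.inl hs
    · rw [if_neg (by simp)]
      by_cases hp : (l + i).Prime
      · rw [if_pos (by simp [hp])]
        exact Or.inl ⟨hp, by omega, by omega⟩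
      · rw [if_neg (by simp [hp])]
        refine Or.inr ⟨rfl, fun j hj => ?_⟩
        rcases (Nat.lt_succ_iff_lt_or_eq.mp hj) with hj | rfl
        · exact hs j hj
        · exact hp

theorem Ok.primeAbove {l : ℕ} (hl1 : 1 ≤ l) (hl : 2 * l ≤ B ^ 1) :
    Ok B 1 30 (primeAbove (.var (τ := .nat) l)) := by
  have hlv : Ok B 1 0 (.var (τ := .nat) l : Tm Ty.den Proc .nat) :=
    Ok.var ((size_self_le l).trans (by omega))
  have hp := nv_primeAbove l hl1
  refine ⟨(size_self_le _).trans (hp.2.2.trans hl), ?_⟩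
  refine Ok.cost (B := B) (i := 2) ?_
  refine (Ok.loop (j₁ := 2) (j := 2) (l := 20) (hlv.add (Ok.ofNat 1)) ?_ (Ok.ofNat 0)
    (fun _ s => Bd (B ^ 2) .nat s) (by change Nat.size 0 ≤ _; simp) ?_ fun _ h => h).mono le_rfl
    (by decide)
  · simp only [nv_add, nv_var, nv_one]
    have := succ_pow_le (B := B) 1
    simp only [Nat.reduceAdd] at *
    omega
  · intro i hi s hs
    simp only [nv_add, nv_var, nv_one] at hi
    have hli : l + i ≤ B ^ 1 := by omega
    have hiv : Ok B 1 0 (.var (τ := .nat) i : Tm Ty.den Proc .nat) :=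
      Ok.var ((size_self_le i).trans (by omega))
    have hsv : Ok B 2 0 (.var (τ := .nat) s : Tm Ty.den Proc .nat) := Ok.var hs
    have h := hlv.add hiv
    have := hsv.cond (fun _ => hsv) fun _ =>
      (h.isPrime (j := 1) hli).cond (fun _ => h) fun _ => Ok.ofNat 0
    exact ⟨(this.mono (by decide) le_rfl).bd, (this.mono le_rfl (by decide)).cost⟩

-- The state is multiplied by `p ≥ 2` only while it is below `x`. Hence `size x` passes suffice to
-- reach `x`, and the result stays below `p * x`. The exponent is positive because `x ≥ 2`.
omit hB in
theorem nv_powerAbove {p x : ℕ} {xt : Tm Ty.den Proc .nat} (hv : xt.nv = x) (hp : 2 ≤ p)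
    (hx : 2 ≤ x) :
    ∃ n, n ≠ 0 ∧ (powerAbove (.var (τ := .nat) p) xt).nv = p ^ n ∧ x ≤ p ^ n ∧ p ^ n < p * x := by
  have h := loop_nv (n := size xt) (x := 1)
    (b := fun _ s => MME.cond (lt s xt) (s * .var (τ := .nat) p) s)
    (fun i s => ∃ n, s = p ^ n ∧ p ^ n < p * x ∧ (x ≤ p ^ n ∨ n = i))
    ⟨0, rfl, by nlinarith, Or.inr rfl⟩ ?_
  · obtain ⟨n, h1, h2, h3⟩ := h
    have hxn : x ≤ p ^ n := by
      rcases h3 with h3 | h3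
      · exact h3
      · rw [h3, nv_size, hv]
        exact (Nat.lt_size_self x).le.trans (Nat.pow_le_pow_left hp _)
    refine ⟨n, ?_, h1, hxn, h2⟩
    rintro rfl
    rw [pow_zero] at hxn
    omega
  · rintro i hi s ⟨n, rfl, h2, h3⟩
    rw [nv_cond]
    simp only [nv_lt, nv_var, nv_mul, hv]
    by_cases hlt : p ^ n < x
    · rw [if_pos (by simp [hlt])]
      refine ⟨n + 1, (pow_succ _ _).symm, ?_, Or.inr ?_⟩
      · rw [pow_succ, mul_comm]; exact Nat.mul_lt_mul_of_pos_left hlt (by omega)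
      · rcases h3 with h3 | h3 <;> omega
    · rw [if_neg (by simp [hlt])]
      exact ⟨n, rfl, h2, Or.inl (by omega)⟩

theorem Ok.powerAbove {p x : ℕ} {xt : Tm Ty.den Proc .nat} (hxt : Ok B 1 12 xt) (hv : xt.nv = x)
    (hx : 2 ≤ x) (h : Nat.size (p * x) ≤ B ^ 1) :
    Ok B 1 30 (powerAbove (.var (τ := .nat) p) xt) := by
  have hpv : Ok B 1 0 (.var (τ := .nat) p : Tm Ty.den Proc .nat) :=
    Ok.var ((Nat.size_le_size (Nat.le_mul_of_pos_right _ (by omega))).trans h)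
  refine (Ok.loop (j₁ := 1) (j := 1) (l := 20) hxt.size ?_ (Ok.ofNat 1)
    (fun _ s => Bd (B ^ 1) .nat s) (one_size_le _) ?_ fun _ h => h).mono le_rfl (by decide)
  · rw [nv_size]; exact hxt.bd
  · intro i hi s hs
    have hsv : Ok B 1 0 (.var (τ := .nat) s : Tm Ty.den Proc .nat) := Ok.var hs
    refine ⟨?_, ?_⟩
    · rw [val_cond]
      split_ifs with h0
      · refine (Nat.size_le_size (?_ : s * p ≤ p * x)).trans h
        rw [mul_comm]
        refine Nat.mul_le_mul_left _ ?_
        by_contra hlt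
        exact h0 (by rw [nv_lt, hv]; exact if_neg (by simp only [nv_var]; omega))
      · exact hs
    · exact (((hsv.lt hxt).cond (fun _ => hsv.mul hpv) fun _ => hsv).mono (j := 2) (by decide)
        (by decide : _ ≤ 20)).cost

/-! ## Taylor's formula modulo a power of `z - j` -/

theorem mul_modByMonic_mod {R : Type*} [CommRing R] (p D L : R[X]) :
    ((p %ₘ L) * D) %ₘ L = (p * D) %ₘ L := by
  by_cases hL : L.Monic
  · rw [modByMonic_eq_of_dvd_sub hL]
    rw [← sub_mul]
    refine Dvd.dvd.mul_right ⟨-(p /ₘ L), ?_⟩ _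
    have := modByMonic_add_div p L
    linear_combination this
  -- For a divisor that is not monic, `%ₘ` returns the dividend, so the identity persists.
  · rw [modByMonic_eq_of_not_monic _ hL, modByMonic_eq_of_not_monic _ hL,
      modByMonic_eq_of_not_monic _ hL]

/-- `z ^ u * ∏ c, D_c ^ v_c` modulo `lj`. -/
def powRem (m q : Tm Ty.den Proc .nat) (v : Tm Ty.den Proc (.list .nat))
    (diff : Tm Ty.den Proc (.list (.list .nat))) (lj : Tm Ty.den Proc (.list .nat))
    (u : Tm Ty.den Proc .nat) : Tm Ty.den Proc (.list .nat) :=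
  MME.loop m (polyRem q (tab (u + 1) fun i => eq i u) lj m) fun c h =>
    MME.loop (get v c) h fun _ h => polyRem q (polyMul q h (get diff c)) lj m

/-- Reducing after each multiplication keeps the length at `m`, and by `mul_modByMonic_mod` it does
not affect the final remainder. -/
theorem PolyOk.powRem {m e u : ℕ} {v : Tm Ty.den Proc (.list .nat)} {w : List ℕ}
    {diff : List (List ℕ)} {lj : Tm Ty.den Proc (.list .nat)} {D : ℕ → (ZMod q)[X]} {L : (ZMod q)[X]}
    (hq : Nat.size q ≤ B ^ 1) (hq1 : 1 < q) (hm : m ≤ B ^ 1) (he : e ≤ B ^ 1) (hu : u < e)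
    (hw : v.val = w) (hv : v.cost ≤ B ^ 5) (hvm : ∀ c, w.getD c 0 ≤ B ^ 1)
    (hD : ∀ c < m, PolyOk B 0 q e (.var (τ := .list .nat) (diff.getD c [])) (D c))
    (hlj : PolyOk B 2 q (1 + 2 * m) lj L) (hL : L.Monic)
    (hLm : L.natDegree = m) :
    PolyOk B 70 q m (powRem (.var (τ := .nat) m) (.var (τ := .nat) q) v
      (.var (τ := .list (.list .nat)) diff) lj (.var (τ := .nat) u))
      ((X ^ u * ∏ c ∈ Finset.range m, D c ^ w.getD c 0) %ₘ L) := by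
  have hq0 : 0 < q := by omega
  have hmv : Ok B 1 0 (.var (τ := .nat) m : Tm Ty.den Proc .nat) := Ok.var ((size_self_le m).trans hm)
  have huv : Ok B 1 0 (.var (τ := .nat) u : Tm Ty.den Proc .nat) := Ok.var (Bd.index hu he)
  have hmB : m + e ≤ B ^ 6 := by
    have := eight_mul_pow_le (B := B) 1
    have := pow_mono_exp (B := B) (show 2 ≤ 6 by decide)
    simp only [Nat.reduceAdd] at *
    omega
  have hX : PolyOk B 10 q e (tab (.var (τ := .nat) u + 1) fun i => eq i (.var (τ := .nat) u))
      (X ^ u) := by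
    have hu1 : (.var (τ := .nat) u + 1 : Tm Ty.den Proc .nat).nv = u + 1 := by simp
    refine ⟨?_, ?_, ?_, ?_⟩
    · refine ((Ok.tab (j₁ := 2) (j := 0) (l := 3) (huv.add (Ok.ofNat 1)) ?_ fun n hn => ?_).mono le_rfl
        (by decide : _ ≤ 10)).cost
      · rw [hu1]; exact (by omega : u + 1 ≤ B ^ 1).trans (pow_mono_exp (by decide))
      · rw [hu1] at hn
        exact Ok.eq (Ok.var (i := 1) (Bd.index (by omega : n < e) he)) huv
    · rw [val_tab, List.length_map, List.length_range, hu1]; omega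
    · intro x hx
      rw [val_tab] at hx
      obtain ⟨k, hk, rfl⟩ := List.mem_map.mp hx
      rw [val_eq_nv, nv_eq]
      split_ifs <;> omega
    · rw [val_tab]
      refine toPoly_map_range (fun k _ => ?_) fun k hk => ?_
      · rw [val_eq_nv, nv_eq, coeff_X_pow]
        simp only [nv_var]
        split_ifs <;> simp
      · rw [hu1] at hk
        rw [coeff_X_pow, if_neg (by omega)]
  have hm6 : m ≤ B ^ 6 := by omega
  have hmv6 : Ok B 6 10 (.var (τ := .nat) m : Tm Ty.den Proc .nat) := hmv.mono (by decide) (by decide)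
  refine (PolyOk.loop (k := 53) (l := 60) (j := 1) (fun _ => m)
    (fun i => (X ^ u * ∏ c ∈ Finset.range i, D c ^ w.getD c 0) %ₘ L) (by simp [one_le_pow_base]) hm ?_
    fun c hc s hs => ?_).mono (by decide) le_rfl
  · rw [Finset.prod_range_zero, mul_one]
    exact (hX.rem hq hq1 hlj hmv6 hm6 (by omega) hL hLm).1.mono (by decide) le_rfl
  · have hc : c < m := hc
    have hget : (get v (.var (τ := .nat) c)).nv = w.getD c 0 := by rw [nv_get, hw, nv_var]
    have hd : PolyOk B 1 q e (get (.var (τ := .list (.list .nat)) diff) (.var (τ := .nat) c)) (D c) :=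
      ⟨by rw [cost_get, cost_var, cost_var, pow_one]; have := hB.out; omega, (hD c hc).len,
        (hD c hc).le, (hD c hc).poly⟩
    have := PolyOk.loop (q := q) (k := 7) (l := 57) (j := 1) (B := B) (cnt := get v (.var (τ := .nat) c))
      (x := .var (τ := .list .nat) s)
      (b := fun _ h => polyRem (.var (τ := .nat) q) (polyMul (.var (τ := .nat) q) h
        (get (.var (τ := .list (.list .nat)) diff) (.var (τ := .nat) c)))
        lj (.var (τ := .nat) m)) (fun _ => m)
      (fun i => ((X ^ u * ∏ c ∈ Finset.range c, D c ^ w.getD c 0) * D c ^ i) %ₘ L) ?_ ?_ ?_ ?_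
    · rw [hget] at this
      rw [Finset.prod_range_succ, ← mul_assoc]
      exact this
    · rw [cost_get, cost_var]
      have := succ_pow_le (B := B) 5
      have := succ_pow_le (B := B) 6
      simp only [Nat.reduceAdd] at *
      omega
    · rw [hget]; exact hvm c
    · rw [pow_zero, mul_one]; exact hs.mono (by decide) le_rfl
    · intro i _ s hs
      have := ((hs.mul hq hq0 hd hmB).rem hq hq1 hlj hmv6 hm6 hmB hL hLm).1
      rw [mul_modByMonic_mod, mul_assoc, ← pow_succ] at this
      exact this.mono (by decide) le_rfl

end MME

/-! ### The program `taylorPoly`: differences, single summands, double loop. -/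

namespace MME

open Polynomial

variable {B : ℕ} [hB : Fact (8 ≤ B)] {q : ℕ}

omit hB in
theorem cost_share_le {σ τ : Ty} {a : Tm Ty.den Proc σ} {b : Tm Ty.den Proc σ → Tm Ty.den Proc τ}
    {x y : ℕ} (ha : a.cost ≤ x) (hb : (b (.var a.val)).cost ≤ y) : (share a b).cost ≤ x + y + 1 := by
  rw [cost_share]; omega

/-- The subtracted number changes only the constant coefficient; that coefficient exists because `e
> 0`. -/
theorem taylorPoly_diff {m e : ℕ} {a : Tm Ty.den Proc (.list (.list .nat))} {b : Tm Ty.den Proc (.list .nat)}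
    {a' : List (List ℕ)} {b' : List ℕ} {A : ℕ → (ZMod q)[X]}
    (hq : Nat.size q ≤ B ^ 1) (hq0 : 0 < q) (hm : m ≤ B ^ 1) (he : e ≤ B ^ 1) (he0 : 0 < e)
    (haa : a.val = a') (hbb : b.val = b') (hac : a.cost ≤ B ^ 2) (hbc : b.cost ≤ B ^ 2)
    (ha : ∀ c < m, (a'.getD c []).length = e ∧ (∀ x ∈ a'.getD c [], x < q) ∧
      toPoly q (a'.getD c []) = A c) (hb : ∀ c < m, b'.getD c 0 < q)
    {diff : Tm Ty.den Proc (.list (.list .nat))}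
    (hdiff : diff = MME.tab (.var (τ := .nat) m) fun c => MME.tab (.var (τ := .nat) e) fun k =>
      MME.cond (eq k 0) ((get (get a c) k
        + (.var (τ := .nat) q - get b c)) % .var (τ := .nat) q)
        (get (get a c) k)) :
    diff.cost ≤ B ^ 30 ∧ ∀ c < m, PolyOk B 0 q e
      (.var (τ := .list .nat) (List.getD (α := List ℕ) diff.val c [])) (A c - C (b'.getD c 0 : ZMod q)) := by
  subst hdiff
  have hmv : Ok B 1 0 (.var (τ := .nat) m : Tm Ty.den Proc .nat) := Ok.var ((size_self_le m).trans hm)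
  have hev : Ok B 1 0 (.var (τ := .nat) e : Tm Ty.den Proc .nat) := Ok.var ((size_self_le e).trans he)
  have hqv : Ok B 1 0 (.var (τ := .nat) q : Tm Ty.den Proc .nat) := Ok.var hq
  have ha1 : ∀ c < m, ∀ k, (a'.getD c []).getD k 0 ≤ q := fun c hc k => by
    by_cases hk : k < (a'.getD c []).length
    · rw [List.getD_eq_getElem _ _ hk]; exact ((ha c hc).2.1 _ (List.getElem_mem hk)).le
    · rw [List.getD_eq_default _ _ (by omega)]; exact Nat.zero_le _
  refine ⟨?_, ?_⟩
  · refine ((Ok.tab (j₁ := 1) (j := 1) (l := 20) hmv hm fun c hc => ?_).mono le_rfl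
      (by decide : _ ≤ 30)).cost
    have hc : c < m := hc
    refine (Ok.tab (j₁ := 1) (j := 1) (l := 15) hev he fun k hk => ?_).mono le_rfl (by decide)
    have hk : k < e := hk
    have hkv : Ok B 1 0 (.var (τ := .nat) k : Tm Ty.den Proc .nat) := Ok.var (Bd.index hk he)
    have hcv : Ok B 1 0 (.var (τ := .nat) c : Tm Ty.den Proc .nat) := Ok.var (Bd.index hc hm)
    have h1 : Ok B 1 4 (get (get a (.var (τ := .nat) c))
        (.var (τ := .nat) k)) := by
      refine ⟨?_, ?_⟩
      · rw [val_eq_nv, nv_get, val_get, haa]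
        exact (Nat.size_le_size (ha1 c hc k)).trans hq
      · rw [cost_get, cost_get, cost_var, cost_var]
        have := eight_mul_pow_le (B := B) 2
        have := eight_mul_pow_le (B := B) 3
        have := one_le_pow_base (B := B) 2
        simp only [Nat.reduceAdd] at *
        omega
    have h2 : Ok B 1 4 (get b (.var (τ := .nat) c)) := by
      refine ⟨?_, ?_⟩
      · rw [val_eq_nv, nv_get, hbb]
        exact (Nat.size_le_size (hb c hc).le).trans hq
      · rw [cost_get, cost_var]
        have := eight_mul_pow_le (B := B) 2
        have := eight_mul_pow_le (B := B) 3
        have := one_le_pow_base (B := B) 2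
        simp only [Nat.reduceAdd] at *
        omega
    exact ((Ok.eq hkv (Ok.ofNat 0)).cond (fun _ => (h1.add (hqv.sub h2)).mod_pos hqv hq0)
      fun _ => h1).mono (by decide) (by decide)
  · intro c hc
    have hval : List.getD (α := List ℕ) (Tm.val (MME.tab (.var (τ := .nat) m) fun c =>
        MME.tab (.var (τ := .nat) e) fun k =>
        MME.cond (eq k 0) ((get (get a c) k
          + (.var (τ := .nat) q - get b c)) % .var (τ := .nat) q)
          (get (get a c) k))) c [] =
        (List.range e).map fun k => if k = 0 then ((a'.getD c []).getD k 0 + (q - b'.getD c 0)) % q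
          else (a'.getD c []).getD k 0 := by
      refine Eq.trans (getD_tab (τ := .list .nat) (x := []) (n := .var (τ := .nat) m) hc) ?_
      rw [val_tab]
      refine List.map_congr_left fun k _ => ?_
      rw [val_eq_nv, nv_cond, nv_mod, nv_add, nv_sub, nv_get, nv_get, val_get, haa, hbb]
      by_cases hk : k = 0
      · rw [if_pos (by simp [hk]), if_pos hk]; rfl
      · rw [if_neg (by simp [hk]), if_neg hk]; rfl
    rw [hval]
    refine ⟨by simp, by simp, ?_, ?_⟩
    · intro x hx
      obtain ⟨k, hk, rfl⟩ := List.mem_map.mp (show x ∈ List.map _ _ from hx)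
      split_ifs
      · exact (Nat.mod_lt _ hq0).le
      · exact ha1 c hc k
    · rw [val_var]
      refine toPoly_map_range (fun k _ => ?_) fun k hk => ?_
      · rw [coeff_sub, ← (ha c hc).2.2, coeff_toPoly, coeff_C]
        split_ifs
        · rw [ZMod.natCast_mod, Nat.cast_add, Nat.cast_sub (hb c hc).le, ZMod.natCast_self]
          ring
        · rw [sub_zero]
      · rw [coeff_sub, ← (ha c hc).2.2, coeff_toPoly_of_length_le (by rw [(ha c hc).1]; exact hk),
          coeff_C, if_neg (by omega), sub_zero]

/-- One summand in the program `taylorPoly`. -/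
def taylorTerm (m q : Tm Ty.den Proc .nat) (y : Tm Ty.den Proc .nat)
    (v : Tm Ty.den Proc (.list .nat)) (diff : Tm Ty.den Proc (.list (.list .nat)))
    (lj : Tm Ty.den Proc (.list .nat)) (u : Tm Ty.den Proc .nat) (s : Tm Ty.den Proc (.list .nat)) :
    Tm Ty.den Proc (.list .nat) :=
  share y fun y => share (powRem m q v diff lj u) fun h =>
    MME.tab m fun x => (get s x + y * get h x) % q

theorem PolyOk.taylorTerm {m e u : ℕ} {v : Tm Ty.den Proc (.list .nat)} {w : List ℕ}
    {diff : List (List ℕ)} {lj : Tm Ty.den Proc (.list .nat)} {D : ℕ → (ZMod q)[X]}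
    {L P : (ZMod q)[X]} {y : Tm Ty.den Proc .nat} {s : List ℕ}
    (hq : Nat.size q ≤ B ^ 1) (hq1 : 1 < q) (hm : m ≤ B ^ 1) (he : e ≤ B ^ 1) (hu : u < e)
    (hw : v.val = w) (hv : v.cost ≤ B ^ 5) (hvm : ∀ c, w.getD c 0 ≤ B ^ 1)
    (hD : ∀ c < m, PolyOk B 0 q e (.var (τ := .list .nat) (diff.getD c [])) (D c))
    (hlj : PolyOk B 2 q (1 + 2 * m) lj L) (hL : L.Monic) (hLm : L.natDegree = m)
    (hy : Ok B 1 10 y) (hs : PolyOk B 0 q m (.var (τ := .list .nat) s) P) :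
    PolyOk B 75 q m (taylorTerm (.var (τ := .nat) m) (.var (τ := .nat) q) y v
      (.var (τ := .list (.list .nat)) diff) lj (.var (τ := .nat) u) (.var (τ := .list .nat) s))
      (P + C (y.nv : ZMod q) *
        ((X ^ u * ∏ c ∈ Finset.range m, D c ^ w.getD c 0) %ₘ L)) := by
  have hq0 : 0 < q := by omega
  have hmv : Ok B 1 0 (.var (τ := .nat) m : Tm Ty.den Proc .nat) := Ok.var ((size_self_le m).trans hm)
  have hqv : Ok B 1 0 (.var (τ := .nat) q : Tm Ty.den Proc .nat) := Ok.var hq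
  have hR := PolyOk.powRem hq hq1 hm he hu hw hv hvm hD hlj hL hLm
  refine PolyOk.share (l := 74) hy.cost (by decide) ?_
  have hyv : Ok B 1 0 (.var (τ := .nat) y.nv : Tm Ty.den Proc .nat) := Ok.var hy.bd
  refine PolyOk.share (l := 73) hR.cost (by decide) ?_
  have hr0 := hR.to_var rfl
  generalize (X ^ u * ∏ c ∈ Finset.range m, D c ^ w.getD c 0) %ₘ L = R at hr0 ⊢
  have hs1 := hs.ok hq
  have hr1 := hr0.ok hq
  refine ⟨?_, ?_, ?_, ?_⟩
  · exact ((Ok.tab (j₁ := 1) (j := 1) (l := 20) hmv hm fun x _ =>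
      (((hs1.get_var x).add (hyv.mul (hr1.get_var x))).mod_pos hqv hq0).mono le_rfl
        (by decide)).mono le_rfl (by decide : _ ≤ 73)).cost
  · rw [val_tab, List.length_map, List.length_range]; exact le_rfl
  · intro x hx
    rw [val_tab] at hx
    obtain ⟨k, hk, rfl⟩ := List.mem_map.mp hx
    exact (Nat.mod_lt _ hq0).le
  · rw [val_tab]
    refine toPoly_map_range (fun k _ => ?_) fun k hk => ?_
    · rw [val_eq_nv, nv_mod, nv_add, nv_mul, nv_get, nv_get, nv_var, nv_var, nv_var, ZMod.natCast_mod,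
        Nat.cast_add, Nat.cast_mul, coeff_add, coeff_C_mul, ← hs.poly, ← hr0.poly, coeff_toPoly,
        coeff_toPoly]
      rfl
    · rw [coeff_add, coeff_C_mul, ← hs.poly, ← hr0.poly, coeff_toPoly_of_length_le (hs.len.trans hk),
        coeff_toPoly_of_length_le (hr0.len.trans hk), mul_zero, add_zero]

/-- The inner loop over the exponent vectors is the source of the weight `W`; the outer loop over `u
< e` only costs a power of `B`. -/
theorem taylorPoly_loop {m e : ℕ} {vs : List (List ℕ)} {diff : List (List ℕ)}
    {lj : Tm Ty.den Proc (.list .nat)} {D : ℕ → (ZMod q)[X]} {L : (ZMod q)[X]}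
    {Y : ℕ → ℕ → ZMod q} {W : ℕ}
    {y : Tm Ty.den Proc .nat → Tm Ty.den Proc .nat → Tm Ty.den Proc .nat}
    (hq : Nat.size q ≤ B ^ 1) (hq1 : 1 < q) (hm : m ≤ B ^ 1) (he : e ≤ B ^ 1)
    (hvs : ∀ k < vs.length, ∀ c, (vs.getD k []).getD c 0 ≤ B ^ 1) (hW : vs.length ≤ W) (hW0 : 1 ≤ W)
    (hy : ∀ u < e, ∀ k < vs.length, Ok B 1 10 (y (.var (τ := .nat) u) (.var (τ := .nat) k)) ∧
      ((y (.var (τ := .nat) u) (.var (τ := .nat) k)).nv : ZMod q) = Y u k)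
    (hD : ∀ c < m, PolyOk B 0 q e (.var (τ := .list .nat) (diff.getD c [])) (D c))
    (hlj : PolyOk B 2 q (1 + 2 * m) lj L) (hL : L.Monic) (hLm : L.natDegree = m)
    {t : Tm Ty.den Proc (.list .nat)}
    (ht : t = MME.loop (.var (τ := .nat) e) (MME.tab (.var (τ := .nat) m) fun _ => 0) fun u s =>
      MME.loop (MME.len (.var (τ := .list (.list .nat)) vs)) s fun k s =>
        taylorTerm (.var (τ := .nat) m) (.var (τ := .nat) q) (y u k)
          (get (.var (τ := .list (.list .nat)) vs) k) (.var (τ := .list (.list .nat)) diff) lj u s) :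
    t.cost ≤ W * B ^ 80 ∧ PolyOk B 0 q m (.var (τ := .list .nat) t.val)
      (∑ u ∈ Finset.range e, ∑ k ∈ Finset.range vs.length, C (Y u k) *
        ((X ^ u * ∏ c ∈ Finset.range m, D c ^ (vs.getD k []).getD c 0) %ₘ L)) := by
  subst ht
  have hmv : Ok B 1 0 (.var (τ := .nat) m : Tm Ty.den Proc .nat) := Ok.var ((size_self_le m).trans hm)
  set T : ℕ → ℕ → (ZMod q)[X] := fun u k => C (Y u k) *
    ((X ^ u * ∏ c ∈ Finset.range m, D c ^ (vs.getD k []).getD c 0) %ₘ L) with hT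
  have h0 : Ok B 1 20 (MME.tab (.var (τ := .nat) m) fun _ => 0) :=
    (Ok.tab (j₁ := 1) (j := 1) (l := 1) hmv hm fun _ _ => Ok.ofNat 0).mono le_rfl (by decide)
  have hw1 := Nat.mul_le_mul_right (B ^ 75) hW0
  have key := loop_spec (n := .var (τ := .nat) e) (x := MME.tab (.var (τ := .nat) m) fun _ => 0)
    (b := fun u s => MME.loop (MME.len (.var (τ := .list (.list .nat)) vs)) s fun k s =>
        taylorTerm (.var (τ := .nat) m) (.var (τ := .nat) q) (y u k)
          (get (.var (τ := .list (.list .nat)) vs) k) (.var (τ := .list (.list .nat)) diff) lj u s)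
    (c := W * B ^ 77)
    (fun u (s : List ℕ) => PolyOk B 0 q m (.var (τ := .list .nat) s)
      (∑ u ∈ Finset.range u, ∑ k ∈ Finset.range vs.length, T u k)) ?_ ?_
  · refine ⟨key.2.trans ?_, key.1⟩
    rw [cost_var, nv_var]
    have h1 := h0.cost.trans (pow_mono_exp (show 20 ≤ 75 by decide))
    have h2 : e * (W * B ^ 77 + 1) ≤ B ^ 1 * (2 * (W * B ^ 77)) := by
      refine Nat.mul_le_mul he ?_
      have := Nat.mul_le_mul_right (B ^ 77) hW0
      have := one_le_pow_base (B := B) 77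
      omega
    have h3 : B ^ 1 * (2 * (W * B ^ 77)) = 2 * (W * B ^ 78) := by ring
    have h4 := Nat.mul_le_mul_left W (eight_mul_pow_le (B := B) 78)
    have h5 := Nat.mul_le_mul_left W (eight_mul_pow_le (B := B) 79)
    have h6 := Nat.mul_le_mul_left W (pow_mono_exp (B := B) (show 75 ≤ 78 by decide))
    have h7 : W * (8 * B ^ 78) = 8 * (W * B ^ 78) := by ring
    have h8 : W * (8 * B ^ 79) = 8 * (W * B ^ 79) := by ring
    have h9 := one_le_pow_base (B := B) 75
    simp only [Nat.reduceAdd] at *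
    omega
  · rw [Finset.sum_range_zero]
    refine ⟨by simp, ?_, ?_, ?_⟩
    · rw [val_var, val_tab, List.length_map, List.length_range]; exact le_rfl
    · intro x hx
      rw [val_var, val_tab] at hx
      obtain ⟨k, hk, rfl⟩ := List.mem_map.mp hx
      exact Nat.zero_le _
    · rw [val_var, val_tab]
      exact toPoly_map_range (fun k _ => by simp) fun k _ => by simp
  · intro u hu s hs
    have hu : u < e := hu
    have inner := loop_spec (n := MME.len (.var (τ := .list (.list .nat)) vs))
      (x := .var (τ := .list .nat) s)
      (b := fun k s =>
        taylorTerm (.var (τ := .nat) m) (.var (τ := .nat) q) (y (.var (τ := .nat) u) k)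
          (get (.var (τ := .list (.list .nat)) vs) k) (.var (τ := .list (.list .nat)) diff) lj
          (.var (τ := .nat) u) s)
      (c := B ^ 75)
      (fun k (s : List ℕ) => PolyOk B 0 q m (.var (τ := .list .nat) s)
        (∑ u ∈ Finset.range u, ∑ k ∈ Finset.range vs.length, T u k + ∑ k ∈ Finset.range k, T u k))
      (by simpa using hs) ?_
    · refine ⟨by rw [Finset.sum_range_succ]; exact inner.1, inner.2.trans ?_⟩
      rw [cost_len, cost_var, cost_var, nv_len, val_var]
      have h2 : vs.length * (B ^ 75 + 1) ≤ W * (2 * B ^ 75) := by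
        refine Nat.mul_le_mul hW ?_
        have := one_le_pow_base (B := B) 75
        omega
      have h3 : W * (2 * B ^ 75) = 2 * (W * B ^ 75) := by ring
      have h4 := Nat.mul_le_mul_left W (eight_mul_pow_le (B := B) 75)
      have h6 := Nat.mul_le_mul_left W (pow_mono_exp (B := B) (show 76 ≤ 77 by decide))
      have h7 : W * (8 * B ^ 75) = 8 * (W * B ^ 75) := by ring
      have h9 := one_le_pow_base (B := B) 75
      simp only [Nat.reduceAdd] at *
      omega
    · intro k hk s hs
      have hk : k < vs.length := hk
      have hterm := PolyOk.taylorTerm (v := get (.var (τ := .list (.list .nat)) vs) (.var (τ := .nat) k))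
        (w := vs.getD k []) hq hq1 hm he hu rfl (by
          rw [cost_get, cost_var, cost_var]
          have := eight_mul_pow_le (B := B) 4
          have := one_le_pow_base (B := B) 4
          simp only [Nat.reduceAdd] at *
          omega) (hvs k hk) hD hlj hL hLm (hy u hu k hk).1 hs
      rw [(hy u hu k hk).2, add_assoc, ← Finset.sum_range_succ (fun k => T u k)] at hterm
      exact ⟨hterm.to_var rfl, hterm.cost⟩

theorem taylorPoly_spec {m e : ℕ} {vs : List (List ℕ)} {a : Tm Ty.den Proc (.list (.list .nat))}
    {b lj : Tm Ty.den Proc (.list .nat)} {a' : List (List ℕ)} {b' lj' : List ℕ}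
    {A : ℕ → (ZMod q)[X]} {L : (ZMod q)[X]} {Y : ℕ → ℕ → ZMod q} {W : ℕ}
    {y : Tm Ty.den Proc .nat → Tm Ty.den Proc .nat → Tm Ty.den Proc .nat}
    (hq : Nat.size q ≤ B ^ 1) (hq1 : 1 < q) (hm : m ≤ B ^ 1) (he : e ≤ B ^ 1) (he0 : 0 < e)
    (haa : a.val = a') (hbb : b.val = b') (hljj : lj.val = lj') (hac : a.cost ≤ B ^ 2)
    (hbc : b.cost ≤ B ^ 2) (hljc : lj.cost ≤ B ^ 2)
    (ha : ∀ c < m, (a'.getD c []).length = e ∧ (∀ x ∈ a'.getD c [], x < q) ∧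
      toPoly q (a'.getD c []) = A c) (hb : ∀ c < m, b'.getD c 0 < q)
    (hvs : ∀ k < vs.length, ∀ c, (vs.getD k []).getD c 0 ≤ B ^ 1) (hW : vs.length ≤ W) (hW0 : 1 ≤ W)
    (hy : ∀ u < e, ∀ k < vs.length, Ok B 1 10 (y (.var (τ := .nat) u) (.var (τ := .nat) k)) ∧
      ((y (.var (τ := .nat) u) (.var (τ := .nat) k)).nv : ZMod q) = Y u k)
    (hlj : PolyOk B 0 q (1 + 2 * m) (.var (τ := .list .nat) lj') L) (hL : L.Monic)
    (hLm : L.natDegree = m) :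
    (taylorPoly (.var (τ := .nat) m) (.var (τ := .nat) e) (.var (τ := .nat) q)
      (.var (τ := .list (.list .nat)) vs) y a b lj).cost ≤ W * B ^ 90 ∧
    PolyOk B 0 q m (.var (τ := .list .nat) (taylorPoly (.var (τ := .nat) m) (.var (τ := .nat) e)
      (.var (τ := .nat) q) (.var (τ := .list (.list .nat)) vs) y a b lj).val)
      (∑ u ∈ Finset.range e, ∑ k ∈ Finset.range vs.length, C (Y u k) *
        ((X ^ u * ∏ c ∈ Finset.range m, (A c - C (b'.getD c 0 : ZMod q)) ^
          (vs.getD k []).getD c 0) %ₘ L)) := by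
  have hq0 : 0 < q := by omega
  obtain ⟨hdc, hd⟩ := taylorPoly_diff hq hq0 hm he he0 haa hbb hac hbc ha hb rfl
  have hlj1 : PolyOk B 2 q (1 + 2 * m) lj L :=
    ⟨hljc, by rw [hljj]; exact hlj.len, by rw [hljj]; exact hlj.le, by rw [hljj]; exact hlj.poly⟩
  have key := taylorPoly_loop (diff := (MME.tab (.var (τ := .nat) m) fun c =>
    MME.tab (.var (τ := .nat) e) fun k =>
      MME.cond (eq k 0) ((get (get a c) k + (.var (τ := .nat) q - get b c)) % .var (τ := .nat) q)
        (get (get a c) k)).val) hq hq1 hm he hvs hW hW0 hy hd hlj1 hL hLm rfl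
  refine ⟨?_, key.2⟩
  refine (cost_share_le hdc key.1).trans ?_
  have h1 := Nat.mul_le_mul_right (B ^ 80) hW0
  have h2 := pow_mono_exp (B := B) (show 30 ≤ 80 by decide)
  have h3 := Nat.mul_le_mul_left W (eight_mul_pow_le (B := B) 80)
  have h4 := Nat.mul_le_mul_left W (pow_mono_exp (B := B) (show 81 ≤ 90 by decide))
  have h5 := one_le_pow_base (B := B) 80
  have h7 : W * (8 * B ^ 80) = 8 * (W * B ^ 80) := by ring
  simp only [Nat.reduceAdd] at *
  omega

end MME

namespace MME

open Polynomial

/-! ## Correctness of the extension step -/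

/-- In the quotient ring modulo `(X - j) ^ m`, Taylor's formula is applied at the constant point `b`
with displacements `A i - b i`. These are divisible by `X - j` because `b i` is the value of `A i`
at `j`, so the terms of order at least `m` vanish. -/
theorem taylor_dvd {R : Type*} [CommRing R] {m d e : ℕ} (hm : 0 < m) (c : ℕ → ℕ → R) (A : ℕ → R[X])
    (j : R) (b : ℕ → R) (hb : ∀ i < m, b i = (A i).eval j) :
    (X - C j) ^ m ∣ (∑ u ∈ Finset.range e, X ^ u * ev m d (fun k => C (c u k)) A) -
      ∑ u ∈ Finset.range e, ∑ k ∈ Finset.range (expo m m).length,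
        C (ev m d (hasseC m d (c u) fun i => ((expo m m).getD k []).getD i 0) b) *
          ((X ^ u * ∏ i ∈ Finset.range m, (A i - C (b i)) ^ ((expo m m).getD k []).getD i 0) %ₘ
            (X - C j) ^ m) := by
  set L := (X - C j) ^ m with hL
  set φ := Ideal.Quotient.mk (Ideal.span {L}) with hφ
  have hφ0 : ∀ p, φ p = 0 ↔ L ∣ p := fun p => by
    rw [hφ, Ideal.Quotient.eq_zero_iff_mem, Ideal.mem_span_singleton]
  have hmod : ∀ p, φ (p %ₘ L) = φ p := fun p => by
    rw [← sub_eq_zero, ← map_sub, hφ0]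
    refine ⟨-(p /ₘ L), ?_⟩
    have := modByMonic_add_div p L
    linear_combination this
  rw [← hφ0, map_sub, sub_eq_zero, map_sum, map_sum]
  refine Finset.sum_congr rfl fun u _ => ?_
  rw [map_sum, map_mul, map_ev]
  have h1 := taylor_formula m d (fun k => φ (C (c u k))) (fun i => φ (C (b i)))
    (fun i => φ (A i - C (b i))) (expo m m) (nodup_expo m m) (fun v hv => ((mem_expo hm).mp hv).1) ?_
  · rw [ev_congr (c' := fun k => φ (C (c u k))) (x' := fun i => φ (C (b i)) + φ (A i - C (b i)))
      (fun _ _ => rfl) fun i _ => by rw [← map_add, add_sub_cancel], h1,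
      ← sum_range_getD (expo m m) [], Finset.mul_sum]
    refine Finset.sum_congr rfl fun k _ => ?_
    rw [map_mul, hmod, map_mul, map_prod]
    have h2 : φ (C (ev m d (hasseC m d (c u) fun i => ((expo m m).getD k []).getD i 0) b)) =
        ev m d (hasseC m d (fun k => φ (C (c u k))) fun i => ((expo m m).getD k []).getD i 0)
          fun i => φ (C (b i)) := by
      have := map_ev (φ.comp C) m d (hasseC m d (c u) fun i => ((expo m m).getD k []).getD i 0) b
      simp only [map_hasseC, RingHom.comp_apply] at this
      exact this
    rw [h2]
    simp only [map_pow]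
    ring
  -- A vector of length `m` missing from the list has sum at least `m`, so its product of
  -- displacements is divisible by `(X - j) ^ m`.
  · intro v hv hvL
    have hsum : m ≤ ∑ i ∈ Finset.range m, v.getD i 0 := by
      by_contra hlt
      refine hvL ((mem_expo hm).mpr ⟨hv, ?_⟩)
      rw [← sum_getD, hv]; omega
    have : L ∣ ∏ i ∈ Finset.range m, (A i - C (b i)) ^ v.getD i 0 := by
      refine (pow_dvd_pow (X - C j) hsum).trans ?_
      rw [← Finset.prod_pow_eq_pow_sum]
      refine Finset.prod_dvd_prod_of_dvd _ _ fun i hi => pow_dvd_pow_of_dvd ?_ _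
      rw [dvd_iff_isRoot, IsRoot, eval_sub, eval_C, hb i (Finset.mem_range.mp hi), sub_self]
    have := (hφ0 _).mpr this
    rw [map_prod] at this
    simpa only [map_pow] using this

theorem ev_sum {A : Type*} [CommSemiring A] (m d e : ℕ) (c : ℕ → ℕ → A) (w : ℕ → A) (x : ℕ → A) :
    ev m d (fun k => ∑ u ∈ Finset.range e, w u * c u k) x =
      ∑ u ∈ Finset.range e, w u * ev m d (c u) x := by
  simp only [ev, Finset.sum_mul, Finset.mul_sum]
  rw [Finset.sum_comm]
  exact Finset.sum_congr rfl fun _ _ => Finset.sum_congr rfl fun _ _ => by ring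

end MME

namespace MME

open Polynomial

/-! ## Specifications with costs -/

/-- An array of length `n` whose cell `i` satisfies `S i`; reads outside of the array give `z`. -/
def Arr {α : Type} (z : α) (n : ℕ) (S : ℕ → α → Prop) (L : List α) : Prop :=
  L.length = n ∧ ∀ i < n, S i (L.getD i z)

theorem Arr.mono {α : Type} {z : α} {n : ℕ} {S T : ℕ → α → Prop} {L : List α} (h : Arr z n S L)
    (hST : ∀ i < n, ∀ x, S i x → T i x) : Arr z n T L :=
  ⟨h.1, fun i hi => hST i hi _ (h.2 i hi)⟩

theorem Arr.forall_mem {α : Type} {z : α} {n : ℕ} {S : ℕ → α → Prop} {L : List α} {P : α → Prop}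
    (h : Arr z n S L) (hP : ∀ i < n, ∀ x, S i x → P x) : ∀ x ∈ L, P x := by
  intro x hx
  obtain ⟨i, hi, rfl⟩ := List.getElem_of_mem hx
  have := h.2 i (h.1 ▸ hi)
  rw [List.getD_eq_getElem _ _ hi] at this
  exact hP i (h.1 ▸ hi) _ this

theorem Arr.bd {τ : Ty} {z : τ.den} {n b : ℕ} {S : ℕ → τ.den → Prop} {L : List τ.den}
    (h : Arr z n S L) (hS : ∀ i < n, ∀ x, S i x → Bd b τ x) : Bd b (.list τ) L :=
  h.forall_mem hS

theorem Arr.eq_map {α : Type} {z : α} {n : ℕ} {g : ℕ → α} {L : List α}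
    (h : Arr z n (fun i x => x = g i) L) : L = (List.range n).map g := by
  refine List.ext_getElem (by simp [h.1]) fun i h1 h2 => ?_
  have := h.2 i (h.1 ▸ h1)
  rw [List.getD_eq_getElem _ _ h1] at this
  simpa using this

/-- The program takes at most `W * B ^ k` steps and its result satisfies `S`. -/
structure Runs (B W k : ℕ) {τ : Ty} (t : Tm Ty.den Proc τ) (S : τ.den → Prop) : Prop where
  cost : t.cost ≤ W * B ^ k
  post : S t.val

section

variable {B : ℕ} [hB : Fact (8 ≤ B)] {σ τ : Ty} {i k l W : ℕ}

theorem Runs.mono {W' : ℕ} {t : Tm Ty.den Proc τ} {S T : τ.den → Prop} (h : Runs B W k t S)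
    (hW : W ≤ W') (hk : k ≤ l) (hST : ∀ x, S x → T x) : Runs B W' l t T :=
  ⟨h.cost.trans (Nat.mul_le_mul hW (pow_mono_exp hk)), hST _ h.post⟩

omit hB in
theorem Runs.of_ok {t : Tm Ty.den Proc τ} {S : τ.den → Prop} (h : Ok B i k t) (hS : S t.val) :
    Runs B 1 k t S := ⟨by rw [one_mul]; exact h.cost, hS⟩

omit hB in
theorem Runs.ok {t : Tm Ty.den Proc τ} (h : Ok B i k t) (y : τ.den) (hS : t.val = y) :
    Runs B 1 k t fun x => x = y := .of_ok h hS

theorem Runs.bind {a : Tm Ty.den Proc σ} {b : Tm Ty.den Proc σ → Tm Ty.den Proc τ}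
    {S : σ.den → Prop} {T : τ.den → Prop} (ha : Runs B W k a S) (hW : 1 ≤ W) (hkl : k ≤ l)
    (hb : ∀ x, S x → Runs B W l (b (.var x)) T) : Runs B W (l + 1) (MME.share a b) T := by
  have hb := hb _ ha.post
  refine ⟨?_, hb.post⟩
  rw [cost_share]
  have h1 := ha.cost.trans (Nat.mul_le_mul_left W (pow_mono_exp (B := B) hkl))
  have h2 := hb.cost
  have h3 := Nat.mul_le_mul_left W (eight_mul_pow_le (B := B) l)
  have h4 := Nat.mul_le_mul hW (one_le_pow_base (B := B) l)
  have h5 : W * (8 * B ^ l) = 8 * (W * B ^ l) := by ring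
  omega

theorem Runs.tab {cnt : Tm Ty.den Proc .nat} {b : Tm Ty.den Proc .nat → Tm Ty.den Proc τ}
    {z : τ.den} {n W₁ W₂ : ℕ} {S : ℕ → τ.den → Prop} (hc : cnt.cost ≤ 2) (hv : cnt.nv = n)
    (hn : n ≤ W₁) (hW : W₁ * W₂ ≤ W) (hW0 : 1 ≤ W) (hW2 : 1 ≤ W₂)
    (h : ∀ i < n, Runs B W₂ l (b (.var (τ := .nat) i)) (S i)) :
    Runs B W (l + 1) (MME.tab cnt b) (Arr z n S) := by
  subst hv
  refine ⟨(cost_tab_le fun i hi => (h i hi).cost).trans ?_, ?_, fun i hi => ?_⟩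
  · have h1 := one_le_pow_base (B := B) l
    have h2 : W₂ * B ^ l + 1 ≤ W₂ * (2 * B ^ l) := by
      have := Nat.mul_le_mul hW2 h1
      have : W₂ * (2 * B ^ l) = 2 * (W₂ * B ^ l) := by ring
      omega
    have h3 := (Nat.mul_le_mul hn h2).trans_eq
      (show W₁ * (W₂ * (2 * B ^ l)) = (W₁ * W₂) * (2 * B ^ l) by ring)
    have h4 := h3.trans (Nat.mul_le_mul_right _ hW)
    have h5 := Nat.mul_le_mul_left W (eight_mul_pow_le (B := B) l)
    have h6 := Nat.mul_le_mul hW0 h1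
    have h7 : W * (8 * B ^ l) = 8 * (W * B ^ l) := by ring
    have h8 : W * (2 * B ^ l) = 2 * (W * B ^ l) := by ring
    omega
  · rw [val_tab, List.length_map, List.length_range]
  · rw [getD_tab hi]
    exact (h i hi).post

theorem Runs.tab_var {b : Tm Ty.den Proc .nat → Tm Ty.den Proc τ} {z : τ.den} {n : ℕ}
    {S : ℕ → τ.den → Prop} (hn : n ≤ B ^ 1) (hW : 1 ≤ W)
    (h : ∀ i < n, Runs B W l (b (.var (τ := .nat) i)) (S i)) :
    Runs B W (l + 2) (MME.tab (.var (τ := .nat) n) b) (Arr z n S) := by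
  have h1 := one_le_pow_base (B := B) 1
  have := Runs.tab (z := z) (W := B ^ 1 * W) (cnt := .var (τ := .nat) n) (by simp) (by simp) hn le_rfl
    (Nat.mul_le_mul h1 hW) hW h
  refine ⟨this.cost.trans_eq ?_, this.post⟩
  ring

theorem Runs.tab_len {L : List σ.den} {b : Tm Ty.den Proc .nat → Tm Ty.den Proc τ} {z : τ.den}
    {n W₁ W₂ : ℕ} {S : ℕ → τ.den → Prop} (hL : L.length = n) (hn : n ≤ W₁) (hW : W₁ * W₂ ≤ W)
    (hW0 : 1 ≤ W) (hW2 : 1 ≤ W₂)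
    (h : ∀ i < n, Runs B W₂ l (b (.var (τ := .nat) i)) (S i)) :
    Runs B W (l + 1) (MME.tab (MME.len (.var (τ := .list σ) L)) b) (Arr z n S) :=
  Runs.tab (by simp [cost_len]) (by simpa using hL) hn hW hW0 hW2 h

end

/-! ## The stages of the algorithm -/

section Stages

variable {B : ℕ} [hB : Fact (8 ≤ B)] {m d e l q r N : ℕ}

/-- Bounds on the sizes of the numbers that occur. -/
structure Sizes (B m d e l q : ℕ) : Prop where
  fits : Fits B (.var (τ := .nat) m) (.var (τ := .nat) d)
  e_pos : 0 < e
  e_le : e ≤ B ^ 1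
  l_eq : l = e * d
  l_le : l ≤ B ^ 1
  q_gt : 1 < q
  q_size : Nat.size q ≤ B ^ 1

omit hB in
theorem Sizes.m_le (h : Sizes B m d e l q) : m ≤ B ^ 1 := by
  have := h.fits.m_le; simp only [nv_var] at this; omega

omit hB in
theorem Sizes.d_le (h : Sizes B m d e l q) : d ≤ B ^ 1 := by
  have := h.fits.m_le; simp only [nv_var] at this; omega

omit hB in
theorem Sizes.qv (h : Sizes B m d e l q) : Ok B 1 0 (.var (τ := .nat) q : Tm Ty.den Proc .nat) :=
  Ok.var h.q_size

omit hB in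
theorem Sizes.m_pos (h : Sizes B m d e l q) : 0 < m := h.fits.m_pos

omit hB in
theorem Sizes.d_pos (h : Sizes B m d e l q) : 0 < d := h.fits.d_pos

omit hB in
theorem Sizes.dm_pos (h : Sizes B m d e l q) : 0 < d ^ m := Nat.pow_pos h.d_pos

/-- The entries are already below `q`, so the reduction copies them. -/
theorem runs_reduce {A : Tm Ty.den Proc (.list .nat)} (h : Sizes B m d e l q) {x : List ℕ} {k : ℕ}
    (hA : A.val = x) (hk : A.cost ≤ B ^ k) (hx : ∀ u, x.getD u 0 < q) :
    Runs B 1 (k + 6) (MME.tab (.var (τ := .nat) e) fun u => get A u % .var (τ := .nat) q)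
      (Arr 0 e fun u y => y = x.getD u 0) := by
  have hq0 : 0 < q := by have := h.q_gt; omega
  refine (Runs.tab_var (l := k + 4) h.e_le le_rfl fun u hu => ?_).mono le_rfl le_rfl fun _ h => h
  have h1 : Ok B 1 (k + 2) (get A (.var (τ := .nat) u)) := by
    refine ⟨?_, ?_⟩
    · rw [val_eq_nv, nv_get, hA]
      exact (Nat.size_le_size (hx u).le).trans h.q_size
    · rw [cost_get, cost_var]
      have := eight_mul_pow_le (B := B) k
      have := eight_mul_pow_le (B := B) (k + 1)
      have := one_le_pow_base (B := B) k
      simp only [Nat.add_assoc, Nat.reduceAdd] at *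
      omega
  refine Runs.ok ((h1.mod_pos h.qv hq0).mono le_rfl (by omega : _ ≤ k + 4)) _ ?_
  rw [val_eq_nv, nv_mod, nv_get, hA]
  exact Nat.mod_eq_of_lt (hx u)

theorem runs_coeffs (h : Sizes B m d e l q) {f : List (List ℕ)} (hf : f.length = d ^ m)
    (hfq : ∀ k u, (f.getD k []).getD u 0 < q) :
    Runs B (d ^ m) 20 (MME.tab (MME.len (.var (τ := .list (.list .nat)) f)) fun k =>
      MME.tab (.var (τ := .nat) e) fun u => get (get (.var (τ := .list (.list .nat)) f) k) u
        % .var (τ := .nat) q)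
      (Arr [] (d ^ m) fun k => Arr 0 e fun u y => y = (f.getD k []).getD u 0) := by
  refine (Runs.tab_len (l := 7) hf le_rfl (mul_one _).le h.dm_pos le_rfl fun k hk => ?_).mono
    le_rfl (by decide) fun _ h => h
  refine runs_reduce (k := 1) h rfl ?_ (hfq k)
  rw [cost_get, cost_var, cost_var, pow_one]; have := hB.out; omega

theorem runs_points (h : Sizes B m d e l q) {as : List (List (List ℕ))} (has : as.length = N)
    (haq : ∀ i c u, ((as.getD i []).getD c []).getD u 0 < q) :
    Runs B (N + 1) 20 (MME.tab (MME.len (.var (τ := .list (.list (.list .nat))) as)) fun i =>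
      MME.tab (.var (τ := .nat) m) fun c => MME.tab (.var (τ := .nat) e) fun u =>
        get (get (get (.var (τ := .list (.list (.list .nat))) as) i) c) u % .var (τ := .nat) q)
      (Arr [] N fun i => Arr [] m fun c => Arr 0 e fun u y =>
        y = ((as.getD i []).getD c []).getD u 0) := by
  refine (Runs.tab_len (l := 10) (W₂ := 1) has (Nat.le_succ N) (mul_one _).le (by omega) le_rfl fun i hi => ?_).mono
    le_rfl (by decide) fun _ h => h
  refine (Runs.tab_var (l := 8) h.m_le le_rfl fun c hc => ?_).mono le_rfl le_rfl fun _ h => h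
  refine (runs_reduce (k := 1) (x := (as.getD i []).getD c []) h rfl ?_ (haq i c)).mono le_rfl (by decide) fun _ h => h
  rw [cost_get, cost_get, cost_var, cost_var, cost_var, pow_one]; have := hB.out; omega

theorem runs_transpose (h : Sizes B m d e l q) {f : List (List ℕ)} {c : ℕ → ℕ → ℕ}
    (hf : Arr [] (d ^ m) (fun k => Arr 0 e fun u y => y = c u k) f) :
    Runs B (d ^ m) 20 (MME.tab (.var (τ := .nat) e) fun u =>
      MME.tab (MME.len (.var (τ := .list (.list .nat)) f)) fun k =>
        get (get (.var (τ := .list (.list .nat)) f) k) u)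
      (Arr [] e fun u => Arr 0 (d ^ m) fun k y => y = c u k) := by
  refine (Runs.tab_var (l := 2) h.e_le h.dm_pos fun u hu => ?_).mono le_rfl (by decide) fun _ h => h
  refine (Runs.tab_len (l := 1) hf.1 le_rfl (mul_one _).le h.dm_pos le_rfl fun k hk => ?_)
  refine ⟨?_, (hf.2 k hk).2 u hu⟩
  rw [cost_get, cost_get, cost_var, cost_var, cost_var, pow_one, one_mul]; have := hB.out; omega

end Stages

end MME

namespace MME

open Polynomial

/-! ### Expansions at the nodes, Hasse derivatives, powers of `z - j`. -/

section Stages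

variable {B : ℕ} [hB : Fact (8 ≤ B)] {m d e l q r N : ℕ}

/-- Only the constant term of each expansion, the value at the node `j`, is used afterwards; about
the other coefficients it is enough to know that they are reduced. -/
theorem runs_expansions (h : Sizes B m d e l q) {as : List (List (List ℕ))} {α : ℕ → ℕ → ℕ → ℕ}
    (has : Arr [] N (fun i => Arr [] m fun c => Arr 0 e fun u y => y = α i c u) as)
    (hα : ∀ i c u, α i c u < q) :
    Runs B (N + 1) 60 (MME.tab (.var (τ := .nat) l) fun j =>
      MME.tab (MME.len (.var (τ := .list (.list (.list .nat))) as)) fun i =>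
      MME.tab (.var (τ := .nat) e) fun u => MME.tab (.var (τ := .nat) m) fun c =>
        sumMod (.var (τ := .nat) q) (.var (τ := .nat) e) fun v =>
          binom v u * get (get (get (.var (τ := .list (.list (.list .nat))) as) i) c) v
            * powMod (.var (τ := .nat) q) j (v - u))
      (Arr [] l fun j => Arr [] N fun i => Arr [] e fun u => Arr 0 m fun c x =>
        x < q ∧ (u = 0 → (x : ZMod q) = ∑ v ∈ Finset.range e, (α i c v : ZMod q) * (j : ZMod q) ^ v)) := by
  have hq0 : 0 < q := by have := h.q_gt; omega
  have hev : Ok B 1 0 (.var (τ := .nat) e : Tm Ty.den Proc .nat) :=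
    Ok.var ((size_self_le e).trans h.e_le)
  refine (Runs.tab_var (l := 55) h.l_le (by omega) fun j hj => ?_).mono le_rfl (by decide) fun _ h => h
  refine (Runs.tab_len (l := 54) (W₂ := 1) has.1 (Nat.le_succ N) (mul_one _).le (by omega) le_rfl
    fun i hi => ?_)
  refine (Runs.tab_var (l := 52) h.e_le le_rfl fun u hu => ?_)
  refine (Runs.tab_var (l := 50) h.m_le le_rfl fun c hc => ?_)
  have hα' : ∀ v < e, (get (get (get (.var (τ := .list (.list (.list .nat))) as)
      (.var (τ := .nat) i)) (.var (τ := .nat) c)) (.var (τ := .nat) v)).nv = α i c v :=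
    fun v hv => ((has.2 i hi).2 c hc).2 v hv
  have hjv : Ok B 1 0 (.var (τ := .nat) j : Tm Ty.den Proc .nat) := Ok.var (Bd.index hj h.l_le)
  have huv : Ok B 1 0 (.var (τ := .nat) u : Tm Ty.den Proc .nat) := Ok.var (Bd.index hu h.e_le)
  refine Runs.of_ok (i := 1) ?_ ?_
  · refine (Ok.sumMod_mixed (j := 5) (l := 1) (k := 20) (h.qv.mono le_rfl (by decide))
      (by rw [cost_var]; exact one_le_pow_base _) (show (Tm.var (τ := .nat) e).nv ≤ B ^ 1 from h.e_le) hq0 fun v hv => ?_).mono le_rfl (by decide)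
    have hv : v < e := hv
    have hvv : Ok B 1 0 (.var (τ := .nat) v : Tm Ty.den Proc .nat) := Ok.var (Bd.index hv h.e_le)
    have h1 : Ok B 1 3 (get (get (get (.var (τ := .list (.list (.list .nat))) as)
        (.var (τ := .nat) i)) (.var (τ := .nat) c)) (.var (τ := .nat) v)) := by
      refine ⟨?_, ?_⟩
      · rw [val_eq_nv, hα' v hv]; exact (Nat.size_le_size (hα i c v).le).trans h.q_size
      · rw [cost_get, cost_get, cost_get, cost_var, cost_var, cost_var, cost_var]
        have := eight_mul_pow_le (B := B) 2
        have := one_le_pow_base (B := B) 2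
        simp only [Nat.reduceAdd] at *
        omega
    exact (((Ok.binom (j := 1) hvv huv (hv.le.trans h.e_le) (hu.le.trans h.e_le)).mul h1).mul
      (Ok.powMod (j := 1) (k := 10) (h.qv.mono le_rfl (by decide)) (hjv.mono le_rfl (by decide))
        ((hvv.sub huv).mono le_rfl (by decide)) (by
          simp only [nv_sub, nv_var]; have := h.e_le; omega) hq0)).mono (by decide) (by decide)
  · rw [val_eq_nv, nv_sumMod]
    refine ⟨Nat.mod_lt _ hq0, ?_⟩
    rintro rfl
    rw [nv_var, nv_var, ZMod.natCast_mod, Nat.cast_sum]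
    refine Finset.sum_congr rfl fun v hv => ?_
    rw [nv_mul, nv_mul, hα' v (Finset.mem_range.mp hv), nv_binom,
      nv_powMod (.var (τ := .nat) q) _ _ h.q_gt]
    simp

theorem hasseC_congr {A : Type*} [CommSemiring A] {m d : ℕ} {c c' : ℕ → A}
    (h : ∀ k < d ^ m, c k = c' k) (v : ℕ → ℕ) (k : ℕ) : hasseC m d c v k = hasseC m d c' v k := by
  unfold hasseC
  split_ifs with h1
  · rw [h _ (index_lt h1)]
  · rfl

theorem runs_hasse (h : Sizes B m d e l q) {fus vs : List (List ℕ)} {c : ℕ → ℕ → ℕ}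
    (hf : Arr [] e (fun u => Arr 0 (d ^ m) fun k y => y = c u k) fus) (hc : ∀ u k, c u k < q)
    (hvs : vs = expo m m) :
    Runs B (2 ^ (2 * m) * d ^ m) 60 (MME.tab (MME.len (.var (τ := .list (.list .nat)) vs)) fun k =>
      MME.tab (.var (τ := .nat) e) fun u => hasse (.var (τ := .nat) m) (.var (τ := .nat) d)
        (.var (τ := .nat) q) (get (.var (τ := .list (.list .nat)) fus) u)
        (get (.var (τ := .list (.list .nat)) vs) k))
      (Arr [] vs.length fun k => Arr [] e fun u L => Bd (B ^ 1) (.list .nat) L ∧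
        ∀ κ < d ^ m, (L.getD κ 0 : ZMod q) =
          hasseC m d (fun κ => (c u κ : ZMod q)) (fun i => (vs.getD k []).getD i 0) κ) := by
  have hq0 : 0 < q := by have := h.q_gt; omega
  have hV : vs.length ≤ 2 ^ (2 * m) := by rw [hvs, two_mul]; exact length_expo_le m m
  refine (Runs.tab_len (l := 55) (W₂ := d ^ m) rfl hV le_rfl
    (Nat.mul_pos (by positivity) h.dm_pos) h.dm_pos fun k hk => ?_).mono
    le_rfl (by decide) fun _ h => h
  refine (Runs.tab_var (l := 50) h.e_le h.dm_pos fun u hu => ?_).mono le_rfl (by decide) fun _ h => h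
  have hfu : ∀ κ < d ^ m, (fus.getD u []).getD κ 0 = c u κ := (hf.2 u hu).2
  have hcost : ∀ (L : List (List ℕ)) (x : ℕ), (get (.var (τ := .list (.list .nat)) L)
      (.var (τ := .nat) x)).cost ≤ B ^ 2 := fun L x => by
    rw [cost_get, cost_var, cost_var]
    have := eight_mul_pow_le (B := B) 1
    have := one_le_pow_base (B := B) 1
    simp only [Nat.reduceAdd] at *
    omega
  have hvb : ∀ w ∈ vs, ∀ x ∈ w, Nat.size x ≤ B ^ 1 := fun w hw x hx => by
    rw [hvs] at hw
    exact bd_expo h.m_pos h.m_le w hw x hx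
  have hok : OkW B (d ^ m) 1 40 (hasse (.var (τ := .nat) m) (.var (τ := .nat) d)
        (.var (τ := .nat) q) (get (.var (τ := .list (.list .nat)) fus) (.var (τ := .nat) u))
        (get (.var (τ := .list (.list .nat)) vs) (.var (τ := .nat) k))) := by
    refine OkW.hasse (h.fits.m_ok.mono le_rfl (by decide)) h.m_le (h.fits.d_ok.mono le_rfl (by decide))
      h.d_le h.d_pos (h.qv.mono le_rfl (by decide)) hq0 ⟨?_, hcost _ _⟩ ⟨?_, hcost _ _⟩ h.fits.size_dm
    · exact (hf.2 u hu).bd (τ := .nat) fun κ hκ x hx => hx ▸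
        (Nat.size_le_size (hc u κ).le).trans h.q_size
    · rw [val_get, val_var, nv_var, List.getD_eq_getElem _ _ hk]
      exact hvb _ (List.getElem_mem hk)
  refine ⟨hok.cost.trans (Nat.mul_le_mul_left _ (pow_mono_exp (by decide))), hok.bd, fun κ hκ => ?_⟩
  refine (congrArg (Nat.cast (R := ZMod q)) (getD_val_hasse
    (m := .var (τ := .nat) m) (d := .var (τ := .nat) d) _ _ _ hκ)).trans ?_
  rw [nv_var, nv_var, nv_var, ZMod.natCast_mod]
  have := map_hasseC (Nat.castRingHom (ZMod q)) m d (fun κ => (fus.getD u []).getD κ 0)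
    (fun i => (vs.getD k []).getD i 0) κ
  exact this.trans (hasseC_congr (fun κ hκ => by rw [hfu κ hκ]; rfl) _ _)

theorem runs_heads (h : Sizes B m d e l q) {as : List (List (List ℕ))} (has : as.length = N)
    {ajs : List (List (List (List ℕ)))} {S : ℕ → ℕ → ℕ → ℕ → ℕ → Prop}
    (hajs : Arr [] l (fun j => Arr [] N fun i => Arr [] e fun u => Arr 0 m fun c x =>
      S j i u c x) ajs) :
    Runs B (N + 1) 20 (MME.tab (.var (τ := .nat) l) fun j =>
      MME.tab (MME.len (.var (τ := .list (.list (.list .nat))) as)) fun i =>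
        get (get (get (.var (τ := .list (.list (.list (.list .nat)))) ajs) j) i) 0)
      (Arr [] l fun j => Arr [] N fun i => Arr 0 m fun c x => S j i 0 c x) := by
  refine (Runs.tab_var (l := 3) h.l_le (by omega) fun j hj => ?_).mono le_rfl (by decide) fun _ h => h
  refine (Runs.tab_len (l := 2) (W₂ := 1) has (Nat.le_succ N) (mul_one _).le (by omega) le_rfl
    fun i hi => ?_)
  refine ⟨?_, ((hajs.2 j hj).2 i hi).2 0 h.e_pos⟩
  rw [cost_get, cost_get, cost_get, cost_var, cost_var, cost_var, cost_ofNat, one_mul]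
  have := eight_mul_pow_le (B := B) 1
  have := hB.out
  rw [Nat.size_zero]
  simp only [Nat.reduceAdd, pow_one] at *
  omega

theorem runs_linPow (h : Sizes B m d e l q) (hlq : l ≤ q) :
    Runs B 1 70 (MME.tab (.var (τ := .nat) l) fun j =>
      linPow (.var (τ := .nat) q) j (.var (τ := .nat) m))
      (Arr [] l fun j L => PolyOk B 0 q (1 + 2 * m) (.var (τ := .list .nat) L)
        ((X - C (j : ZMod q)) ^ m)) := by
  have hq0 : 0 < q := by have := h.q_gt; omega
  refine (Runs.tab_var (l := 60) h.l_le (by omega) fun j hj => ?_).mono le_rfl (by decide) fun _ h => h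
  have := PolyOk.linPow h.q_size hq0 (hj.le.trans hlq) h.m_le
  exact ⟨by rw [one_mul]; exact this.cost, this.to_var rfl⟩

end Stages

end MME

namespace MME

open Polynomial

/-! ## The polynomials in the extension step -/

/-- The polynomial of degree less than `e` in `z` with the coefficients `a`. -/
noncomputable def trunc {R : Type*} [CommSemiring R] (e : ℕ) (a : ℕ → ℕ) : R[X] :=
  ∑ v ∈ Finset.range e, C (a v : R) * X ^ v

/-- The value at the point with coordinates `trunc e (α c)` of the polynomial with coefficients
`trunc e fun u => c u k`. -/
noncomputable def valuePoly (R : Type*) [CommSemiring R] (m d e : ℕ) (c : ℕ → ℕ → ℕ)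
    (α : ℕ → ℕ → ℕ) : R[X] :=
  ev m d (fun k => trunc e fun u => c u k) fun i => trunc e (α i)

theorem valuePoly_eq_sum (R : Type*) [CommSemiring R] (m d e : ℕ) (c : ℕ → ℕ → ℕ)
    (α : ℕ → ℕ → ℕ) : valuePoly R m d e c α =
      ∑ u ∈ Finset.range e, X ^ u * ev m d (fun k => C (c u k : R)) fun i => trunc e (α i) := by
  rw [← ev_sum]
  refine ev_congr (fun k _ => ?_) fun _ _ => rfl
  exact Finset.sum_congr rfl fun u _ => mul_comm _ _

theorem map_trunc {R S : Type*} [CommSemiring R] [CommSemiring S] (φ : R →+* S) (e : ℕ) (a : ℕ → ℕ) :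
    (trunc e a : R[X]).map φ = trunc e a := by
  simp [trunc, Polynomial.map_sum]

theorem map_valuePoly {R S : Type*} [CommSemiring R] [CommSemiring S] (φ : R →+* S) (m d e : ℕ)
    (c : ℕ → ℕ → ℕ) (α : ℕ → ℕ → ℕ) :
    (valuePoly R m d e c α).map φ = valuePoly S m d e c α := by
  have := map_ev (mapRingHom φ) m d (fun k => (trunc e fun u => c u k : R[X])) fun i => trunc e (α i)
  simp only [coe_mapRingHom, map_trunc] at this
  exact this

theorem coeff_trunc {R : Type*} [CommSemiring R] (e : ℕ) (a : ℕ → ℕ) (k : ℕ) :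
    (trunc e a : R[X]).coeff k = if k < e then (a k : R) else 0 := by
  simp [trunc, finsetSum_coeff, coeff_X_pow]

theorem eval_trunc {R : Type*} [CommSemiring R] (e : ℕ) (a : ℕ → ℕ) (x : R) :
    (trunc e a : R[X]).eval x = ∑ v ∈ Finset.range e, (a v : R) * x ^ v := by
  simp [trunc, eval_finsetSum]

theorem natDegree_trunc_le {R : Type*} [CommSemiring R] (e : ℕ) (a : ℕ → ℕ) :
    (trunc e a : R[X]).natDegree ≤ e - 1 := by
  refine natDegree_le_iff_coeff_eq_zero.mpr fun k hk => ?_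
  rw [coeff_trunc, if_neg (by omega)]

/-- A coefficient contributes at most `e - 1` to the degree and each of the `m` coordinates at most
`(d - 1) * (e - 1)`; the sum is at most `m * d * (e - 1)` because `m ≥ 1`. -/
theorem natDegree_valuePoly_le {R : Type*} [CommSemiring R] {m d e : ℕ} (hd : 0 < d) (hm : 0 < m)
    (c : ℕ → ℕ → ℕ) (α : ℕ → ℕ → ℕ) : (valuePoly R m d e c α).natDegree ≤ m * d * (e - 1) := by
  unfold valuePoly ev
  refine natDegree_sum_le_of_forall_le _ _ fun k _ => natDegree_mul_le.trans ?_
  have h1 : (∏ i ∈ Finset.range m, (trunc e (α i) : R[X]) ^ (k / d ^ i % d)).natDegree ≤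
      m * ((d - 1) * (e - 1)) := by
    refine (natDegree_prod_le _ _).trans ?_
    refine (Finset.sum_le_card_nsmul _ _ ((d - 1) * (e - 1)) fun i _ => ?_).trans (by simp)
    refine natDegree_pow_le.trans (Nat.mul_le_mul ?_ (natDegree_trunc_le _ _))
    have := Nat.mod_lt (k / d ^ i) hd
    omega
  have h2 := natDegree_trunc_le (R := R) e fun u => c u k
  obtain ⟨d, rfl⟩ : ∃ d', d = d' + 1 := ⟨d - 1, by omega⟩
  obtain ⟨m, rfl⟩ : ∃ m', m = m' + 1 := ⟨m - 1, by omega⟩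
  have h3 : (m + 1) * (d + 1) * (e - 1) = (e - 1) + (m + 1) * (d * (e - 1)) + m * (e - 1) := by ring
  rw [h3]
  simp only [Nat.add_sub_cancel] at h1
  exact (Nat.add_le_add h2 h1).trans (Nat.le_add_right _ _)

/-- The bound `e * d * m` is the number of conditions imposed by `e * d` nodes of multiplicity `m`.
-/
theorem degree_valuePoly_lt {R : Type*} [CommSemiring R] {m d e : ℕ} (hd : 0 < d) (hm : 0 < m)
    (he : 0 < e) (c : ℕ → ℕ → ℕ) (α : ℕ → ℕ → ℕ) :
    (valuePoly R m d e c α).degree < (e * d * m : ℕ) := by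
  refine (degree_le_natDegree.trans (Nat.cast_le.mpr (natDegree_valuePoly_le hd hm c α))).trans_lt ?_
  rw [Nat.cast_lt]
  obtain ⟨e, rfl⟩ : ∃ e', e = e' + 1 := ⟨e - 1, by omega⟩
  have := Nat.mul_pos hm hd
  have h : (e + 1) * d * m = m * d * e + m * d := by ring
  rw [Nat.add_sub_cancel, h]
  omega

/-- The value at `1` is the sum of the coefficients, and over `ℕ` there is no cancellation. This is
the reason for working in `ℕ[X]`. -/
theorem coeff_le_eval_one (P : ℕ[X]) (k : ℕ) : P.coeff k ≤ P.eval 1 := by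
  rw [eval_eq_sum_range]
  by_cases hk : k ≤ P.natDegree
  · simpa using Finset.single_le_sum (f := fun i => P.coeff i * 1 ^ i) (fun _ _ => Nat.zero_le _)
      (Finset.mem_range.mpr (Nat.lt_succ_of_le hk))
  · rw [coeff_eq_zero_of_natDegree_lt (by omega)]; exact Nat.zero_le _

/-- At `z = 1` the coefficients become at most `e * (r - 1)` and the coordinates at most `e * r`. So
the value is at most `d ^ m * e * (r - 1) * (e * r) ^ (m * (d - 1))`, and the strict inequality
comes from `e * (r - 1) < e * r`. -/
theorem coeff_valuePoly_lt {m d e r q : ℕ} (hd : 0 < d) (hm : 0 < m) (he : 0 < e) (hr : 0 < r)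
    {c : ℕ → ℕ → ℕ} {α : ℕ → ℕ → ℕ} (hc : ∀ u k, c u k < r) (hα : ∀ i v, α i v < r)
    (hq : (d * (e * r) ^ d) ^ m ≤ q) (k : ℕ) : (valuePoly ℕ m d e c α).coeff k < q := by
  refine (coeff_le_eval_one _ k).trans_lt (lt_of_lt_of_le ?_ hq)
  have h1 : (valuePoly ℕ m d e c α).eval 1 =
      ev m d (fun k => ∑ u ∈ Finset.range e, c u k) fun i => ∑ v ∈ Finset.range e, α i v := by
    have := map_ev (evalRingHom (1 : ℕ)) m d (fun k => (trunc e fun u => c u k : ℕ[X]))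
      fun i => trunc e (α i)
    simp only [coe_evalRingHom, eval_trunc, one_pow, mul_one, Nat.cast_id] at this
    exact this
  rw [h1]
  have hs : ∀ a : ℕ → ℕ, (∀ v, a v < r) → ∑ v ∈ Finset.range e, a v ≤ e * (r - 1) := fun a ha => by
    refine (Finset.sum_le_card_nsmul _ _ (r - 1) fun v _ => ?_).trans (by simp)
    have := ha v
    omega
  refine (ev_le (Q := e * (r - 1)) (r := e * r) (Nat.mul_pos he hr) (fun k _ => hs _ fun u => hc u k)
    fun i _ => (hs _ (hα i)).trans (Nat.mul_le_mul_left _ (Nat.sub_le _ _))).trans_lt ?_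
  have h2 : e * (r - 1) < e * r := Nat.mul_lt_mul_of_pos_left (by omega) he
  have h3 : (d * (e * r) ^ d) ^ m = d ^ m * (e * r) ^ (d * m) := by rw [mul_pow, pow_mul]
  rw [h3]
  refine Nat.mul_lt_mul_of_pos_left ?_ (Nat.pow_pos hd)
  have h4 : 0 < (e * r) ^ (m * (d - 1)) := Nat.pow_pos (Nat.mul_pos he hr)
  refine (Nat.mul_lt_mul_of_pos_right h2 h4).trans_le ?_
  rw [← pow_succ']
  refine Nat.pow_le_pow_right (Nat.mul_pos he hr) ?_
  obtain ⟨d, rfl⟩ : ∃ d', d = d' + 1 := ⟨d - 1, by omega⟩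
  rw [Nat.add_sub_cancel, Nat.mul_comm (d + 1), Nat.mul_succ]
  omega

/-! ## Evaluation and interpolation -/

section Stages

variable {B : ℕ} [hB : Fact (8 ≤ B)] {m d e l q r N : ℕ}

theorem cost_get_get_le (L : List (List (List ℕ))) (i j : ℕ) :
    (get (get (.var (τ := .list (.list (.list .nat))) L) (.var (τ := .nat) i))
      (.var (τ := .nat) j)).cost ≤ B ^ 2 := by
  rw [cost_get, cost_get, cost_var, cost_var, cost_var]
  have := eight_mul_pow_le (B := B) 1
  have := one_le_pow_base (B := B) 1
  simp only [Nat.reduceAdd] at *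
  omega

theorem cost_get_le {τ : Ty} (L : List τ.den) (i : ℕ) :
    (get (.var (τ := .list τ) L) (.var (τ := .nat) i)).cost ≤ B ^ 1 := by
  rw [cost_get, cost_var, cost_var, pow_one]
  have := hB.out
  omega

/-- MME-B is called for every exponent vector, node and `u < e`. The vectors give the weight, while
`l` and `e` are at most `B` and only raise the exponent. -/
theorem runs_mmeB (h : Sizes B m d e l q) {r t : ℕ} (hr : 1 < r) (hq : q = r ^ m)
    (hrB : SmallBase B (.var (τ := .nat) m) (.var (τ := .nat) d) r) {vs : List (List ℕ)}
    (hvs : vs = expo m m) {fvs bjs : List (List (List ℕ))} {c : ℕ → ℕ → ℕ} {p : ℕ → ℕ → ℕ → ZMod q}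
    (hf : Arr [] vs.length (fun k => Arr [] e fun u L => Bd (B ^ 1) (.list .nat) L ∧
        ∀ κ < d ^ m, (L.getD κ 0 : ZMod q) =
          hasseC m d (fun κ => (c u κ : ZMod q)) (fun i => (vs.getD k []).getD i 0) κ) fvs)
    (hb : Arr [] l (fun j => Arr [] N fun i => Arr 0 m fun c x => x < q ∧ (x : ZMod q) = p i c j) bjs) :
    Runs B (2 ^ (2 * m) * (1 + timeB B m d t r N)) 20
      (MME.tab (MME.len (.var (τ := .list (.list .nat)) vs)) fun k =>
        MME.tab (.var (τ := .nat) l) fun j => MME.tab (.var (τ := .nat) e) fun u =>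
          mmeB (.var (τ := .nat) m) (.var (τ := .nat) d)
            (get (get (.var (τ := .list (.list (.list .nat))) fvs) k) u)
            (get (.var (τ := .list (.list (.list .nat))) bjs) j) (.var (τ := .nat) r)
            (.var (τ := .nat) m) (.var (τ := .nat) t))
      (Arr [] vs.length fun k => Arr [] l fun j => Arr [] e fun u => Arr 0 N fun i y =>
        Nat.size y ≤ B ^ 1 ∧ (y : ZMod q) =
          ev m d (hasseC m d (fun κ => (c u κ : ZMod q)) fun i => (vs.getD k []).getD i 0)
            fun c => p i c j) := by
  have hV : vs.length ≤ 2 ^ (2 * m) := by rw [hvs, two_mul]; exact length_expo_le m m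
  set T := timeB B m d t r N with hT
  refine (Runs.tab_len (l := 10) (W₂ := 1 + T) rfl hV le_rfl
    (Nat.mul_pos (by positivity) (by omega)) (by omega) fun k hk => ?_).mono
    le_rfl (by decide) fun _ h => h
  refine (Runs.tab_var (l := 8) h.l_le (by omega) fun j hj => ?_)
  refine (Runs.tab_var (l := 6) h.e_le (by omega) fun u hu => ?_)
  have hF : Ok B 1 2 (get (get (.var (τ := .list (.list (.list .nat))) fvs) (.var (τ := .nat) k))
      (.var (τ := .nat) u)) := ⟨((hf.2 k hk).2 u hu).1, cost_get_get_le _ _ _⟩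
  have hbj := hb.2 j hj
  have hP : Ok B 1 2 (get (.var (τ := .list (.list (.list .nat))) bjs) (.var (τ := .nat) j)) := by
    refine ⟨?_, (cost_get_le _ _).trans (pow_mono_exp (by decide))⟩
    exact hbj.bd (τ := .list .nat) fun i _ x hx => hx.bd (τ := .nat) fun c _ y hy =>
      (Nat.size_le_size hy.1.le).trans h.q_size
  have hmv : Ok B 1 2 (.var (τ := .nat) m : Tm Ty.den Proc .nat) := h.fits.m_ok.mono le_rfl (by decide)
  obtain ⟨h1, h2⟩ := mmeB_spec (t := .var (τ := .nat) t) h.fits hF hP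
    ((show Ok B 1 0 (.var (τ := .nat) r) from Ok.var hrB.size_le).mono le_rfl (by decide)) hmv
    (by rw [cost_var]; exact one_le_pow_base _) hr h.m_pos le_rfl hrB
  have hval : (mmeB (.var (τ := .nat) m) (.var (τ := .nat) d)
            (get (get (.var (τ := .list (.list (.list .nat))) fvs) (.var (τ := .nat) k)) (.var (τ := .nat) u))
            (get (.var (τ := .list (.list (.list .nat))) bjs) (.var (τ := .nat) j)) (.var (τ := .nat) r)
            (.var (τ := .nat) m) (.var (τ := .nat) t)).val = (List.range N).map fun i =>
      ev m d (fun κ => ((fvs.getD k []).getD u []).getD κ 0)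
        (fun c => ((bjs.getD j []).getD i []).getD c 0) % q := by
    rw [val_mmeB]
    refine (evaluates_mmeProc (.var (τ := .nat) m) (.var (τ := .nat) d) h.d_pos h.m_pos t _ _ r m hr h.m_pos le_rfl).trans ?_
    rw [hq]
    exact congrArg (fun n => (List.range n).map _) hbj.1
  refine ⟨h2.trans ?_, ?_⟩
  · have e1 : timeB B (Tm.var (τ := .nat) m).nv (Tm.var (τ := .nat) d).nv (Tm.var (τ := .nat) t).nv
        (Tm.var (τ := .nat) r).nv (List.length (α := List ℕ)
          (get (.var (τ := .list (.list (.list .nat))) bjs) (.var (τ := .nat) j)).val) = T := by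
      rw [hT, ← hbj.1]; rfl
    rw [e1, add_mul, one_mul]
    exact Nat.add_le_add (pow_mono_exp (by decide)) (Nat.le_mul_of_pos_right _ (one_le_pow_base _))
  · rw [hval] at h1 ⊢
    refine ⟨by simp, fun i hi => ?_⟩
    have e2 := getD_map_range (fun i => ev m d (fun κ => ((fvs.getD k []).getD u []).getD κ 0)
        (fun c => ((bjs.getD j []).getD i []).getD c 0) % q) 0 hi
    rw [e2]
    refine ⟨h1 _ (List.mem_map.mpr ⟨i, List.mem_range.mpr hi, rfl⟩), ?_⟩
    rw [ZMod.natCast_mod]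
    refine (map_ev (Nat.castRingHom (ZMod q)) m d _ _).trans (ev_congr (fun κ hκ => ?_) fun c hc => ?_)
    · exact ((hf.2 k hk).2 u hu).2 κ hκ
    · exact ((hbj.2 i hi).2 c hc).2

end Stages

end MME

namespace MME

open Polynomial

/-! ### Taylor sums, Hermite interpolation, reduction modulo `r` and `E`. -/

section Stages

variable {B : ℕ} [hB : Fact (8 ≤ B)] {m d e l q r N : ℕ}

omit hB in
theorem toPoly_of_arr {a : ℕ → ℕ} {L : List ℕ} (h : Arr 0 e (fun u y => y = a u) L) :
    toPoly q L = trunc e a := by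
  ext k
  rw [coeff_toPoly, coeff_trunc]
  split_ifs with hk
  · rw [h.2 k hk]
  · rw [List.getD_eq_default _ _ (by rw [h.1]; omega), Nat.cast_zero]

/-- The polynomial found at the node `j` is pinned down only up to a multiple of `(z - j) ^ m`, by
`taylor_dvd`; interpolation needs no more. -/
theorem runs_taylor (h : Sizes B m d e l q) {vs : List (List ℕ)} (hvs : vs = expo m m)
    {as bjs : List (List (List ℕ))} {ys : List (List (List (List ℕ)))} {ls : List (List ℕ)}
    {c : ℕ → ℕ → ℕ} {α : ℕ → ℕ → ℕ → ℕ}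
    (has : Arr [] N (fun i => Arr [] m fun c => Arr 0 e fun u y => y = α i c u) as)
    (hα : ∀ i c u, α i c u < q)
    (hb : Arr [] l (fun j => Arr [] N fun i => Arr 0 m fun c x => x < q ∧ (x : ZMod q) =
      ∑ v ∈ Finset.range e, (α i c v : ZMod q) * (j : ZMod q) ^ v) bjs)
    (hy : Arr [] vs.length (fun k => Arr [] l fun j => Arr [] e fun u => Arr 0 N fun i y =>
        Nat.size y ≤ B ^ 1 ∧ (y : ZMod q) =
          ev m d (hasseC m d (fun κ => (c u κ : ZMod q)) fun i => (vs.getD k []).getD i 0)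
            fun c => ∑ v ∈ Finset.range e, (α i c v : ZMod q) * (j : ZMod q) ^ v) ys)
    (hls : Arr [] l (fun j L => PolyOk B 0 q (1 + 2 * m) (.var (τ := .list .nat) L)
        ((X - C (j : ZMod q)) ^ m)) ls) :
    Runs B (2 ^ (2 * m) * (N + 1)) 100
      (MME.tab (MME.len (.var (τ := .list (.list (.list .nat))) as)) fun i =>
        MME.tab (.var (τ := .nat) l) fun j =>
          taylorPoly (.var (τ := .nat) m) (.var (τ := .nat) e) (.var (τ := .nat) q)
            (.var (τ := .list (.list .nat)) vs)
            (fun u k => get (get (get (get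
              (.var (τ := .list (.list (.list (.list .nat)))) ys) k) j) u) i)
            (get (.var (τ := .list (.list (.list .nat))) as) i)
            (get (get (.var (τ := .list (.list (.list .nat))) bjs) j) i)
            (get (.var (τ := .list (.list .nat)) ls) j))
      (Arr [] N fun i => Arr [] l fun j L => ∃ P,
        PolyOk B 0 q m (.var (τ := .list .nat) L) P ∧
          (X - C (j : ZMod q)) ^ m ∣ valuePoly (ZMod q) m d e c (α i) - P) := by
  have hV : vs.length ≤ 2 ^ (2 * m) := by rw [hvs, two_mul]; exact length_expo_le m m
  have hV1 : 1 ≤ 2 ^ (2 * m) := Nat.one_le_two_pow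
  have hq0 : 0 < q := by have := h.q_gt; omega
  have : Nontrivial (ZMod q) := ZMod.nontrivial_iff.mpr (by have := h.q_gt; omega)
  refine (Runs.tab_len (l := 95) (W₁ := N + 1) (W₂ := 2 ^ (2 * m)) has.1 (Nat.le_succ N)
    (mul_comm _ _).le (Nat.mul_pos hV1 (by omega)) hV1 fun i hi => ?_).mono le_rfl (by decide)
    fun _ h => h
  refine (Runs.tab_var (l := 93) h.l_le hV1 fun j hj => ?_)
  have hspec := taylorPoly_spec (B := B) (q := q) (vs := vs) (W := 2 ^ (2 * m))
    (a := get (.var (τ := .list (.list (.list .nat))) as) (.var (τ := .nat) i))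
    (b := get (get (.var (τ := .list (.list (.list .nat))) bjs) (.var (τ := .nat) j))
      (.var (τ := .nat) i))
    (lj := get (.var (τ := .list (.list .nat)) ls) (.var (τ := .nat) j))
    (A := fun c => trunc e (α i c)) (L := (X - C (j : ZMod q)) ^ m)
    (Y := fun u k => ev m d (hasseC m d (fun κ => (c u κ : ZMod q)) fun i =>
      (vs.getD k []).getD i 0) fun c => ∑ v ∈ Finset.range e, (α i c v : ZMod q) * (j : ZMod q) ^ v)
    (y := fun u k => get (get (get (get
      (.var (τ := .list (.list (.list (.list .nat)))) ys) k) (.var (τ := .nat) j)) u)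
      (.var (τ := .nat) i))
    h.q_size h.q_gt h.m_le h.e_le h.e_pos rfl rfl rfl
    ((cost_get_le _ _).trans (pow_mono_exp (by decide))) (cost_get_get_le _ _ _)
    ((cost_get_le _ _).trans (pow_mono_exp (by decide)))
    (fun c hc => ?_) (fun c hc => (((hb.2 j hj).2 i hi).2 c hc).1) ?_ hV hV1
    (fun u hu k hk => ?_) (hls.2 j hj) ((monic_X_sub_C _).pow m)
    (by rw [(monic_X_sub_C _).natDegree_pow, natDegree_X_sub_C, mul_one])
  · refine ⟨hspec.1.trans (Nat.mul_le_mul_left _ (pow_mono_exp (by decide))), _, hspec.2, ?_⟩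
    rw [valuePoly_eq_sum]
    subst hvs
    have htd := taylor_dvd (d := d) (e := e) h.m_pos (fun u k => (c u k : ZMod q))
      (fun c => trunc e (α i c)) (j : ZMod q)
      (fun c => ((bjs.getD j []).getD i []).getD c 0) fun c hc => by
        rw [eval_trunc]; exact (((hb.2 j hj).2 i hi).2 c hc).2
    convert htd using 6 with u hu k hk
    · refine ev_congr (fun _ _ => rfl) fun c hc => ?_
      exact (((hb.2 j hj).2 i hi).2 c hc).2.symm
    · rfl
  · have hc' := (has.2 i hi).2 c hc
    refine ⟨hc'.1, hc'.forall_mem fun u _ x hx => hx ▸ hα i c u, toPoly_of_arr hc'⟩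
  · intro k hk c
    have hw : vs.getD k [] ∈ expo m m := by
      rw [List.getD_eq_getElem _ _ hk, ← hvs]; exact List.getElem_mem hk
    generalize vs.getD k [] = w at hw
    by_cases hcw : c < w.length
    · rw [List.getD_eq_getElem _ _ hcw]
      exact (List.single_le_sum (by simp) _ (List.getElem_mem hcw)).trans
        (((mem_expo h.m_pos).mp hw).2.le.trans h.m_le)
    · rw [List.getD_eq_default _ _ (by omega)]; exact Nat.zero_le _
  · have hyk := (((hy.2 k hk).2 j hj).2 u hu).2 i hi
    refine ⟨⟨hyk.1, ?_⟩, hyk.2⟩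
    rw [cost_get, cost_get, cost_get, cost_get, cost_var, cost_var, cost_var, cost_var, cost_var]
    have := eight_mul_pow_le (B := B) 1
    have := pow_mono_exp (B := B) (show 2 ≤ 10 by decide)
    have := hB.out
    simp only [Nat.reduceAdd, pow_one] at *
    omega

theorem runs_hermiteBasis (h : Sizes B m d e l q) {p R : ℕ} (hp : p.Prime) (hR : R ≠ 0)
    (hqR : q = p ^ R) (hlp : l ≤ p) (hpB : p ≤ B ^ 2) {ls : List (List ℕ)}
    (hls : Arr [] l (fun j L => PolyOk B 0 q (1 + 2 * m) (.var (τ := .list .nat) L)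
        ((X - C (j : ZMod q)) ^ m)) ls) :
    Runs B 1 90 (hermiteBasis (.var (τ := .nat) p) (.var (τ := .nat) q) (.var (τ := .nat) l)
        (.var (τ := .nat) m) (.var (τ := .list (.list .nat)) ls))
      (Arr [] l fun j L => ∃ D, PolyOk B 0 q (1 + B ^ 5) (.var (τ := .list .nat) L) D ∧
        (X - C (j : ZMod q)) ^ m ∣ D - 1 ∧ ∀ k < l, k ≠ j → (X - C (k : ZMod q)) ^ m ∣ D) := by
  rw [hermiteBasis_eq]
  refine (Runs.tab_var (l := 80) h.l_le le_rfl fun j hj => ?_).mono le_rfl (by decide) fun _ h => h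
  obtain ⟨D, hD, h1⟩ := hermiteCell_spec (n := m) (ls := ls) hp hR hqR h.q_size hj hlp hpB h.l_le
    h.m_le hls.2
  exact ⟨by rw [one_mul]; exact hD.cost, D, hD.to_var rfl, h1⟩

theorem runs_modulus (h : Sizes B m d e l q) {ls : List (List ℕ)}
    (hls : Arr [] l (fun j L => PolyOk B 0 q (1 + 2 * m) (.var (τ := .list .nat) L)
        ((X - C (j : ZMod q)) ^ m)) ls) :
    Runs B 1 62 (prodExcept (.var (τ := .nat) q) (.var (τ := .nat) l) (.var (τ := .nat) l)
        (.var (τ := .list (.list .nat)) ls))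
      fun L => PolyOk B 0 q (B ^ 4) (.var (τ := .list .nat) L)
        (∏ k ∈ Finset.range l, (X - C (k : ZMod q)) ^ m) := by
  have hq0 : 0 < q := by have := h.q_gt; omega
  have := PolyOk.prodExcept (j := l) h.q_size hq0 h.l_le h.l_le h.m_le hls.2
  -- The omitted index is `l` itself, which is not a node, so no factor is left out.
  rw [Finset.erase_eq_of_notMem (by simp)] at this
  refine ⟨by rw [one_mul]; exact this.cost, (this.to_var rfl).mono le_rfl ?_⟩
  have h1 : 1 + 2 * m ≤ B ^ 2 := by
    have := eight_mul_pow_le (B := B) 1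
    have := one_le_pow_base (B := B) 1
    have := h.m_le
    simp only [Nat.reduceAdd] at *
    omega
  have h3 := (Nat.mul_le_mul h.l_le h1).trans_eq (by rw [← pow_add])
  have := succ_pow_le (B := B) 3
  simp only [Nat.reduceAdd] at *
  omega

theorem runs_hermite (h : Sizes B m d e l q) {p R : ℕ} (hp : p.Prime)
    (hqR : q = p ^ R) (hlp : l ≤ p) {bijs : List (List (List ℕ))} {ds : List (List ℕ)}
    {g : List ℕ} {A : ℕ → (ZMod q)[X]}
    (hds : Arr [] l (fun j L => ∃ D, PolyOk B 0 q (1 + B ^ 5) (.var (τ := .list .nat) L) D ∧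
        (X - C (j : ZMod q)) ^ m ∣ D - 1 ∧ ∀ k < l, k ≠ j → (X - C (k : ZMod q)) ^ m ∣ D) ds)
    (hg : PolyOk B 0 q (B ^ 4) (.var (τ := .list .nat) g)
      (∏ k ∈ Finset.range l, (X - C (k : ZMod q)) ^ m))
    (hb : Arr [] N (fun i => Arr [] l fun j L => ∃ P,
        PolyOk B 0 q m (.var (τ := .list .nat) L) P ∧ (X - C (j : ZMod q)) ^ m ∣ A i - P) bijs)
    (hA : ∀ i < N, (A i).degree < (l * m : ℕ)) {as : List (List (List ℕ))} (has : as.length = N) :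
    Runs B (N + 1) 80 (MME.tab (MME.len (.var (τ := .list (.list (.list .nat))) as)) fun i =>
        hermite (.var (τ := .nat) q) (.var (τ := .nat) l) (.var (τ := .nat) m)
          (.var (τ := .list (.list .nat)) ds) (.var (τ := .list .nat) g)
          (get (.var (τ := .list (.list (.list .nat))) bijs) i))
      (Arr [] N fun i L => L.length ≤ l * m ∧ (∀ x ∈ L, x < q) ∧ toPoly q L = A i) := by
  refine (Runs.tab_len (l := 70) (W₂ := 1) has (Nat.le_succ N) (mul_one _).le (by omega) le_rfl
    fun i hi => ?_).mono le_rfl (by decide) fun _ h => h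
  have hbi := hb.2 i hi
  choose! D hD hD1 hD0 using hds.2
  choose! b hbP hbA using hbi.2
  obtain ⟨h1, h2⟩ := hermite_spec (bs := get (.var (τ := .list (.list (.list .nat))) bijs)
    (.var (τ := .nat) i)) (D := D) (b := b) (A := A i) h.q_size h.q_gt h.l_le h.m_le hD
    (fun j hj => ⟨(cost_get_get_le _ _ _).trans (pow_mono_exp (by decide)), (hbP j hj).len,
      (hbP j hj).le, (hbP j hj).poly⟩) hg
    (fun j hj k hk hjk => isUnit_sub_of_lt hp hqR (by omega) (by omega) hjk) hD1 hD0 hbA (hA i hi)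
  exact ⟨by rw [one_mul]; exact h1.cost, h1.len, h2, h1.poly⟩

-- `PolyOk` only guarantees entries at most `r`. The output has to consist of the canonical
-- representatives, so the strict bound is tracked through the division separately.
omit hB in
theorem polyRem_lt {a g : Tm Ty.den Proc (.list .nat)} {n : Tm Ty.den Proc .nat} (hr : 0 < r)
    (ha : ∀ x ∈ (show List ℕ from a.val), x < r) :
    ∀ x ∈ (show List ℕ from (polyRem (.var (τ := .nat) r) a g n).val), x < r := by
  intro x hx
  have hget : ∀ (L : List ℕ) (y : ℕ), (∀ x ∈ L, x < r) → L.getD y 0 < r := fun L y hL => by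
    by_cases hy : y < L.length
    · rw [List.getD_eq_getElem _ _ hy]; exact hL _ (List.getElem_mem hy)
    · rw [List.getD_eq_default _ _ (by omega)]; exact hr
  unfold polyRem at hx
  rw [val_share, val_share, val_share, val_tab] at hx
  obtain ⟨k, -, rfl⟩ := List.mem_map.mp hx
  refine hget _ _ ?_
  refine loop_val (τ := .list .nat) (fun _ (s : List ℕ) => ∀ x ∈ s, x < r) ha ?_
  intro i _ s hs x hx
  rw [val_share, val_share, val_tab] at hx
  obtain ⟨k, -, rfl⟩ := List.mem_map.mp hx
  rw [val_eq_nv, nv_cond]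
  split_ifs
  · exact hget s _ hs
  · exact Nat.mod_lt _ hr

/-- The array represents a polynomial over `ℕ` modulo `q`. Its entries and the true coefficients are
all below `q`, so they agree, and they may then be reduced modulo the unrelated number `r`. -/
theorem runs_reduction (h : Sizes B m d e l q) (hr : 1 < r) (hrq : r ≤ q) {bs : List (List ℕ)}
    {P : ℕ → ℕ[X]} {E : List ℕ} {G : (ZMod r)[X]}
    (hb : Arr [] N (fun i L => L.length ≤ l * m ∧ (∀ x ∈ L, x < q) ∧
      toPoly q L = (P i).map (Nat.castRingHom (ZMod q))) bs)
    (hP : ∀ i < N, ∀ k, (P i).coeff k < q)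
    (hE : PolyOk B 0 r (1 + e) (.var (τ := .list .nat) E) G) (hG : G.Monic)
    (hGe : G.natDegree = e) :
    Runs B (N + 1) 80 (MME.tab (MME.len (.var (τ := .list (.list .nat)) bs)) fun i =>
        polyRem (.var (τ := .nat) r)
          (MME.tab (MME.len (get (.var (τ := .list (.list .nat)) bs) i)) fun k =>
            get (get (.var (τ := .list (.list .nat)) bs) i) k % .var (τ := .nat) r)
          (.var (τ := .list .nat) E) (.var (τ := .nat) e))
      (Arr [] N fun i L => L = (List.range e).map fun u =>
        (((P i).map (Nat.castRingHom (ZMod r)) %ₘ G).coeff u).val) := by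
  have hr0 : 0 < r := by omega
  have : NeZero r := ⟨by omega⟩
  have hrs : Nat.size r ≤ B ^ 1 := (Nat.size_le_size hrq).trans h.q_size
  have hrv : Ok B 1 0 (.var (τ := .nat) r : Tm Ty.den Proc .nat) := Ok.var hrs
  refine (Runs.tab_len (l := 70) (W₂ := 1) hb.1 (Nat.le_succ N) (mul_one _).le (by omega) le_rfl
    fun i hi => ?_).mono le_rfl (by decide) fun _ h => h
  obtain ⟨hl, hlt, hpoly⟩ := hb.2 i hi
  set L := bs.getD i [] with hL
  have hlm : l * m ≤ B ^ 2 := (Nat.mul_le_mul h.l_le h.m_le).trans_eq (by rw [← pow_add])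
  -- Two natural numbers below `q` that are congruent modulo `q` are equal; this is the passage from
  -- `ZMod q` back to `ℕ`.
  have hget : ∀ k, L.getD k 0 = (P i).coeff k := fun k => by
    have h1 := congrArg (fun p => p.coeff k) hpoly
    simp only [coeff_toPoly, coeff_map, eq_natCast] at h1
    have h2 := (ZMod.natCast_eq_natCast_iff' _ _ _).mp h1
    rw [Nat.mod_eq_of_lt (hP i hi k)] at h2
    rw [← h2, Nat.mod_eq_of_lt]
    by_cases hk : k < L.length
    · rw [List.getD_eq_getElem _ _ hk]; exact hlt _ (List.getElem_mem hk)
    · rw [List.getD_eq_default _ _ (by omega)]; have := h.q_gt; omega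
  have hLb : Bd (B ^ 1) (.list .nat) L := fun x hx => (Nat.size_le_size (hlt x hx).le).trans h.q_size
  have hgL : Ok B 1 1 (get (.var (τ := .list (.list .nat)) bs) (.var (τ := .nat) i)) :=
    ⟨hLb, cost_get_le _ _⟩
  set A : Tm Ty.den Proc (.list .nat) := MME.tab (MME.len (get (.var (τ := .list (.list .nat)) bs) (.var (τ := .nat) i)))
    fun k => get (get (.var (τ := .list (.list .nat)) bs) (.var (τ := .nat) i)) k
      % .var (τ := .nat) r with hA
  have hnv : (MME.len (get (.var (τ := .list (.list .nat)) bs) (.var (τ := .nat) i))).nv = L.length :=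
    rfl
  have hAlt : ∀ x ∈ (show List ℕ from A.val), x < r := fun x hx => by
    rw [hA, val_tab] at hx
    obtain ⟨k, -, rfl⟩ := List.mem_map.mp hx
    exact Nat.mod_lt _ hr0
  have hAok : PolyOk B 40 r (l * m) A ((P i).map (Nat.castRingHom (ZMod r))) := by
    refine ⟨?_, ?_, fun x hx => (hAlt x hx).le, ?_⟩
    · exact ((Ok.tab (j₁ := 2) (j := 1) (l := 20) (hgL.len (j := 2) (hl.trans hlm)) (hl.trans hlm)
        fun k _ => ((hgL.get_var k).mod_pos hrv hr0).mono le_rfl (by decide)).mono le_rfl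
        (by decide : _ ≤ 40)).cost
    · rw [hA, val_tab, List.length_map, List.length_range, hnv]; exact hl
    · rw [hA, val_tab]
      refine toPoly_map_range (fun k _ => ?_) fun k hk => ?_
      · rw [val_eq_nv, nv_mod, nv_var, ZMod.natCast_mod, coeff_map, eq_natCast, ← hget]
        rfl
      · rw [hnv] at hk
        rw [coeff_map, ← hget, List.getD_eq_default _ _ hk, map_zero]
  have hev : Ok B 6 10 (.var (τ := .nat) e : Tm Ty.den Proc .nat) :=
    (show Ok B 1 0 (.var (τ := .nat) e) from Ok.var ((size_self_le e).trans h.e_le)).mono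
      (by decide) (by decide)
  obtain ⟨h1, h2⟩ := hAok.rem hrs hr hE hev (h.e_le.trans (pow_mono_exp (by decide)))
    (hlm.trans (pow_mono_exp (by decide))) hG hGe
  set Z := polyRem (V := Ty.den) (F := Proc) (.var (τ := .nat) r) A (.var (τ := .list .nat) E)
    (.var (τ := .nat) e) with hZ
  have h3 : ∀ x ∈ (show List ℕ from Z.val), x < r := polyRem_lt hr0 hAlt
  refine ⟨by rw [one_mul]; exact h1.cost.trans (pow_mono_exp (by decide)), ?_⟩
  have h4 := h1.poly
  generalize Z.val = L' at h2 h3 h4 ⊢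
  obtain ⟨L', rfl⟩ : ∃ v : List ℕ, v = L' := ⟨L', rfl⟩
  have h2 : L'.length = e := h2
  rw [← h4]
  refine List.ext_getElem (by simp [h2]) fun u hu1 hu2 => ?_
  rw [List.getElem_map, List.getElem_range, coeff_toPoly, List.getD_eq_getElem _ _ hu1,
    ZMod.val_natCast, Nat.mod_eq_of_lt (h3 _ (List.getElem_mem hu1))]

end Stages

end MME

namespace MME

/-! ### Composition of the stages of MME-For-Extension-Rings-B. -/

open Polynomial

variable {B : ℕ} [hB : Fact (8 ≤ B)]

omit hB in
theorem le_mul_mul_pow {d e r : ℕ} (hd : 1 ≤ d) (he : 1 ≤ e) :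
    r ≤ d * (e * r) ^ d := by
  have h1 : r ≤ e * r := Nat.le_mul_of_pos_left _ he
  have h2 : e * r ≤ (e * r) ^ d := Nat.le_self_pow (by omega) _
  exact h1.trans (h2.trans (Nat.le_mul_of_pos_left _ hd))

/-- The result and the number of steps of MME-For-Extension-Rings-B. -/
theorem runs_mmeForExtensionRingsB {m d e r t N x R : ℕ}
    (hF : Fits B (.var (τ := .nat) m) (.var (τ := .nat) d)) (he : 1 ≤ e) (hr : 2 ≤ r)
    (hx : x = d * (e * r) ^ d) (hR : R = 2 * (e * d) * x)
    (hRB : SmallBase B (.var (τ := .nat) m) (.var (τ := .nat) d) R) (heB : e ≤ B ^ 1)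
    (hlB : 2 * (e * d) ≤ B ^ 1) {f : List (List ℕ)} {as : List (List (List ℕ))} {E : List ℕ}
    {G : (ZMod r)[X]} (hf : f.length = d ^ m) (has : as.length = N)
    (hfr : ∀ k u, (f.getD k []).getD u 0 < r)
    (har : ∀ i c u, ((as.getD i []).getD c []).getD u 0 < r)
    (hE : PolyOk B 0 r (1 + e) (.var (τ := .list .nat) E) G) (hG : G.Monic)
    (hGe : G.natDegree = e) :
    Runs B (2 ^ (2 * m) * (d ^ m + N + 1 + timeB B m d t R N)) 130
      (mmeForExtensionRingsB (.var (τ := .nat) m) (.var (τ := .nat) d) (.var (τ := .nat) e)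
        (.var (τ := .list (.list .nat)) f) (.var (τ := .list (.list (.list .nat))) as)
        (.var (τ := .nat) r) (.var (τ := .nat) t) (.var (τ := .list .nat) E))
      fun L => L = (List.range N).map fun i => (List.range e).map fun u =>
        (((valuePoly (ZMod r) m d e (fun u k => (f.getD k []).getD u 0) fun c v =>
          ((as.getD i []).getD c []).getD v 0) %ₘ G).coeff u).val := by
  have hm0 : 0 < m := hF.m_pos
  have hd0 : 0 < d := hF.d_pos
  have hmB : m ≤ B ^ 1 := by have := hF.m_le; simp only [nv_var] at this; omega
  have hdB : d ≤ B ^ 1 := by have := hF.m_le; simp only [nv_var] at this; omega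
  have hl0 : 0 < e * d := Nat.mul_pos he hd0
  have hrx : r ≤ x := hx ▸ le_mul_mul_pow hd0 he
  have hxR : x ≤ R := hR ▸ Nat.le_mul_of_pos_left _ (by omega)
  have hev : Ok B 1 0 (.var (τ := .nat) e : Tm Ty.den Proc .nat) :=
    Ok.var ((size_self_le e).trans heB)
  have hdv : Ok B 1 0 (.var (τ := .nat) d : Tm Ty.den Proc .nat) :=
    Ok.var ((size_self_le d).trans hdB)
  have hrv : Ok B 1 0 (.var (τ := .nat) r : Tm Ty.den Proc .nat) :=
    Ok.var ((Nat.size_le_size (hrx.trans hxR)).trans hRB.size_le)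
  have hmv : Ok B 1 0 (.var (τ := .nat) m : Tm Ty.den Proc .nat) :=
    Ok.var ((size_self_le m).trans hmB)
  set V := 2 ^ (2 * m) with hV
  set T := timeB B m d t R N with hT
  set W := V * (d ^ m + N + 1 + T) with hW
  have hV1 : 1 ≤ V := Nat.one_le_two_pow
  have hdm : 0 < d ^ m := Nat.pow_pos hd0
  have hW1 : 1 ≤ W := Nat.mul_pos hV1 (by omega)
  have hWdm : d ^ m ≤ W := (show _ ≤ d ^ m + N + 1 + T by omega).trans (Nat.le_mul_of_pos_left _ hV1)
  have hWN : N + 1 ≤ W := (show _ ≤ d ^ m + N + 1 + T by omega).trans (Nat.le_mul_of_pos_left _ hV1)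
  have hWVd : V * d ^ m ≤ W := Nat.mul_le_mul_left _ (by omega)
  have hWVN : V * (N + 1) ≤ W := Nat.mul_le_mul_left _ (by omega)
  have hWVT : V * (1 + T) ≤ W := Nat.mul_le_mul_left _ (by omega)
  have weaken : ∀ {τ : Ty} {w k : ℕ} {a : Tm Ty.den Proc τ} {S : τ.den → Prop}, Runs B w k a S →
      w ≤ W → k ≤ 110 → Runs B W 110 a S := fun h hw hk => h.mono hw hk fun _ h => h
  unfold mmeForExtensionRingsB
  -- the number of nodes, the prime and its powers
  refine Runs.bind (l := 129) (weaken (Runs.ok ((hev.mul hdv).mono le_rfl le_rfl) (e * d : ℕ) rfl) hW1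
    (by decide)) hW1 (by decide) fun (l : ℕ) hl => ?_
  obtain hl : l = e * d := hl
  rw [← hl] at hlB hl0 hR
  obtain ⟨hp, hlp, hpl⟩ := nv_primeAbove l hl0
  refine Runs.bind (l := 128) (weaken (Runs.ok (Ok.primeAbove hl0 hlB) _ rfl) hW1 (by decide)) hW1
    (by decide) fun (p : ℕ) hpv => ?_
  obtain hpv : p = (primeAbove (.var (τ := .nat) l)).nv := hpv
  rw [← hpv] at hp hlp hpl
  -- The chosen power of `p` is below `p * x`, and `p ≤ 2 * l`; this explains the form `R = 2 * (e *
  -- d) * x` of the quantity in the time bound.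
  have hpx : p * x ≤ R := hR ▸ Nat.mul_le_mul_right _ hpl
  have hx2 : 2 ≤ x := hr.trans hrx
  have hxv : (.var (τ := .nat) d * pow (.var (τ := .nat) e * .var (τ := .nat) r) (.var (τ := .nat) d) :
      Tm Ty.den Proc .nat).nv = x := by simp [hx]
  have hxok : Ok B 1 12 (.var (τ := .nat) d *
      pow (.var (τ := .nat) e * .var (τ := .nat) r) (.var (τ := .nat) d)) := by
    refine ⟨?_, ?_⟩
    · rw [val_eq_nv, hxv]
      exact (Nat.size_le_size hxR).trans hRB.size_le
    · exact ((hdv.mul (Ok.pow (j := 1) (i := 2) (k := 3) ((hev.mul hrv).mono le_rfl (by decide))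
        (hdv.mono (by decide) (by decide)) hdB)).mono le_rfl (by decide : _ ≤ 12)).cost
  obtain ⟨n, hn0, hnv, hxn, hnx⟩ := nv_powerAbove hxv hp.two_le hx2
  have hpB : p ≤ B ^ 1 := hpl.trans hlB
  refine Runs.bind (l := 127) (weaken (Runs.ok (Ok.powerAbove hxok hxv hx2
    ((Nat.size_le_size hpx).trans hRB.size_le)) _ hnv) hW1 (by decide)) hW1
    (by decide) fun (r₀ : ℕ) hr₀ => ?_
  obtain hr₀ : r₀ = p ^ n := hr₀
  have hr₀R : r₀ ≤ R := hr₀ ▸ hnx.le.trans hpx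
  have hr₀B : SmallBase B (.var (τ := .nat) m) (.var (τ := .nat) d) r₀ :=
    le_trans (Nat.mul_le_mul_left _ (Nat.succ_le_succ (Nat.size_le_size hr₀R))) hRB
  have hr₀1 : 1 < r₀ := by rw [hr₀]; exact Nat.one_lt_pow hn0 hp.one_lt
  have hr₀v : Ok B 1 0 (.var (τ := .nat) r₀ : Tm Ty.den Proc .nat) := Ok.var hr₀B.size_le
  have hqnv : (pow (.var (τ := .nat) r₀) (.var (τ := .nat) m) : Tm Ty.den Proc .nat).nv = r₀ ^ m := by
    simp
  refine Runs.bind (l := 126) (weaken (Runs.ok (i := 1) (k := 12) ⟨by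
    rw [val_eq_nv, hqnv]; exact hr₀B.size_pow le_rfl, ((Ok.pow (j := 1) hr₀v hmv hmB).mono le_rfl
      (by decide : _ ≤ 12)).cost⟩ (r₀ ^ m : ℕ) hqnv) hW1 (by decide)) hW1
    (by decide) fun (q : ℕ) hq => ?_
  obtain hq : q = r₀ ^ m := hq
  have hS : Sizes B m d e l q := ⟨hF, he, heB, hl, by omega, by
    rw [hq]; exact Nat.one_lt_pow hm0.ne' hr₀1, by rw [hq]; exact hr₀B.size_pow le_rfl⟩
  have hr₀q : r₀ ≤ q := hq ▸ Nat.le_self_pow hm0.ne' _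
  have hrq : r ≤ q := (hrx.trans (hr₀ ▸ hxn)).trans hr₀q
  have hpq : p ≤ q := ((Nat.le_self_pow hn0 p).trans hr₀.ge).trans hr₀q
  have hqp : q = p ^ (n * m) := by rw [hq, hr₀, pow_mul]
  have hR0 : n * m ≠ 0 := Nat.mul_ne_zero hn0 hm0.ne'
  have hfq : ∀ k u, (f.getD k []).getD u 0 < q := fun k u => (hfr k u).trans_le hrq
  have haq : ∀ i c u, ((as.getD i []).getD c []).getD u 0 < q := fun i c u =>
    (har i c u).trans_le hrq
  -- the input modulo `q`
  refine Runs.bind (l := 125) (weaken (runs_coeffs hS hf hfq) hWdm (by decide)) hW1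
    (by decide) fun (f' : List (List ℕ)) hf' => ?_
  refine Runs.bind (l := 124) (weaken (runs_points hS has haq) hWN (by decide)) hW1
    (by decide) fun (as' : List (List (List ℕ))) has' => ?_
  refine Runs.bind (l := 123) (weaken (runs_transpose (c := fun u k => (f.getD k []).getD u 0) hS hf')
    hWdm (by decide)) hW1 (by decide) fun (fus : List (List ℕ)) hfus => ?_
  refine Runs.bind (l := 122) (weaken (runs_expansions
    (α := fun i c u => ((as.getD i []).getD c []).getD u 0) hS has' haq) hWN (by decide)) hW1
    (by decide) fun (ajs : List (List (List (List ℕ)))) hajs => ?_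
  -- Hasse derivatives and their values
  refine Runs.bind (l := 121) (weaken (S := fun x => x = expo m m) (w := V) (k := 16)
    ⟨hV ▸ (two_mul m).symm ▸ (OkW.exponents hF.m_ok hF.m_ok hmB hmB hm0).cost,
      val_exponents _ _⟩ (Nat.le_mul_of_pos_right _ (by omega)) (by decide)) hW1
    (by decide) fun (vs : List (List ℕ)) hvs => ?_
  obtain hvs : vs = expo m m := hvs
  refine Runs.bind (l := 120) (weaken (runs_hasse (c := fun u k => (f.getD k []).getD u 0) hS hfus
    (fun u k => hfq k u) hvs) hWVd (by decide)) hW1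
    (by decide) fun (fvs : List (List (List ℕ))) hfvs => ?_
  refine Runs.bind (l := 119) (weaken (runs_heads hS has'.1 hajs) hWN (by decide)) hW1
    (by decide) fun (bjs : List (List (List ℕ))) hbjs => ?_
  have hbjs := hbjs.mono fun j hj L hL => hL.mono fun i hi L hL => hL.mono fun c hc x hx =>
    (⟨hx.1, hx.2 rfl⟩ : x < q ∧ (x : ZMod q) = ∑ v ∈ Finset.range e,
      ((((as.getD i []).getD c []).getD v 0 : ℕ) : ZMod q) * (j : ZMod q) ^ v)
  -- The base handed to MME-B depends on the prime that was found; the time bound is stated with its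
  -- upper bound `R` instead.
  have hTr : timeB B m d t r₀ N ≤ T := timeB_mono _ _ _ _ _ hr₀R
  refine Runs.bind (l := 118) (weaken (runs_mmeB (t := t) (c := fun u k => (f.getD k []).getD u 0)
    (p := fun i c j => ∑ v ∈ Finset.range e,
      ((((as.getD i []).getD c []).getD v 0 : ℕ) : ZMod q) * (j : ZMod q) ^ v) hS hr₀1 hq hr₀B hvs
    hfvs hbjs) ((Nat.mul_le_mul_left _ (by omega)).trans hWVT) (by decide)) hW1
    (by decide) fun (ys : List (List (List (List ℕ)))) hys => ?_
  -- Taylor's formula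
  refine Runs.bind (l := 117) (weaken (runs_linPow hS (hlp.trans hpq)) hW1 (by decide)) hW1
    (by decide) fun (ls : List (List ℕ)) hls => ?_
  refine Runs.bind (l := 116) (weaken (runs_taylor (c := fun u k => (f.getD k []).getD u 0)
    (α := fun i c u => ((as.getD i []).getD c []).getD u 0) hS hvs has' haq hbjs hys hls)
    hWVN (by decide)) hW1 (by decide) fun (bijs : List (List (List ℕ))) hbijs => ?_
  -- Hermite interpolation
  refine Runs.bind (l := 115) (weaken (runs_hermiteBasis hS hp hR0 hqp hlp
    (hpB.trans (pow_mono_exp (by decide))) hls) hW1 (by decide)) hW1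
    (by decide) fun (ds : List (List ℕ)) hds => ?_
  refine Runs.bind (l := 114) (weaken (runs_modulus hS hls) hW1 (by decide)) hW1
    (by decide) fun (g : List ℕ) hg => ?_
  refine Runs.bind (l := 113) (weaken (runs_hermite hS hp hqp hlp hds hg hbijs (fun i _ => hl ▸
    degree_valuePoly_lt hd0 hm0 he _ _) has'.1) hWN (by decide)) hW1
    (by decide) fun (bs : List (List ℕ)) hbs => ?_
  -- reduction
  have hbs' := hbs.mono fun i hi L hL => (⟨hL.1, hL.2.1, by rw [hL.2.2, map_valuePoly]⟩ :
    L.length ≤ l * m ∧ (∀ x ∈ L, x < q) ∧ toPoly q L =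
      (valuePoly ℕ m d e (fun u k => (f.getD k []).getD u 0) fun c v =>
          ((as.getD i []).getD c []).getD v 0).map (Nat.castRingHom (ZMod q)))
  refine (runs_reduction hS (by omega) hrq hbs' (fun i _ k => coeff_valuePoly_lt hd0 hm0 he (by omega)
    (fun u k => hfr k u) (har i) ?_ k) hE hG hGe).mono hWN (by decide) fun L hL => ?_
  -- The modulus is `r₀ ^ m` with `r₀ ≥ d * (e * r) ^ d`, which is what the bound on the
  -- coefficients asks for.
  · rw [hq, ← hx]
    exact Nat.pow_le_pow_left (hr₀ ▸ hxn) m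
  · refine Arr.eq_map (z := []) (hL.mono fun i _ x hx => ?_)
    rw [map_valuePoly] at hx
    exact hx

end MME

namespace MME

open Polynomial

/-! ## The encoding -/

section Encoding

variable {r : ℕ} {E : (ZMod r)[X]} (hE : E.Monic)

theorem length_encode (x : AdjoinRoot E) : (encode hE x).length = E.natDegree := by
  simp [encode]

theorem getD_encode (x : AdjoinRoot E) {u : ℕ} (hu : u < E.natDegree) :
    (encode hE x).getD u 0 = ((AdjoinRoot.modByMonicHom hE x).coeff u).val :=
  getD_map_range _ _ hu

theorem getD_encode_lt [NeZero r] (x : AdjoinRoot E) (u : ℕ) : (encode hE x).getD u 0 < r := by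
  by_cases hu : u < E.natDegree
  · rw [getD_encode hE x hu]; exact ZMod.val_lt _
  · rw [List.getD_eq_default _ _ (by rw [length_encode]; omega)]; exact Nat.pos_of_ne_zero (NeZero.ne r)

theorem coeff_modByMonicHom_eq_zero [Nontrivial (ZMod r)] (x : AdjoinRoot E) {u : ℕ}
    (hu : E.natDegree ≤ u) : (AdjoinRoot.modByMonicHom hE x).coeff u = 0 := by
  obtain ⟨p, rfl⟩ := AdjoinRoot.mk_surjective x
  rw [AdjoinRoot.modByMonicHom_mk]
  refine coeff_eq_zero_of_degree_lt ((degree_modByMonic_lt p hE).trans_le ?_)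
  rw [degree_eq_natDegree hE.ne_zero]
  exact_mod_cast hu

/-- The remainder modulo `E` is a section of the quotient map, and it is determined by the encoded
coefficients because its degree is less than that of `E`. -/
theorem mk_trunc_encode [NeZero r] [Nontrivial (ZMod r)] (x : AdjoinRoot E) :
    AdjoinRoot.mk E (trunc E.natDegree fun u => (encode hE x).getD u 0) = x := by
  conv_rhs => rw [← AdjoinRoot.mk_leftInverse hE x]
  congr 1
  ext u
  rw [coeff_trunc]
  split_ifs with hu
  · rw [getD_encode hE x hu, ZMod.natCast_zmod_val]
  · rw [coeff_modByMonicHom_eq_zero hE x (by omega)]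

theorem encode_mk (p : (ZMod r)[X]) : encode hE (AdjoinRoot.mk E p) =
    (List.range E.natDegree).map fun u => ((p %ₘ E).coeff u).val := by
  simp only [encode, AdjoinRoot.modByMonicHom_mk]

/-- The degree bounds place the support inside the box of exponents below `d`, and on the rest of
the box the coefficients are zero. -/
theorem eval_eq_ev {A : Type*} [CommRing A] {m d : ℕ} (f : MvPolynomial (Fin m) A)
    (hf : ∀ i, f.degreeOf i < d) {a : Fin m → A} {c a' : ℕ → A}
    (hc : ∀ k < d ^ m, c k =
      f.coeff (Finsupp.equivFunOnFinite.symm fun i : Fin m => k / d ^ (i : ℕ) % d))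
    (ha : ∀ i : Fin m, a' i = a i) :
    MvPolynomial.eval a f = ev m d c a' := by
  have h1 : ev m d c a' =
      ∑ b ∈ boxFun m d, f.coeff (Finsupp.equivFunOnFinite.symm b) * ∏ i : Fin m, a i ^ b i := by
    rw [← sum_digits m d fun _ b => f.coeff (Finsupp.equivFunOnFinite.symm b) *
      ∏ i : Fin m, a i ^ b i]
    refine Finset.sum_congr rfl fun k hk => ?_
    rw [hc k (Finset.mem_range.mp hk), Finset.prod_range fun i => a' i ^ (k / d ^ i % d)]
    simp only [ha]
  rw [h1, MvPolynomial.eval_eq']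
  refine (Finset.sum_subset_zero_on_sdiff (s₂ := (boxFun m d).map Finsupp.equivFunOnFinite.symm.toEmbedding)
    ?_ ?_ fun _ _ => rfl).trans ?_
  · intro b hb
    refine Finset.mem_map.mpr ⟨b, mem_boxFun.mpr fun i => ?_, by ext; simp⟩
    exact (MvPolynomial.monomial_le_degreeOf i hb).trans_lt (hf i)
  · intro b hb
    rw [MvPolynomial.notMem_support_iff.mp (Finset.mem_sdiff.mp hb).2, zero_mul]
  · rw [Finset.sum_map]
    rfl

theorem getD_encodePoly {m d k : ℕ} (f : MvPolynomial (Fin m) (AdjoinRoot E)) (hk : k < d ^ m) :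
    (encodePoly hE d f).getD k [] = encode hE (f.coeff
      (Finsupp.equivFunOnFinite.symm fun i : Fin m => k / d ^ (i : ℕ) % d)) :=
  getD_map_range _ _ hk

theorem getD_getD_ofFn {α : Type*} {N m : ℕ} (a : Fin N → Fin m → List α) (i : Fin N) (c : Fin m) :
    ((List.ofFn fun i => List.ofFn fun c => a i c).getD i []).getD c [] = a i c := by
  simp [List.getD_eq_getElem?_getD]

/-- The quotient map is a ring homomorphism, so it sends the value of the lifted polynomial to the
value of `f`; the encoding of a class is read off from the remainder modulo `E`. -/
theorem encode_eval [NeZero r] [Nontrivial (ZMod r)] {m d N : ℕ}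
    (f : MvPolynomial (Fin m) (AdjoinRoot E)) (hf : ∀ i, f.degreeOf i < d)
    (a : Fin N → Fin m → AdjoinRoot E) (i : Fin N) :
    encode hE (MvPolynomial.eval (a i) f) = (List.range E.natDegree).map fun u =>
      ((valuePoly (ZMod r) m d E.natDegree (fun u k => ((encodePoly hE d f).getD k []).getD u 0)
        (fun c v => (((List.ofFn fun i => List.ofFn fun c => encode hE (a i c)).getD i []).getD c
          []).getD v 0) %ₘ E).coeff u).val := by
  rw [← encode_mk hE]
  congr 1
  rw [valuePoly, map_ev]
  refine eval_eq_ev f hf (fun k hk => ?_) fun c => ?_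
  · rw [getD_encodePoly hE f hk, mk_trunc_encode]
  · rw [getD_getD_ofFn, mk_trunc_encode]

theorem toPoly_encodeModulus [NeZero r] : toPoly r (encodeModulus E) = E := by
  refine toPoly_map_range (fun k _ => ZMod.natCast_zmod_val _) fun k hk => ?_
  exact coeff_eq_zero_of_natDegree_lt (by omega)

end Encoding

/-- Correctness of the algorithm and its running time in terms of `timeB`. -/
theorem run_spec {B : ℕ} [hB : Fact (8 ≤ B)] {m d r t N R : ℕ} {E : (ZMod r)[X]} (hE : E.Monic)
    (hF : Fits B (.var (τ := .nat) m) (.var (τ := .nat) d)) (he : 1 ≤ E.natDegree) (hr : 2 ≤ r)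
    (hR : R = 2 * (E.natDegree * d) * (d * (E.natDegree * r) ^ d))
    (hRB : SmallBase B (.var (τ := .nat) m) (.var (τ := .nat) d) R)
    (hlB : 2 * (E.natDegree * d) ≤ B) (f : MvPolynomial (Fin m) (AdjoinRoot E))
    (hf : ∀ i, f.degreeOf i < d) (a : Fin N → Fin m → AdjoinRoot E) :
    (run m d E.natDegree (encodePoly hE d f)
      (List.ofFn fun i => List.ofFn fun c => encode hE (a i c)) r t (encodeModulus E)).1 =
      (List.ofFn fun i => encode hE (MvPolynomial.eval (a i) f)) ∧
    (run m d E.natDegree (encodePoly hE d f)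
      (List.ofFn fun i => List.ofFn fun c => encode hE (a i c)) r t (encodeModulus E)).2 ≤
      2 ^ (2 * m) * (d ^ m + N + 1 + timeB B m d t R N) * B ^ 130 := by
  have : NeZero r := ⟨by omega⟩
  have : Nontrivial (ZMod r) := ZMod.nontrivial_iff.mpr (by omega)
  have hd0 : 0 < d := hF.d_pos
  have hr0 : 0 < r := by omega
  have hfr : ∀ k u, ((encodePoly hE d f).getD k []).getD u 0 < r := fun k u => by
    by_cases hk : k < d ^ m
    · rw [getD_encodePoly hE f hk]; exact getD_encode_lt hE _ u
    · rw [List.getD_eq_default (encodePoly hE d f) _ (by simp [encodePoly]; omega)]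
      simpa using hr0
  have har : ∀ i c u, (((List.ofFn fun i => List.ofFn fun c => encode hE (a i c)).getD i []).getD c
      []).getD u 0 < r := fun i c u => by
    by_cases hi : i < N
    · by_cases hc : c < m
      · rw [getD_getD_ofFn _ ⟨i, hi⟩ ⟨c, hc⟩]; exact getD_encode_lt hE _ u
      · simpa [List.getD_eq_getElem?_getD, hi, hc] using hr0
    · simpa [List.getD_eq_getElem?_getD, hi] using hr0
  have h := runs_mmeForExtensionRingsB (t := t) (N := N) (f := encodePoly hE d f)
    (as := List.ofFn fun i => List.ofFn fun c => encode hE (a i c)) (E := encodeModulus E) (G := E)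
    hF he hr rfl hR hRB (by
      rw [pow_one]
      have := Nat.mul_le_mul_left E.natDegree hd0
      omega) (by rwa [pow_one]) (by simp [encodePoly]) (by simp) hfr har
      ⟨by simp, by simp [encodeModulus, add_comm], fun x hx => by
        obtain ⟨u, -, rfl⟩ := List.mem_map.mp (show x ∈ List.map _ _ from hx)
        exact (ZMod.val_lt _).le, toPoly_encodeModulus⟩ hE rfl
  refine ⟨?_, h.cost⟩
  refine (show (run m d E.natDegree (encodePoly hE d f)
      (List.ofFn fun i => List.ofFn fun c => encode hE (a i c)) r t (encodeModulus E)).1 = _ from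
      h.post).trans ?_
  refine List.ext_getElem (by simp) fun i h1 h2 => ?_
  rw [List.length_ofFn] at h2
  rw [List.getElem_map, List.getElem_range, List.getElem_ofFn]
  exact (encode_eval hE f hf a ⟨i, h2⟩).symm

end MME

namespace MME

/-! ## Iterated logarithms -/

theorem iterLog_zero (x : ℝ) : iterLog 0 x = x := rfl

theorem iterLog_succ (c : ℕ) (x : ℝ) : iterLog (c + 1) x = Real.logb 2 (iterLog c x) :=
  Function.iterate_succ_apply' _ _ _

theorem iterLog_logb (c : ℕ) (x : ℝ) : iterLog c (Real.logb 2 x) = iterLog (c + 1) x :=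
  (Function.iterate_succ_apply _ _ _).symm

/-- Bernoulli's inequality gives `x ≤ 2 ^ (x - 1)`. -/
theorem logb_two_le_sub_one {x : ℝ} (hx : 2 ≤ x) : Real.logb 2 x ≤ x - 1 := by
  rw [Real.logb_le_iff_le_rpow one_lt_two (by linarith)]
  have := one_add_mul_self_le_rpow_one_add (s := 1) (by norm_num) (p := x - 1) (by linarith)
  norm_num at this
  linarith

theorem logb_two_le_self {x : ℝ} (hx : 0 < x) : Real.logb 2 x ≤ x := by
  rcases le_total 2 x with h | h
  · linarith [logb_two_le_sub_one h]
  · rcases le_total 1 x with h1 | h1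
    · have := Real.logb_le_logb_of_le one_lt_two hx h
      rw [Real.logb_self_eq_one one_lt_two] at this
      linarith
    · have := Real.logb_nonpos one_lt_two hx.le h1
      linarith

/-- As long as the argument is at least `2`, a logarithm lowers it by at least `1`. Without this
fact the infimum in `logStar` could be that of an empty set. -/
theorem exists_iterLog_le_one (x : ℝ) : ∃ c, iterLog c x ≤ 1 := by
  have key : ∀ (n : ℕ) (x : ℝ), x ≤ n + 1 → ∃ c, iterLog c x ≤ 1 := by
    intro n
    induction n with
    | zero => intro x hx; exact ⟨0, by simpa [iterLog_zero] using hx⟩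
    | succ n ih =>
      intro x hx
      push_cast at hx
      rcases le_total x 1 with h1 | h1
      · exact ⟨0, h1⟩
      rcases le_total x 2 with h2 | h2
      · refine ⟨1, ?_⟩
        have := Real.logb_le_logb_of_le one_lt_two (by linarith) h2
        rwa [Real.logb_self_eq_one one_lt_two] at this
      · obtain ⟨c, hc⟩ := ih (Real.logb 2 x) (by linarith [logb_two_le_sub_one h2])
        exact ⟨c + 1, by rwa [← iterLog_logb]⟩
  obtain ⟨n, hn⟩ := exists_nat_ge x
  exact key n x (by linarith)

theorem iterLog_logStar_le (x : ℝ) : iterLog (logStar x) x ≤ 1 :=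
  Nat.sInf_mem (s := {c : ℕ | iterLog c x ≤ 1}) (exists_iterLog_le_one x)

theorem one_lt_iterLog {x : ℝ} {i : ℕ} (h : i < logStar x) : 1 < iterLog i x := by
  have := Nat.notMem_of_lt_sInf h
  simpa using this

theorem le_logStar {x : ℝ} {t : ℕ} (h : ∀ i < t, 1 < iterLog i x) : t ≤ logStar x := by
  by_contra hlt
  exact absurd (iterLog_logStar_le x) (not_le.mpr (h _ (not_le.mp hlt)))

/-- The logarithm is monotone only on positive numbers, hence the condition on the earlier iterates
of the smaller argument. -/
theorem iterLog_mono {x y : ℝ} {i : ℕ} (hxy : x ≤ y) (hx : ∀ j < i, 1 < iterLog j x) :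
    iterLog i x ≤ iterLog i y := by
  induction i with
  | zero => exact hxy
  | succ i ih =>
    rw [iterLog_succ, iterLog_succ]
    exact Real.logb_le_logb_of_le one_lt_two (by linarith [hx i (Nat.lt_succ_self i)])
      (ih fun j hj => hx j (hj.trans (Nat.lt_succ_self i)))

theorem lam_eq_prod (k : ℕ) (x : ℝ) :
    lam k x = ∏ i ∈ Finset.range (min (k + 1) (logStar x)), iterLog i x := by
  unfold lam
  congr 2
  omega

theorem one_le_lam (k : ℤ) (x : ℝ) : 1 ≤ lam k x := by
  refine Finset.one_le_prod (fun i hi => ?_)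
  exact (one_lt_iterLog (by have := Finset.mem_range.mp hi; omega)).le

/-- For `t ≥ 1` and `log^* d ≥ 2`, both `d` and `log d` are among the factors of `λ_t(d)`, and all
factors exceed `1`. Otherwise `log d ≤ 1`, and the maximum is `1`. -/
theorem mul_log_le_lam {d t : ℕ} (hd : 1 ≤ d) (ht : 1 ≤ t) :
    (d : ℝ) * max 1 (Real.logb 2 d) ≤ lam t d := by
  have hd1 : (1 : ℝ) ≤ d := by exact_mod_cast hd
  have hsub : ∀ n ≤ min (t + 1) (logStar (d : ℝ)),
      ∏ i ∈ Finset.range n, iterLog i (d : ℝ) ≤ lam t d := fun n hn => by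
    rw [lam_eq_prod]
    refine Finset.prod_le_prod_of_subset_of_one_le (Finset.range_mono hn)
      (fun i hi => zero_le_one.trans (one_lt_iterLog ?_).le) fun i hi _ => (one_lt_iterLog ?_).le
    all_goals have := Finset.mem_range.mp hi; omega
  rcases Nat.lt_or_ge (logStar (d : ℝ)) 2 with h | h
  · have hlog : Real.logb 2 d ≤ 1 := by
      have h1 := iterLog_logStar_le (d : ℝ)
      interval_cases hs : logStar (d : ℝ)
      · have h1 : (d : ℝ) ≤ 1 := h1
        have : (d : ℝ) = 1 := le_antisymm h1 hd1
        rw [this]; simp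
      · exact h1
    rw [max_eq_left hlog, mul_one]
    rcases Nat.eq_zero_or_pos (logStar (d : ℝ)) with h0 | h0
    · have h1 := iterLog_logStar_le (d : ℝ)
      rw [h0, iterLog_zero] at h1
      exact h1.trans (one_le_lam _ _)
    · have := hsub 1 (by omega)
      simpa [iterLog_zero] using this
  · have h1 : 1 < Real.logb 2 d := one_lt_iterLog (x := (d : ℝ)) (i := 1) (by omega)
    rw [max_eq_right h1.le]
    have := hsub 2 (by omega)
    simpa [Finset.prod_range_succ, iterLog_zero, iterLog_succ] using this

theorem size_le_logb {n : ℕ} (hn : n ≠ 0) : (Nat.size n : ℝ) ≤ Real.logb 2 n + 1 := by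
  have h0 : 0 < Nat.size n := Nat.size_pos.mpr (Nat.pos_of_ne_zero hn)
  have h1 : 2 ^ (Nat.size n - 1) ≤ n := Nat.lt_size.mp (by omega)
  have h2 : ((2 : ℝ) ^ (Nat.size n - 1)) ≤ n := by exact_mod_cast h1
  have h3 := Real.logb_le_logb_of_le one_lt_two (by positivity) h2
  rw [Real.logb_pow, Real.logb_self_eq_one one_lt_two, mul_one, Nat.cast_sub h0] at h3
  push_cast at h3
  linarith

theorem primeCount_le_logb {d r : ℕ} (hd : d ≠ 0) (hr : r ≠ 0) :
    (primeCount d r : ℝ) ≤ Real.logb 2 d + d * Real.logb 2 r + 1 := by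
  have hd' : (d : ℝ) ≠ 0 := Nat.cast_ne_zero.mpr hd
  have hr' : (r : ℝ) ≠ 0 := Nat.cast_ne_zero.mpr hr
  refine (size_le_logb (Nat.mul_ne_zero hd (pow_ne_zero _ hr))).trans_eq ?_
  push_cast
  rw [Real.logb_mul hd' (pow_ne_zero _ hr'), Real.logb_pow]

/-- With `D = max 1 (log d)`, each of the terms `log d`, `8 * d`, `2 * d * D`, `d * l` and `1` is at
most its coefficient times `d * D * l`, and `1 + 8 + 2 + 1 + 1 = 13`. -/
theorem primeCount_le_of_logb_le {d r : ℕ} (hd : 1 ≤ d) (hr : r ≠ 0) {l : ℝ} (hl : 1 < l)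
    (h : Real.logb 2 r ≤ 8 + 2 * max 1 (Real.logb 2 d) + l) :
    (primeCount d r : ℝ) ≤ 13 * (d * max 1 (Real.logb 2 d)) * l := by
  have hd1 : (1 : ℝ) ≤ d := by exact_mod_cast hd
  set D := max 1 (Real.logb 2 (d : ℝ))
  have hD1 : 1 ≤ D := le_max_left _ _
  have hDd : Real.logb 2 (d : ℝ) ≤ D := le_max_right _ _
  have hdD : (d : ℝ) * D ≤ d * D * l := le_mul_of_one_le_right (by positivity) hl.le
  have hDl : D ≤ d * D * l := (le_mul_of_one_le_left (by positivity) hd1).trans hdD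
  have hdl : (d : ℝ) * l ≤ d * D * l :=
    mul_le_mul_of_nonneg_right (le_mul_of_one_le_right (by positivity) hD1) (by linarith)
  have hd0 : (d : ℝ) ≤ d * D * l := (le_mul_of_one_le_right (by positivity) hD1).trans hdD
  have h3 := mul_le_mul_of_nonneg_left h (by linarith : (0 : ℝ) ≤ d)
  refine (primeCount_le_logb (by omega) hr).trans ?_
  linarith

/-- The factor `d * max 1 (log d)` does not accumulate from level to level: under the next logarithm
it becomes a summand, which is again dominated by `max 1 (log d)`. -/
theorem primeCount_iterate_le {d R : ℕ} (hd : 1 ≤ d) (hR : 1 ≤ R) {i : ℕ}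
    (hi : ∀ j ≤ i + 1, 1 < iterLog j (R : ℝ)) :
    (primeCount d ((nextBase d)^[i] R) : ℝ) ≤
      13 * (d * max 1 (Real.logb 2 d)) * iterLog (i + 1) (R : ℝ) := by
  have hd1 : (1 : ℝ) ≤ d := by exact_mod_cast hd
  have hD1 : 1 ≤ max 1 (Real.logb 2 (d : ℝ)) := le_max_left _ _
  have hDd : Real.logb 2 (d : ℝ) ≤ max 1 (Real.logb 2 (d : ℝ)) := le_max_right _ _
  induction i with
  | zero =>
    refine primeCount_le_of_logb_le hd (iterate_nextBase_pos hd hR 0).ne' (hi _ le_rfl) ?_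
    have : Real.logb 2 (((nextBase d)^[0] R : ℕ) : ℝ) = iterLog (0 + 1) (R : ℝ) := rfl
    linarith
  | succ i ih =>
    have hpos := iterate_nextBase_pos hd hR (i + 1)
    refine primeCount_le_of_logb_le hd hpos.ne' (hi _ le_rfl) ?_
    replace ih := ih fun j hj => hi j (by omega)
    have hl' : 1 < iterLog (i + 1) (R : ℝ) := hi _ (by omega)
    rw [iterLog_succ (i + 1)]
    set l := iterLog (i + 1) (R : ℝ)
    set D := max 1 (Real.logb 2 (d : ℝ))
    -- Here `16 * 13 = 208 ≤ 2 ^ 8`. Taking logarithms gives `8 + log d + log D + log l ≤ 8 + 2 * D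
    -- + log l`, which is the hypothesis of `primeCount_le_of_logb_le` for the next level.
    have hnext : (((nextBase d)^[i + 1] R : ℕ) : ℝ) ≤ 2 ^ 8 * d * D * l := by
      have h0 : 0 ≤ (d : ℝ) * D * l := by positivity
      rw [Function.iterate_succ_apply', nextBase]
      push_cast
      linarith
    have hlog := Real.logb_le_logb_of_le one_lt_two (Nat.cast_pos.mpr hpos) hnext
    have e1 : (2 : ℝ) ^ 8 ≠ 0 := by norm_num
    rw [Real.logb_mul (mul_ne_zero (mul_ne_zero e1 (by linarith)) (by linarith)) (by linarith),
      Real.logb_mul (mul_ne_zero e1 (by linarith)) (by linarith), Real.logb_mul e1 (by linarith),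
      Real.logb_pow, Real.logb_self_eq_one one_lt_two] at hlog
    have hDD := logb_two_le_self (x := D) (by linarith)
    push_cast at hlog
    linarith

/-- For `t ≥ 1` the last base is `16` times the preceding prime count, and `16 * 13 ≤ 256`. For `t =
0` it is `R` itself. -/
theorem iterate_nextBase_le {d R t : ℕ} (hd : 1 ≤ d) (hR : 1 ≤ R)
    (ht : ∀ j ≤ t, 1 < iterLog j (R : ℝ)) :
    (((nextBase d)^[t] R : ℕ) : ℝ) ≤ 256 * (lam t d * iterLog t (R : ℝ)) := by
  rcases t with _ | t
  · have h1 : (1 : ℝ) ≤ lam (0 : ℕ) d := one_le_lam _ _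
    have h2 : (1 : ℝ) ≤ R := by exact_mod_cast hR
    rw [Function.iterate_zero_apply, iterLog_zero]
    nlinarith
  · have h := primeCount_iterate_le hd hR ht
    have h1 := mul_log_le_lam hd (Nat.succ_le_succ (Nat.zero_le t))
    have h2 := ht (t + 1) le_rfl
    rw [Function.iterate_succ_apply', nextBase]
    push_cast at h1 ⊢
    have h3 := mul_le_mul_of_nonneg_right h1 (by linarith : 0 ≤ iterLog (t + 1) (R : ℝ))
    have h4 : (1 : ℝ) ≤ lam (t + 1) d := one_le_lam _ _
    nlinarith

/-- The prime count of level `i` brings a factor `13 * λ_t(d)` and the iterated logarithm of order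
`i + 1` of `R`. The latter multiply to `λ_{t-1}(log R)`, where the minimum in its definition is `t`
because these iterates exceed `1`. -/
theorem prod_primeCount_le {d R t : ℕ} (hd : 1 ≤ d) (hR : 1 ≤ R)
    (ht : ∀ j ≤ t, 1 < iterLog j (R : ℝ)) :
    ((∏ i ∈ Finset.range t, primeCount d ((nextBase d)^[i] R) : ℕ) : ℝ) ≤
      13 ^ t * (lam t d ^ t * lam ((t : ℤ) - 1) (Real.logb 2 R)) := by
  have hlam : lam ((t : ℤ) - 1) (Real.logb 2 R) = ∏ i ∈ Finset.range t, iterLog (i + 1) (R : ℝ) := by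
    have hs : t ≤ logStar (Real.logb 2 (R : ℝ)) := le_logStar fun i hi => by
      rw [iterLog_logb]; exact ht _ (by omega)
    unfold lam
    have : (min ((t : ℤ) - 1 + 1) (logStar (Real.logb 2 (R : ℝ)))).toNat = t := by omega
    rw [this]
    exact Finset.prod_congr rfl fun i _ => iterLog_logb _ _
  rw [hlam, ← mul_assoc, ← mul_pow]
  have h1 : (13 * lam t d) ^ t = ∏ _i ∈ Finset.range t, (13 * lam t d) := by simp
  rw [h1, ← Finset.prod_mul_distrib, Nat.cast_prod]
  refine Finset.prod_le_prod (fun _ _ => Nat.cast_nonneg _) fun i hi => ?_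
  have hi := Finset.mem_range.mp hi
  refine (primeCount_iterate_le hd hR fun j hj => ht j (by omega)).trans ?_
  have h1 := mul_log_le_lam hd (show 1 ≤ t by omega)
  have h2 := ht (i + 1) (by omega)
  exact mul_le_mul_of_nonneg_right (by linarith) (by linarith)

end MME

namespace MME

open Polynomial

/-! ## The final estimate -/

/-- A number polynomial in `m`, `d` and `s` that bounds the bit lengths and the sizes of the small
numbers of a run, where `s` is the bit length of an element of the ring. -/
def sizeBound (m d s : ℕ) : ℕ := 64 * (m + d + s) ^ 4

theorem size_modulus_le {d e r : ℕ} (he : 1 ≤ e) (hr : 2 ≤ r) :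
    Nat.size (2 * (e * d) * (d * (e * r) ^ d)) ≤
      3 + e * Nat.size r + 2 * d + 2 * (d * (e * Nat.size r)) := by
  have hs : 1 ≤ Nat.size r := Nat.size_pos.mpr (by omega)
  have h1 := size_mul_le (2 * (e * d)) (d * (e * r) ^ d)
  have h2 := size_mul_le 2 (e * d)
  have h3 := size_mul_le e d
  have h4 := size_mul_le d ((e * r) ^ d)
  have h5 := size_pow_le (e * r) d
  have h6 := Nat.mul_le_mul_left d (size_mul_le e r)
  have h7 : Nat.size 2 = 2 := by decide
  have h8 := size_self_le d
  have h9 := size_self_le e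
  have h10 : e ≤ e * Nat.size r := Nat.le_mul_of_pos_right _ hs
  have h11 : Nat.size r ≤ e * Nat.size r := Nat.le_mul_of_pos_left _ he
  have h12 : d * (Nat.size e + Nat.size r) ≤ d * (2 * (e * Nat.size r)) :=
    Nat.mul_le_mul_left d (by omega)
  have h13 : d * (2 * (e * Nat.size r)) = 2 * (d * (e * Nat.size r)) := by ring
  omega

/-- With `w = m + d + e * size r`, the modulus bound `R` has a number of digits that is quadratic in
`w`, and `SmallBase` multiplies it by `m + d + 2`, so a cubic bound is needed; the bound `64 * w ^
4` leaves room for all constants. -/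
theorem sizeBound_spec {m d e r : ℕ} (hm : 1 ≤ m) (hd : 1 ≤ d) (he : 1 ≤ e) (hr : 2 ≤ r) :
    8 ≤ sizeBound m d (e * Nat.size r) ∧
    Fits (sizeBound m d (e * Nat.size r)) (.var (τ := .nat) m) (.var (τ := .nat) d) ∧
    SmallBase (sizeBound m d (e * Nat.size r)) (.var (τ := .nat) m) (.var (τ := .nat) d)
      (2 * (e * d) * (d * (e * r) ^ d)) ∧
    2 * (e * d) ≤ sizeBound m d (e * Nat.size r) := by
  have hs : 1 ≤ Nat.size r := Nat.size_pos.mpr (by omega)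
  have hR := size_modulus_le (d := d) he hr
  have hes : e ≤ e * Nat.size r := Nat.le_mul_of_pos_right _ hs
  have hed := Nat.mul_le_mul_right d hes
  set s := e * Nat.size r
  have hs1 : 1 ≤ s := he.trans hes
  obtain ⟨w, hw⟩ : ∃ w, w = m + d + s := ⟨_, rfl⟩
  have hB : sizeBound m d s = 64 * w ^ 4 := by rw [sizeBound, hw]
  have hw3 : 3 ≤ w := by omega
  have hds : 2 * (d * s) ≤ w ^ 2 := by
    subst hw
    nlinarith
  have hww : 3 * w ≤ w ^ 2 := by nlinarith
  have h24 : w ^ 2 ≤ w ^ 4 := Nat.pow_le_pow_right (by omega) (by norm_num)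
  have h34 : w ^ 3 ≤ w ^ 4 := Nat.pow_le_pow_right (by omega) (by norm_num)
  have hBig : w ≤ 64 * w ^ 4 := by omega
  have : Fact (8 ≤ 64 * w ^ 4) := ⟨by omega⟩
  rw [hB]
  refine ⟨by omega, ⟨?_, ?_, ?_, ?_, ?_⟩, ?_, ?_⟩
  · refine (Ok.var (i := 1) ?_).mono le_rfl (by norm_num)
    exact (size_self_le m).trans (by rw [pow_one]; omega)
  · refine (Ok.var (i := 1) ?_).mono le_rfl (by norm_num)
    exact (size_self_le d).trans (by rw [pow_one]; omega)
  · exact hm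
  · exact hd
  · have h1 := size_mul_le 64 (w ^ 4)
    have h2 := size_pow_le w 4
    have h3 := size_self_le w
    have h4 : Nat.size 64 = 7 := by decide
    have h5 : (m + d + 2) * (Nat.size (64 * w ^ 4) + 6) ≤ (2 * w) * (9 * w) :=
      Nat.mul_le_mul (by omega) (by omega)
    refine h5.trans ?_
    have : 2 * w * (9 * w) = 18 * w ^ 2 := by ring
    omega
  · have h5 : (m + d + 2) * (Nat.size (2 * (e * d) * (d * (e * r) ^ d)) + 1) ≤
        (2 * w) * (5 * w ^ 2) := Nat.mul_le_mul (by omega) (by omega)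
    refine h5.trans ?_
    have : 2 * w * (5 * w ^ 2) = 10 * w ^ 3 := by ring
    omega
  · rw [mul_comm e d]
    rw [mul_comm e d, mul_comm s d] at *
    omega

theorem logb_natCard_adjoinRoot {r : ℕ} (hr : 2 ≤ r) {E : (ZMod r)[X]} (hE : E.Monic) :
    Real.logb 2 (Nat.card (AdjoinRoot E)) = E.natDegree * Real.logb 2 r := by
  have : NeZero r := ⟨by omega⟩
  have h : Nat.card (AdjoinRoot E) = r ^ E.natDegree := by
    rw [Nat.card_congr (AdjoinRoot.powerBasis' hE).basis.equivFun.toEquiv, Nat.card_fun,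
      Nat.card_zmod, Nat.card_fin, AdjoinRoot.powerBasis'_dim]
  rw [h, Nat.cast_pow, Real.logb_pow]

/-- As `r ≥ 2`, the rounding in `size r ≤ log r + 1` costs at most a factor `2`. This factor
reappears in `timePolynomial`. -/
theorem mul_size_le_logb {e r : ℕ} (hr : 2 ≤ r) :
    ((e * Nat.size r : ℕ) : ℝ) ≤ 2 * (e * Real.logb 2 r) := by
  have h1 := size_le_logb (n := r) (by omega)
  have h2 : Real.logb 2 2 ≤ Real.logb 2 r :=
    Real.logb_le_logb_of_le one_lt_two two_pos (by exact_mod_cast hr)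
  rw [Real.logb_self_eq_one one_lt_two] at h2
  have h3 : (Nat.size r : ℝ) ≤ 2 * Real.logb 2 r := by linarith
  push_cast
  have := mul_le_mul_of_nonneg_left h3 (Nat.cast_nonneg (α := ℝ) e)
  linarith

/-- The polynomial factor of the running time, in `m`, `d` and the bit length of the ring. -/
noncomputable def timePolynomial : MvPolynomial (Fin 3) ℕ :=
  (64 * (.X 0 + .X 1 + 2 * .X 2) ^ 4) ^ 210

theorem sizeBound_pow_le {m d s : ℕ} {x : ℝ} (h : (s : ℝ) ≤ 2 * x) :
    ((sizeBound m d s ^ 210 : ℕ) : ℝ) ≤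
      MvPolynomial.aeval (![(m : ℝ), (d : ℝ), x] : Fin 3 → ℝ) timePolynomial := by
  simp only [timePolynomial, sizeBound, map_pow, map_mul, map_add, MvPolynomial.aeval_X, map_ofNat]
  push_cast
  gcongr

/-- With `n = (t + 1) * m` the five factors are at most `2 ^ n`, `4 ^ n`, `4 ^ n`, `16 ^ n` and `256
^ n`, and `1 + 2 + 2 + 4 + 8 = 17`. -/
theorem constants_le {m t : ℕ} (hm : 1 ≤ m) :
    (t + 1) * 4 ^ m * 4 ^ (m * (t + 1)) * 13 ^ t * 256 ^ m ≤ 2 ^ (17 * (t + 1) * m) := by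
  have h1 : t + 1 ≤ (t + 1) * m := Nat.le_mul_of_pos_right _ hm
  have h2 : m ≤ (t + 1) * m := Nat.le_mul_of_pos_left _ (Nat.succ_pos t)
  obtain ⟨n, hn⟩ : ∃ n, n = (t + 1) * m := ⟨_, rfl⟩
  rw [← hn] at h1 h2
  have e1 : t + 1 ≤ 2 ^ n := h1.trans Nat.lt_two_pow_self.le
  have e2 : 4 ^ m ≤ 4 ^ n := Nat.pow_le_pow_right (by norm_num) h2
  have e3 : 4 ^ (m * (t + 1)) = 4 ^ n := by rw [hn, mul_comm]
  have e4 : 13 ^ t ≤ 16 ^ n := (Nat.pow_le_pow_left (by norm_num) t).trans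
    (Nat.pow_le_pow_right (by norm_num) (by omega))
  have e5 : 256 ^ m ≤ 256 ^ n := Nat.pow_le_pow_right (by norm_num) h2
  calc _ ≤ 2 ^ n * 4 ^ n * 4 ^ n * 16 ^ n * 256 ^ n := by rw [e3]; gcongr
    _ = 2 ^ (17 * n) := by rw [← mul_pow, ← mul_pow, ← mul_pow, ← mul_pow, pow_mul]; norm_num
    _ = _ := by rw [hn, mul_assoc]

/-- The bounds for the prime counts and for the last base are inserted into the solution of the
recurrence. The exponent `210` is `80` from MME-B plus `130` from the extension step. -/
theorem time_le {m d t R N B : ℕ} (hm : 1 ≤ m) (hd : 1 ≤ d) (hdR : d ≤ R)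
    (ht : ∀ j ≤ t, 1 < iterLog j (R : ℝ)) (hB : 1 ≤ B) :
    ((2 ^ (2 * m) * (d ^ m + N + 1 + timeB B m d t R N) * B ^ 130 : ℕ) : ℝ) ≤
      5 * ((2 ^ (17 * (t + 1) * m) : ℕ) * lam t d ^ t *
        lam ((t : ℤ) - 1) (Real.logb 2 R) * ((lam t d * iterLog t R) ^ m + N)) *
        (B ^ 210 : ℕ) := by
  have hR : 1 ≤ R := hd.trans hdR
  have hT := timeB_le (B := B) (m := m) hd N t hR
  set T := timeB B m d t R N
  have hP := prod_primeCount_le hd hR ht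
  set P := ∏ i ∈ Finset.range t, primeCount d ((nextBase d)^[i] R)
  have hRt := iterate_nextBase_le hd hR ht
  set Rt := (nextBase d)^[t] R
  have hΛ : (1 : ℝ) ≤ lam t d := one_le_lam _ _
  have hY : (1 : ℝ) ≤ lam ((t : ℤ) - 1) (Real.logb 2 R) := one_le_lam _ _
  have hL := ht t le_rfl
  -- The summand `d ^ m` must be absorbed into the last base. For `t ≥ 1` this follows from `d ≤
  -- λ_t(d)`; for `t = 0` it rests on `d ≤ R`.
  have hdΛ : (d : ℝ) ≤ lam t d * iterLog t R := by
    rcases Nat.eq_zero_or_pos t with rfl | h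
    · have : (d : ℝ) ≤ R := by exact_mod_cast hdR
      exact this.trans (le_mul_of_one_le_left (by positivity) hΛ)
    · have h1 := mul_log_le_lam hd h
      have h2 : (d : ℝ) ≤ d * max 1 (Real.logb 2 d) :=
        le_mul_of_one_le_right (by positivity) (le_max_left _ _)
      exact (h2.trans h1).trans (le_mul_of_one_le_right (by linarith) hL.le)
  set Λ := lam t d
  set Y := lam ((t : ℤ) - 1) (Real.logb 2 R)
  set L := iterLog t (R : ℝ)
  have hΛL : 1 ≤ Λ * L := one_le_mul_of_one_le_of_one_le hΛ hL.le
  have hS1 : 1 ≤ (Λ * L) ^ m := one_le_pow₀ hΛL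
  have hdm : (d : ℝ) ^ m ≤ (Λ * L) ^ m := pow_le_pow_left₀ (by positivity) hdΛ m
  have hRm : (Rt : ℝ) ^ m ≤ 256 ^ m * (Λ * L) ^ m := by
    rw [← mul_pow]; exact pow_le_pow_left₀ (by positivity) hRt m
  have hN : (0 : ℝ) ≤ N := Nat.cast_nonneg N
  have h256 : (1 : ℝ) ≤ 256 ^ m := one_le_pow₀ (by norm_num)
  -- Each of `Rt ^ m`, `d ^ m` and `1` is at most `256 ^ m * (Λ * L) ^ m`, hence the factor `3`.
  have hsum : (Rt : ℝ) ^ m + d ^ m + N + 1 ≤ 3 * (256 ^ m * ((Λ * L) ^ m + N)) := by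
    nlinarith [mul_nonneg (sub_nonneg.mpr h256) hN,
      mul_nonneg (sub_nonneg.mpr h256) (zero_le_one.trans hS1)]
  have hsum' : (d : ℝ) ^ m + N + 1 ≤ 2 * ((Λ * L) ^ m + N) := by linarith
  have hΛt : 1 ≤ Λ ^ t := one_le_pow₀ hΛ
  set S := (Λ * L) ^ m + N
  have hS0 : 0 ≤ S := by positivity
  set A : ℝ := (t + 1) * (2 ^ (2 * m)) ^ (t + 1) * (13 ^ t * (Λ ^ t * Y)) * 256 ^ m
  have hA : 1 ≤ A := by
    have h1 : (1 : ℝ) ≤ (2 ^ (2 * m)) ^ (t + 1) := one_le_pow₀ (one_le_pow₀ (by norm_num))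
    have h2 : (1 : ℝ) ≤ 13 ^ t := one_le_pow₀ (by norm_num)
    have h3 : (1 : ℝ) ≤ t + 1 := by linarith [Nat.cast_nonneg (α := ℝ) t]
    exact one_le_mul_of_one_le_of_one_le (one_le_mul_of_one_le_of_one_le
      (one_le_mul_of_one_le_of_one_le h3 h1) (one_le_mul_of_one_le_of_one_le h2
        (one_le_mul_of_one_le_of_one_le hΛt hY))) h256
  have hB80 : (1 : ℝ) ≤ (B : ℝ) ^ 80 := one_le_pow₀ (by exact_mod_cast hB)
  have hTR : (T : ℝ) ≤ 3 * (A * S * B ^ 80) := by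
    have h1 : (T : ℝ) ≤ (t + 1) * (2 ^ (2 * m)) ^ (t + 1) * P * (Rt ^ m + d ^ m + N + 1) * B ^ 80 :=
      by exact_mod_cast hT
    refine h1.trans ?_
    calc _ ≤ (t + 1) * (2 ^ (2 * m)) ^ (t + 1) * (13 ^ t * (Λ ^ t * Y)) *
          (3 * (256 ^ m * S)) * (B : ℝ) ^ 80 := by gcongr
      _ = _ := by simp only [A]; ring
  -- The `5` is `2` for the work outside MME-B plus `3` for MME-B.
  have hTot : (d : ℝ) ^ m + N + 1 + T ≤ 5 * (A * S * B ^ 80) := by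
    have h1 : S ≤ A * S * B ^ 80 := by
      refine (le_mul_of_one_le_left hS0 hA).trans (le_mul_of_one_le_right (by positivity) hB80)
    linarith
  have hconst : (t + 1 : ℝ) * 4 ^ m * 4 ^ (m * (t + 1)) * 13 ^ t * 256 ^ m ≤
      (2 ^ (17 * (t + 1) * m) : ℕ) := by exact_mod_cast constants_le (t := t) hm
  push_cast
  calc (2 : ℝ) ^ (2 * m) * (d ^ m + N + 1 + T) * B ^ 130
      ≤ 2 ^ (2 * m) * (5 * (A * S * B ^ 80)) * B ^ 130 := by gcongr
    _ = 5 * (((t + 1 : ℝ) * 4 ^ m * 4 ^ (m * (t + 1)) * 13 ^ t * 256 ^ m) * Λ ^ t * Y * S) *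
        B ^ 210 := by
      have h4 : (4 : ℝ) ^ m = 2 ^ (2 * m) := by rw [pow_mul]; norm_num
      have h5 : (4 : ℝ) ^ (m * (t + 1)) = (2 ^ (2 * m)) ^ (t + 1) := by rw [pow_mul, h4]
      rw [h4, h5]
      simp only [A]
      ring
    _ ≤ _ := by push_cast at hconst; gcongr

end MME

/-! ### The theorem. -/

theorem mainTheorem8 :
    ∃ C K : ℝ, 0 < C ∧ 0 < K ∧ ∃ Q : MvPolynomial (Fin 3) ℕ,
      ∀ (r : ℕ) (_ : 2 ≤ r) (e : ℕ) (_ : 1 ≤ e)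
        (E : Polynomial (ZMod r)) (hE : E.Monic) (_ : E.natDegree = e)
        (m d : ℕ) (_ : 1 ≤ m) (_ : 1 ≤ d)
        (f : MvPolynomial (Fin m) (AdjoinRoot E)) (_ : ∀ i, f.degreeOf i < d)
        (N : ℕ) (a : Fin N → Fin m → AdjoinRoot E)
        (t : ℕ) (_ : t < MME.logStar ((d : ℝ) * ((e : ℝ) * r) ^ d))
        (r' : ℝ) (_ : r' = 2 * e * (d : ℝ) ^ 2 * ((e : ℝ) * r) ^ d)
        (out : List (List ℕ) × ℕ)
        (_ : out = MME.run m d e (MME.encodePoly hE d f)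
          (List.ofFn fun i => List.ofFn fun c => MME.encode hE (a i c)) r t
          (MME.encodeModulus E)),
        out.1 = (List.ofFn fun i => MME.encode hE (MvPolynomial.eval (a i) f)) ∧
        (out.2 : ℝ) ≤
          K * ((2 : ℝ) ^ (C * (t + 1) * m) * MME.lam t d ^ t *
              MME.lam ((t : ℤ) - 1) (Real.logb 2 r') *
              ((MME.lam t d * MME.iterLog t r') ^ m + N)) *
            MvPolynomial.aeval
              (![(m : ℝ), (d : ℝ), Real.logb 2 (Nat.card (AdjoinRoot E))] : Fin 3 → ℝ) Q := by
  -- The exponent `17` comes from `MME.constants_le`, the factor `5` from `MME.time_le`.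
  refine ⟨17, 5, by norm_num, by norm_num, MME.timePolynomial, ?_⟩
  intro r hr e he E hE hEe m d hm hd f hf N a t ht r' hr' out hout
  subst hEe hout
  obtain ⟨h8, hF, hRB, hlB⟩ := MME.sizeBound_spec hm hd he hr
  obtain ⟨R, hR⟩ : ∃ R, R = 2 * (E.natDegree * d) * (d * (E.natDegree * r) ^ d) := ⟨_, rfl⟩
  rw [← hR] at hRB
  have : Fact (8 ≤ MME.sizeBound m d (E.natDegree * Nat.size r)) := ⟨h8⟩
  obtain ⟨hout, hcost⟩ := MME.run_spec (t := t) hE hF he hr hR hRB hlB f hf a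
  refine ⟨hout, ?_⟩
  have hpow : 1 ≤ (E.natDegree * r) ^ d := Nat.one_le_pow _ _ (by positivity)
  have hxR : d * (E.natDegree * r) ^ d ≤ R :=
    hR ▸ Nat.le_mul_of_pos_left _ (by positivity)
  have hxR' : (d : ℝ) * ((E.natDegree : ℝ) * r) ^ d ≤ R := by exact_mod_cast hxR
  have hrR : r' = R := by rw [hr', hR]; push_cast; ring
  -- The strict inequality for `t` makes the iterates of `d * (e * r) ^ d` exceed `1` up to index
  -- `t` inclusive, and they are carried over to the larger number `R` by monotonicity.
  have htR : ∀ j ≤ t, 1 < MME.iterLog j (R : ℝ) := fun j hj =>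
    (MME.one_lt_iterLog (hj.trans_lt ht)).trans_le
      (MME.iterLog_mono hxR' fun k hk => MME.one_lt_iterLog (by omega))
  have hdR : d ≤ R := (Nat.le_mul_of_pos_right d hpow).trans hxR
  have h2 : (2 : ℝ) ^ ((17 : ℝ) * (t + 1) * m) = (2 ^ (17 * (t + 1) * m) : ℕ) := by
    rw [Nat.cast_pow, ← Real.rpow_natCast]
    push_cast
    rfl
  rw [hrR, h2, MME.logb_natCard_adjoinRoot hr hE]
  refine (Nat.cast_le.mpr hcost).trans ((MME.time_le hm hd hdR htR (by omega)).trans ?_)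
  refine mul_le_mul_of_nonneg_left (MME.sizeBound_pow_le (MME.mul_size_le_logb hr)) ?_
  have h3 := (htR t le_rfl).le
  have h4 := MME.one_le_lam t (d : ℝ)
  have h5 := MME.one_le_lam ((t : ℤ) - 1) (Real.logb 2 R)
  positivity
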